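/- For a graph $G$, a clique is a (possibly empty) set of pairwise adjacent vertices and its order is its number of vertices. In the problem $K_r$-Cover, given a finite graph $G$ and $k\in\mathbb{N}$, one has to decide whether there is a set $X\subseteq V(G)$ with $|X|\le k$ such that $G-X$ has no clique of order $r$. A class of finite graphs is hereditary if it is closed under isomorphism and under taking induced subgraphs. Running times count steps of a random access machine with unit-cost addition and subtraction, indirect addressing and tests for zero; the input is the number of vertices of $G$, the number $k$, and the adjacency matrix of $G$. **Theorem.** For every $r\in\mathbb{N}$ there are constants $A_r\in\mathbb{R}$ and $B_r\in\mathbb{N}$, depending only on $r$, such that the following holds. Let $\alpha\in(0,1)$ and let $\mathcal{G}$ be a hereditary graph class for which there are constants $c_1,c_2$ such that every $G\in\mathcal{G}$ with $n\ge 1$ vertices has at most $c_1 n$ cliques of order less than $r$ and has treewidth at most $c_2 n^{\alpha}$. Then there are an algorithm and a constant $C$ (both may depend on $r$, $\alpha$ and $\mathcal{G}$) such that for every $G\in\mathcal{G}$ with $n$ vertices and every $k\in\mathbb{N}$ the algorithm correctly decides the instance $(G,k)$ of $K_r$-Cover in at most $$C\cdot 2^{A_r\, k^{2/(1+1/\alpha)}\log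 k}\cdot \max(n,1)^{B_r}$$ steps, where $k^{2/(1+1/\alpha)}\log k$ is read as $0$ for $k=0$. In other words, $K_r$-Cover is solvable on $\mathcal{G}$ in time $2^{O_r(k^{2/(1+1/\alpha)}\log k)}\cdot n^{O_r(1)}$. -/

import Mathlib

/-! ### Random access machines with a step count -/

namespace RAM

/-- A machine state: registers (a program mentions only finitely many of them) and a memory that is
accessed indirectly. All cells hold natural numbers. -/
structure State where
  reg : ℕ → ℕ
  mem : ℕ → ℕ

/-- The state with register `x` set to `v`. -/
def State.setReg (s : State) (x v : ℕ) : State :=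
  { s with reg := Function.update s.reg x v }

/-- The state with memory cell `a` set to `v`. -/
def State.setMem (s : State) (a v : ℕ) : State :=
  { s with mem := Function.update s.mem a v }

/-- Programs of a random access machine, in structured form. Addition and (truncated) subtraction
are the only arithmetic operations; there is no multiplication. -/
inductive Prog : Type
  /-- `reg x := c` for a constant `c` -/
  | const (x c : ℕ)
  /-- `reg x := reg y` -/
  | copy (x y : ℕ)
  /-- `reg x := reg y + reg z` -/
  | add (x y z : ℕ)
  /-- `reg x := reg y - reg z` (and `0` if `reg y < reg z`) -/
  | sub (x y z : ℕ)
  /-- `reg x := mem (reg y)` -/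
  | load (x y : ℕ)
  /-- `mem (reg x) := reg y` -/
  | store (x y : ℕ)
  /-- first `p`, then `q` -/
  | seq (p q : Prog)
  /-- if `reg x ≠ 0` then `p` else `q` -/
  | ite (x : ℕ) (p q : Prog)
  /-- while `reg x ≠ 0` do `p` -/
  | loop (x : ℕ) (p : Prog)

/-- `Exec p s t s'`: started in state `s`, the program `p` halts in state `s'` after exactly `t`
steps. Every elementary instruction and every evaluation of a test is one step. -/
inductive Exec : Prog → State → ℕ → State → Prop
  | const (x c : ℕ) (s : State) : Exec (.const x c) s 1 (s.setReg x c)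
  | copy (x y : ℕ) (s : State) : Exec (.copy x y) s 1 (s.setReg x (s.reg y))
  | add (x y z : ℕ) (s : State) : Exec (.add x y z) s 1 (s.setReg x (s.reg y + s.reg z))
  | sub (x y z : ℕ) (s : State) : Exec (.sub x y z) s 1 (s.setReg x (s.reg y - s.reg z))
  | load (x y : ℕ) (s : State) : Exec (.load x y) s 1 (s.setReg x (s.mem (s.reg y)))
  | store (x y : ℕ) (s : State) : Exec (.store x y) s 1 (s.setMem (s.reg x) (s.reg y))
  | seq {p q : Prog} {s₁ s₂ s₃ : State} {t u : ℕ} :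
      Exec p s₁ t s₂ → Exec q s₂ u s₃ → Exec (.seq p q) s₁ (t + u) s₃
  | ite_true {x : ℕ} {p q : Prog} {s s' : State} {t : ℕ} :
      s.reg x ≠ 0 → Exec p s t s' → Exec (.ite x p q) s (t + 1) s'
  | ite_false {x : ℕ} {p q : Prog} {s s' : State} {t : ℕ} :
      s.reg x = 0 → Exec q s t s' → Exec (.ite x p q) s (t + 1) s'
  | loop_stop {x : ℕ} {p : Prog} {s : State} :
      s.reg x = 0 → Exec (.loop x p) s 1 s
  | loop_step {x : ℕ} {p : Prog} {s₁ s₂ s₃ : State} {t u : ℕ} :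
      s₁.reg x ≠ 0 → Exec p s₁ t s₂ → Exec (.loop x p) s₂ u s₃ →
        Exec (.loop x p) s₁ (t + u + 1) s₃

open Classical in
/-- The initial state for the instance `(G, k)`: register `0` holds the number `n` of vertices,
register `1` holds `k`, memory cell `i * n + j` holds the entry `(i, j)` of the adjacency matrix
for `i, j < n`, and everything else is `0`. -/
noncomputable def input {n : ℕ} (G : SimpleGraph (Fin n)) (k : ℕ) : State where
  reg x := if x = 0 then n else if x = 1 then k else 0
  mem a := if ∃ i j : Fin n, a = (i : ℕ) * n + j ∧ G.Adj i j then 1 else 0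

end RAM

/-! ### Treewidth -/

/-- A tree decomposition of a graph. -/
structure TreeDecomposition {V : Type*} (G : SimpleGraph V) where
  /-- the number of nodes of the tree -/
  size : ℕ
  tree : SimpleGraph (Fin size)
  isTree : tree.IsTree
  bag : Fin size → Finset V
  vertex_mem : ∀ v : V, ∃ i, v ∈ bag i
  edge_mem : ∀ u v : V, G.Adj u v → ∃ i, u ∈ bag i ∧ v ∈ bag i
  subtree : ∀ v : V, (tree.induce {i | v ∈ bag i}).Preconnected

/-- The treewidth of a graph: the least `w` such that some tree decomposition has all its bags
of size at most `w + 1` (with value `0` for the graph without vertices). -/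
noncomputable def treewidth {V : Type*} (G : SimpleGraph V) : ℕ :=
  sInf {w : ℕ | ∃ D : TreeDecomposition G, ∀ i, (D.bag i).card ≤ w + 1}

/-! ### Graph classes and the covering problem -/

/-- A class of finite graphs, given by its members with vertex set `{0, …, n - 1}`, for every `n`. -/
abbrev GraphClass : Type := ∀ n : ℕ, Set (SimpleGraph (Fin n))

/-- Closed under isomorphism and under taking induced subgraphs. -/
def GraphClass.IsHereditary (𝒢 : GraphClass) : Prop :=
  ∀ (m n : ℕ) (H : SimpleGraph (Fin m)) (G : SimpleGraph (Fin n)),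
    Nonempty (H ↪g G) → G ∈ 𝒢 n → H ∈ 𝒢 m

/-- The number of cliques of order less than `r`, a clique being a set of pairwise adjacent
vertices (the empty one is counted as well). -/
noncomputable def numCliquesLT {V : Type*} (G : SimpleGraph V) (r : ℕ) : ℕ :=
  {K : Finset V | G.IsClique (K : Set V) ∧ K.card < r}.ncard

/-- `(G, k)` is a positive instance of `K_r`-Cover: some set of at most `k` vertices has a
complement that induces a graph without `r`-clique. -/
def HasCliqueCover {V : Type*} (G : SimpleGraph V) (r k : ℕ) : Prop :=
  ∃ X : Finset V, X.card ≤ k ∧ (G.induce {v | v ∉ X}).CliqueFree r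

/-- The program `p` solves `K_r`-Cover on the class `𝒢` and makes at most `T n k` steps on every
instance `(G, k)` with `n` vertices: it halts with `1` in register `0` on the positive instances and
with another value there on the negative ones. -/
def RAM.Prog.SolvesCliqueCover (p : RAM.Prog) (r : ℕ) (𝒢 : GraphClass) (T : ℕ → ℕ → ℝ) : Prop :=
  ∀ (n : ℕ) (G : SimpleGraph (Fin n)), G ∈ 𝒢 n → ∀ k : ℕ,
    ∃ (t : ℕ) (s : RAM.State), RAM.Exec p (RAM.input G k) t s ∧ (t : ℝ) ≤ T n k ∧
      (s.reg 0 = 1 ↔ HasCliqueCover G r k)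

/-! The search is first confined to a set `M` of `k^(1+o(1))` vertices, and then solved on `M` by
trying all strings of decisions that an elimination forest of depth `O(|M|^α)` can prescribe. There
are `|M|^{O(|M|^α)}` such strings, so the exponent of `k` is only slightly above `α`. As `α < 1`, it
lies strictly below `2/(1+1/α)`, and this gap swallows the `o(1)` and every constant that depends on
the class (`exists_exponents`, `exists_absorb`). This is why the final constants depend on `r`
alone.

Separators. Heredity carries the treewidth bound to all induced subgraphs, and the bag at a centroid
of the decomposition tree is a balanced separator of size `O(u^α)`
(`TreeDecomposition.exists_balanced`, `HasSeparators`). Recursive separation gives elimination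
forests (`exists_elimDepth`).

Density. A family of subsets of `M` whose small subfamilies have sublinear balanced separations
crossed by sublinearly many members has size `O(|M|^(1+ε))` (`exists_card_le_of_hasSeparations`). In
a subset where the ratio of members to size to the power `1+ε` is largest, every balanced separation
with a small middle part is crossed by a constant fraction of the members. A potential argument
picks linearly many members that cross every such separation often, and the separation promised for
this sample is a contradiction. The result applies to the edges and to the traces, that is, the
neighbourhoods in `M` of outside vertices.

Kernelization. The starting `M` is the union of a maximal packing of at most `k` disjoint
`r`-cliques, hence a cover. A round moves the vertices with more than `d` neighbours in `M` into
`M`, with `d` least such that there are at most `|M|` of them, so `d` is `|M|^ε` by density. For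
each small clique `τ` in `M` a maximal packing of disjoint completions by low vertices is computed.
If it is larger than `d` times the number of traces containing `τ`, then an exchange argument shows
that some solution of the required size meets `τ`; otherwise the packing is added to `M`. After each
round, a clique contains such a forced `τ` or meets `M` in one more vertex (`KernelInv.step`). After
`r - 1` rounds a solution, if there is one, can be chosen inside `M`.

Dynamic program. The undecided vertices of a clique are pairwise adjacent, so they lie in one
component, and the components of what is left after some decisions are independent. The table gives
the cheapest completion for every string of decisions, trying every vertex of a component as the
next one. The elimination forest need not be known: its existence shows that short strings suffice
(`IsTable.sound`, `IsTable.complete`).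

Machine. The algorithm is written in a language of bounded loops with a functional semantics, which
is compiled to the machine. Its time is polynomial in `n`, `k` and the number of strings, with an
exponent given by the nesting depth of the loops, hence by `r`. -/

/-! ### Balanced separators from tree decompositions. -/

section Tree

variable {I : Type*} {T : SimpleGraph I}

/-- In a tree, the neighbour of `i` on the way to `l` is unique. -/
theorem SimpleGraph.IsTree.next_unique (hT : T.IsTree) {i j j' l : I} (hj : T.Adj i j)
    (hj' : T.Adj i j') (h : T.dist l i = T.dist l j + 1) (h' : T.dist l i = T.dist l j' + 1) :
    j = j' := by
  obtain ⟨p, hp, hpl⟩ := hT.1.exists_path_of_dist l j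
  obtain ⟨p', hp', hpl'⟩ := hT.1.exists_path_of_dist l j'
  have q1 : (p.concat hj.symm).IsPath :=
    SimpleGraph.Walk.isPath_of_length_eq_dist _ (by simp [hpl, h])
  have q2 : (p'.concat hj'.symm).IsPath :=
    SimpleGraph.Walk.isPath_of_length_eq_dist _ (by simp [hpl', h'])
  have := (hT.2.subsingleton_path _ _).elim ⟨_, q1⟩ ⟨_, q2⟩
  have h3 : (p.concat hj.symm).penultimate = (p'.concat hj'.symm).penultimate := by
    rw [Subtype.mk.inj this]
  simpa using h3

theorem SimpleGraph.IsTree.exists_next (hT : T.IsTree) {i l : I} (h : l ≠ i) :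
    ∃ j, T.Adj i j ∧ T.dist l i = T.dist l j + 1 := by
  obtain ⟨p, hp, hpl⟩ := hT.1.exists_path_of_dist i l
  cases p with
  | nil => exact absurd rfl h
  | cons hadj q =>
    rename_i j
    refine ⟨j, hadj, ?_⟩
    have h1 := SimpleGraph.dist_le q
    have h2 := hT.dist_eq_dist_add_one_of_adj l hadj
    rw [SimpleGraph.dist_comm (u := l) (v := i), SimpleGraph.dist_comm (u := l) (v := j)] at *
    simp at hpl
    omega

/-- If the side of the edge `i j` changed from `l` to `l'`, then the path from `l` through `j` to
`i` and the path that starts with the edge `l l'` would both be paths from `l` to `i`. As they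
coincide, `l'` lies on the path from `l` to `j`, which contradicts its distance from `j`. -/
theorem SimpleGraph.IsTree.side_of_adj (hT : T.IsTree) {i j l l' : I} (hij : T.Adj i j)
    (hl : T.Adj l l') (hli : l' ≠ i) (h : T.dist l i = T.dist l j + 1) :
    T.dist l' i = T.dist l' j + 1 := by
  classical
  by_contra hcon
  have a1 := hT.dist_eq_dist_add_one_of_adj l' hij
  have a2 := hT.dist_eq_dist_add_one_of_adj i hl
  have a3 := hT.dist_eq_dist_add_one_of_adj j hl
  simp only [SimpleGraph.dist_comm (u := i), SimpleGraph.dist_comm (u := j)] at a2 a3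
  have b1 : T.dist l' i = T.dist l j := by omega
  have b2 : T.dist l' j = T.dist l j + 1 := by omega
  obtain ⟨p, hp, hpl⟩ := hT.1.exists_path_of_dist l j
  obtain ⟨p', hp', hpl'⟩ := hT.1.exists_path_of_dist l' i
  have q1 : (p.concat hij.symm).IsPath :=
    SimpleGraph.Walk.isPath_of_length_eq_dist _ (by simp [hpl, h])
  have q2 : (SimpleGraph.Walk.cons hl p').IsPath :=
    SimpleGraph.Walk.isPath_of_length_eq_dist _ (by simp [hpl', h, b1])
  have := Subtype.mk.inj ((hT.2.subsingleton_path _ _).elim ⟨_, q1⟩ ⟨_, q2⟩)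
  have h3 : l' ∈ (p.concat hij.symm).support := by rw [this]; simp
  rw [SimpleGraph.Walk.support_concat] at h3
  simp [hli] at h3
  have h4 := SimpleGraph.Walk.length_dropUntil_le_length p h3
  have h5 := SimpleGraph.dist_le (p.dropUntil l' h3)
  omega

/-- Weighted trees have centroids. -/
theorem SimpleGraph.IsTree.exists_centroid [Fintype I] (hT : T.IsTree) (w : I → ℕ) :
    ∃ i, ∀ j, T.Adj i j →
      2 * ∑ l with T.dist l i = T.dist l j + 1, w l ≤ ∑ l, w l := by
  classical
  have := hT.1.nonempty
  -- Minimise the weighted sum of distances. A move from `i` to `j` lowers it by the weight on the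
  -- side of `j` and raises it by the remaining weight.
  obtain ⟨i, hi⟩ := Finite.exists_min (fun i => ∑ l, w l * T.dist l i)
  refine ⟨i, fun j hij => ?_⟩
  have h1 := hi j
  have h2 : ∑ l, w l * T.dist l i + ∑ l, w l =
      ∑ l, w l * T.dist l j + 2 * ∑ l with T.dist l i = T.dist l j + 1, w l := by
    rw [Finset.sum_filter, Finset.mul_sum, ← Finset.sum_add_distrib, ← Finset.sum_add_distrib]
    refine Finset.sum_congr rfl fun l _ => ?_
    rcases hT.dist_eq_dist_add_one_of_adj l hij with h | h
    · rw [if_pos h, h]; ring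
    · rw [if_neg (by omega), h]; ring
  omega

end Tree

/-- Splitting a set with small fibres into two balanced unions of fibres. -/
theorem exists_balanced_grouping {ι J : Type*} [DecidableEq J] (S : Finset ι) (f : ι → J) (w : ℕ)
    (hS : S.card ≤ w) (hf : ∀ j, 2 * (S.filter fun s => f s = j).card ≤ w) :
    ∃ P : Finset J, 3 * (S.filter fun s => f s ∈ P).card ≤ 2 * w ∧
      3 * (S.filter fun s => f s ∉ P).card ≤ 2 * w := by
  classical
  have split : ∀ P : Finset J, (S.filter fun s => f s ∈ P).card +
      (S.filter fun s => f s ∉ P).card = S.card := fun P =>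
    Finset.card_filter_add_card_filter_not _
  -- A fibre with more than `w/3` elements is a part by itself, as it has at most `w/2`.
  by_cases hbig : ∃ j, w < 3 * (S.filter fun s => f s = j).card
  · obtain ⟨j, hj⟩ := hbig
    refine ⟨{j}, ?_, ?_⟩
    · have := hf j
      simp only [Finset.mem_singleton]
      omega
    · have := split {j}
      simp only [Finset.mem_singleton] at this ⊢
      omega
  push Not at hbig
  -- All fibres have at most `w/3` elements. If a largest union of fibres within `2w/3` left out
  -- more than `2w/3`, it would have less than `w/3` itself, and one more fibre would still fit.
  obtain ⟨P, hP, hmax⟩ := Finset.exists_max_image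
    ((S.image f).powerset.filter fun P => 3 * (S.filter fun s => f s ∈ P).card ≤ 2 * w)
    (fun P => (S.filter fun s => f s ∈ P).card)
    ⟨∅, by simp⟩
  simp only [Finset.mem_filter, Finset.mem_powerset] at hP hmax
  refine ⟨P, hP.2, ?_⟩
  by_contra hcon
  have hs := split P
  have : (S.filter fun s => f s ∉ P).Nonempty := by
    rw [← Finset.card_pos]; omega
  obtain ⟨s, hs'⟩ := this
  simp only [Finset.mem_filter] at hs'
  have e : (S.filter fun x => f x ∈ insert (f s) P).card =
      (S.filter fun x => f x = f s).card + (S.filter fun x => f x ∈ P).card := by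
    rw [← Finset.card_union_of_disjoint]
    · congr 1; ext x; simp only [Finset.mem_filter, Finset.mem_insert, Finset.mem_union]; tauto
    · rw [Finset.disjoint_filter]; intro x _ h1 h2; exact hs'.2 (h1 ▸ h2)
  have h1 := hbig (f s)
  have h2 := hmax (insert (f s) P) ⟨Finset.insert_subset (Finset.mem_image_of_mem f hs'.1) hP.1,
    by rw [e]; omega⟩
  rw [e] at h2
  have : 0 < (S.filter fun x => f x = f s).card :=
    Finset.card_pos.2 ⟨s, by simp [hs'.1]⟩
  omega

/-- A bag of a tree decomposition is a balanced separator. -/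
theorem TreeDecomposition.exists_balanced {V : Type*} [Fintype V] [DecidableEq V]
    {G : SimpleGraph V} (D : TreeDecomposition G) (W : Finset V) :
    ∃ (i : Fin D.size) (A B : Finset V), A ∪ B = Finset.univ ∧ A ∩ B = D.bag i ∧
      (∀ a ∈ A \ B, ∀ b ∈ B \ A, ¬ G.Adj a b) ∧
      3 * (W ∩ (A \ B)).card ≤ 2 * W.card ∧ 3 * (W ∩ (B \ A)).card ≤ 2 * W.card := by
  classical
  -- Every vertex is charged to one node whose bag contains it; the centroid is taken for the number
  -- of charged vertices of `W`.
  choose node hnode using D.vertex_mem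
  obtain ⟨i, hi⟩ := D.isTree.exists_centroid (fun l => (W.filter fun v => node v = l).card)
  have hnext : ∀ l : Fin D.size, ∃ j, l ≠ i →
      D.tree.Adj i j ∧ D.tree.dist l i = D.tree.dist l j + 1 := by
    intro l
    by_cases h : l = i
    · exact ⟨l, fun h' => absurd h h'⟩
    · obtain ⟨j, hj⟩ := D.isTree.exists_next h
      exact ⟨j, fun _ => hj⟩
  choose nx hnx using hnext
  have hstep : ∀ l l', l ≠ i → l' ≠ i → D.tree.Adj l l' → nx l = nx l' := by
    intro l l' hl hl' hadj
    obtain ⟨h1, h2⟩ := hnx l hl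
    obtain ⟨h3, h4⟩ := hnx l' hl'
    exact D.isTree.next_unique h1 h3 (D.isTree.side_of_adj h1 hadj hl' h2) h4
  -- The nodes whose bags contain `v` form a connected set that avoids `i`, hence lie in a single
  -- branch at `i`. An edge between vertices outside the bag therefore stays within one branch.
  have hconst : ∀ v, v ∉ D.bag i → ∀ l, v ∈ D.bag l → nx l = nx (node v) := by
    intro v hv l hl
    have hne : ∀ x : {i | v ∈ D.bag i}, (x : Fin D.size) ≠ i := by
      rintro ⟨x, hx⟩ rfl; exact hv hx
    obtain ⟨p⟩ := D.subtree v ⟨l, hl⟩ ⟨node v, hnode v⟩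
    have : ∀ (x y : {i | v ∈ D.bag i}), (D.tree.induce {i | v ∈ D.bag i}).Walk x y →
        nx x = nx y := by
      intro x y p
      induction p with
      | nil => rfl
      | cons h _ ih => exact (hstep _ _ (hne _) (hne _) h).trans ih
    exact this _ _ p
  -- Each branch at the centroid holds at most half of `W`, so the branches can be grouped into two
  -- balanced sides.
  obtain ⟨P, hP1, hP2⟩ := exists_balanced_grouping (W \ D.bag i) (fun v => nx (node v)) W.card
    (Finset.card_le_card Finset.sdiff_subset) (by
      intro j
      by_cases hj : ∃ v ∈ W \ D.bag i, nx (node v) = j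
      · obtain ⟨v, hv, rfl⟩ := hj
        have hni : ∀ v ∈ W \ D.bag i, node v ≠ i := by
          intro v hv h
          rw [Finset.mem_sdiff] at hv
          exact hv.2 (h ▸ hnode v)
        have h1 := hi (nx (node v)) (hnx _ (hni v hv)).1
        have h2 : ∑ l, (W.filter fun v => node v = l).card = W.card :=
          (Finset.card_eq_sum_card_fiberwise (fun x _ => Finset.mem_univ (node x))).symm
        rw [h2] at h1
        refine le_trans (Nat.mul_le_mul_left 2 ?_) h1
        rw [← Finset.card_biUnion]
        · refine Finset.card_le_card fun x hx => ?_
          simp only [Finset.mem_filter, Finset.mem_biUnion, Finset.mem_univ, true_and] at hx ⊢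
          refine ⟨node x, ?_, (Finset.mem_sdiff.1 hx.1).1, rfl⟩
          rw [← hx.2]
          exact (hnx _ (hni x hx.1)).2
        · intro a _ b _ hab
          rw [Function.onFun, Finset.disjoint_filter]
          intro x _ h1 h2
          exact hab (h1.symm.trans h2)
      · rw [Finset.filter_eq_empty_iff.2 (fun x hx h => hj ⟨x, hx, h⟩)]
        simp)
  refine ⟨i, D.bag i ∪ Finset.univ.filter (fun v => nx (node v) ∈ P),
    D.bag i ∪ Finset.univ.filter (fun v => nx (node v) ∉ P), ?_, ?_, ?_, ?_, ?_⟩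
  · ext v; simp only [Finset.mem_union, Finset.mem_filter, Finset.mem_univ, true_and, iff_true]
    tauto
  · ext v; simp only [Finset.mem_union, Finset.mem_filter, Finset.mem_univ, true_and,
      Finset.mem_inter]
    tauto
  · intro a ha b hb hadj
    simp only [Finset.mem_union, Finset.mem_filter, Finset.mem_univ, true_and,
      Finset.mem_sdiff] at ha hb
    obtain ⟨l, hla, hlb⟩ := D.edge_mem a b hadj
    have e1 := hconst a (by tauto) l hla
    have e2 := hconst b (by tauto) l hlb
    rw [← e1] at ha; rw [← e2] at hb
    tauto
  · refine le_trans (Nat.mul_le_mul_left 3 (Finset.card_le_card fun v hv => ?_)) hP1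
    simp only [Finset.mem_union, Finset.mem_filter, Finset.mem_univ, true_and,
      Finset.mem_sdiff, Finset.mem_inter] at hv ⊢
    tauto
  · refine le_trans (Nat.mul_le_mul_left 3 (Finset.card_le_card fun v hv => ?_)) hP2
    simp only [Finset.mem_union, Finset.mem_filter, Finset.mem_univ, true_and,
      Finset.mem_sdiff, Finset.mem_inter] at hv ⊢
    tauto

/-- Every nonempty finite vertex type carries the decomposition with a single bag. -/
theorem exists_treeDecomposition_card_le {n : ℕ} (G : SimpleGraph (Fin n)) :
    ∃ D : TreeDecomposition G, ∀ i, (D.bag i).card ≤ treewidth G + 1 := by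
  have hne : {w : ℕ | ∃ D : TreeDecomposition G, ∀ i, (D.bag i).card ≤ w + 1}.Nonempty := by
    refine ⟨n, ⟨1, ⊥, SimpleGraph.IsTree.of_subsingleton, fun _ => Finset.univ, fun v => ⟨0, by simp⟩,
      fun u v _ => ⟨0, by simp⟩, fun v x y => ?_⟩, fun i => ?_⟩
    · rw [Subsingleton.elim x y]
    · simp
  exact Nat.sInf_mem hne

/-- Sublinear balanced separators in the subgraphs induced by subsets of `vs`. -/
def HasSeparators {V : Type*} [DecidableEq V] (Γ : SimpleGraph V) (vs : Finset V) (c α : ℝ) : Prop :=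
  ∀ U ⊆ vs, U.Nonempty → ∀ W ⊆ U, ∃ A B : Finset V, A ∪ B = U ∧
    (∀ a ∈ A \ B, ∀ b ∈ B \ A, ¬ Γ.Adj a b) ∧ ((A ∩ B).card : ℝ) ≤ c * (U.card : ℝ) ^ α ∧
    3 * (W ∩ (A \ B)).card ≤ 2 * W.card ∧ 3 * (W ∩ (B \ A)).card ≤ 2 * W.card

/-- The graph induced by `U`, relabelled by `Fin U.card`, is again in the class, and one bag of an
optimal decomposition of it separates `W`. The bag exceeds the treewidth by at most one, which `c +
1` absorbs as `1 ≤ |U|^α`. -/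
theorem GraphClass.IsHereditary.hasSeparators {𝒢 : GraphClass} (h𝒢 : 𝒢.IsHereditary) {c α : ℝ}
    (hα : 0 < α) (hc : ∀ (n : ℕ) (G : SimpleGraph (Fin n)), 1 ≤ n → G ∈ 𝒢 n →
      (treewidth G : ℝ) ≤ c * (n : ℝ) ^ α) {n : ℕ} {G : SimpleGraph (Fin n)} (hG : G ∈ 𝒢 n) :
    HasSeparators (G.map Fin.valEmbedding) (Finset.range n) (c + 1) α := by
  classical
  intro U hU hne W hW
  let φ : Fin U.card ≃ U := U.equivFin.symm
  have hlt : ∀ x : Fin U.card, (φ x : ℕ) < n := fun x => Finset.mem_range.1 (hU (φ x).2)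
  let e : Fin U.card ↪ Fin n := ⟨fun x => ⟨φ x, hlt x⟩, fun x y hxy => by
    simpa using φ.injective (Subtype.ext (Fin.mk.inj hxy))⟩
  have hH : G.comap e ∈ 𝒢 U.card := h𝒢 _ _ _ _ ⟨SimpleGraph.Embedding.comap e G⟩ hG
  have hcard : 1 ≤ U.card := Finset.card_pos.2 hne
  obtain ⟨D, hD⟩ := exists_treeDecomposition_card_le (G.comap e)
  let ψ : Fin U.card ↪ ℕ := ⟨fun x => (φ x : ℕ), fun x y hxy => φ.injective (Subtype.ext hxy)⟩
  have hψ : ∀ v ∈ U, ∃ x, ψ x = v := fun v hv => ⟨φ.symm ⟨v, hv⟩, by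
    change ((φ (φ.symm ⟨v, hv⟩) : U) : ℕ) = v
    simp⟩
  have hψU : ∀ x, ψ x ∈ U := fun x => (φ x).2
  obtain ⟨i, A, B, hAB, hI, hno, hA, hB⟩ := D.exists_balanced (Finset.univ.filter fun x => ψ x ∈ W)
  have hWc : ((Finset.univ.filter fun x => ψ x ∈ W).map ψ) = W := by
    ext v
    simp only [Finset.mem_map, Finset.mem_filter, Finset.mem_univ, true_and]
    constructor
    · rintro ⟨x, hx, rfl⟩; exact hx
    · intro hv
      obtain ⟨x, rfl⟩ := hψ v (hW hv)
      exact ⟨x, hv, rfl⟩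
  refine ⟨A.map ψ, B.map ψ, ?_, ?_, ?_, ?_, ?_⟩
  · rw [← Finset.map_union, hAB]
    ext v
    simp only [Finset.mem_map, Finset.mem_univ, true_and]
    exact ⟨fun ⟨x, hx⟩ => hx ▸ hψU x, fun hv => hψ v hv⟩
  · intro a ha b hb hadj
    rw [← Finset.map_sdiff, Finset.mem_map] at ha hb
    obtain ⟨x, hx, rfl⟩ := ha
    obtain ⟨y, hy, rfl⟩ := hb
    refine hno x hx y hy ?_
    rw [SimpleGraph.map_adj] at hadj
    obtain ⟨p, q, hpq, h1, h2⟩ := hadj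
    have e1 : e x = p := Fin.ext h1.symm
    have e2 : e y = q := Fin.ext h2.symm
    simpa [SimpleGraph.comap_adj, e1, e2] using hpq
  · rw [← Finset.map_inter, Finset.card_map, hI]
    have h1 := hc _ _ hcard hH
    have h2 : ((D.bag i).card : ℝ) ≤ treewidth (G.comap e) + 1 := by exact_mod_cast hD i
    have h3 : (1 : ℝ) ≤ (U.card : ℝ) ^ α := Real.one_le_rpow (by exact_mod_cast hcard) hα.le
    linarith
  · rw [← hWc, ← Finset.map_sdiff, ← Finset.map_inter, Finset.card_map, Finset.card_map]
    exact hA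
  · rw [← hWc, ← Finset.map_sdiff, ← Finset.map_inter, Finset.card_map, Finset.card_map]
    exact hB


/-! ### Density of set families with sublinear separations. -/

/-- If every index is hit by many items, then few items suffice to hit all indices often. -/
theorem exists_subset_potential_le {ι τ : Type*} (𝒬 : Finset ι) (𝒯 : Finset τ) (cr : ι → τ → Prop)
    [∀ P, DecidablePred (cr P)] (h : ℕ) (hN : 2 * h ≤ 𝒯.card) (hcr : ∀ P ∈ 𝒬, 2 * h ≤ (𝒯.filter (cr P)).card) :
    ∀ s ≤ h, ∃ Q ⊆ 𝒯, Q.card = s ∧ ∑ P ∈ 𝒬, (1 / 2 : ℝ) ^ (Q.filter (cr P)).card ≤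
      𝒬.card * (1 - h / (2 * 𝒯.card) : ℝ) ^ s := by
  classical
  intro s
  induction s with
  | zero => intro _; exact ⟨∅, by simp, by simp, by simp⟩
  | succ s ih =>
    intro hs
    obtain ⟨Q, hQ, hQc, hQs⟩ := ih (by omega)
    -- An index weighs `1/2` to the power of the number of its hits so far; the next item is chosen
    -- greedily against the total weight.
    set w : ι → ℝ := fun P => (1 / 2 : ℝ) ^ (Q.filter (cr P)).card with hw
    have hw0 : ∀ P, 0 ≤ w P := fun P => by positivity
    have hcard : (𝒯 \ Q).card = 𝒯.card - s := by rw [Finset.card_sdiff_of_subset hQ, hQc]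
    have hNpos : 0 < 𝒯.card := by omega
    have hne : (𝒯 \ Q).Nonempty := Finset.card_pos.1 (by omega)
    -- Fewer than `h` items are used, so each index still has `h` of its `2 * h` items available.
    have hsum : (h : ℝ) * ∑ P ∈ 𝒬, w P ≤ ∑ T ∈ 𝒯 \ Q, ∑ P ∈ 𝒬 with cr P T, w P := by
      have e : ∑ T ∈ 𝒯 \ Q, ∑ P ∈ 𝒬 with cr P T, w P =
          ∑ P ∈ 𝒬, (((𝒯 \ Q).filter (cr P)).card : ℝ) * w P := by
        simp only [Finset.sum_filter]
        rw [Finset.sum_comm]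
        refine Finset.sum_congr rfl fun P _ => ?_
        rw [← Finset.sum_filter, Finset.sum_const, nsmul_eq_mul]
      rw [e, Finset.mul_sum]
      refine Finset.sum_le_sum fun P hP => mul_le_mul_of_nonneg_right ?_ (hw0 P)
      have h1 := hcr P hP
      have h2 : (𝒯.filter (cr P)).card ≤ ((𝒯 \ Q).filter (cr P)).card + Q.card := by
        refine (Finset.card_le_card (t := (𝒯 \ Q).filter (cr P) ∪ Q) fun x hx => ?_).trans
          (Finset.card_union_le _ _)
        simp only [Finset.mem_filter, Finset.mem_union, Finset.mem_sdiff] at hx ⊢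
        tauto
      exact_mod_cast (by omega : h ≤ ((𝒯 \ Q).filter (cr P)).card)
    -- On average an unused item hits at least a fraction `h / |𝒯|` of the total weight; halving
    -- that much yields the factor `1 - h / (2|𝒯|)`.
    obtain ⟨T, hT, hTle⟩ := Finset.exists_le_of_sum_le (s := 𝒯 \ Q)
      (f := fun _ => (h : ℝ) / 𝒯.card * ∑ P ∈ 𝒬, w P)
      (g := fun T => ∑ P ∈ 𝒬 with cr P T, w P) hne (by
        refine le_trans ?_ hsum
        rw [Finset.sum_const, nsmul_eq_mul, ← mul_assoc]
        refine mul_le_mul_of_nonneg_right ?_ (Finset.sum_nonneg fun P _ => hw0 P)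
        have h1 : ((𝒯 \ Q).card : ℝ) ≤ 𝒯.card := by
          exact_mod_cast Finset.card_le_card Finset.sdiff_subset
        have h2 : (0 : ℝ) < 𝒯.card := by exact_mod_cast hNpos
        rw [mul_div_assoc', div_le_iff₀ h2, mul_comm]
        exact mul_le_mul_of_nonneg_left h1 (by positivity))
    rw [Finset.mem_sdiff] at hT
    refine ⟨insert T Q, Finset.insert_subset hT.1 hQ, by
      rw [Finset.card_insert_of_notMem hT.2, hQc], ?_⟩
    have step : ∑ P ∈ 𝒬, (1 / 2 : ℝ) ^ ((insert T Q).filter (cr P)).card =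
        ∑ P ∈ 𝒬, w P - (1 / 2) * ∑ P ∈ 𝒬 with cr P T, w P := by
      rw [Finset.sum_filter, Finset.mul_sum, ← Finset.sum_sub_distrib]
      refine Finset.sum_congr rfl fun P _ => ?_
      rw [Finset.filter_insert]
      split_ifs with hc
      · rw [Finset.card_insert_of_notMem (by simp [hT.2]), pow_succ]
        simp only [hw]; ring
      · simp [hw]
    rw [step, pow_succ]
    have h2 : (0 : ℝ) < 𝒯.card := by exact_mod_cast hNpos
    have hfac : (0 : ℝ) ≤ 1 - h / (2 * 𝒯.card) := by
      rw [sub_nonneg, div_le_one (by positivity)]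
      have : (2 * h : ℝ) ≤ 𝒯.card := by exact_mod_cast hN
      linarith [(Nat.cast_nonneg h : (0 : ℝ) ≤ h)]
    calc ∑ P ∈ 𝒬, w P - (1 / 2) * ∑ P ∈ 𝒬 with cr P T, w P
        ≤ ∑ P ∈ 𝒬, w P - (1 / 2) * ((h : ℝ) / 𝒯.card * ∑ P ∈ 𝒬, w P) := by linarith
      _ = (∑ P ∈ 𝒬, w P) * (1 - h / (2 * 𝒯.card)) := by field_simp
      _ ≤ _ := by
        rw [← mul_assoc]
        exact mul_le_mul_of_nonneg_right hQs hfac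

/-- Subfamilies of `𝒯`, restricted to subsets of `M`, have sublinear balanced separations that few
members cross. -/
def HasSeparations {V : Type*} [DecidableEq V] (𝒯 : Finset (Finset V)) (M : Finset V)
    (c α : ℝ) : Prop :=
  ∀ M' ⊆ M, M'.Nonempty → ∀ Q ⊆ 𝒯, (∀ T ∈ Q, T ⊆ M') → ∃ A B : Finset V, A ∪ B = M' ∧
    3 * (A \ B).card ≤ 2 * M'.card ∧ 3 * (B \ A).card ≤ 2 * M'.card ∧
    ((A ∩ B).card : ℝ) ≤ c * ((M'.card + Q.card : ℕ) : ℝ) ^ α ∧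
    ((Q.filter fun T => ¬ T ⊆ A ∧ ¬ T ⊆ B).card : ℝ) ≤ c * ((M'.card + Q.card : ℕ) : ℝ) ^ α

theorem exists_forall_mul_rpow_le (c α η : ℝ) (hα : α < 1) (hη : 0 < η) :
    ∃ m₀ : ℕ, ∀ m : ℕ, m₀ ≤ m → c * (m : ℝ) ^ α ≤ η * m := by
  have h1 : Filter.Tendsto (fun m : ℕ => (m : ℝ) ^ (1 - α)) Filter.atTop Filter.atTop :=
    (tendsto_rpow_atTop (by linarith)).comp tendsto_natCast_atTop_atTop
  obtain ⟨m₀, hm₀⟩ := Filter.eventually_atTop.1 (h1.eventually_ge_atTop (c / η))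
  refine ⟨m₀ + 1, fun m hm => ?_⟩
  have h2 := hm₀ m (by omega)
  have hm0 : (0 : ℝ) < m := by exact_mod_cast (by omega : 0 < m)
  rw [div_le_iff₀ hη] at h2
  calc c * (m : ℝ) ^ α ≤ (m : ℝ) ^ (1 - α) * η * (m : ℝ) ^ α :=
        mul_le_mul_of_nonneg_right h2 (by positivity)
    _ = η * ((m : ℝ) ^ (1 - α) * (m : ℝ) ^ α) := by ring
    _ = η * m := by rw [← Real.rpow_add hm0]; simp

set_option maxHeartbeats 1000000 in
/-- Families with sublinear separations are of almost linear size. -/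
theorem exists_card_le_of_hasSeparations (c α ε : ℝ) (hα : α < 1) (hε : 0 < ε) :
    ∃ C : ℝ, 0 ≤ C ∧ ∀ (V : Type) [DecidableEq V] (𝒯 : Finset (Finset V)) (M : Finset V),
      M.Nonempty → HasSeparations 𝒯 M c α →
        ((𝒯.filter fun T => T ⊆ M).card : ℝ) ≤ C * (M.card : ℝ) ^ (1 + ε) := by
  classical
  set q : ℝ := (7 / 10 : ℝ) ^ ε with hq
  have hq0 : 0 < q := by positivity
  have hq1 : q < 1 := Real.rpow_lt_one (by norm_num) (by norm_num) hε
  -- With `q = 1 - 2κ` one has `q (1 + κ) ≤ 1 - κ`: if the two sides of a separation have total size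
  -- at most `(1 + κ) m`, a fraction `κ` of the members crosses it.
  set κ : ℝ := (1 - q) / 2 with hκ
  have hκ0 : 0 < κ := by rw [hκ]; linarith
  have hκ1 : κ < 1 := by rw [hκ]; linarith
  -- `L` sampled members per vertex outweigh the at most `4 ^ m` separations: `4 ^ m * (1 - κ/8) ^
  -- (L m) ≤ 4 ^ (-m)`.
  obtain ⟨L, hL⟩ := exists_pow_lt_of_lt_one (show (0 : ℝ) < 1 / 16 by norm_num)
    (show 1 - κ / 8 < 1 by linarith)
  -- The bound `3/100` keeps both sides below `2/3 + 3/100 ≤ 7/10` of the set, and the bound `κ`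
  -- limits the overlap.
  set η : ℝ := min (3 / 100) κ with hη
  have hη0 : 0 < η := lt_min (by norm_num) hκ0
  obtain ⟨m₀, hm₀⟩ := exists_forall_mul_rpow_le (c * (1 + L : ℝ) ^ α) α η hα hη0
  refine ⟨max (2 ^ m₀) (4 * (L + 1) / κ), by positivity, ?_⟩
  intro V _ 𝒯 M hM hsep
  set N : Finset V → ℕ := fun U => (𝒯.filter fun T => T ⊆ U).card with hNdef
  -- It suffices to bound the ratio where it is largest; maximality then shows that the sides of a
  -- separation contain few members.
  obtain ⟨M', hM', hmax⟩ := Finset.exists_max_image (M.powerset.filter fun U => U.Nonempty)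
    (fun U => (N U : ℝ) / (U.card : ℝ) ^ (1 + ε)) ⟨M, by simp [hM]⟩
  simp only [Finset.mem_filter, Finset.mem_powerset] at hM' hmax
  set m := M'.card with hm
  have hmpos : 0 < m := Finset.card_pos.2 hM'.2
  have hmR : (0 : ℝ) < m := by exact_mod_cast hmpos
  have hm1 : (1 : ℝ) ≤ m := by exact_mod_cast hmpos
  have hmp : (0 : ℝ) < (m : ℝ) ^ (1 + ε) := by positivity
  have hmle : (m : ℝ) ≤ (m : ℝ) ^ (1 + ε) := by
    calc (m : ℝ) = (m : ℝ) ^ (1 : ℝ) := (Real.rpow_one _).symm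
      _ ≤ _ := Real.rpow_le_rpow_of_exponent_le hm1 (by linarith)
  suffices hmain : (N M' : ℝ) / (m : ℝ) ^ (1 + ε) ≤ max (2 ^ m₀) (4 * (L + 1) / κ) by
    have h1 := (hmax M ⟨subset_rfl, hM⟩).trans hmain
    have hMp : (0 : ℝ) < (M.card : ℝ) ^ (1 + ε) := by
      have : (0 : ℝ) < M.card := by exact_mod_cast Finset.card_pos.2 hM
      positivity
    rwa [div_le_iff₀ hMp] at h1
  rw [div_le_iff₀ hmp]
  by_cases hsmall : m < m₀
  · have h1 : N M' ≤ 2 ^ m := by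
      rw [hm, ← Finset.card_powerset]
      exact Finset.card_le_card fun T hT => by simpa using (Finset.mem_filter.1 hT).2
    have h2 : (N M' : ℝ) ≤ 2 ^ m₀ := by
      exact_mod_cast h1.trans (Nat.pow_le_pow_right (by norm_num) hsmall.le)
    calc (N M' : ℝ) ≤ 2 ^ m₀ := h2
      _ ≤ max (2 ^ m₀) (4 * (L + 1) / κ) * 1 := by rw [mul_one]; exact le_max_left _ _
      _ ≤ _ := mul_le_mul_of_nonneg_left (hm1.trans hmle) (by positivity)
  push Not at hsmall
  by_cases hfew : (N M' : ℝ) ≤ 4 * (L + 1) / κ * m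
  · calc (N M' : ℝ) ≤ 4 * (L + 1) / κ * m := hfew
      _ ≤ max (2 ^ m₀) (4 * (L + 1) / κ) * (m : ℝ) ^ (1 + ε) := by
        gcongr; exact le_max_right _ _
  exfalso
  push Not at hfew
  have hNL : 4 * (L + 1) * m < κ * N M' := by
    rw [div_mul_eq_mul_div, div_lt_iff₀ hκ0] at hfew; linarith
  have hNpos : (0 : ℝ) < N M' := by
    have : (0 : ℝ) < κ * N M' := lt_of_le_of_lt (by positivity) hNL
    exact pos_of_mul_pos_right this hκ0.le
  -- `2 * h` is at most the guaranteed number `κ N` of crossing members, while `h ≥ κ N / 4` makes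
  -- every sampling step gain a factor `1 - κ/8`.
  set h : ℕ := ⌊κ * N M' / 2⌋₊ with hh
  have hh1 : (2 * h : ℝ) ≤ κ * N M' := by
    have := Nat.floor_le (show 0 ≤ κ * N M' / 2 by positivity)
    linarith
  have hLm : (1 : ℝ) ≤ (L + 1) * m := by nlinarith [(Nat.cast_nonneg L : (0 : ℝ) ≤ L)]
  have hh2 : κ * N M' / 4 ≤ h := by
    have := Nat.lt_floor_add_one (κ * N M' / 2)
    linarith
  have hsh : L * m ≤ h := by
    have : ((L * m : ℕ) : ℝ) ≤ h := by push_cast; linarith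
    exact_mod_cast this
  set 𝒬 : Finset (Finset V × Finset V) := (M'.powerset ×ˢ M'.powerset).filter fun P =>
    P.1 ∪ P.2 = M' ∧ ((P.1 ∩ P.2).card : ℝ) ≤ η * m ∧ ((P.1.card : ℝ) ≤ 7 / 10 * m) ∧
      ((P.2.card : ℝ) ≤ 7 / 10 * m) with h𝒬
  set 𝒯' := 𝒯.filter fun T => T ⊆ M' with h𝒯'
  have hcard𝒬 : (𝒬.card : ℝ) ≤ 4 ^ m := by
    have : 𝒬.card ≤ 2 ^ m * 2 ^ m := by
      refine (Finset.card_filter_le _ _).trans ?_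
      rw [Finset.card_product, Finset.card_powerset]
    calc (𝒬.card : ℝ) ≤ 2 ^ m * 2 ^ m := by exact_mod_cast this
      _ = 4 ^ m := by rw [← mul_pow]; norm_num
  -- By maximality `N A ≤ N M' * (|A|/m)^(1+ε)`, and `(|A|/m)^ε ≤ (7/10)^ε = q`.
  have hsub : ∀ A ⊆ M', A.Nonempty → (A.card : ℝ) ≤ 7 / 10 * m →
      (N A : ℝ) ≤ N M' * q * (A.card / m) := by
    intro A hA hAne hAc
    have h1 := hmax A ⟨hA.trans hM'.1, hAne⟩
    have ha : (0 : ℝ) < A.card := by exact_mod_cast Finset.card_pos.2 hAne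
    rw [div_le_div_iff₀ (by positivity) hmp] at h1
    have e1 : (A.card : ℝ) ^ (1 + ε) = (A.card / m) * (A.card / m : ℝ) ^ ε * (m : ℝ) ^ (1 + ε) := by
      rw [Real.div_rpow ha.le hmR.le, Real.rpow_add ha, Real.rpow_add hmR, Real.rpow_one,
        Real.rpow_one]
      field_simp
    have e2 : (A.card / m : ℝ) ^ ε ≤ q :=
      Real.rpow_le_rpow (by positivity) ((div_le_iff₀ hmR).2 hAc) hε.le
    rw [e1, ← mul_assoc] at h1
    have h2 := le_of_mul_le_mul_right h1 hmp
    calc (N A : ℝ) ≤ N M' * (A.card / m * (A.card / m : ℝ) ^ ε) := h2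
      _ ≤ N M' * (A.card / m * q) := by gcongr
      _ = _ := by ring
  have hcross : ∀ P ∈ 𝒬, 2 * h ≤
      (𝒯'.filter fun T => ¬ T ⊆ P.1 ∧ ¬ T ⊆ P.2).card := by
    rintro ⟨A, B⟩ hP
    simp only [h𝒬, Finset.mem_filter, Finset.mem_product, Finset.mem_powerset] at hP
    obtain ⟨⟨hA, hB⟩, hU, hI, hAc, hBc⟩ := hP
    have hAne : A.Nonempty := by
      rw [Finset.nonempty_iff_ne_empty]; rintro rfl
      rw [Finset.empty_union] at hU
      rw [hU, ← hm] at hBc; linarith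
    have hBne : B.Nonempty := by
      rw [Finset.nonempty_iff_ne_empty]; rintro rfl
      rw [Finset.union_empty] at hU
      rw [hU, ← hm] at hAc; linarith
    have h1 := hsub A hA hAne hAc
    have h2 := hsub B hB hBne hBc
    have h3 : N M' ≤ N A + N B + (𝒯'.filter fun T => ¬ T ⊆ A ∧ ¬ T ⊆ B).card := by
      refine (Finset.card_le_card (t := ((𝒯.filter fun T => T ⊆ A) ∪ (𝒯.filter fun T => T ⊆ B)) ∪
        (𝒯'.filter fun T => ¬ T ⊆ A ∧ ¬ T ⊆ B)) fun T hT => ?_).trans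
        ((Finset.card_union_le _ _).trans (Nat.add_le_add_right (Finset.card_union_le _ _) _))
      simp only [h𝒯', Finset.mem_filter, Finset.mem_union] at hT ⊢
      tauto
    have h4 : (A.card : ℝ) + B.card ≤ (1 + κ) * m := by
      have : A.card + B.card = m + (A ∩ B).card := by
        rw [hm, ← hU, Finset.card_union_add_card_inter]
      have h5 : (A.card : ℝ) + B.card = m + (A ∩ B).card := by exact_mod_cast this
      have h6 : η * m ≤ κ * m := mul_le_mul_of_nonneg_right (min_le_right _ _) hmR.le
      linarith
    have h5 : (N A : ℝ) + N B ≤ N M' * (1 - κ) := by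
      calc (N A : ℝ) + N B ≤ N M' * q * (A.card / m) + N M' * q * (B.card / m) := add_le_add h1 h2
        _ = N M' * q * ((A.card + B.card) / m) := by ring
        _ ≤ N M' * q * (1 + κ) := by
          refine mul_le_mul_of_nonneg_left ?_ (by positivity)
          rwa [div_le_iff₀ hmR]
        _ ≤ N M' * (1 - κ) := by
          rw [mul_assoc]
          refine mul_le_mul_of_nonneg_left ?_ hNpos.le
          have : q = 1 - 2 * κ := by rw [hκ]; ring
          rw [this]; nlinarith only [sq_nonneg κ]
    have h6 : (2 * h : ℝ) ≤ (𝒯'.filter fun T => ¬ T ⊆ A ∧ ¬ T ⊆ B).card := by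
      have : (N M' : ℝ) ≤ N A + N B + (𝒯'.filter fun T => ¬ T ⊆ A ∧ ¬ T ⊆ B).card := by
        exact_mod_cast h3
      linarith
    exact_mod_cast h6
  have h2N : 2 * h ≤ 𝒯'.card := by
    have : (2 * h : ℝ) ≤ 𝒯'.card := by
      change (2 * h : ℝ) ≤ N M'
      exact hh1.trans (mul_le_of_le_one_left hNpos.le hκ1.le)
    exact_mod_cast this
  obtain ⟨Q, hQ, hQc, hQs⟩ := exists_subset_potential_le 𝒬 𝒯'
    (fun P T => ¬ T ⊆ P.1 ∧ ¬ T ⊆ P.2) h h2N hcross (L * m) hsh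
  -- The hypothesis is used for the sample only: `m + |Q|` is linear in `m`, so the number of
  -- crossings is sublinear in `m`.
  obtain ⟨A, B, hU, hA, hB, hI, hX⟩ := hsep M' hM'.1 hM'.2 Q
    (hQ.trans (Finset.filter_subset _ _)) (fun T hT => (Finset.mem_filter.1 (hQ hT)).2)
  have hsize : c * ((m + Q.card : ℕ) : ℝ) ^ α ≤ η * m := by
    have := hm₀ m hsmall
    rw [hQc]
    have e : ((m + L * m : ℕ) : ℝ) = (1 + L) * m := by push_cast; ring
    rw [e, Real.mul_rpow (by positivity) hmR.le, ← mul_assoc]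
    exact this
  have hη3 : η * m ≤ 3 / 100 * m := mul_le_mul_of_nonneg_right (min_le_left _ _) hmR.le
  have hI' := hI.trans hsize
  have hcA : (A.card : ℝ) ≤ 7 / 10 * m := by
    have : A.card = (A \ B).card + (A ∩ B).card := (Finset.card_sdiff_add_card_inter A B).symm
    have e : (A.card : ℝ) = (A \ B).card + (A ∩ B).card := by exact_mod_cast this
    have : (3 * (A \ B).card : ℝ) ≤ 2 * m := by exact_mod_cast hA
    linarith
  have hcB : (B.card : ℝ) ≤ 7 / 10 * m := by
    have : B.card = (B \ A).card + (B ∩ A).card := (Finset.card_sdiff_add_card_inter B A).symm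
    rw [Finset.inter_comm] at this
    have e : (B.card : ℝ) = (B \ A).card + (A ∩ B).card := by exact_mod_cast this
    have : (3 * (B \ A).card : ℝ) ≤ 2 * m := by exact_mod_cast hB
    linarith
  have hP : (A, B) ∈ 𝒬 := by
    simp only [h𝒬, Finset.mem_filter, Finset.mem_product, Finset.mem_powerset]
    exact ⟨⟨hU ▸ Finset.subset_union_left, hU ▸ Finset.subset_union_right⟩, hU, hI', hcA, hcB⟩
  have hterm : (1 / 2 : ℝ) ^ (Q.filter fun T => ¬ T ⊆ A ∧ ¬ T ⊆ B).card ≤ (1 / 4) ^ m := by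
    have h1 := Finset.single_le_sum (f := fun P : Finset V × Finset V =>
      (1 / 2 : ℝ) ^ (Q.filter fun T => ¬ T ⊆ P.1 ∧ ¬ T ⊆ P.2).card)
      (fun P _ => by positivity) hP
    refine (h1.trans hQs).trans ?_
    have hfac : (1 - h / (2 * 𝒯'.card) : ℝ) ≤ 1 - κ / 8 := by
      have h3 : κ / 8 ≤ h / (2 * 𝒯'.card) := by
        rw [le_div_iff₀ (by change (0 : ℝ) < 2 * N M'; positivity)]
        change κ / 8 * (2 * N M') ≤ h
        linarith
      linarith
    have hfac0 : (0 : ℝ) ≤ 1 - h / (2 * 𝒯'.card) := by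
      rw [sub_nonneg, div_le_one (by change (0 : ℝ) < 2 * N M'; positivity)]
      have : (2 * h : ℝ) ≤ 𝒯'.card := by exact_mod_cast h2N
      linarith [(Nat.cast_nonneg h : (0 : ℝ) ≤ h)]
    calc (𝒬.card : ℝ) * (1 - h / (2 * 𝒯'.card) : ℝ) ^ (L * m)
        ≤ 4 ^ m * ((1 - κ / 8) ^ L) ^ m := by
          rw [← pow_mul]
          gcongr
      _ ≤ 4 ^ m * (1 / 16) ^ m := by
          gcongr
          exact pow_nonneg (by linarith) _
      _ = (1 / 4) ^ m := by rw [← mul_pow]; norm_num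
  -- A single term of the potential is at most `4 ^ (-m) = 2 ^ (-2m)`, so `2m` sampled members
  -- cross, whereas at most `η m` may.
  have hge : 2 * m ≤ (Q.filter fun T => ¬ T ⊆ A ∧ ¬ T ⊆ B).card := by
    have e : (1 / 4 : ℝ) ^ m = (1 / 2) ^ (2 * m) := by rw [pow_mul]; norm_num
    rw [e] at hterm
    exact (pow_le_pow_iff_right_of_lt_one₀ (by norm_num) (by norm_num)).1 hterm
  have : (2 * m : ℝ) ≤ (Q.filter fun T => ¬ T ⊆ A ∧ ¬ T ⊆ B).card := by exact_mod_cast hge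
  have := hX.trans hsize
  linarith


/-! ### Edges and traces have separations with few crossings. -/

open Classical in
/-- The neighbours of `z` in `M`. -/
noncomputable def trace (Γ : SimpleGraph ℕ) (M : Finset ℕ) (z : ℕ) : Finset ℕ := M.filter (Γ.Adj z)

theorem mem_trace {Γ : SimpleGraph ℕ} {M : Finset ℕ} {z u : ℕ} :
    u ∈ trace Γ M z ↔ u ∈ M ∧ Γ.Adj z u := by simp [trace]

/-- No edge joins the two sides of a separator, so no pair of adjacent vertices crosses it. -/
theorem HasSeparators.hasSeparations_edges {Γ : SimpleGraph ℕ} {vs : Finset ℕ} {c α : ℝ}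
    (hc : 0 ≤ c) (hα : 0 ≤ α) (h : HasSeparators Γ vs c α) (𝒯 : Finset (Finset ℕ))
    (h𝒯 : ∀ T ∈ 𝒯, ∃ a b, Γ.Adj a b ∧ T = {a, b}) {M₀ : Finset ℕ} (hM₀ : M₀ ⊆ vs) :
    HasSeparations 𝒯 M₀ c α := by
  intro M hM hne Q hQ hQM
  obtain ⟨A, B, hU, hno, hI, hA, hB⟩ := h M (hM.trans hM₀) hne M subset_rfl
  have hAM : A ⊆ M := hU ▸ Finset.subset_union_left
  have hBM : B ⊆ M := hU ▸ Finset.subset_union_right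
  have hcross : (Q.filter fun T => ¬ T ⊆ A ∧ ¬ T ⊆ B) = ∅ := by
    rw [Finset.filter_eq_empty_iff]
    rintro T hT ⟨h1, h2⟩
    obtain ⟨a, b, hab, rfl⟩ := h𝒯 T (hQ hT)
    have := hQM _ hT
    simp only [Finset.insert_subset_iff, Finset.singleton_subset_iff, ← hU,
      Finset.mem_union] at this h1 h2
    have n1 := hno a
    have n2 := hno b
    simp only [Finset.mem_sdiff] at n1 n2
    have := hab.symm
    grind
  refine ⟨A, B, hU, ?_, ?_, ?_, ?_⟩
  · rwa [Finset.inter_eq_right.2 (Finset.sdiff_subset.trans hAM)] at hA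
  · rwa [Finset.inter_eq_right.2 (Finset.sdiff_subset.trans hBM)] at hB
  · exact hI.trans (by gcongr; simp)
  · rw [hcross]; simp only [Finset.card_empty, Nat.cast_zero]; positivity

/-- Each trace in `Q` is represented by an outside vertex that has it, and `M'` together with these
vertices is separated, balanced with respect to `M'`. A crossing trace contains vertices strictly on
both sides, so its representative is adjacent to both and belongs to the separator. This is the
reason for the term `Q.card` in the bound of `HasSeparations`. -/
theorem HasSeparators.hasSeparations_traces {Γ : SimpleGraph ℕ} {vs : Finset ℕ} {c α : ℝ}
    (h : HasSeparators Γ vs c α) {M R : Finset ℕ} (hM : M ⊆ vs) (hR : R ⊆ vs \ M) :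
    HasSeparations (R.image (trace Γ M)) M c α := by
  intro M' hM' hne Q hQ hQM
  have hrep : ∀ T, ∃ z, T ∈ Q → z ∈ R ∧ trace Γ M z = T := by
    intro T
    by_cases hT : T ∈ Q
    · obtain ⟨z, hz, hzT⟩ := Finset.mem_image.1 (hQ hT)
      exact ⟨z, fun _ => ⟨hz, hzT⟩⟩
    · exact ⟨0, fun h => absurd h hT⟩
  choose rep hrep using hrep
  have hinj : Set.InjOn rep (Q : Set (Finset ℕ)) := by
    intro T hT T' hT' hTT'
    rw [← (hrep T hT).2, ← (hrep T' hT').2, hTT']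
  have hout : ∀ T ∈ Q, rep T ∈ vs ∧ rep T ∉ M := fun T hT => by
    simpa using hR (hrep T hT).1
  have hdisj : Disjoint M' (Q.image rep) := by
    rw [Finset.disjoint_left]
    intro x hx hx'
    obtain ⟨T, hT, rfl⟩ := Finset.mem_image.1 hx'
    exact (hout T hT).2 (hM' hx)
  have hcard : (M' ∪ Q.image rep).card = M'.card + Q.card := by
    rw [Finset.card_union_of_disjoint hdisj, Finset.card_image_of_injOn hinj]
  obtain ⟨A, B, hU, hno, hI, hA, hB⟩ := h (M' ∪ Q.image rep)
    (Finset.union_subset (hM'.trans hM) (fun x hx => by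
      obtain ⟨T, hT, rfl⟩ := Finset.mem_image.1 hx
      exact (hout T hT).1)) (hne.mono Finset.subset_union_left) M' Finset.subset_union_left
  have hmem : ∀ x, (x ∈ A ∨ x ∈ B) ↔ (x ∈ M' ∨ x ∈ Q.image rep) := by
    intro x; rw [← Finset.mem_union, ← Finset.mem_union, hU]
  rw [hcard] at hI
  refine ⟨A ∩ M', B ∩ M', ?_, ?_, ?_, ?_, ?_⟩
  · ext x; have := hmem x; simp only [Finset.mem_union, Finset.mem_inter]; tauto
  · convert hA using 3; ext x; simp only [Finset.mem_sdiff, Finset.mem_inter]; tauto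
  · convert hB using 3; ext x; simp only [Finset.mem_sdiff, Finset.mem_inter]; tauto
  · refine le_trans ?_ hI
    exact_mod_cast Finset.card_le_card (Finset.inter_subset_inter Finset.inter_subset_left
      Finset.inter_subset_left)
  · refine le_trans ?_ hI
    have : (Q.filter fun T => ¬ T ⊆ A ∩ M' ∧ ¬ T ⊆ B ∩ M').card ≤ (A ∩ B).card := by
      refine Finset.card_le_card_of_injOn rep (fun T hT => ?_)
        (hinj.mono fun T hT => (Finset.mem_filter.1 hT).1)
      simp only [Finset.coe_filter, Set.mem_ofPred_eq, Finset.subset_iff, Finset.mem_inter,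
        not_forall, exists_prop] at hT
      obtain ⟨hTQ, ⟨a, haT, ha⟩, ⟨b, hbT, hb⟩⟩ := hT
      have haM := hQM T hTQ haT
      have hbM := hQM T hTQ hbT
      have e := (hrep T hTQ).2
      have ha' : Γ.Adj (rep T) a := by rw [← e] at haT; exact (mem_trace.1 haT).2
      have hb' : Γ.Adj (rep T) b := by rw [← e] at hbT; exact (mem_trace.1 hbT).2
      have m1 := hmem a
      have m2 := hmem b
      have m3 := (hmem (rep T)).2 (Or.inr (Finset.mem_image_of_mem _ hTQ))
      have n1 := hno (rep T)
      have n2 := hno b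
      have n3 := hb'.symm
      simp only [Finset.mem_sdiff] at n1 n2
      simp only [Finset.coe_inter, Set.mem_inter_iff, Finset.mem_coe]
      grind
    exact_mod_cast this

/-! ### The kernelization: size and correctness of a round. -/

/-- `C` is the vertex set of an `r`-clique inside `vs`. -/
def IsRClique (Γ : SimpleGraph ℕ) (vs : Finset ℕ) (r : ℕ) (C : Finset ℕ) : Prop :=
  C ⊆ vs ∧ C.card = r ∧ ∀ a ∈ C, ∀ b ∈ C, a ≠ b → Γ.Adj a b

/-- `S` meets all `r`-cliques. -/
def IsCover (Γ : SimpleGraph ℕ) (vs : Finset ℕ) (r : ℕ) (S : Finset ℕ) : Prop :=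
  ∀ C, IsRClique Γ vs r C → (C ∩ S).Nonempty

/-- The vertices outside `M` with more than `d` neighbours in `M`. -/
noncomputable def highSet (Γ : SimpleGraph ℕ) (vs M : Finset ℕ) (d : ℕ) : Finset ℕ :=
  (vs \ M).filter fun z => d < (trace Γ M z).card

/-- The vertices outside `M` with at most `d` neighbours in `M`. -/
noncomputable def lowSet (Γ : SimpleGraph ℕ) (vs M : Finset ℕ) (d : ℕ) : Finset ℕ :=
  (vs \ M).filter fun z => (trace Γ M z).card ≤ d

/-- The number of traces of vertices in `lowSet` that contain the tuple `τ`. -/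
noncomputable def numTraces (Γ : SimpleGraph ℕ) (vs M : Finset ℕ) (d : ℕ) {j : ℕ}
    (τ : Fin j → ℕ) : ℕ :=
  (((lowSet Γ vs M d).image (trace Γ M)).filter fun T => ∀ i, τ i ∈ T).card

/-- A tuple of fewer than `r` pairwise adjacent vertices of `M`. -/
structure IsCore (Γ : SimpleGraph ℕ) (M : Finset ℕ) (r : ℕ) {j : ℕ} (τ : Fin j → ℕ) : Prop where
  pos : 0 < j
  lt : j < r
  mem : ∀ i, τ i ∈ M
  adj : ∀ i i', i < i' → Γ.Adj (τ i) (τ i')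

/-- `Z` extends the tuple `τ` to an `r`-clique by vertices of `L`. -/
def IsPetal (Γ : SimpleGraph ℕ) (vs L : Finset ℕ) (r : ℕ) {j : ℕ} (τ : Fin j → ℕ)
    (Z : Finset ℕ) : Prop :=
  Z ⊆ L ∧ Disjoint (Finset.univ.image τ) Z ∧ IsRClique Γ vs r (Finset.univ.image τ ∪ Z)

/-- `𝒵` is a maximal family of disjoint petals of `τ`. -/
structure IsPetalPacking (Γ : SimpleGraph ℕ) (vs L : Finset ℕ) (r : ℕ) {j : ℕ} (τ : Fin j → ℕ)
    (𝒵 : Finset (Finset ℕ)) : Prop where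
  petal : ∀ Z ∈ 𝒵, IsPetal Γ vs L r τ Z
  disjoint : ∀ Z ∈ 𝒵, ∀ Z' ∈ 𝒵, Z ≠ Z' → Disjoint Z Z'
  maximal : ∀ Z, IsPetal Γ vs L r τ Z → ∃ Z' ∈ 𝒵, ¬ Disjoint Z Z'

/-- One round of the kernelization: `M` is enlarged to `M'`. -/
structure IsKernelStep (Γ : SimpleGraph ℕ) (vs : Finset ℕ) (r : ℕ) (M M' : Finset ℕ) (d : ℕ)
    (pk : ∀ j, (Fin j → ℕ) → Finset (Finset ℕ)) : Prop where
  sub : M' ⊆ vs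
  sup : M ⊆ M'
  high_card : (highSet Γ vs M d).card ≤ M.card
  high_min : ∀ d' < d, M.card < (highSet Γ vs M d').card
  high : highSet Γ vs M d ⊆ M'
  packing : ∀ j (τ : Fin j → ℕ), IsCore Γ M r τ → IsPetalPacking Γ vs (lowSet Γ vs M d) r τ (pk j τ)
  add : ∀ j (τ : Fin j → ℕ), IsCore Γ M r τ → (pk j τ).card ≤ d * numTraces Γ vs M d τ →
    ∀ Z ∈ pk j τ, Z ⊆ M'
  only : ∀ v ∈ M', v ∈ M ∨ v ∈ highSet Γ vs M d ∨ ∃ j, ∃ τ : Fin j → ℕ, IsCore Γ M r τ ∧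
    (pk j τ).card ≤ d * numTraces Γ vs M d τ ∧ ∃ Z ∈ pk j τ, v ∈ Z

theorem IsPetal.card_le {Γ : SimpleGraph ℕ} {vs L : Finset ℕ} {r : ℕ} {j : ℕ} {τ : Fin j → ℕ}
    {Z : Finset ℕ} (h : IsPetal Γ vs L r τ Z) : Z.card ≤ r :=
  h.2.2.2.1 ▸ Finset.card_le_card Finset.subset_union_right

section Size

variable {Γ : SimpleGraph ℕ} {vs : Finset ℕ} {r d : ℕ} {M M' : Finset ℕ}
  {pk : ∀ j, (Fin j → ℕ) → Finset (Finset ℕ)}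

/-- At most `|M|` high vertices are added. The rest lies in petals of at most `r` vertices, at most
`d * numTraces` of them for a core. Double counting bounds the sum of `numTraces` over the cores of
a given length: a low trace has at most `d` elements, hence contains at most `(d + 1) ^ r` of these
tuples. -/
theorem IsKernelStep.card_le (h : IsKernelStep Γ vs r M M' d pk) :
    M'.card ≤ 2 * M.card +
      r * ((d + 1) ^ r * (r * d * ((lowSet Γ vs M d).image (trace Γ M)).card)) := by
  classical
  set 𝒯 := (lowSet Γ vs M d).image (trace Γ M) with h𝒯
  let cores : ∀ j, Finset (Fin j → ℕ) := fun j =>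
    (Fintype.piFinset fun _ : Fin j => M).filter fun τ => IsCore Γ M r τ ∧
      (pk j τ).card ≤ d * numTraces Γ vs M d τ
  have hsub : M' ⊆ (M ∪ highSet Γ vs M d) ∪
      (Finset.range r).biUnion fun j => (cores j).biUnion fun τ => (pk j τ).biUnion id := by
    intro v hv
    simp only [Finset.mem_union, Finset.mem_biUnion, Finset.mem_range]
    rcases h.only v hv with h1 | h1 | ⟨j, τ, h1, h2, Z, hZ, hvZ⟩
    · exact Or.inl (Or.inl h1)
    · exact Or.inl (Or.inr h1)
    · exact Or.inr ⟨j, h1.lt, τ, by simp [cores, h1, h2, h1.mem], Z, hZ, hvZ⟩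
  refine (Finset.card_le_card hsub).trans ((Finset.card_union_le _ _).trans (add_le_add ?_ ?_))
  · refine (Finset.card_union_le _ _).trans ?_
    have := h.high_card
    omega
  · refine Finset.card_biUnion_le.trans ?_
    rw [show r * ((d + 1) ^ r * (r * d * 𝒯.card)) =
      ∑ j ∈ Finset.range r, (d + 1) ^ r * (r * d * 𝒯.card) by simp]
    refine Finset.sum_le_sum fun j hj => ?_
    rw [Finset.mem_range] at hj
    have h1 : ∀ τ ∈ cores j, ((pk j τ).biUnion id).card ≤ r * (d * numTraces Γ vs M d τ) := by
      intro τ hτ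
      simp only [cores, Finset.mem_filter] at hτ
      refine Finset.card_biUnion_le.trans ?_
      calc ∑ Z ∈ pk j τ, (id Z).card ≤ ∑ Z ∈ pk j τ, r :=
            Finset.sum_le_sum fun Z hZ => ((h.packing j τ hτ.2.1).petal Z hZ).card_le
        _ = (pk j τ).card * r := by simp
        _ ≤ _ := by rw [mul_comm]; exact Nat.mul_le_mul_left _ hτ.2.2
    refine Finset.card_biUnion_le.trans ((Finset.sum_le_sum h1).trans ?_)
    rw [← Finset.mul_sum, ← Finset.mul_sum]
    have h2 : ∑ τ ∈ cores j, numTraces Γ vs M d τ ≤ 𝒯.card * (d + 1) ^ r := by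
      calc ∑ τ ∈ cores j, numTraces Γ vs M d τ
          = ∑ T ∈ 𝒯, ((cores j).filter fun τ => ∀ i, τ i ∈ T).card := by
            simp only [numTraces, Finset.card_filter]
            rw [Finset.sum_comm]
        _ ≤ ∑ T ∈ 𝒯, (d + 1) ^ r := by
            refine Finset.sum_le_sum fun T hT => ?_
            calc ((cores j).filter fun τ => ∀ i, τ i ∈ T).card
                ≤ (Fintype.piFinset fun _ : Fin j => T).card := by
                  refine Finset.card_le_card fun τ hτ => ?_
                  rw [Finset.mem_filter] at hτ
                  exact Fintype.mem_piFinset.2 hτ.2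
              _ = T.card ^ j := by simp
              _ ≤ (d + 1) ^ j := by
                  refine Nat.pow_le_pow_left ?_ j
                  obtain ⟨z, hz, rfl⟩ := Finset.mem_image.1 hT
                  have := (Finset.mem_filter.1 hz).2
                  omega
              _ ≤ (d + 1) ^ r := Nat.pow_le_pow_right (by omega) hj.le
        _ = _ := by simp
    calc r * (d * ∑ τ ∈ cores j, numTraces Γ vs M d τ) ≤ r * (d * (𝒯.card * (d + 1) ^ r)) := by
          gcongr
      _ = _ := by ring

/-- The edges between `H` and `M` are determined by their ends on the two sides. The density bound
for the edges inside `M ∪ H` will therefore bound `d`. -/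
theorem card_mul_le_edges {H : Finset ℕ} (hH : H ⊆ vs \ M) (hd : ∀ z ∈ H, d ≤ (trace Γ M z).card) :
    ∃ 𝒯 : Finset (Finset ℕ), (∀ T ∈ 𝒯, ∃ a b, Γ.Adj a b ∧ T = {a, b}) ∧
      d * H.card ≤ (𝒯.filter fun T => T ⊆ M ∪ H).card := by
  classical
  refine ⟨(H.sigma fun z => trace Γ M z).image fun p => {p.1, p.2}, ?_, ?_⟩
  · intro T hT
    obtain ⟨⟨z, u⟩, hzu, rfl⟩ := Finset.mem_image.1 hT
    rw [Finset.mem_sigma] at hzu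
    exact ⟨z, u, (mem_trace.1 hzu.2).2, rfl⟩
  · rw [Finset.filter_true_of_mem, Finset.card_image_of_injOn, Finset.card_sigma]
    · rw [mul_comm, ← smul_eq_mul, ← Finset.sum_const]
      exact Finset.sum_le_sum hd
    · rintro ⟨z, u⟩ hzu ⟨z', u'⟩ hzu' heq
      simp only [Finset.coe_sigma, Set.mem_sigma_iff, Finset.mem_coe] at hzu hzu'
      dsimp only at heq
      have a1 := (Finset.mem_sdiff.1 (hH hzu.1)).2
      have a2 := (Finset.mem_sdiff.1 (hH hzu'.1)).2
      have b1 := (mem_trace.1 hzu.2).1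
      have b2 := (mem_trace.1 hzu'.2).1
      have e1 : z ∈ ({z', u'} : Finset ℕ) := by
        have : z ∈ ({z, u} : Finset ℕ) := by simp
        exact heq ▸ this
      have e2 : u ∈ ({z', u'} : Finset ℕ) := by
        have : u ∈ ({z, u} : Finset ℕ) := by simp
        exact heq ▸ this
      simp only [Finset.mem_insert, Finset.mem_singleton] at e1 e2
      have f1 : z = z' := by rcases e1 with e | e; exacts [e, absurd (e ▸ b2) a1]
      have f2 : u = u' := by rcases e2 with e | e; exacts [absurd (e ▸ b1) a2, e]
      subst f1 f2; rfl
    · intro T hT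
      obtain ⟨⟨z, u⟩, hzu, rfl⟩ := Finset.mem_image.1 hT
      rw [Finset.mem_sigma] at hzu
      simp only [Finset.insert_subset_iff, Finset.singleton_subset_iff, Finset.mem_union]
      exact ⟨Or.inr hzu.1, Or.inl (mem_trace.1 hzu.2).1⟩

end Size

/-- The density bound gives `O(m^(1+ε))` traces, and applied to edges it gives `d = O(m^ε)`; both
are inserted into `IsKernelStep.card_le`. -/
theorem exists_kernelStep_card_le (r : ℕ) (c α δ : ℝ) (hc : 0 ≤ c) (hα0 : 0 ≤ α) (hα : α < 1)
    (hδ : 0 < δ) : ∃ C : ℝ, 0 ≤ C ∧ ∀ (Γ : SimpleGraph ℕ) (vs M M' : Finset ℕ) (d : ℕ)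
      (pk : ∀ j, (Fin j → ℕ) → Finset (Finset ℕ)), M ⊆ vs → HasSeparators Γ vs c α →
      IsKernelStep Γ vs r M M' d pk → (M'.card : ℝ) ≤ C * (M.card : ℝ) ^ (1 + δ) := by
  -- The product to be bounded is `m` to the power `r ε + ε + (1 + ε)`, which is at most `1 + δ`.
  set ε : ℝ := δ / (r + 3) with hε
  have hε0 : 0 < ε := by positivity
  obtain ⟨C, hC0, hC⟩ := exists_card_le_of_hasSeparations c α ε hα hε0
  set C₁ : ℝ := C * 2 ^ (1 + ε) with hC₁
  have hC₁0 : 0 ≤ C₁ := by positivity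
  refine ⟨2 + r * ((C₁ + 1) ^ r * (r * C₁ * C)), by positivity, ?_⟩
  intro Γ vs M M' d pk hM hsep h
  have hcard := h.card_le
  -- If `M` is empty, there are no high vertices for the bound `0`, so minimality forces `d = 0` and
  -- nothing is added.
  rcases M.eq_empty_or_nonempty with rfl | hne
  · have hd : d = 0 := by
      by_contra hd
      have := h.high_min 0 (Nat.pos_of_ne_zero hd)
      simp [highSet, trace] at this
    have : M'.card = 0 := by simpa [hd] using hcard
    rw [this]; simp
    positivity
  set m : ℝ := (M.card : ℝ) with hm
  have hm1 : (1 : ℝ) ≤ m := by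
    rw [hm]; exact_mod_cast Finset.card_pos.2 hne
  have hm0 : 0 < m := by linarith
  have ht : (((lowSet Γ vs M d).image (trace Γ M)).card : ℝ) ≤ C * m ^ (1 + ε) := by
    have h1 := hC ℕ _ M hne (hsep.hasSeparations_traces hM (R := lowSet Γ vs M d)
      (Finset.filter_subset _ _))
    rwa [Finset.filter_true_of_mem] at h1
    intro T hT
    obtain ⟨z, _, rfl⟩ := Finset.mem_image.1 hT
    exact fun x hx => (mem_trace.1 hx).1
  have hd : (d : ℝ) ≤ C₁ * m ^ ε := by
    rcases Nat.eq_zero_or_pos d with rfl | hd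
    · simp; positivity
    -- By minimality of `d` more than `|M|` vertices have at least `d` neighbours in `M`; exactly
    -- `|M|` of them are kept, so that `M ∪ H` has at most `2|M|` vertices.
    obtain ⟨H, hH, hHc⟩ := Finset.exists_subset_card_eq (h.high_min (d - 1) (by omega)).le
    obtain ⟨𝒯, h𝒯, h𝒯c⟩ := card_mul_le_edges (Γ := Γ) (vs := vs) (M := M) (d := d) (H := H)
      (hH.trans (Finset.filter_subset _ _)) (fun z hz => by
        have := (Finset.mem_filter.1 (hH hz)).2
        omega)
    have hsub : M ∪ H ⊆ vs := Finset.union_subset hM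
      ((hH.trans (Finset.filter_subset _ _)).trans Finset.sdiff_subset)
    have h1 := hC ℕ 𝒯 (M ∪ H) (hne.mono Finset.subset_union_left)
      (hsep.hasSeparations_edges hc hα0 𝒯 h𝒯 hsub)
    have h2 : ((M ∪ H).card : ℝ) ≤ 2 * m := by
      have : (M ∪ H).card ≤ 2 * M.card := (Finset.card_union_le _ _).trans (by omega)
      rw [hm]; exact_mod_cast this
    have h3 : (d : ℝ) * m ≤ C₁ * m ^ ε * m := by
      calc (d : ℝ) * m = ((d * H.card : ℕ) : ℝ) := by rw [hHc]; push_cast; rfl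
        _ ≤ ((𝒯.filter fun T => T ⊆ M ∪ H).card : ℝ) := by exact_mod_cast h𝒯c
        _ ≤ C * ((M ∪ H).card : ℝ) ^ (1 + ε) := h1
        _ ≤ C * (2 * m) ^ (1 + ε) := by gcongr
        _ = C₁ * (m ^ ε * m) := by
          rw [Real.mul_rpow (by norm_num) hm0.le, hC₁, Real.rpow_add hm0, Real.rpow_one]; ring
        _ = _ := by ring
    exact le_of_mul_le_mul_right h3 hm0
  have hmε : 1 ≤ m ^ ε := Real.one_le_rpow hm1 hε0.le
  have hd1 : (d : ℝ) + 1 ≤ (C₁ + 1) * m ^ ε := by linarith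
  have hcast : (M'.card : ℝ) ≤ 2 * m + r * ((d + 1) ^ r *
      (r * d * ((lowSet Γ vs M d).image (trace Γ M)).card)) := by
    rw [hm]; exact_mod_cast hcard
  have hexp : (m ^ ε) ^ r * (m ^ ε * m ^ (1 + ε)) ≤ m ^ (1 + δ) := by
    rw [← Real.rpow_natCast, ← Real.rpow_mul hm0.le, ← Real.rpow_add hm0, ← Real.rpow_add hm0]
    refine Real.rpow_le_rpow_of_exponent_le hm1 ?_
    have : ε * (r + 3) = δ := by rw [hε]; field_simp
    nlinarith
  have hm2 : m ≤ m ^ (1 + δ) := by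
    calc m = m ^ (1 : ℝ) := (Real.rpow_one _).symm
      _ ≤ _ := Real.rpow_le_rpow_of_exponent_le hm1 (by linarith)
  calc (M'.card : ℝ) ≤ 2 * m + r * ((d + 1) ^ r *
      (r * d * ((lowSet Γ vs M d).image (trace Γ M)).card)) := hcast
    _ ≤ 2 * m + r * (((C₁ + 1) * m ^ ε) ^ r * (r * (C₁ * m ^ ε) * (C * m ^ (1 + ε)))) := by gcongr
    _ = 2 * m + r * ((C₁ + 1) ^ r * (r * C₁ * C)) * ((m ^ ε) ^ r * (m ^ ε * m ^ (1 + ε))) := by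
      rw [mul_pow]; ring
    _ ≤ 2 * m ^ (1 + δ) + r * ((C₁ + 1) ^ r * (r * C₁ * C)) * m ^ (1 + δ) := by gcongr
    _ = _ := by ring

/-- What the rounds of the kernelization maintain. -/
def KernelInv (Γ : SimpleGraph ℕ) (vs : Finset ℕ) (r : ℕ) (M : Finset ℕ) (i : ℕ) : Prop :=
  M ⊆ vs ∧ IsCover Γ vs r M ∧ ∃ 𝓕 : Set (Finset ℕ), (∀ F ∈ 𝓕, F ⊆ M) ∧
    (∀ k, (∃ S, IsCover Γ vs r S ∧ S.card ≤ k) →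
      ∃ S ⊆ vs, IsCover Γ vs r S ∧ S.card ≤ k ∧ ∀ F ∈ 𝓕, (F ∩ S).Nonempty) ∧
    ∀ C, IsRClique Γ vs r C → (∃ F ∈ 𝓕, F ⊆ C) ∨ i ≤ (C ∩ M).card

/-- The start of the induction. The members of `𝓕` are the subsets of `M` that a solution may be
assumed to meet; none is needed yet, since a cover meets every clique in a vertex. -/
theorem IsCover.kernelInv {Γ : SimpleGraph ℕ} {vs : Finset ℕ} {r : ℕ} {M : Finset ℕ}
    (hM : M ⊆ vs) (h : IsCover Γ vs r M) : KernelInv Γ vs r M 1 := by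
  refine ⟨hM, h, ∅, by simp, fun k ⟨S, hS, hk⟩ => ⟨S ∩ vs, Finset.inter_subset_right, ?_, ?_,
    by simp⟩, fun C hC => Or.inr (Finset.card_pos.2 (h C hC))⟩
  · intro C hC
    obtain ⟨x, hx⟩ := hS C hC
    rw [Finset.mem_inter] at hx
    exact ⟨x, by simp [hx, hC.1 hx.1]⟩
  · exact (Finset.card_le_card Finset.inter_subset_left).trans hk

/-- A clique either contains a member of `𝓕`, which the solution meets inside `M`, or has all its
`r` vertices in `M`. In both cases the part of the solution in `M` meets it. -/
theorem KernelInv.exists_cover_subset {Γ : SimpleGraph ℕ} {vs : Finset ℕ} {r : ℕ} {M : Finset ℕ}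
    (h : KernelInv Γ vs r M r) {k : ℕ} :
    (∃ S, IsCover Γ vs r S ∧ S.card ≤ k) ↔ ∃ S ⊆ M, IsCover Γ vs r S ∧ S.card ≤ k := by
  refine ⟨fun hk => ?_, fun ⟨S, _, h1, h2⟩ => ⟨S, h1, h2⟩⟩
  obtain ⟨_, _, 𝓕, h𝓕M, h𝓕, hC⟩ := h
  obtain ⟨S, _, hS, hSk, hSF⟩ := h𝓕 k hk
  refine ⟨S ∩ M, Finset.inter_subset_right, fun C hCr => ?_,
    (Finset.card_le_card Finset.inter_subset_left).trans hSk⟩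
  rcases hC C hCr with ⟨F, hF, hFC⟩ | hle
  · obtain ⟨x, hx⟩ := hSF F hF
    rw [Finset.mem_inter] at hx
    exact ⟨x, by simp [hFC hx.1, hx.2, h𝓕M F hF hx.1]⟩
  · have : C ∩ M = C := Finset.eq_of_subset_of_card_le Finset.inter_subset_left
      (by rw [hCr.2.1]; exact hle)
    have hCM : C ⊆ M := Finset.inter_eq_left.1 this
    obtain ⟨x, hx⟩ := hS C hCr
    rw [Finset.mem_inter] at hx
    exact ⟨x, by simp [hx, hCM hx.1]⟩

/-- The cores with large packings become forced sets: a solution that misses one must meet each of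
its disjoint petals in a low vertex, and too many of these vertices share a trace, so that
exchanging them for the trace itself is no loss. A clique without a forced subset has a high vertex
or a petal that meets a packing added to `M'`, hence gains a vertex, unless it lies in `M'` already.
-/
theorem KernelInv.step {Γ : SimpleGraph ℕ} {vs : Finset ℕ} {r : ℕ} {M M' : Finset ℕ} {i d : ℕ}
    {pk : ∀ j, (Fin j → ℕ) → Finset (Finset ℕ)} (hi : i < r) (hinv : KernelInv Γ vs r M i)
    (h : IsKernelStep Γ vs r M M' d pk) : KernelInv Γ vs r M' (i + 1) := by
  classical
  obtain ⟨hM, hcov, 𝓕, h𝓕M, h𝓕, hC⟩ := hinv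
  refine ⟨h.sub, fun C hCr => (hcov C hCr).mono (Finset.inter_subset_inter_left h.sup),
    𝓕 ∪ {F | ∃ j, ∃ τ : Fin j → ℕ, IsCore Γ M r τ ∧ d * numTraces Γ vs M d τ < (pk j τ).card ∧
      F = Finset.univ.image τ}, ?_, ?_, ?_⟩
  · rintro F (hF | ⟨j, τ, hτ, _, rfl⟩)
    · exact (h𝓕M F hF).trans h.sup
    · intro x hx
      obtain ⟨i, _, rfl⟩ := Finset.mem_image.1 hx
      exact h.sup (hτ.mem i)
  · intro k hk
    obtain ⟨S₀, hS₀vs, hS₀⟩ := h𝓕 k hk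
    -- Among the solutions that meet all old forced sets, one with the most vertices in `M` is
    -- stable under the exchange.
    obtain ⟨S, hS, hmax⟩ := Finset.exists_max_image
      (vs.powerset.filter fun S => IsCover Γ vs r S ∧ S.card ≤ k ∧ ∀ F ∈ 𝓕, (F ∩ S).Nonempty)
      (fun S => (S ∩ M).card) ⟨S₀, by simp only [Finset.mem_filter, Finset.mem_powerset]; exact ⟨hS₀vs, hS₀⟩⟩
    simp only [Finset.mem_filter, Finset.mem_powerset] at hS hmax
    obtain ⟨hSvs, hScov, hSk, hSF⟩ := hS
    refine ⟨S, hSvs, hScov, hSk, ?_⟩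
    -- Otherwise replace the outside vertices of `S` with trace `T` by `T`. A clique met in such a
    -- vertex also meets the cover `M`, in a neighbour of that vertex, so in `T`. The size does not
    -- grow, but the part in `M` does.
    have hexch : ∀ T ⊆ M, ¬ T ⊆ S →
        (S.filter fun z => z ∈ vs \ M ∧ trace Γ M z = T).card < T.card := by
      intro T hT hTS
      by_contra hcon
      push Not at hcon
      set VT := S.filter fun z => z ∈ vs \ M ∧ trace Γ M z = T with hVT
      have hVS : VT ⊆ S := Finset.filter_subset _ _
      have hVM : ∀ z ∈ VT, z ∉ M := fun z hz => by
        have := (Finset.mem_filter.1 hz).2.1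
        simp at this; exact this.2
      have h1 := hmax (S \ VT ∪ T) ⟨Finset.union_subset (Finset.sdiff_subset.trans hSvs)
        (hT.trans hM), ?_, ?_, ?_⟩
      · have hlt : S ∩ M ⊂ (S \ VT ∪ T) ∩ M := by
          rw [Finset.ssubset_iff_subset_ne]
          constructor
          · intro x hx
            simp only [Finset.mem_inter, Finset.mem_union, Finset.mem_sdiff] at hx ⊢
            exact ⟨Or.inl ⟨hx.1, fun hxV => hVM x hxV hx.2⟩, hx.2⟩
          · intro heq
            apply hTS
            intro x hx
            have : x ∈ (S \ VT ∪ T) ∩ M := by simp [hx, hT hx]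
            rw [← heq] at this
            exact (Finset.mem_inter.1 this).1
        exact absurd h1 (not_le.2 (Finset.card_lt_card hlt))
      · intro C hCr
        obtain ⟨z, hz⟩ := hScov C hCr
        rw [Finset.mem_inter] at hz
        by_cases hzV : z ∈ VT
        · obtain ⟨u, hu⟩ := hcov C hCr
          rw [Finset.mem_inter] at hu
          have hzu : z ≠ u := fun e => hVM z hzV (e ▸ hu.2)
          have huT : u ∈ T := by
            rw [← (Finset.mem_filter.1 hzV).2.2]
            exact mem_trace.2 ⟨hu.2, hCr.2.2 z hz.1 u hu.1 hzu⟩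
          exact ⟨u, by simp [hu.1, huT]⟩
        · exact ⟨z, by simp [hz, hzV]⟩
      · refine (Finset.card_union_le _ _).trans ?_
        rw [Finset.card_sdiff_of_subset hVS]
        have := Finset.card_le_card hVS
        omega
      · intro F hF
        obtain ⟨x, hx⟩ := hSF F hF
        rw [Finset.mem_inter] at hx
        exact ⟨x, by
          simp only [Finset.mem_inter, Finset.mem_union, Finset.mem_sdiff]
          exact ⟨hx.1, Or.inl ⟨hx.2, fun hxV => hVM x hxV (h𝓕M F hF hx.1)⟩⟩⟩
    rintro F (hF | ⟨j, τ, hτ, hrich, rfl⟩)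
    · exact hSF F hF
    by_contra hcon
    rw [Finset.not_nonempty_iff_eq_empty] at hcon
    have hun : ∀ i, τ i ∉ S := fun i hiS => by
      have : τ i ∈ Finset.univ.image τ ∩ S := by simp [hiS]
      rw [hcon] at this; simp at this
    have hpack := h.packing j τ hτ
    refine absurd hrich (not_lt.2 ?_)
    -- every petal contains a vertex of `S`
    have hpick : ∀ Z, ∃ z, Z ∈ pk j τ → z ∈ Z ∧ z ∈ S := by
      intro Z
      by_cases hZ : Z ∈ pk j τ
      · obtain ⟨z, hz⟩ := hScov _ (hpack.petal Z hZ).2.2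
        rw [Finset.mem_inter, Finset.mem_union] at hz
        refine ⟨z, fun _ => ⟨hz.1.resolve_left fun hzτ => ?_, hz.2⟩⟩
        obtain ⟨i, _, rfl⟩ := Finset.mem_image.1 hzτ
        exact hun i hz.2
      · exact ⟨0, fun h => absurd h hZ⟩
    choose pick hpick using hpick
    set 𝒯 := ((lowSet Γ vs M d).image (trace Γ M)).filter fun T => ∀ i, τ i ∈ T with h𝒯
    have hmaps : ∀ Z ∈ pk j τ, trace Γ M (pick Z) ∈ 𝒯 := by
      intro Z hZ
      have hp := hpack.petal Z hZ
      have hz := hpick Z hZ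
      rw [h𝒯, Finset.mem_filter]
      refine ⟨Finset.mem_image_of_mem _ (hp.1 hz.1), fun i => mem_trace.2 ⟨hτ.mem i, ?_⟩⟩
      refine hp.2.2.2.2 _ (Finset.mem_union_right _ hz.1) _ (Finset.mem_union_left _
        (Finset.mem_image_of_mem _ (Finset.mem_univ i))) ?_
      intro e
      exact hun i (e ▸ hz.2)
    -- The petals are sorted by the traces of their picked vertices. The petals are disjoint, so the
    -- picked vertices are distinct, and each trace accounts for at most `d` of them.
    rw [Finset.card_eq_sum_card_fiberwise hmaps, numTraces, ← h𝒯, mul_comm, ← smul_eq_mul,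
      ← Finset.sum_const]
    refine Finset.sum_le_sum fun T hT => ?_
    rw [h𝒯, Finset.mem_filter] at hT
    obtain ⟨z, hz, rfl⟩ := Finset.mem_image.1 hT.1
    -- The core is nonempty and misses `S`, so the exchange bound applies to every trace that
    -- contains it.
    have hTS : ¬ trace Γ M z ⊆ S := fun hsub => hun ⟨0, hτ.pos⟩ (hsub (hT.2 ⟨0, hτ.pos⟩))
    have h1 := hexch (trace Γ M z) (Finset.filter_subset _ _) hTS
    have h2 := (Finset.mem_filter.1 hz).2
    refine le_trans ?_ (h1.le.trans h2)
    refine Finset.card_le_card_of_injOn pick (fun Z hZ => ?_) ?_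
    · simp only [Finset.coe_filter, Set.mem_ofPred_eq] at hZ ⊢
      refine ⟨(hpick Z hZ.1).2, ?_, hZ.2⟩
      exact Finset.filter_subset _ _ ((hpack.petal Z hZ.1).1 (hpick Z hZ.1).1)
    · intro Z hZ Z' hZ' heq
      simp only [Finset.coe_filter, Set.mem_ofPred_eq] at hZ hZ'
      by_contra hne
      have hdj := hpack.disjoint Z hZ.1 Z' hZ'.1 hne
      exact Finset.disjoint_left.1 hdj (hpick Z hZ.1).1 (heq ▸ (hpick Z' hZ'.1).1)
  · intro C hCr
    rcases hC C hCr with ⟨F, hF, hFC⟩ | hle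
    · exact Or.inl ⟨F, Or.inl hF, hFC⟩
    by_cases hCM : C ⊆ M'
    · right; rw [Finset.inter_eq_left.2 hCM, hCr.2.1]; omega
    have hgrow : ∀ v ∈ C, v ∈ M' → v ∉ M → i + 1 ≤ (C ∩ M').card := by
      intro v hvC hvM' hvM
      have : C ∩ M ⊂ C ∩ M' := by
        rw [Finset.ssubset_iff_of_subset (Finset.inter_subset_inter_left h.sup)]
        exact ⟨v, by simp [hvC, hvM'], by simp [hvM]⟩
      have := Finset.card_lt_card this
      omega
    by_cases hhigh : ∃ v ∈ C, v ∈ highSet Γ vs M d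
    · obtain ⟨v, hv, hvh⟩ := hhigh
      refine Or.inr (hgrow v hv (h.high hvh) ?_)
      have := Finset.filter_subset _ _ hvh
      simp at this; exact this.2
    push Not at hhigh
    have hlow : C \ M ⊆ lowSet Γ vs M d := by
      intro v hv
      have hv' := Finset.mem_sdiff.1 hv
      have := hhigh v hv'.1
      simp only [highSet, lowSet, Finset.mem_filter, Finset.mem_sdiff, hCr.1 hv'.1, hv'.2,
        not_false_eq_true, and_self, true_and, not_lt] at this ⊢
      exact this
    -- The core of `C` is `C ∩ M`: nonempty as `M` is a cover, and with fewer than `r` elements as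
    -- `C` is not inside `M`.
    let τ : Fin (C ∩ M).card → ℕ := fun x => ((C ∩ M).equivFin.symm x : ℕ)
    have hτinj : Function.Injective τ := fun x y hxy =>
      (C ∩ M).equivFin.symm.injective (Subtype.ext hxy)
    have hτmem : ∀ x, τ x ∈ C ∩ M := fun x => ((C ∩ M).equivFin.symm x).2
    have hτimg : Finset.univ.image τ = C ∩ M := by
      refine Finset.eq_of_subset_of_card_le (fun x hx => ?_) ?_
      · obtain ⟨i, _, rfl⟩ := Finset.mem_image.1 hx; exact hτmem i
      · rw [Finset.card_image_of_injective _ hτinj]; simp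
    have hcore : IsCore Γ M r τ := by
      refine ⟨Finset.card_pos.2 (hcov C hCr), ?_, fun x => (Finset.mem_inter.1 (hτmem x)).2,
        fun x y hxy => hCr.2.2 _ (Finset.mem_inter.1 (hτmem x)).1 _
          (Finset.mem_inter.1 (hτmem y)).1 fun e => hxy.ne (hτinj e)⟩
      rw [← hCr.2.1]
      refine Finset.card_lt_card ?_
      rw [Finset.ssubset_iff_subset_ne]
      refine ⟨Finset.inter_subset_left, fun e => hCM ?_⟩
      exact (Finset.inter_eq_left.1 e).trans h.sup
    have hun : C ∩ M ∪ C \ M = C := by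
      ext x; simp only [Finset.mem_union, Finset.mem_inter, Finset.mem_sdiff]; tauto
    have hpet : IsPetal Γ vs (lowSet Γ vs M d) r τ (C \ M) := by
      refine ⟨hlow, ?_, ?_⟩
      · rw [hτimg, Finset.disjoint_left]
        intro x hx hx'
        simp at hx hx'; tauto
      · rw [hτimg, hun]; exact hCr
    by_cases hrich : d * numTraces Γ vs M d τ < (pk _ τ).card
    · left
      exact ⟨C ∩ M, Or.inr ⟨_, τ, hcore, hrich, hτimg.symm⟩, Finset.inter_subset_left⟩
    · right
      obtain ⟨Z', hZ', hdj⟩ := (h.packing _ τ hcore).maximal _ hpet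
      rw [Finset.not_disjoint_iff] at hdj
      obtain ⟨v, hv, hvZ⟩ := hdj
      rw [Finset.mem_sdiff] at hv
      exact hgrow v hv.1 (h.add _ τ hcore (not_lt.1 hrich) Z' hZ' hvZ) hv.2


/-! ### Elimination forests from separators. -/

/-- `U` has an elimination forest of depth `t`. -/
inductive ElimDepth (Γ : SimpleGraph ℕ) : ℕ → Finset ℕ → Prop
  | empty (t : ℕ) : ElimDepth Γ t ∅
  | split {t : ℕ} {A B : Finset ℕ} : ElimDepth Γ t A → ElimDepth Γ t B →
      (∀ a ∈ A, ∀ b ∈ B, ¬ Γ.Adj a b) → ElimDepth Γ t (A ∪ B)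
  | branch {t : ℕ} {U : Finset ℕ} (v : ℕ) : ElimDepth Γ t (U.erase v) → ElimDepth Γ (t + 1) U

namespace ElimDepth

variable {Γ : SimpleGraph ℕ}

theorem subset {t : ℕ} {U : Finset ℕ} (h : ElimDepth Γ t U) :
    ∀ {U' : Finset ℕ}, U' ⊆ U → ElimDepth Γ t U' := by
  induction h with
  | empty t => intro U' h; rw [Finset.subset_empty.1 h]; exact .empty t
  | split hA hB hno ihA ihB =>
    rename_i t A B
    intro U' h
    rw [← Finset.inter_eq_left.2 h, Finset.inter_union_distrib_left]
    exact .split (ihA Finset.inter_subset_right) (ihB Finset.inter_subset_right) fun a ha b hb =>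
      hno a (Finset.mem_inter.1 ha).2 b (Finset.mem_inter.1 hb).2
  | branch v h ih => intro U' hU; exact .branch v (ih (Finset.erase_subset_erase v hU))

theorem add_of_sdiff {t : ℕ} (X : Finset ℕ) : ∀ {U : Finset ℕ}, ElimDepth Γ t (U \ X) →
    ElimDepth Γ (t + X.card) U := by
  induction X using Finset.induction_on with
  | empty => intro U h; simpa using h
  | insert v X hv ih =>
    intro U h
    rw [Finset.card_insert_of_notMem hv, ← add_assoc]
    refine .branch v (ih (h.subset fun x hx => ?_))
    simp only [Finset.mem_sdiff, Finset.mem_erase, Finset.mem_insert] at hx ⊢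
    tauto

theorem card_self (U : Finset ℕ) : ElimDepth Γ U.card U := by
  simpa using (ElimDepth.empty (Γ := Γ) 0).subset (by simp) |>.add_of_sdiff (U := U) U

/-- For a connected set, one part of a `split` is everything, so the derivation reaches a `branch`,
whose vertex is the root of the tree. A branch at a vertex outside `K` only wastes depth, and then
any vertex of `K` will do. -/
theorem exists_erase {t : ℕ} {K : Finset ℕ} (h : ElimDepth Γ t K) (hne : K.Nonempty)
    (hconn : ∀ A B : Finset ℕ, A.Nonempty → B.Nonempty → Disjoint A B → A ∪ B = K →
      ∃ a ∈ A, ∃ b ∈ B, Γ.Adj a b) :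
    ∃ v ∈ K, ∃ t', t = t' + 1 ∧ ElimDepth Γ t' (K.erase v) := by
  induction h with
  | empty t => simp at hne
  | split hA hB hno ihA ihB =>
    rename_i t A B
    rcases A.eq_empty_or_nonempty with rfl | hAne
    · rw [Finset.empty_union] at *; exact ihB hne hconn
    rcases (B \ A).eq_empty_or_nonempty with hBA | hBne
    · rw [Finset.sdiff_eq_empty_iff_subset] at hBA
      rw [Finset.union_eq_left.2 hBA] at *
      exact ihA hne hconn
    · obtain ⟨a, ha, b, hb, hab⟩ := hconn A (B \ A) hAne hBne Finset.disjoint_sdiff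
        (Finset.union_sdiff_self_eq_union)
      exact absurd hab (hno a ha b (Finset.mem_sdiff.1 hb).1)
  | branch v h ih =>
    rename_i t U
    by_cases hv : v ∈ U
    · exact ⟨v, hv, t, rfl, h⟩
    · obtain ⟨u, hu⟩ := hne
      rw [Finset.erase_eq_of_notMem hv] at h
      exact ⟨u, hu, t, rfl, h.subset (Finset.erase_subset _ _)⟩

end ElimDepth

/-- Branch on the vertices of a balanced separator and recurse on the two sides, which share the
remaining depth and have at most `2/3` of the vertices. The separator sizes along a branch are
dominated by a geometric series. -/
theorem exists_elimDepth (c α : ℝ) (hc : 0 ≤ c) (hα : 0 < α) : ∃ C : ℝ, 0 ≤ C ∧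
    ∀ (Γ : SimpleGraph ℕ) (vs : Finset ℕ), HasSeparators Γ vs c α →
      ∀ U ⊆ vs, ∀ t : ℕ, C * (U.card : ℝ) ^ α ≤ t → ElimDepth Γ t U := by
  set q : ℝ := (2 / 3 : ℝ) ^ α with hq
  have hq1 : q < 1 := Real.rpow_lt_one (by norm_num) (by norm_num) hα
  have hq0 : 0 < q := by positivity
  -- The sum of the geometric series, that is, the solution of `C = c + C q` with `q = (2/3)^α`.
  set C : ℝ := c / (1 - q) with hC
  have hCq : C = c + C * q := by
    rw [hC]
    have : 1 - q ≠ 0 := by linarith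
    field_simp; ring
  have hC0 : 0 ≤ C := div_nonneg hc (by linarith)
  refine ⟨C, hC0, fun Γ vs hsep U => ?_⟩
  induction hu : U.card using Nat.strong_induction_on generalizing U with
  | _ u ih =>
    intro hU t ht
    rcases U.eq_empty_or_nonempty with rfl | hne
    · exact .empty t
    have hupos : 0 < u := hu ▸ Finset.card_pos.2 hne
    obtain ⟨A, B, hAB, hno, hI, hA, hB⟩ := hsep U hU hne U subset_rfl
    have hAU : A \ B ⊆ U := Finset.sdiff_subset.trans (hAB ▸ Finset.subset_union_left)
    have hBU : B \ A ⊆ U := Finset.sdiff_subset.trans (hAB ▸ Finset.subset_union_right)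
    rw [Finset.inter_eq_right.2 hAU, hu] at hA
    rw [Finset.inter_eq_right.2 hBU, hu] at hB
    rw [hu] at hI
    have hup : (0 : ℝ) ≤ (u : ℝ) ^ α := by positivity
    have hmain : c * (u : ℝ) ^ α + C * q * (u : ℝ) ^ α ≤ t := by
      calc _ = C * (u : ℝ) ^ α := by rw [← add_mul, ← hCq]
        _ ≤ t := ht
    have hxt : (A ∩ B).card ≤ t := by
      have : ((A ∩ B).card : ℝ) ≤ t := by
        have : 0 ≤ C * q * (u : ℝ) ^ α := by positivity
        linarith
      exact_mod_cast this
    have key : ∀ D ⊆ U, 3 * D.card ≤ 2 * u → ElimDepth Γ (t - (A ∩ B).card) D := by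
      intro D hD hDc
      refine ih D.card (by omega) D rfl (hD.trans hU) _ ?_
      have h1 : (D.card : ℝ) ≤ 2 / 3 * u := by
        have : (3 * D.card : ℝ) ≤ 2 * u := by exact_mod_cast hDc
        linarith
      calc C * (D.card : ℝ) ^ α ≤ C * (2 / 3 * u : ℝ) ^ α :=
            mul_le_mul_of_nonneg_left (Real.rpow_le_rpow (Nat.cast_nonneg _) h1 hα.le) hC0
        _ = C * q * (u : ℝ) ^ α := by
          rw [Real.mul_rpow (by norm_num) (by positivity), ← mul_assoc]
        _ ≤ ((t - (A ∩ B).card : ℕ) : ℝ) := by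
          rw [Nat.cast_sub hxt]; linarith
    have h1 := ElimDepth.split (key _ hAU hA) (key _ hBU hB) hno
    have h2 := ElimDepth.add_of_sdiff (U := U) (A ∩ B) (h1.subset fun x hx => by
      obtain ⟨hxU, hxn⟩ := Finset.mem_sdiff.1 hx
      rw [Finset.mem_inter, not_and_or] at hxn
      have hxAB := Finset.mem_union.1 (hAB.symm ▸ hxU : x ∈ A ∪ B)
      rw [Finset.mem_union, Finset.mem_sdiff, Finset.mem_sdiff]
      tauto)
    rwa [Nat.sub_add_cancel hxt] at h2

/-! ### Components of induced subgraphs. -/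

open Classical in
/-- The vertices reachable from `w` through vertices of `U`. -/
noncomputable def reach (Γ : SimpleGraph ℕ) (U : Finset ℕ) (w : ℕ) : Finset ℕ :=
  (insert w U).filter (Relation.ReflTransGen (fun a b => Γ.Adj a b ∧ b ∈ U) w)

section Reach

variable {Γ : SimpleGraph ℕ} {U : Finset ℕ} {w x y v : ℕ}

theorem mem_reach :
    x ∈ reach Γ U w ↔ Relation.ReflTransGen (fun a b => Γ.Adj a b ∧ b ∈ U) w x := by
  classical
  simp only [reach, Finset.mem_filter, and_iff_right_iff_imp]
  intro h
  rcases Relation.ReflTransGen.cases_tail h with h | ⟨y, _, h⟩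
  · simp [h]
  · simp [h.2]

theorem self_mem_reach : w ∈ reach Γ U w := mem_reach.2 .refl

theorem reach_subset (hw : w ∈ U) : reach Γ U w ⊆ U := by
  intro x hx
  rcases Relation.ReflTransGen.cases_tail (mem_reach.1 hx) with h | ⟨y, _, h⟩
  · exact h ▸ hw
  · exact h.2

theorem mem_reach_of_adj (hx : x ∈ reach Γ U w) (hxy : Γ.Adj x y) (hy : y ∈ U) :
    y ∈ reach Γ U w := mem_reach.2 ((mem_reach.1 hx).tail ⟨hxy, hy⟩)

theorem mem_reach_symm (hw : w ∈ U) (hx : x ∈ reach Γ U w) : w ∈ reach Γ U x := by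
  rw [mem_reach] at *
  induction hx with
  | refl => exact .refl
  | tail h1 h2 ih =>
    refine Relation.ReflTransGen.head ⟨h2.1.symm, ?_⟩ ih
    exact reach_subset hw (mem_reach.2 h1)

theorem mem_reach_trans (hx : x ∈ reach Γ U w) (hy : y ∈ reach Γ U x) : y ∈ reach Γ U w :=
  mem_reach.2 ((mem_reach.1 hx).trans (mem_reach.1 hy))

theorem reach_eq_of_mem (hw : w ∈ U) (hx : x ∈ reach Γ U w) : reach Γ U x = reach Γ U w := by
  ext y
  exact ⟨fun h => mem_reach_trans hx h, fun h => mem_reach_trans (mem_reach_symm hw hx) h⟩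

theorem reach_connected (hw : w ∈ U) (A B : Finset ℕ) (hA : A.Nonempty) (hB : B.Nonempty)
    (hdj : Disjoint A B) (hAB : A ∪ B = reach Γ U w) : ∃ a ∈ A, ∃ b ∈ B, Γ.Adj a b := by
  by_contra hcon
  push Not at hcon
  obtain ⟨a, ha⟩ := hA
  obtain ⟨b, hb⟩ := hB
  have ha' : a ∈ reach Γ U w := hAB ▸ Finset.mem_union_left _ ha
  have hb' : b ∈ reach Γ U a := by
    rw [reach_eq_of_mem hw ha', ← hAB]; exact Finset.mem_union_right _ hb
  have hall : ∀ x, x ∈ reach Γ U a → x ∈ A := by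
    intro x hx
    rw [mem_reach] at hx
    induction hx with
    | refl => exact ha
    | tail h1 h2 ih =>
      have : _ ∈ reach Γ U w := mem_reach_trans ha' (mem_reach.2 (h1.tail h2))
      rw [← hAB, Finset.mem_union] at this
      exact this.resolve_right fun hB => hcon _ ih _ hB h2.1
  exact Finset.disjoint_left.1 hdj (hall b hb') hb

/-- A walk from `v` may be restarted at its last visit to `v`. Hence what remains of a component
after deciding `v` can be recovered from `v` and the set of undecided vertices, which makes
`pending` computable from a code. -/
theorem reach_erase (hw : w ∈ U) (hv : v ∈ reach Γ U w) :
    (reach Γ (U.erase v) v).erase v = (reach Γ U w).erase v := by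
  ext x
  simp only [Finset.mem_erase, and_congr_right_iff]
  intro hxv
  rw [← reach_eq_of_mem hw hv, mem_reach, mem_reach]
  constructor
  · intro h
    exact Relation.ReflTransGen.mono (fun a b h => ⟨h.1, Finset.mem_of_mem_erase h.2⟩) _ _ h
  · intro h
    have : ∀ y, Relation.ReflTransGen (fun a b => Γ.Adj a b ∧ b ∈ U) v y →
        y = v ∨ Relation.ReflTransGen (fun a b => Γ.Adj a b ∧ b ∈ U.erase v) v y := by
      intro y hy
      induction hy with
      | refl => exact Or.inl rfl
      | tail h1 h2 ih =>
        rename_i p q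
        by_cases hqv : q = v
        · exact Or.inl hqv
        right
        have h3 : Γ.Adj p q ∧ q ∈ U.erase v := ⟨h2.1, Finset.mem_erase.2 ⟨hqv, h2.2⟩⟩
        rcases ih with rfl | ih
        · exact .single h3
        · exact ih.tail h3
    exact (this x h).resolve_left hxv

end Reach

/-! ### The dynamic program over strings of decisions -/

section Strings

/-- Strings of decisions are coded by natural numbers; the letter `x < m` puts the vertex `mv x`
into the solution (status `1`), the letter `m + x` leaves `mv x` out (status `2`). -/
def letterVertex (mv : ℕ → ℕ) (m x : ℕ) : ℕ := if x < m then mv x else mv (x - m)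

def letterStatus (m x : ℕ) : ℕ := if x < m then 1 else 2

/-- The status of every vertex after the decisions coded by the argument. -/
def statusOf (mv : ℕ → ℕ) (m : ℕ) : ℕ → ℕ → ℕ
  | 0 => fun _ => 0
  | c + 1 => fun v =>
    if statusOf mv m (c / (2 * m)) v ≠ 0 then statusOf mv m (c / (2 * m)) v
    else if v = letterVertex mv m (c % (2 * m)) then letterStatus m (c % (2 * m)) else 0
  decreasing_by all_goals exact Nat.lt_succ_of_le (Nat.div_le_self _ _)

/-- Appending the letter `x` turns the code `c` into `c * (2 * m) + x + 1`. The shift by one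
reserves `0` for the empty string and makes every child larger than its parent. An earlier decision
prevails over a later one. -/
theorem statusOf_child {mv : ℕ → ℕ} {m c x : ℕ} (hx : x < 2 * m) :
    statusOf mv m (c * (2 * m) + x + 1) = fun v =>
      if statusOf mv m c v ≠ 0 then statusOf mv m c v
      else if v = letterVertex mv m x then letterStatus m x else 0 := by
  have h1 : (c * (2 * m) + x) / (2 * m) = c := by
    rw [mul_comm, Nat.mul_add_div (by omega), Nat.div_eq_of_lt hx, add_zero]
  have h2 : (c * (2 * m) + x) % (2 * m) = x := by
    rw [mul_comm, Nat.mul_add_mod, Nat.mod_eq_of_lt hx]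
  rw [statusOf, h1, h2]

variable (Γ : SimpleGraph ℕ) (vs : Finset ℕ) (r : ℕ) (M : Finset ℕ) (mv : ℕ → ℕ) (m : ℕ)

/-- The undecided vertices. -/
noncomputable def undecided (c : ℕ) : Finset ℕ := M.filter fun v => statusOf mv m c v = 0

/-- The vertices for which the decisions following those coded by `c` are responsible. -/
noncomputable def pending (c : ℕ) : Finset ℕ :=
  if c = 0 then M else
    (reach Γ (undecided M mv m c) (letterVertex mv m ((c - 1) % (2 * m)))).erase
      (letterVertex mv m ((c - 1) % (2 * m)))

/-- Some `r`-clique meets `M` only in vertices left out. -/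
def Conflict (c : ℕ) : Prop := ∃ C, IsRClique Γ vs r C ∧ ∀ v ∈ C, v ∈ M → statusOf mv m c v = 2

/-- The components of the pending vertices, represented by their least vertices. -/
noncomputable def compReps (c : ℕ) : Finset ℕ :=
  (pending Γ M mv m c).filter fun w => ∀ a ∈ reach Γ (undecided M mv m c) w, w ≤ a

/-- `x` is the cheapest value (plus one; zero if there is none) of a decision for a vertex in `K`,
according to the table `F` of values (plus one; zero for infinity). -/
def IsBest (F : ℕ → ℕ) (c : ℕ) (K : Finset ℕ) (x : ℕ) : Prop :=
  (x ≠ 0 → ∃ i < m, mv i ∈ K ∧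
    ((F (c * (2 * m) + i + 1) ≠ 0 ∧ x = F (c * (2 * m) + i + 1) + 1) ∨
      (F (c * (2 * m) + (m + i) + 1) ≠ 0 ∧ x = F (c * (2 * m) + (m + i) + 1)))) ∧
  ∀ i < m, mv i ∈ K →
    (F (c * (2 * m) + i + 1) ≠ 0 → x ≠ 0 ∧ x ≤ F (c * (2 * m) + i + 1) + 1) ∧
    (F (c * (2 * m) + (m + i) + 1) ≠ 0 → x ≠ 0 ∧ x ≤ F (c * (2 * m) + (m + i) + 1))

/-- `F` is the table that the dynamic program computes for the codes below `N`. -/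
def IsTable (F : ℕ → ℕ) (N : ℕ) : Prop :=
  (∀ c, N ≤ c → F c = 0) ∧ ∀ c < N, ∃ best : ℕ → ℕ,
    (∀ w ∈ compReps Γ M mv m c, IsBest mv m F c (reach Γ (undecided M mv m c) w) (best w)) ∧
    (Conflict Γ vs r M mv m c ∨ (∃ w ∈ compReps Γ M mv m c, best w = 0) → F c = 0) ∧
    (¬ Conflict Γ vs r M mv m c → (∀ w ∈ compReps Γ M mv m c, best w ≠ 0) →
      F c = 1 + ∑ w ∈ compReps Γ M mv m c, (best w - 1))

variable {Γ vs r M mv m}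

/-- The invariant that the recursion maintains for the pending among the undecided vertices. It does
not hold for every code, since a string may decide vertices in unrelated places; only the reached
codes matter. -/
structure IsUnionOfComps (Γ : SimpleGraph ℕ) (U W : Finset ℕ) : Prop where
  sub : W ⊆ U
  closed : ∀ w ∈ W, reach Γ U w ⊆ W

theorem pending_child {c x w : ℕ} (hx : x < 2 * m) (hw : w ∈ undecided M mv m c)
    (hv : letterVertex mv m x ∈ reach Γ (undecided M mv m c) w) :
    undecided M mv m (c * (2 * m) + x + 1) = (undecided M mv m c).erase (letterVertex mv m x) ∧
    pending Γ M mv m (c * (2 * m) + x + 1) =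
      (reach Γ (undecided M mv m c) w).erase (letterVertex mv m x) := by
  have hvU := reach_subset hw hv
  have h2 : (c * (2 * m) + x) % (2 * m) = x := by
    rw [mul_comm, Nat.mul_add_mod, Nat.mod_eq_of_lt hx]
  have h1 : undecided M mv m (c * (2 * m) + x + 1) =
      (undecided M mv m c).erase (letterVertex mv m x) := by
    ext v
    rw [undecided, statusOf_child hx]
    simp only [undecided, Finset.mem_filter, Finset.mem_erase]
    by_cases h : statusOf mv m c v = 0
    · by_cases h' : v = letterVertex mv m x
      · simp [← h', h, letterStatus]; split_ifs <;> simp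
      · simp [h, h']
    · simp [h]
  refine ⟨h1, ?_⟩
  rw [pending, if_neg (by omega), Nat.add_sub_cancel, h2, h1, reach_erase hw hv]

theorem isUnionOfComps_child {U : Finset ℕ} {w v : ℕ} (hw : w ∈ U) :
    IsUnionOfComps Γ (U.erase v) ((reach Γ U w).erase v) := by
  refine ⟨Finset.erase_subset_erase v (reach_subset hw), fun x hx y hy => ?_⟩
  rw [Finset.mem_erase] at hx
  have hxU : x ∈ U.erase v := Finset.mem_erase.2 ⟨hx.1, reach_subset hw hx.2⟩
  refine Finset.mem_erase.2 ⟨(Finset.mem_erase.1 (reach_subset hxU hy)).1, ?_⟩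
  refine mem_reach_trans hx.2 (mem_reach.2 ?_)
  exact Relation.ReflTransGen.mono (fun a b h => ⟨h.1, Finset.mem_of_mem_erase h.2⟩) _ _ (mem_reach.1 hy)

theorem exists_compRep {c x : ℕ}
    (hu : IsUnionOfComps Γ (undecided M mv m c) (pending Γ M mv m c)) (hx : x ∈ pending Γ M mv m c) :
    ∃ w ∈ compReps Γ M mv m c, x ∈ reach Γ (undecided M mv m c) w := by
  have hne : (reach Γ (undecided M mv m c) x).Nonempty := ⟨x, self_mem_reach⟩
  have hmin := Finset.min'_mem _ hne
  have hxU := hu.sub hx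
  refine ⟨Finset.min' _ hne, Finset.mem_filter.2 ⟨hu.closed x hx hmin, fun a ha => ?_⟩,
    mem_reach_symm hxU hmin⟩
  rw [reach_eq_of_mem hxU hmin] at ha
  exact Finset.min'_le _ _ ha

theorem compRep_unique {c x w w' : ℕ}
    (hu : IsUnionOfComps Γ (undecided M mv m c) (pending Γ M mv m c))
    (hw : w ∈ compReps Γ M mv m c) (hw' : w' ∈ compReps Γ M mv m c)
    (hx : x ∈ reach Γ (undecided M mv m c) w) (hx' : x ∈ reach Γ (undecided M mv m c) w') :
    w = w' := by
  have h1 := Finset.mem_filter.1 hw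
  have h2 := Finset.mem_filter.1 hw'
  have e1 := reach_eq_of_mem (hu.sub h1.1) hx
  have e2 := reach_eq_of_mem (hu.sub h2.1) hx'
  have e : reach Γ (undecided M mv m c) w = reach Γ (undecided M mv m c) w' := e1.symm.trans e2
  exact le_antisymm (h1.2 w' (e ▸ self_mem_reach)) (h2.2 w (e ▸ self_mem_reach))

/-- A finite value is witnessed by decisions. The witnesses of the children chosen in the components
are united; children have larger codes, so the induction is on `N - c`. -/
theorem IsTable.sound {F : ℕ → ℕ} {N : ℕ} (hF : IsTable Γ vs r M mv m F N) :
    ∀ j c, N - c = j → IsUnionOfComps Γ (undecided M mv m c) (pending Γ M mv m c) → F c ≠ 0 →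
      ∃ S ⊆ pending Γ M mv m c, S.card + 1 ≤ F c ∧ ∀ C, IsRClique Γ vs r C →
        ¬ ∀ v ∈ C, v ∈ M → statusOf mv m c v = 2 ∨ (v ∈ pending Γ M mv m c ∧ v ∉ S) := by
  intro j
  induction j using Nat.strong_induction_on with
  | _ j ih =>
    intro c hj hu hFc
    have hcN : c < N := by
      by_contra h; exact hFc (hF.1 c (not_lt.1 h))
    obtain ⟨best, hbest, hbad, hval⟩ := hF.2 c hcN
    have hconf : ¬ Conflict Γ vs r M mv m c := fun h => hFc (hbad (Or.inl h))
    have hb0 : ∀ w ∈ compReps Γ M mv m c, best w ≠ 0 := fun w hw h => hFc (hbad (Or.inr ⟨w, hw, h⟩))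
    -- the choice made in a component and the solution for the rest of it
    have hchoice : ∀ w, ∃ S, w ∈ compReps Γ M mv m c →
        S ⊆ reach Γ (undecided M mv m c) w ∧ S.card + 1 ≤ best w ∧
        ∀ C, IsRClique Γ vs r C → ¬ ∀ v ∈ C, v ∈ M → statusOf mv m c v = 2 ∨
          (v ∈ reach Γ (undecided M mv m c) w ∧ v ∉ S) := by
      intro w
      by_cases hw : w ∈ compReps Γ M mv m c
      swap
      · exact ⟨∅, fun h => absurd h hw⟩
      have hwU : w ∈ undecided M mv m c := hu.sub (Finset.mem_filter.1 hw).1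
      obtain ⟨i, hi, hiK, hcases⟩ := (hbest w hw).1 (hb0 w hw)
      have hiU := reach_subset hwU hiK
      have hi0 : statusOf mv m c (mv i) = 0 := (Finset.mem_filter.1 hiU).2
      have child : ∀ x < 2 * m, letterVertex mv m x = mv i →
          F (c * (2 * m) + x + 1) ≠ 0 →
          ∃ S ⊆ (reach Γ (undecided M mv m c) w).erase (mv i),
            S.card + 1 ≤ F (c * (2 * m) + x + 1) ∧ ∀ C, IsRClique Γ vs r C →
            ¬ ∀ v ∈ C, v ∈ M → (if statusOf mv m c v ≠ 0 then statusOf mv m c v else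
              if v = mv i then letterStatus m x else 0) = 2 ∨
              (v ∈ (reach Γ (undecided M mv m c) w).erase (mv i) ∧ v ∉ S) := by
        intro x hx hxv hF0
        obtain ⟨e1, e2⟩ := pending_child (Γ := Γ) hx hwU (hxv ▸ hiK)
        have hcx : c < c * (2 * m) + x + 1 := by nlinarith
        have := ih (N - (c * (2 * m) + x + 1)) (by omega) (c * (2 * m) + x + 1) rfl
          (by rw [e1, e2]; exact isUnionOfComps_child hwU) hF0
        rw [e2, statusOf_child hx, hxv] at this
        exact this
      rcases hcases with ⟨hF0, hx⟩ | ⟨hF0, hx⟩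
      · obtain ⟨S, hS, hSc, hSC⟩ := child i (by omega) (by simp [letterVertex, hi]) hF0
        refine ⟨insert (mv i) S, fun _ => ⟨Finset.insert_subset hiK
          (hS.trans (Finset.erase_subset _ _)), ?_, fun C hC hcon => hSC C hC fun v hv hvM => ?_⟩⟩
        · have := Finset.card_insert_le (mv i) S
          omega
        · rcases hcon v hv hvM with h | ⟨h1, h2⟩
          · left; rw [if_pos (by omega)]; exact h
          · rw [Finset.mem_insert, not_or] at h2
            exact Or.inr ⟨Finset.mem_erase.2 ⟨h2.1, h1⟩, h2.2⟩
      · obtain ⟨S, hS, hSc, hSC⟩ := child (m + i) (by omega) (by simp [letterVertex]) hF0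
        refine ⟨S, fun _ => ⟨hS.trans (Finset.erase_subset _ _), by omega,
          fun C hC hcon => hSC C hC fun v hv hvM => ?_⟩⟩
        rcases hcon v hv hvM with h | ⟨h1, h2⟩
        · left; rw [if_pos (by omega)]; exact h
        · by_cases hvi : v = mv i
          · left; rw [hvi, if_neg (by omega), if_pos rfl]; simp [letterStatus]
          · exact Or.inr ⟨Finset.mem_erase.2 ⟨hvi, h1⟩, h2⟩
    choose S hS using hchoice
    refine ⟨(compReps Γ M mv m c).biUnion S, ?_, ?_, ?_⟩
    · intro x hx
      obtain ⟨w, hw, hxw⟩ := Finset.mem_biUnion.1 hx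
      exact hu.closed w (Finset.mem_filter.1 hw).1 ((hS w hw).1 hxw)
    · rw [hval hconf hb0, add_comm]
      refine Nat.add_le_add_left (Finset.card_biUnion_le.trans (Finset.sum_le_sum fun w hw => ?_)) 1
      have := (hS w hw).2.1
      omega
    · intro C hC hcon
      -- A clique with a pending vertex has all its pending vertices in one component, whose witness
      -- excludes it; a clique without one would be a conflict.
      by_cases hx : ∃ x ∈ C, x ∈ M ∧ x ∈ pending Γ M mv m c
      · obtain ⟨x, hxC, hxM, hxW⟩ := hx
        obtain ⟨w, hw, hxw⟩ := exists_compRep hu hxW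
        refine (hS w hw).2.2 C hC fun v hv hvM => ?_
        rcases hcon v hv hvM with h | ⟨h1, h2⟩
        · exact Or.inl h
        · refine Or.inr ⟨?_, fun h => h2 (Finset.mem_biUnion.2 ⟨w, hw, h⟩)⟩
          by_cases hvx : x = v
          · exact hvx ▸ hxw
          · exact mem_reach_of_adj hxw (hC.2.2 x hxC v hv hvx) (hu.sub h1)
      · push Not at hx
        exact hconf ⟨C, hC, fun v hv hvM => (hcon v hv hvM).resolve_right fun h => hx v hv hvM h.1⟩

/-- The largest code of a string extending the one coded by `c` by `t` letters. -/
def lastCode (b : ℕ) : ℕ → ℕ → ℕ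
  | 0, c => c
  | t + 1, c => lastCode b t (c * b + b)

theorem lastCode_mono (b : ℕ) : ∀ t {c c' : ℕ}, c ≤ c' → lastCode b t c ≤ lastCode b t c'
  | 0, _, _, h => h
  | t + 1, _, _, h => lastCode_mono b t (by gcongr)

theorem le_lastCode {b : ℕ} (hb : 0 < b) : ∀ t c, c ≤ lastCode b t c
  | 0, _ => le_rfl
  | t + 1, c => le_trans (by nlinarith) (le_lastCode hb t (c * b + b))

theorem lastCode_succ (b : ℕ) : ∀ t c, lastCode b (t + 1) c = lastCode b t c * b + b
  | 0, _ => rfl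
  | t + 1, c => by rw [lastCode, lastCode_succ b t]; rfl

/-- A given solution `S` is followed along the elimination forest: in every component the root is
decided as `S` prescribes, which costs one unit of depth. The strings met have at most `t` further
letters, so their codes stay below `N`, and the minimum over all decisions is at most the one
followed. -/
theorem IsTable.complete {F : ℕ → ℕ} {N : ℕ} (hF : IsTable Γ vs r M mv m F N)
    (hmv : ∀ v ∈ M, ∃ i < m, mv i = v) :
    ∀ t c, c < N → lastCode (2 * m) t c < N →
      IsUnionOfComps Γ (undecided M mv m c) (pending Γ M mv m c) →
      ElimDepth Γ t (pending Γ M mv m c) → ∀ S, (∀ C, IsRClique Γ vs r C →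
        ¬ ∀ v ∈ C, v ∈ M → statusOf mv m c v = 2 ∨ (v ∈ pending Γ M mv m c ∧ v ∉ S)) →
      F c ≠ 0 ∧ F c ≤ (S ∩ pending Γ M mv m c).card + 1 := by
  intro t
  induction t using Nat.strong_induction_on with
  | _ t ih =>
    intro c hcN hlast hu hel S hS
    obtain ⟨best, hbest, hbad, hval⟩ := hF.2 c hcN
    have hconf : ¬ Conflict Γ vs r M mv m c := by
      rintro ⟨C, hC, h⟩
      exact hS C hC fun v hv hvM => Or.inl (h v hv hvM)
    have hw : ∀ w ∈ compReps Γ M mv m c, best w ≠ 0 ∧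
        best w ≤ (S ∩ reach Γ (undecided M mv m c) w).card + 1 := by
      intro w hw
      have hwW := (Finset.mem_filter.1 hw).1
      have hwU := hu.sub hwW
      -- The component is connected, so its elimination forest has a single root, the next vertex to
      -- be decided.
      obtain ⟨v, hvK, t', rfl, hel'⟩ := (hel.subset (hu.closed w hwW)).exists_erase
        ⟨w, self_mem_reach⟩ (reach_connected hwU)
      have hvU := reach_subset hwU hvK
      obtain ⟨i, hi, rfl⟩ := hmv v (Finset.mem_filter.1 hvU).1
      have hi0 : statusOf mv m c (mv i) = 0 := (Finset.mem_filter.1 hvU).2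
      have child : ∀ x < 2 * m, letterVertex mv m x = mv i →
          (∀ C, IsRClique Γ vs r C →
            ¬ ∀ v ∈ C, v ∈ M → (if statusOf mv m c v ≠ 0 then statusOf mv m c v else
              if v = mv i then letterStatus m x else 0) = 2 ∨
              (v ∈ (reach Γ (undecided M mv m c) w).erase (mv i) ∧ v ∉ S)) →
          F (c * (2 * m) + x + 1) ≠ 0 ∧ F (c * (2 * m) + x + 1) ≤
            (S ∩ (reach Γ (undecided M mv m c) w).erase (mv i)).card + 1 := by
        intro x hx hxv hC
        obtain ⟨e1, e2⟩ := pending_child (Γ := Γ) hx hwU (hxv ▸ hvK)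
        have hl : lastCode (2 * m) t' (c * (2 * m) + x + 1) < N :=
          lt_of_le_of_lt (lastCode_mono _ _ (by omega)) hlast
        have := ih t' (by omega) (c * (2 * m) + x + 1)
          (lt_of_le_of_lt (le_lastCode (by omega) _ _) hl) hl
          (by rw [e1, e2]; exact isUnionOfComps_child hwU) (by rw [e2, hxv]; exact hel') S
        rw [e2, statusOf_child hx, hxv] at this
        exact this hC
      have hb := (hbest w hw).2 i hi hvK
      by_cases hiS : mv i ∈ S
      · have hch := child i (by omega) (by simp [letterVertex, hi]) (by
          intro C hC hcon
          refine hS C hC fun v hv hvM => ?_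
          rcases hcon v hv hvM with h | ⟨h1, h2⟩
          · left
            split_ifs at h with h3 h4
            · exact h
            · simp [letterStatus, hi] at h
          · exact Or.inr ⟨hu.closed w hwW (Finset.mem_of_mem_erase h1), h2⟩)
        have h2 := hb.1 hch.1
        have h3 : (S ∩ (reach Γ (undecided M mv m c) w).erase (mv i)).card + 1 =
            (S ∩ reach Γ (undecided M mv m c) w).card := by
          rw [Finset.inter_erase, Finset.card_erase_add_one]
          simp [hiS, hvK]
        omega
      · have hch := child (m + i) (by omega) (by simp [letterVertex]) (by
          intro C hC hcon
          refine hS C hC fun v hv hvM => ?_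
          rcases hcon v hv hvM with h | ⟨h1, h2⟩
          · split_ifs at h with h3 h4
            · exact Or.inl h
            · right; rw [h4]; exact ⟨hu.closed w hwW hvK, hiS⟩
          · exact Or.inr ⟨hu.closed w hwW (Finset.mem_of_mem_erase h1), h2⟩)
        have h2 := hb.2 hch.1
        have h3 : (S ∩ (reach Γ (undecided M mv m c) w).erase (mv i)).card ≤
            (S ∩ reach Γ (undecided M mv m c) w).card :=
          Finset.card_le_card (Finset.inter_subset_inter_left (Finset.erase_subset _ _))
        omega
    have hFc := hval hconf fun w hw' => (hw w hw').1
    refine ⟨by omega, ?_⟩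
    rw [hFc, add_comm]
    refine Nat.add_le_add_right ?_ 1
    calc ∑ w ∈ compReps Γ M mv m c, (best w - 1)
        ≤ ∑ w ∈ compReps Γ M mv m c, (S ∩ reach Γ (undecided M mv m c) w).card :=
          Finset.sum_le_sum fun w hw' => by have := (hw w hw').2; omega
      _ = ((compReps Γ M mv m c).biUnion fun w => S ∩ reach Γ (undecided M mv m c) w).card := by
          refine (Finset.card_biUnion fun w hw' w' hw'' hne => ?_).symm
          rw [Function.onFun, Finset.disjoint_left]
          intro x hx hx'
          exact hne (compRep_unique hu hw' hw'' (Finset.mem_inter.1 hx).2 (Finset.mem_inter.1 hx').2)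
      _ ≤ _ := by
          refine Finset.card_le_card fun x hx => ?_
          obtain ⟨w, hw', hxw⟩ := Finset.mem_biUnion.1 hx
          rw [Finset.mem_inter] at hxw ⊢
          exact ⟨hxw.1, hu.closed w (Finset.mem_filter.1 hw').1 hxw.2⟩

theorem IsTable.root {F : ℕ → ℕ} {N t k : ℕ} (hF : IsTable Γ vs r M mv m F N)
    (hmv : ∀ v ∈ M, ∃ i < m, mv i = v) (hN : lastCode (2 * m) t 0 < N) (hel : ElimDepth Γ t M) :
    (F 0 ≠ 0 ∧ F 0 ≤ k + 1) ↔ ∃ S ⊆ M, IsCover Γ vs r S ∧ S.card ≤ k := by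
  have e0 : undecided M mv m 0 = M := by simp [undecided, statusOf]
  have e1 : pending Γ M mv m 0 = M := by simp [pending]
  have hu : IsUnionOfComps Γ (undecided M mv m 0) (pending Γ M mv m 0) := by
    rw [e0, e1]; exact ⟨subset_rfl, fun w hw => reach_subset hw⟩
  constructor
  · rintro ⟨h1, h2⟩
    obtain ⟨S, hS, hSc, hSC⟩ := hF.sound _ 0 rfl hu h1
    rw [e1] at hS
    refine ⟨S, hS, fun C hC => ?_, by omega⟩
    by_contra hcon
    rw [Finset.not_nonempty_iff_eq_empty] at hcon
    refine hSC C hC fun v hv hvM => Or.inr ⟨by rw [e1]; exact hvM, fun hvS => ?_⟩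
    have : v ∈ C ∩ S := Finset.mem_inter.2 ⟨hv, hvS⟩
    rw [hcon] at this; simp at this
  · rintro ⟨S, hS, hcov, hk⟩
    have := hF.complete hmv t 0 (by omega) hN hu (by rw [e1]; exact hel) S (by
      intro C hC hcon
      obtain ⟨x, hx⟩ := hcov C hC
      rw [Finset.mem_inter] at hx
      rcases hcon x hx.1 (hS hx.2) with h | h
      · simp [statusOf] at h
      · exact h.2 hx.2)
    have h2 := Finset.card_le_card (Finset.inter_subset_left : S ∩ pending Γ M mv m 0 ⊆ S)
    exact ⟨this.1, by omega⟩

end Strings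


/-! ### A small language of bounded loops, compiled to the random access machine -/

namespace Loop

/-- A store of the loop language: variables, arrays, and a read-only input. -/
structure Store where
  v : ℕ → ℕ
  a : ℕ → ℕ → ℕ
  inp : ℕ → ℕ

namespace Store

def setV (s : Store) (x w : ℕ) : Store := { s with v := Function.update s.v x w }

def setA (s : Store) (b i w : ℕ) : Store :=
  { s with a := Function.update s.a b (Function.update (s.a b) i w) }

variable (s : Store) (x y w w' b b' i j : ℕ)

@[simp] theorem setV_a : (s.setV x w).a = s.a := rfl
@[simp] theorem setV_inp : (s.setV x w).inp = s.inp := rfl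
@[simp] theorem setA_v : (s.setA b i w).v = s.v := rfl
@[simp] theorem setA_inp : (s.setA b i w).inp = s.inp := rfl
@[simp] theorem setV_v : (s.setV x w).v y = if y = x then w else s.v y := by
  simp [setV, Function.update_apply]
@[simp] theorem setA_a : (s.setA b i w).a b' j = if b' = b ∧ j = i then w else s.a b' j := by
  by_cases h : b' = b
  · subst h; simp [setA, Function.update_apply]
  · simp [setA, h]
theorem setA_a_ne {b b' : ℕ} (h : b' ≠ b) : (s.setA b i w).a b' = s.a b' := by
  funext j; simp [h]
@[simp] theorem setV_setV : (s.setV x w).setV x w' = s.setV x w' := by simp [setV]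
@[simp] theorem setV_self : s.setV x (s.v x) = s := by simp [setV]

end Store

/-- Expressions; `sum x y e` is the sum of the values of `e` for `x` from `0` to the value of the
variable `y` minus one. -/
inductive Ex : Type
  | c (n : ℕ)
  | v (x : ℕ)
  | add (p q : Ex)
  | sub (p q : Ex)
  | arr (b : ℕ) (p : Ex)
  | inp (p : Ex)
  | ite (g p q : Ex)
  | sum (x y : ℕ) (p : Ex)

/-- Commands; `loop x y p` runs `p` for `x` from `0` to the initial value of `y` minus one. -/
inductive Cmd : Type
  | set (x : ℕ) (p : Ex)
  | put (b : ℕ) (i p : Ex)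
  | seq (p q : Cmd)
  | loop (x y : ℕ) (p : Cmd)

namespace Ex

def eval : Ex → Store → ℕ
  | c n, _ => n
  | v x, s => s.v x
  | add p q, s => p.eval s + q.eval s
  | sub p q, s => p.eval s - q.eval s
  | arr b p, s => s.a b (p.eval s)
  | inp p, s => s.inp (p.eval s)
  | ite g p q, s => if g.eval s ≠ 0 then p.eval s else q.eval s
  | sum x y p, s => ∑ i ∈ Finset.range (s.v y), p.eval (s.setV x i)

/-- The number of steps of the compiled expression. -/
def time : Ex → Store → ℕ
  | c _, _ => 1
  | v _, _ => 1
  | add p q, s => p.time s + (q.time s + 1)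
  | sub p q, s => p.time s + (q.time s + 1)
  | arr b p, s => p.time s + (1 + (b + 4))
  | inp p, s => p.time s + 3
  | ite g p q, s => g.time s + (if g.eval s ≠ 0 then p.time s else q.time s) + 1
  | sum x y p, s => ∑ i ∈ Finset.range (s.v y), (p.time (s.setV x i) + 5) + 5

/-- The nesting depth of the sums. -/
def depth : Ex → ℕ
  | c _ => 0
  | v _ => 0
  | add p q => max p.depth q.depth
  | sub p q => max p.depth q.depth
  | arr _ p => p.depth
  | inp p => p.depth
  | ite g p q => max g.depth (max p.depth q.depth)
  | sum _ _ p => p.depth + 1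

/-- The sums range over numbers below the variables less than `l` and do not change these. -/
def Ok (l : ℕ) : Ex → Prop
  | c _ => True
  | v _ => True
  | add p q => p.Ok l ∧ q.Ok l
  | sub p q => p.Ok l ∧ q.Ok l
  | arr _ p => p.Ok l
  | inp p => p.Ok l
  | ite g p q => g.Ok l ∧ p.Ok l ∧ q.Ok l
  | sum x y p => y < l ∧ l ≤ x ∧ p.Ok l

/-- Sums range below variables that are never overwritten, so every level of nesting costs a factor
of at most `Q + 1`. Other values may be arbitrarily large, as arithmetic has unit cost. -/
theorem exists_time_le (p : Ex) : ∃ K, ∀ l Q s, p.Ok l → (∀ y < l, s.v y ≤ Q) →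
    p.time s ≤ K * (Q + 1) ^ p.depth := by
  have hmono : ∀ {a b Q : ℕ}, a ≤ b → (Q + 1) ^ a ≤ (Q + 1) ^ b :=
    fun h => Nat.pow_le_pow_right (Nat.succ_pos _) h
  have hpos : ∀ {a Q : ℕ}, 1 ≤ (Q + 1) ^ a := Nat.one_le_pow _ _ (Nat.succ_pos _)
  induction p with
  | c n => exact ⟨1, fun _ _ _ _ _ => by simp [time, depth]⟩
  | v x => exact ⟨1, fun _ _ _ _ _ => by simp [time, depth]⟩
  | add p q hp hq =>
    obtain ⟨K, hK⟩ := hp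
    obtain ⟨L, hL⟩ := hq
    refine ⟨K + L + 1, fun l Q s hok hs => ?_⟩
    have h1 := (hK l Q s hok.1 hs).trans (Nat.mul_le_mul_left K (hmono (le_max_left _ q.depth)))
    have h2 := (hL l Q s hok.2 hs).trans (Nat.mul_le_mul_left L (hmono (le_max_right p.depth _)))
    have h3 := hpos (a := max p.depth q.depth) (Q := Q)
    rw [time, depth, add_mul, add_mul]; omega
  | sub p q hp hq =>
    obtain ⟨K, hK⟩ := hp
    obtain ⟨L, hL⟩ := hq
    refine ⟨K + L + 1, fun l Q s hok hs => ?_⟩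
    have h1 := (hK l Q s hok.1 hs).trans (Nat.mul_le_mul_left K (hmono (le_max_left _ q.depth)))
    have h2 := (hL l Q s hok.2 hs).trans (Nat.mul_le_mul_left L (hmono (le_max_right p.depth _)))
    have h3 := hpos (a := max p.depth q.depth) (Q := Q)
    rw [time, depth, add_mul, add_mul]; omega
  | arr b p hp =>
    obtain ⟨K, hK⟩ := hp
    refine ⟨K + (b + 5), fun l Q s hok hs => ?_⟩
    have h1 := hK l Q s hok hs
    have h3 := Nat.mul_le_mul_left (b + 5) (hpos (a := p.depth) (Q := Q))
    rw [time, depth, add_mul]; omega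
  | inp p hp =>
    obtain ⟨K, hK⟩ := hp
    refine ⟨K + 3, fun l Q s hok hs => ?_⟩
    have h1 := hK l Q s hok hs
    have h3 := hpos (a := p.depth) (Q := Q)
    rw [time, depth, add_mul]; omega
  | ite g p q hg hp hq =>
    obtain ⟨J, hJ⟩ := hg
    obtain ⟨K, hK⟩ := hp
    obtain ⟨L, hL⟩ := hq
    refine ⟨J + K + L + 1, fun l Q s hok hs => ?_⟩
    have h0 := (hJ l Q s hok.1 hs).trans (Nat.mul_le_mul_left J
      (hmono (le_max_left _ (max p.depth q.depth))))
    have h1 := (hK l Q s hok.2.1 hs).trans (Nat.mul_le_mul_left K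
      (hmono ((le_max_left _ q.depth).trans (le_max_right g.depth _))))
    have h2 := (hL l Q s hok.2.2 hs).trans (Nat.mul_le_mul_left L
      (hmono ((le_max_right p.depth _).trans (le_max_right g.depth _))))
    have h3 := hpos (a := max g.depth (max p.depth q.depth)) (Q := Q)
    rw [time, depth, add_mul, add_mul, add_mul]
    split_ifs <;> omega
  | sum x y p hp =>
    obtain ⟨K, hK⟩ := hp
    refine ⟨K + 10, fun l Q s hok hs => ?_⟩
    have h1 : ∀ i ∈ Finset.range (s.v y), p.time (s.setV x i) + 5 ≤ (K + 5) * (Q + 1) ^ p.depth := by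
      intro i _
      have h1 := hK l Q (s.setV x i) hok.2.2 fun z hz => by
        rw [Store.setV_v, if_neg (by have := hok.2.1; omega)]; exact hs z hz
      have h3 := hpos (a := p.depth) (Q := Q)
      rw [add_mul]; omega
    have h2 := Finset.sum_le_card_nsmul _ _ _ h1
    rw [Finset.card_range, smul_eq_mul] at h2
    have h3 := hpos (a := p.depth + 1) (Q := Q)
    rw [time, depth]
    calc _ ≤ (Q + 1) * ((K + 5) * (Q + 1) ^ p.depth) + 5 * (Q + 1) ^ (p.depth + 1) := by
          refine Nat.add_le_add (h2.trans (Nat.mul_le_mul_right _ ?_)) (by omega)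
          exact (hs y hok.1).trans (Nat.le_succ Q)
      _ = _ := by ring

end Ex

namespace Cmd

def run : Cmd → Store → Store
  | set x p, s => s.setV x (p.eval s)
  | put b i p, s => s.setA b (i.eval s) (p.eval s)
  | seq p q, s => q.run (p.run s)
  | loop x y p, s => Nat.rec s (fun i s' => p.run (s'.setV x i)) (s.v y)

/-- The store after `i` rounds of `loop x y p`. -/
def iter (x : ℕ) (p : Cmd) (s : Store) : ℕ → Store
  | 0 => s
  | i + 1 => p.run ((iter x p s i).setV x i)

theorem run_loop (x y : ℕ) (p : Cmd) (s : Store) : (loop x y p).run s = iter x p s (s.v y) := by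
  rw [run]
  induction s.v y with
  | zero => rfl
  | succ i ih => rw [iter, ← ih]

/-- The number of steps of the compiled command. -/
def time : Cmd → Store → ℕ
  | set _ p, s => p.time s + 1
  | put b i p, s => i.time s + p.time s + (1 + (b + 4))
  | seq p q, s => p.time s + q.time (p.run s)
  | loop x y p, s => ∑ i ∈ Finset.range (s.v y), (p.time ((iter x p s i).setV x i) + 5) + 3

def depth : Cmd → ℕ
  | set _ p => p.depth
  | put _ i p => max i.depth p.depth
  | seq p q => max p.depth q.depth
  | loop _ _ p => p.depth + 1

def Ok (l : ℕ) : Cmd → Prop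
  | set x p => l ≤ x ∧ p.Ok l
  | put _ i p => i.Ok l ∧ p.Ok l
  | seq p q => p.Ok l ∧ q.Ok l
  | loop x y p => y < l ∧ l ≤ x ∧ p.Ok l

/-- The variable `z` is not written. -/
def KeepsV (z : ℕ) : Cmd → Prop
  | set x _ => z ≠ x
  | put _ _ _ => True
  | seq p q => p.KeepsV z ∧ q.KeepsV z
  | loop x _ p => z ≠ x ∧ p.KeepsV z

/-- The array `b` is not written. -/
def KeepsA (b : ℕ) : Cmd → Prop
  | set _ _ => True
  | put b' _ _ => b ≠ b'
  | seq p q => p.KeepsA b ∧ q.KeepsA b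
  | loop _ _ p => p.KeepsA b

theorem KeepsV.run_v {z : ℕ} {p : Cmd} (h : p.KeepsV z) : ∀ s, (p.run s).v z = s.v z := by
  induction p with
  | set x p => intro s; simp [run, show z ≠ x from h]
  | put b i p => intro s; rfl
  | seq p q hp hq => intro s; rw [run, hq h.2, hp h.1]
  | loop x y p hp =>
    intro s
    rw [run_loop]
    induction s.v y with
    | zero => rfl
    | succ i ih => rw [iter, hp h.2, Store.setV_v, if_neg h.1, ih]

theorem KeepsV.iter_v {z x : ℕ} {p : Cmd} (h : p.KeepsV z) (hx : z ≠ x) (s : Store) (i : ℕ) :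
    (iter x p s i).v z = s.v z := by
  induction i with
  | zero => rfl
  | succ i ih => rw [iter, h.run_v, Store.setV_v, if_neg hx, ih]

theorem KeepsA.run_a {b : ℕ} {p : Cmd} (h : p.KeepsA b) : ∀ s, (p.run s).a b = s.a b := by
  induction p with
  | set x p => intro s; rfl
  | put b' i p => intro s; rw [run, Store.setA_a_ne _ _ _ h]
  | seq p q hp hq => intro s; rw [run, hq h.2, hp h.1]
  | loop x y p hp =>
    intro s
    rw [run_loop]
    induction s.v y with
    | zero => rfl
    | succ i ih => rw [iter, hp h, Store.setV_a, ih]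

theorem KeepsA.iter_a {b x : ℕ} {p : Cmd} (h : p.KeepsA b) (s : Store) (i : ℕ) :
    (iter x p s i).a b = s.a b := by
  induction i with
  | zero => rfl
  | succ i ih => rw [iter, h.run_a, Store.setV_a, ih]

@[simp] theorem run_inp (p : Cmd) : ∀ s, (p.run s).inp = s.inp := by
  induction p with
  | set x p => intro s; rfl
  | put b' i p => intro s; rfl
  | seq p q hp hq => intro s; rw [run, hq, hp]
  | loop x y p hp =>
    intro s
    rw [run_loop]
    induction s.v y with
    | zero => rfl
    | succ i ih => rw [iter, hp, Store.setV_inp, ih]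

@[simp] theorem iter_inp (x : ℕ) (p : Cmd) (s : Store) (i : ℕ) : (iter x p s i).inp = s.inp := by
  induction i with
  | zero => rfl
  | succ i ih => rw [iter, run_inp, Store.setV_inp, ih]

theorem Ok.keepsV {l : ℕ} {p : Cmd} (h : p.Ok l) {z : ℕ} (hz : z < l) : p.KeepsV z := by
  induction p with
  | set x p => exact (lt_of_lt_of_le hz h.1).ne
  | put b' i p => trivial
  | seq p q hp hq => exact ⟨hp h.1, hq h.2⟩
  | loop x y p hp => exact ⟨(lt_of_lt_of_le hz h.2.1).ne, hp h.2.2⟩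

/-- Induction over the rounds of a loop. -/
theorem loop_induction {x y : ℕ} {p : Cmd} {s : Store} (I : ℕ → Store → Prop) (h0 : I 0 s)
    (hstep : ∀ i < s.v y, ∀ s' : Store, (∀ z, z ≠ x → p.KeepsV z → s'.v z = s.v z) →
      (∀ b, p.KeepsA b → s'.a b = s.a b) → s'.inp = s.inp → I i s' →
      I (i + 1) (p.run (s'.setV x i))) :
    I (s.v y) ((loop x y p).run s) := by
  rw [run_loop]
  have : ∀ i ≤ s.v y, I i (iter x p s i) := by
    intro i hi
    induction i with
    | zero => exact h0
    | succ i ih =>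
      exact hstep i (by omega) _ (fun z hz h => h.iter_v hz s i) (fun b h => h.iter_a s i)
        (iter_inp x p s i) (ih (by omega))
  exact this _ le_rfl

theorem exists_time_le (p : Cmd) : ∃ K, ∀ l Q s, p.Ok l → (∀ y < l, s.v y ≤ Q) →
    p.time s ≤ K * (Q + 1) ^ p.depth := by
  have hmono : ∀ {a b Q : ℕ}, a ≤ b → (Q + 1) ^ a ≤ (Q + 1) ^ b :=
    fun h => Nat.pow_le_pow_right (Nat.succ_pos _) h
  have hpos : ∀ {a Q : ℕ}, 1 ≤ (Q + 1) ^ a := Nat.one_le_pow _ _ (Nat.succ_pos _)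
  induction p with
  | set x p =>
    obtain ⟨K, hK⟩ := p.exists_time_le
    refine ⟨K + 1, fun l Q s hok hs => ?_⟩
    have h1 := hK l Q s hok.2 hs
    have h3 := hpos (a := p.depth) (Q := Q)
    rw [time, depth, add_mul]; omega
  | put b p q =>
    obtain ⟨K, hK⟩ := p.exists_time_le
    obtain ⟨L, hL⟩ := q.exists_time_le
    refine ⟨K + L + (b + 5), fun l Q s hok hs => ?_⟩
    have h1 := (hK l Q s hok.1 hs).trans (Nat.mul_le_mul_left K (hmono (le_max_left _ q.depth)))
    have h2 := (hL l Q s hok.2 hs).trans (Nat.mul_le_mul_left L (hmono (le_max_right p.depth _)))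
    have h3 := Nat.mul_le_mul_left (b + 5) (hpos (a := max p.depth q.depth) (Q := Q))
    rw [time, depth, add_mul, add_mul]; omega
  | seq p q hp hq =>
    obtain ⟨K, hK⟩ := hp
    obtain ⟨L, hL⟩ := hq
    refine ⟨K + L, fun l Q s hok hs => ?_⟩
    have h1 := (hK l Q s hok.1 hs).trans (Nat.mul_le_mul_left K (hmono (le_max_left _ q.depth)))
    have h2 := (hL l Q (p.run s) hok.2 fun y hy => by
      rw [(hok.1.keepsV hy).run_v]; exact hs y hy).trans
        (Nat.mul_le_mul_left L (hmono (le_max_right p.depth _)))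
    rw [time, depth, add_mul]; omega
  | loop x y p hp =>
    obtain ⟨K, hK⟩ := hp
    refine ⟨K + 8, fun l Q s hok hs => ?_⟩
    have h1 : ∀ i ∈ Finset.range (s.v y), p.time ((iter x p s i).setV x i) + 5 ≤
        (K + 5) * (Q + 1) ^ p.depth := by
      intro i _
      have h1 := hK l Q ((iter x p s i).setV x i) hok.2.2 fun z hz => by
        have hzx : z ≠ x := by have := hok.2.1; omega
        rw [Store.setV_v, if_neg hzx, (hok.2.2.keepsV hz).iter_v hzx]; exact hs z hz
      have h3 := hpos (a := p.depth) (Q := Q)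
      rw [add_mul]; omega
    have h2 := Finset.sum_le_card_nsmul _ _ _ h1
    rw [Finset.card_range, smul_eq_mul] at h2
    have h3 := hpos (a := p.depth + 1) (Q := Q)
    rw [time, depth]
    calc _ ≤ (Q + 1) * ((K + 5) * (Q + 1) ^ p.depth) + 3 * (Q + 1) ^ (p.depth + 1) := by
          refine Nat.add_le_add (h2.trans (Nat.mul_le_mul_right _ ?_)) (by omega)
          exact (hs y hok.1).trans (Nat.le_succ Q)
      _ = _ := by ring

end Cmd

/-! #### Compilation -/

/-- The register that holds the variable `x`. -/
def varReg (x : ℕ) : ℕ := 2 * x + 4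

/-- The auxiliary register number `d`. -/
def auxReg (d : ℕ) : ℕ := 2 * d + 5

/-- The memory cell that holds the entry `i` of the array `b`. -/
def cell (n b i : ℕ) : ℕ := n * n + 2 ^ b * (2 * i + 1)

@[simp] theorem varReg_inj {x y : ℕ} : varReg x = varReg y ↔ x = y := by simp [varReg]
@[simp] theorem auxReg_inj {x y : ℕ} : auxReg x = auxReg y ↔ x = y := by simp [auxReg]
@[simp] theorem varReg_ne_auxReg (x y : ℕ) : varReg x ≠ auxReg y := by unfold varReg auxReg; omega
@[simp] theorem auxReg_ne_varReg (x y : ℕ) : auxReg x ≠ varReg y := by unfold varReg auxReg; omega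
@[simp] theorem two_ne_auxReg (x : ℕ) : 2 ≠ auxReg x := by unfold auxReg; omega
@[simp] theorem two_ne_varReg (x : ℕ) : 2 ≠ varReg x := by unfold varReg; omega

/-- Every positive number is uniquely a power of two times an odd number, so the memory above the
input is shared by infinitely many unbounded arrays. The multiplication by `2 ^ b` consists of `b`
doublings, for a constant `b`. -/
theorem cell_inj {n b i b' i' : ℕ} : cell n b i = cell n b' i' ↔ b = b' ∧ i = i' := by
  constructor
  · intro h
    have h : 2 ^ b * (2 * i + 1) = 2 ^ b' * (2 * i' + 1) := by unfold cell at h; omega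
    have key : ∀ b b' i i' : ℕ, b ≤ b' → 2 ^ b * (2 * i + 1) = 2 ^ b' * (2 * i' + 1) →
        b = b' ∧ i = i' := by
      intro b b' i i' hb h
      obtain ⟨e, rfl⟩ := Nat.exists_eq_add_of_le hb
      rw [pow_add, mul_assoc] at h
      have h := Nat.eq_of_mul_eq_mul_left (by positivity) h
      rcases e with _ | e
      · simp at h; exact ⟨rfl, h⟩
      · rw [pow_succ, mul_comm (2 ^ e), mul_assoc] at h; omega
    rcases le_total b b' with hb | hb
    · exact key b b' i i' hb h
    · obtain ⟨h1, h2⟩ := key b' b i' i hb h.symm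
      exact ⟨h1.symm, h2.symm⟩
  · rintro ⟨rfl, rfl⟩; rfl

theorem le_cell (n b i : ℕ) : n * n ≤ cell n b i := Nat.le_add_right _ _

open RAM

@[simp] theorem _root_.RAM.State.setReg_reg (σ : State) (x y w : ℕ) :
    (σ.setReg x w).reg y = if y = x then w else σ.reg y := by
  simp [State.setReg, Function.update_apply]
@[simp] theorem _root_.RAM.State.setReg_mem (σ : State) (x w : ℕ) :
    (σ.setReg x w).mem = σ.mem := rfl
@[simp] theorem _root_.RAM.State.setMem_reg (σ : State) (x w : ℕ) :
    (σ.setMem x w).reg = σ.reg := rfl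
@[simp] theorem _root_.RAM.State.setMem_mem (σ : State) (x y w : ℕ) :
    (σ.setMem x w).mem y = if y = x then w else σ.mem y := by
  simp [State.setMem, Function.update_apply]

/-- The machine state `σ` represents the store `s`. -/
structure Rel (n : ℕ) (σ : State) (s : Store) : Prop where
  sq : σ.reg 2 = n * n
  var : ∀ x, σ.reg (varReg x) = s.v x
  arr : ∀ b i, σ.mem (cell n b i) = s.a b i
  inp : ∀ i < n * n, σ.mem i = s.inp i
  inp_eq_zero : ∀ i, n * n ≤ i → s.inp i = 0

theorem Rel.setAux {n : ℕ} {σ : State} {s : Store} (h : Rel n σ s) (d w : ℕ) :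
    Rel n (σ.setReg (auxReg d) w) s :=
  ⟨by simp [h.sq], fun x => by simp [h.var], h.arr, h.inp, h.inp_eq_zero⟩

theorem Rel.setVar {n : ℕ} {σ : State} {s : Store} (h : Rel n σ s) (x w : ℕ) :
    Rel n (σ.setReg (varReg x) w) (s.setV x w) :=
  ⟨by simp [h.sq], fun y => by simp [h.var], h.arr, h.inp, h.inp_eq_zero⟩

theorem Rel.setCell {n : ℕ} {σ : State} {s : Store} (h : Rel n σ s) (b i w : ℕ) :
    Rel n (σ.setMem (cell n b i) w) (s.setA b i w) :=
  ⟨h.sq, h.var, fun b' i' => by simp [cell_inj, h.arr], fun i' hi' => by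
    have := le_cell n b i
    rw [State.setMem_mem, if_neg (by omega)]; exact h.inp i' hi', h.inp_eq_zero⟩

/-- `p` takes `σ` to a state representing `s'` in `t` steps, without changing the
auxiliary registers below `d`. -/
def Steps (n d : ℕ) (p : Prog) (σ : State) (s' : Store) (t : ℕ) (P : State → Prop) : Prop :=
  ∃ σ', Exec p σ t σ' ∧ Rel n σ' s' ∧ (∀ i < d, σ'.reg (auxReg i) = σ.reg (auxReg i)) ∧ P σ'

theorem _root_.RAM.Exec.cast {p : Prog} {σ σ' : State} {t t' : ℕ} (h : Exec p σ t σ')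
    (ht : t = t') : Exec p σ t' σ' := ht ▸ h

/-- Doubles the register `x` `b` times, then runs `q`. -/
def double (x : ℕ) (q : Prog) : ℕ → Prog
  | 0 => q
  | b + 1 => .seq (.add x x x) (double x q b)

theorem exec_double {x : ℕ} {q : Prog} {σ' : State} {t : ℕ} :
    ∀ (b : ℕ) (σ : State), Exec q (σ.setReg x (2 ^ b * σ.reg x)) t σ' →
      Exec (double x q b) σ (t + b) σ'
  | 0, σ, h => by
    have e : σ.setReg x (2 ^ 0 * σ.reg x) = σ := by simp [State.setReg]
    rw [e] at h; exact h
  | b + 1, σ, h => by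
    have e : (σ.setReg x (σ.reg x + σ.reg x)).setReg x
        (2 ^ b * (σ.setReg x (σ.reg x + σ.reg x)).reg x) = σ.setReg x (2 ^ (b + 1) * σ.reg x) := by
      simp only [State.setReg, Function.update_self, Function.update_idem]
      congr 2; ring
    rw [← e] at h
    have := Exec.seq (Exec.add x x x σ) (exec_double b _ h)
    rwa [show 1 + (t + b) = t + (b + 1) by omega] at this

/-- Replaces the index `i` in the auxiliary register `d` by the cell of the entry `i` of the
array `b`, then runs `q`. -/
def address (d b : ℕ) (q : Prog) : Prog :=
  .seq (.add (auxReg d) (auxReg d) (auxReg d)) <| .seq (.const (auxReg (d + 1)) 1) <|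
    .seq (.add (auxReg d) (auxReg d) (auxReg (d + 1))) <|
      double (auxReg d) (.seq (.add (auxReg d) (auxReg d) 2) q) b

theorem exec_address {n d b t : ℕ} {q : Prog} {σ σ' : State} (hn : σ.reg 2 = n * n)
    (h : Exec q ((σ.setReg (auxReg (d + 1)) 1).setReg (auxReg d) (cell n b (σ.reg (auxReg d)))) t σ') :
    Exec (address d b q) σ (t + (b + 4)) σ' := by
  have e : Exec (address d b q) σ (1 + (1 + (1 + (1 + t + b)))) σ' := by
    refine Exec.seq (Exec.add _ _ _ _) (Exec.seq (Exec.const _ _ _) (Exec.seq (Exec.add _ _ _ _)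
      (exec_double b _ (Exec.seq (Exec.add _ _ _ _) ?_))))
    convert h using 1
    simp only [State.setReg, State.mk.injEq, and_true]
    funext z
    simp only [Function.update_apply]
    by_cases h1 : z = auxReg d
    · subst h1; simp [hn, cell]; ring
    · simp [h1]
  rwa [show 1 + (1 + (1 + (1 + t + b))) = t + (b + 4) by omega] at e

namespace Ex

/-- Evaluates an expression into the auxiliary register `d`. -/
def code : Ex → ℕ → Prog
  | c n, d => .const (auxReg d) n
  | v x, d => .copy (auxReg d) (varReg x)
  | add p q, d => .seq (p.code d) (.seq (q.code (d + 1)) (.add (auxReg d) (auxReg d) (auxReg (d + 1))))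
  | sub p q, d => .seq (p.code d) (.seq (q.code (d + 1)) (.sub (auxReg d) (auxReg d) (auxReg (d + 1))))
  | arr b p, d => .seq (p.code d) (address d b (.load (auxReg d) (auxReg d)))
  | inp p, d => .seq (p.code d) (.seq (.sub (auxReg (d + 1)) 2 (auxReg d))
      (.ite (auxReg (d + 1)) (.load (auxReg d) (auxReg d)) (.const (auxReg d) 0)))
  | ite g p q, d => .seq (g.code d) (.ite (auxReg d) (p.code d) (q.code d))
  | sum x y p, d => .seq (.copy (auxReg (d + 1)) (varReg y)) <|
      .seq (.copy (auxReg (d + 2)) (varReg x)) <| .seq (.const (auxReg d) 0) <|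
      .seq (.loop (auxReg (d + 1)) <| .seq (.const (auxReg (d + 3)) 1) <|
        .seq (.sub (auxReg (d + 1)) (auxReg (d + 1)) (auxReg (d + 3))) <|
        .seq (.copy (varReg x) (auxReg (d + 1))) <| .seq (p.code (d + 3)) <|
        .add (auxReg d) (auxReg d) (auxReg (d + 3))) <|
      .copy (varReg x) (auxReg (d + 2))

/-- Code at level `d` leaves the auxiliary registers below `d` alone, so pending intermediate values
survive. The represented store is unchanged: a sum saves its index variable and restores it. -/
theorem exec (p : Ex) : ∀ (n d : ℕ) (σ : State) (s : Store), Rel n σ s →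
    Steps n d (p.code d) σ s (p.time s) fun σ' => σ'.reg (auxReg d) = p.eval s := by
  induction p with
  | c m =>
    exact fun n d σ s h => ⟨_, .const _ _ _, h.setAux _ _, fun i hi => by simp [hi.ne], by simp [eval]⟩
  | v x =>
    exact fun n d σ s h => ⟨_, .copy _ _ _, h.setAux _ _, fun i hi => by simp [hi.ne],
      by simp [eval, h.var]⟩
  | add p q hp hq =>
    intro n d σ s h
    obtain ⟨σ₁, e₁, r₁, k₁, v₁⟩ := hp n d σ s h
    obtain ⟨σ₂, e₂, r₂, k₂, v₂⟩ := hq n (d + 1) σ₁ s r₁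
    refine ⟨_, Exec.seq e₁ (Exec.seq e₂ (Exec.add _ _ _ _)), r₂.setAux _ _, fun i hi => ?_, ?_⟩
    · simp [hi.ne, k₂ i (by omega), k₁ i hi]
    · simp [eval, v₂, k₂ d (by omega), v₁]
  | sub p q hp hq =>
    intro n d σ s h
    obtain ⟨σ₁, e₁, r₁, k₁, v₁⟩ := hp n d σ s h
    obtain ⟨σ₂, e₂, r₂, k₂, v₂⟩ := hq n (d + 1) σ₁ s r₁
    refine ⟨_, Exec.seq e₁ (Exec.seq e₂ (Exec.sub _ _ _ _)), r₂.setAux _ _, fun i hi => ?_, ?_⟩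
    · simp [hi.ne, k₂ i (by omega), k₁ i hi]
    · simp [eval, v₂, k₂ d (by omega), v₁]
  | arr b p hp =>
    intro n d σ s h
    obtain ⟨σ₁, e₁, r₁, k₁, v₁⟩ := hp n d σ s h
    refine ⟨_, Exec.seq e₁ (exec_address r₁.sq (Exec.load _ _ _)),
      ((r₁.setAux _ _).setAux _ _).setAux _ _, fun i hi => ?_, ?_⟩
    · simp [hi.ne, k₁ i hi, (show i ≠ d + 1 by omega)]
    · simp [eval, v₁, r₁.arr]
  | inp p hp =>
    intro n d σ s h
    obtain ⟨σ₁, e₁, r₁, k₁, v₁⟩ := hp n d σ s h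
    -- From the address `n * n` on the memory is used for arrays, so the code itself has to return
    -- the value `0` there.
    by_cases hlt : p.eval s < n * n
    · refine ⟨_, Exec.seq e₁ (Exec.seq (Exec.sub _ _ _ _)
        (Exec.ite_true (q := .const (auxReg d) 0) (by simp [r₁.sq, v₁]; omega) (Exec.load (auxReg d) (auxReg d) _))),
        (r₁.setAux _ _).setAux _ _, fun i hi => ?_, ?_⟩
      · simp [hi.ne, k₁ i hi, (show i ≠ d + 1 by omega)]
      · simp [eval, v₁, r₁.inp _ hlt]
    · refine ⟨_, Exec.seq e₁ (Exec.seq (Exec.sub _ _ _ _)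
        (Exec.ite_false (p := .load (auxReg d) (auxReg d)) (by simp [r₁.sq, v₁]; omega) (Exec.const (auxReg d) 0 _))),
        (r₁.setAux _ _).setAux _ _, fun i hi => ?_, ?_⟩
      · simp [hi.ne, k₁ i hi, (show i ≠ d + 1 by omega)]
      · simp [eval, r₁.inp_eq_zero _ (not_lt.1 hlt)]
  | ite g p q hg hp hq =>
    intro n d σ s h
    obtain ⟨σ₁, e₁, r₁, k₁, v₁⟩ := hg n d σ s h
    by_cases hg0 : g.eval s ≠ 0
    · obtain ⟨σ₂, e₂, r₂, k₂, v₂⟩ := hp n d σ₁ s r₁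
      refine ⟨σ₂, ?_, r₂, fun i hi => (k₂ i hi).trans (k₁ i hi), ?_⟩
      · rw [time, if_pos hg0, add_assoc]
        exact Exec.seq e₁ (Exec.ite_true (by rwa [v₁]) e₂)
      · exact v₂.trans (by rw [eval, if_pos hg0])
    · obtain ⟨σ₂, e₂, r₂, k₂, v₂⟩ := hq n d σ₁ s r₁
      refine ⟨σ₂, ?_, r₂, fun i hi => (k₂ i hi).trans (k₁ i hi), ?_⟩
      · rw [time, if_neg hg0, add_assoc]
        exact Exec.seq e₁ (Exec.ite_false (by rw [v₁]; exact not_not.1 hg0) e₂)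
      · exact v₂.trans (by rw [eval, if_neg hg0])
  | sum x y p hp =>
    intro n d σ s h
    -- The index runs downwards, with the register `d + 1` as counter and index in one; `j` is
    -- whatever the last round left in the variable `x`.
    have hloop : ∀ N (σ : State) (j : ℕ), Rel n σ (s.setV x j) → σ.reg (auxReg (d + 1)) = N →
        ∃ σ' j', Exec (.loop (auxReg (d + 1)) <| .seq (.const (auxReg (d + 3)) 1) <|
          .seq (.sub (auxReg (d + 1)) (auxReg (d + 1)) (auxReg (d + 3))) <|
          .seq (.copy (varReg x) (auxReg (d + 1))) <| .seq (p.code (d + 3)) <|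
          .add (auxReg d) (auxReg d) (auxReg (d + 3))) σ
            (∑ i ∈ Finset.range N, (p.time (s.setV x i) + 5) + 1) σ' ∧
          Rel n σ' (s.setV x j') ∧ (∀ i < d, σ'.reg (auxReg i) = σ.reg (auxReg i)) ∧
          σ'.reg (auxReg (d + 2)) = σ.reg (auxReg (d + 2)) ∧
          σ'.reg (auxReg d) = σ.reg (auxReg d) + ∑ i ∈ Finset.range N, p.eval (s.setV x i) := by
      intro N
      induction N with
      | zero =>
        intro σ j hr hN
        exact ⟨σ, j, by simpa using Exec.loop_stop hN, hr, fun _ _ => rfl, rfl, by simp⟩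
      | succ N ih =>
        intro σ j hr hN
        have r₁ := ((hr.setAux (d + 3) 1).setAux (d + 1) N).setVar x N
        rw [Store.setV_setV] at r₁
        obtain ⟨σ₂, e₂, r₂, k₂, v₂⟩ := hp n (d + 3) _ _ r₁
        obtain ⟨σ₃, j', e₃, r₃, k₃, w₃, v₃⟩ := ih (σ₂.setReg (auxReg d)
          (σ₂.reg (auxReg d) + σ₂.reg (auxReg (d + 3)))) N (r₂.setAux _ _)
          (by simp [k₂ (d + 1) (by omega)])
        refine ⟨σ₃, j', ?_, r₃, fun i hi => ?_, ?_, ?_⟩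
        · rw [Finset.sum_range_succ]
          have hs : ((σ.setReg (auxReg (d + 3)) 1).setReg (auxReg (d + 1))
              ((σ.setReg (auxReg (d + 3)) 1).reg (auxReg (d + 1)) -
                (σ.setReg (auxReg (d + 3)) 1).reg (auxReg (d + 3)))) =
              (σ.setReg (auxReg (d + 3)) 1).setReg (auxReg (d + 1)) N := by
            simp [hN]
          have hs' : ((σ.setReg (auxReg (d + 3)) 1).setReg (auxReg (d + 1)) N).reg
              (auxReg (d + 1)) = N := by simp
          have eb := Exec.seq (Exec.const (auxReg (d + 3)) 1 σ) (Exec.seq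
            (Exec.sub (auxReg (d + 1)) (auxReg (d + 1)) (auxReg (d + 3)) _)
            (Exec.seq (Exec.copy (varReg x) (auxReg (d + 1)) _)
              (Exec.seq (p := p.code (d + 3)) (s₂ := σ₂) (t := p.time (s.setV x N))
                (by rw [hs, hs']; exact e₂)
                (Exec.add (auxReg d) (auxReg d) (auxReg (d + 3)) σ₂))))
          have := Exec.loop_step (by rw [hN]; omega) eb e₃
          exact this.cast (by ring)
        · rw [k₃ i hi]; simp [hi.ne, k₂ i (by omega), (show i ≠ d + 1 by omega),
            (show i ≠ d + 3 by omega)]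
        · rw [w₃]; simp [k₂ (d + 2) (by omega)]
        · rw [v₃, Finset.sum_range_succ]; simp [k₂ d (by omega), v₂]; ring
    have r₀ := ((h.setAux (d + 1) (s.v y)).setAux (d + 2) (s.v x)).setAux d 0
    obtain ⟨σ₃, j', e₃, r₃, k₃, w₃, v₃⟩ := hloop (s.v y) _ (s.v x) (by rwa [Store.setV_self])
      (by simp)
    refine ⟨σ₃.setReg (varReg x) (σ₃.reg (auxReg (d + 2))), ?_, ?_, fun i hi => ?_, ?_⟩
    · rw [time]
      have hs : σ.setReg (auxReg (d + 1)) (σ.reg (varReg y)) = σ.setReg (auxReg (d + 1)) (s.v y) := by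
        rw [h.var]
      have := Exec.seq (Exec.copy (auxReg (d + 1)) (varReg y) σ) (Exec.seq
        (Exec.copy (auxReg (d + 2)) (varReg x) _) (Exec.seq (Exec.const (auxReg d) 0 _)
          (Exec.seq (s₂ := σ₃) (by
            have : (σ.setReg (auxReg (d + 1)) (s.v y)).reg (varReg x) = s.v x := by simp [h.var]
            rw [hs, this]; exact e₃) (Exec.copy (varReg x) (auxReg (d + 2)) σ₃))))
      exact this.cast (by ring)
    · have := r₃.setVar x (σ₃.reg (auxReg (d + 2)))
      rw [Store.setV_setV, w₃] at this
      simpa [w₃] using this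
    · simp [k₃ i hi, hi.ne, (show i ≠ d + 1 by omega), (show i ≠ d + 2 by omega)]
    · simp [v₃, eval]

end Ex

namespace Cmd

def code : Cmd → ℕ → Prog
  | set x p, d => .seq (p.code d) (.copy (varReg x) (auxReg d))
  | put b i p, d => .seq (i.code d) (address d b (.seq (p.code (d + 1))
      (.store (auxReg d) (auxReg (d + 1)))))
  | seq p q, d => .seq (p.code d) (q.code d)
  | loop x y p, d => .seq (.copy (auxReg (d + 1)) (varReg y)) <| .seq (.const (auxReg d) 0) <|
      .loop (auxReg (d + 1)) <| .seq (.copy (varReg x) (auxReg d)) <| .seq (p.code (d + 2)) <|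
      .seq (.const (auxReg (d + 2)) 1) <| .seq (.add (auxReg d) (auxReg d) (auxReg (d + 2))) <|
      .sub (auxReg (d + 1)) (auxReg (d + 1)) (auxReg (d + 2))

theorem exec (p : Cmd) : ∀ (n d : ℕ) (σ : State) (s : Store), Rel n σ s →
    Steps n d (p.code d) σ (p.run s) (p.time s) fun _ => True := by
  induction p with
  | set x p =>
    intro n d σ s h
    obtain ⟨σ₁, e₁, r₁, k₁, v₁⟩ := p.exec n d σ s h
    exact ⟨_, Exec.seq e₁ (Exec.copy _ _ _), by rw [v₁]; exact r₁.setVar _ _,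
      fun i hi => by simp [k₁ i hi], trivial⟩
  | put b i p =>
    intro n d σ s h
    obtain ⟨σ₁, e₁, r₁, k₁, v₁⟩ := i.exec n d σ s h
    obtain ⟨σ₂, e₂, r₂, k₂, v₂⟩ := p.exec n (d + 1) _ s
      ((r₁.setAux (d + 1) 1).setAux d (cell n b (σ₁.reg (auxReg d))))
    refine ⟨σ₂.setMem (cell n b (i.eval s)) (p.eval s), ?_, ?_, fun j hj => ?_, trivial⟩
    · have h1 := Exec.store (auxReg d) (auxReg (d + 1)) σ₂
      rw [v₂, k₂ d (by omega)] at h1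
      simp only [State.setReg_reg, if_true, v₁] at h1
      have := Exec.seq e₁ (exec_address r₁.sq (Exec.seq e₂ h1))
      exact this.cast (by rw [time]; ring)
    · exact r₂.setCell _ _ _
    · simp [k₂ j (by omega), hj.ne, (show j ≠ d + 1 by omega), k₁ j hj]
  | seq p q hp hq =>
    intro n d σ s h
    obtain ⟨σ₁, e₁, r₁, k₁, -⟩ := hp n d σ s h
    obtain ⟨σ₂, e₂, r₂, k₂, -⟩ := hq n d σ₁ _ r₁
    exact ⟨σ₂, Exec.seq e₁ e₂, r₂, fun i hi => (k₂ i hi).trans (k₁ i hi), trivial⟩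
  | loop x y p hp =>
    intro n d σ s h
    rw [run_loop]
    -- `i` rounds are done and `L` are left. Commands need the index in ascending order, whereas the
    -- machine tests only for zero, so one register counts up and another one down.
    have hloop : ∀ L N i, i + L = N → ∀ σ : State, Rel n σ (iter x p s i) →
        σ.reg (auxReg (d + 1)) = L → σ.reg (auxReg d) = i →
        ∃ σ', Exec (.loop (auxReg (d + 1)) <| .seq (.copy (varReg x) (auxReg d)) <|
          .seq (p.code (d + 2)) <| .seq (.const (auxReg (d + 2)) 1) <|
          .seq (.add (auxReg d) (auxReg d) (auxReg (d + 2))) <|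
          .sub (auxReg (d + 1)) (auxReg (d + 1)) (auxReg (d + 2))) σ
            (∑ i' ∈ Finset.Ico i N, (p.time ((iter x p s i').setV x i') + 5) + 1) σ' ∧
          Rel n σ' (iter x p s N) ∧ (∀ i < d, σ'.reg (auxReg i) = σ.reg (auxReg i)) := by
      intro L N
      induction L with
      | zero =>
        rintro i rfl σ hr hN -
        exact ⟨σ, by simpa using Exec.loop_stop hN, hr, fun _ _ => rfl⟩
      | succ L ih =>
        intro i hi σ hr hL hi0
        obtain ⟨σ₂, e₂, r₂, k₂, -⟩ := hp n (d + 2) _ _ (hr.setVar x i)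
        have k₂0 := k₂ d (by omega)
        have k₂1 := k₂ (d + 1) (by omega)
        simp only [State.setReg_reg, auxReg_ne_varReg, if_false, hi0, hL] at k₂0 k₂1
        obtain ⟨σ₃, e₃, r₃, k₃⟩ := ih (i + 1) (by omega) (((σ₂.setReg (auxReg (d + 2)) 1).setReg
          (auxReg d) (i + 1)).setReg (auxReg (d + 1)) L)
          (((r₂.setAux _ _).setAux _ _).setAux _ _) (by simp) (by simp)
        refine ⟨σ₃, ?_, r₃, fun j hj => ?_⟩
        · rw [Finset.sum_eq_sum_Ico_succ_bot (by omega)]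
          have eb := Exec.seq (Exec.copy (varReg x) (auxReg d) σ) (Exec.seq
            (p := p.code (d + 2)) (s₂ := σ₂) (t := p.time ((iter x p s i).setV x i))
            (by rw [hi0]; exact e₂) (Exec.seq (Exec.const (auxReg (d + 2)) 1 σ₂)
            (Exec.seq (Exec.add (auxReg d) (auxReg d) (auxReg (d + 2)) _)
              (Exec.sub (auxReg (d + 1)) (auxReg (d + 1)) (auxReg (d + 2)) _))))
          simp only [State.setReg_reg, auxReg_inj, if_true, k₂0, k₂1,
            (show d ≠ d + 2 by omega), (show d + 1 ≠ d + 2 by omega), (show d + 1 ≠ d by omega),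
            (show d + 2 ≠ d by omega), if_false, Nat.add_sub_cancel] at eb
          have := Exec.loop_step (by rw [hL]; omega) eb e₃
          exact this.cast (by ring)
        · rw [k₃ j hj]
          simp [hj.ne, k₂ j (by omega), (show j ≠ d + 1 by omega), (show j ≠ d + 2 by omega)]
    obtain ⟨σ₃, e₃, r₃, k₃⟩ := hloop (s.v y) (s.v y) 0 (by omega)
      ((σ.setReg (auxReg (d + 1)) (s.v y)).setReg (auxReg d) 0) ((h.setAux _ _).setAux _ _)
      (by simp) (by simp)
    refine ⟨σ₃, ?_, r₃, fun i hi => ?_, trivial⟩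
    · have h1 := Exec.copy (auxReg (d + 1)) (varReg y) σ
      rw [h.var] at h1
      have := Exec.seq h1 (Exec.seq (Exec.const (auxReg d) 0 _) e₃)
      exact this.cast (by rw [time, ← Finset.range_eq_Ico]; ring)
    · simp [k₃ i hi, hi.ne, (show i ≠ d + 1 by omega)]

end Cmd

end Loop


namespace Loop

open RAM

/-! #### Derived expressions and commands -/

namespace Ex

/-- Truth of an expression. -/
def T (p : Ex) (s : Store) : Prop := p.eval s ≠ 0

def and (p q : Ex) : Ex := ite p q (c 0)
def or (p q : Ex) : Ex := ite p (c 1) q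
def not (p : Ex) : Ex := ite p (c 0) (c 1)
def lt (p q : Ex) : Ex := sub q p
def le (p q : Ex) : Ex := not (lt q p)
def eq (p q : Ex) : Ex := and (le p q) (le q p)
def all (x y : ℕ) (p : Ex) : Ex := not (sum x y (not p))
def count (x y : ℕ) (p : Ex) : Ex := sum x y (ite p (c 1) (c 0))

/-- The conjunction of `f i` for `i < k`. -/
def allF (f : ℕ → Ex) : ℕ → Ex
  | 0 => c 1
  | k + 1 => and (allF f k) (f k)

/-- The disjunction of `f i` for `i < k`. -/
def exF (f : ℕ → Ex) : ℕ → Ex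
  | 0 => c 0
  | k + 1 => or (exF f k) (f k)

section

variable {p q g : Ex} {s : Store} {x y l b k : ℕ} {f : ℕ → Ex}

@[simp] theorem eval_c (k : ℕ) : (c k).eval s = k := rfl
@[simp] theorem eval_v : (v x).eval s = s.v x := rfl
@[simp] theorem eval_add : (add p q).eval s = p.eval s + q.eval s := rfl
@[simp] theorem eval_sub : (sub p q).eval s = p.eval s - q.eval s := rfl
@[simp] theorem eval_arr : (arr b p).eval s = s.a b (p.eval s) := rfl
@[simp] theorem eval_sum : (sum x y p).eval s = ∑ i ∈ Finset.range (s.v y), p.eval (s.setV x i) := rfl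
open Classical in
theorem eval_ite : (ite g p q).eval s = if g.T s then p.eval s else q.eval s := by
  simp only [eval, T]; congr
open Classical in
theorem eval_count : (count x y p).eval s =
    ((Finset.range (s.v y)).filter fun i => p.T (s.setV x i)).card := by
  simp only [count, eval_sum, eval_ite, Finset.card_filter, eval_c]

theorem T_c : (c k).T s ↔ k ≠ 0 := Iff.rfl
theorem T_v : (v x).T s ↔ s.v x ≠ 0 := Iff.rfl
theorem T_arr : (arr b p).T s ↔ s.a b (p.eval s) ≠ 0 := Iff.rfl
@[simp] theorem T_and : (and p q).T s ↔ p.T s ∧ q.T s := by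
  simp only [T, and, eval]; split_ifs with h <;> simp_all
@[simp] theorem T_or : (or p q).T s ↔ p.T s ∨ q.T s := by
  simp only [T, or, eval]; split_ifs with h <;> simp_all
@[simp] theorem T_not : (not p).T s ↔ ¬ p.T s := by
  simp only [T, not, eval]; split_ifs with h <;> simp_all
@[simp] theorem T_lt : (lt p q).T s ↔ p.eval s < q.eval s := by
  simp only [T, lt, eval]; omega
@[simp] theorem T_le : (le p q).T s ↔ p.eval s ≤ q.eval s := by simp [le]
@[simp] theorem T_eq : (eq p q).T s ↔ p.eval s = q.eval s := by
  simp only [eq, T_and, T_le]; omega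
@[simp] theorem T_sum : (sum x y p).T s ↔ ∃ i < s.v y, p.T (s.setV x i) := by
  simp [T]
@[simp] theorem T_all : (all x y p).T s ↔ ∀ i < s.v y, p.T (s.setV x i) := by
  simp [all]
@[simp] theorem T_allF : (allF f k).T s ↔ ∀ i < k, (f i).T s := by
  induction k with
  | zero => simp [allF, T_c]
  | succ k ih => simp only [allF, T_and, ih, Nat.forall_lt_succ_right]
@[simp] theorem T_exF : (exF f k).T s ↔ ∃ i < k, (f i).T s := by
  induction k with
  | zero => simp [exF, T_c]
  | succ k ih => simp only [exF, T_or, ih, Nat.exists_lt_succ_right]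

@[simp] theorem ok_c (k : ℕ) : (c k).Ok l := trivial
@[simp] theorem ok_v : (v x).Ok l := trivial
@[simp] theorem ok_add : (add p q).Ok l ↔ p.Ok l ∧ q.Ok l := Iff.rfl
@[simp] theorem ok_sub : (sub p q).Ok l ↔ p.Ok l ∧ q.Ok l := Iff.rfl
@[simp] theorem ok_arr : (arr b p).Ok l ↔ p.Ok l := Iff.rfl
@[simp] theorem ok_inp : (inp p).Ok l ↔ p.Ok l := Iff.rfl
@[simp] theorem ok_ite : (ite g p q).Ok l ↔ g.Ok l ∧ p.Ok l ∧ q.Ok l := Iff.rfl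
@[simp] theorem ok_sum : (sum x y p).Ok l ↔ y < l ∧ l ≤ x ∧ p.Ok l := Iff.rfl
@[simp] theorem ok_and : (and p q).Ok l ↔ p.Ok l ∧ q.Ok l := by simp [and]
@[simp] theorem ok_or : (or p q).Ok l ↔ p.Ok l ∧ q.Ok l := by simp [or]
@[simp] theorem ok_not : (not p).Ok l ↔ p.Ok l := by simp [not]
@[simp] theorem ok_lt : (lt p q).Ok l ↔ p.Ok l ∧ q.Ok l := by simp [lt, and_comm]
@[simp] theorem ok_le : (le p q).Ok l ↔ p.Ok l ∧ q.Ok l := by simp [le, and_comm]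
@[simp] theorem ok_eq : (eq p q).Ok l ↔ p.Ok l ∧ q.Ok l := by simp [eq, and_comm]
@[simp] theorem ok_all : (all x y p).Ok l ↔ y < l ∧ l ≤ x ∧ p.Ok l := by simp [all]
@[simp] theorem ok_count : (count x y p).Ok l ↔ y < l ∧ l ≤ x ∧ p.Ok l := by simp [count]
theorem ok_allF (h : ∀ i < k, (f i).Ok l) : (allF f k).Ok l := by
  induction k with
  | zero => trivial
  | succ k ih =>
    rw [allF, ok_and]; exact ⟨ih fun i hi => h i (by omega), h k (by omega)⟩
theorem ok_exF (h : ∀ i < k, (f i).Ok l) : (exF f k).Ok l := by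
  induction k with
  | zero => trivial
  | succ k ih =>
    rw [exF, ok_or]; exact ⟨ih fun i hi => h i (by omega), h k (by omega)⟩

end

end Ex

open Ex

namespace Cmd

section

variable {p q : Cmd} {e i : Ex} {s : Store} {x y z l b b' k : ℕ}

@[simp] theorem run_set : (set x e).run s = s.setV x (e.eval s) := rfl
@[simp] theorem run_put : (put b i e).run s = s.setA b (i.eval s) (e.eval s) := rfl
@[simp] theorem run_seq : (seq p q).run s = q.run (p.run s) := rfl
@[simp] theorem ok_set : (set x e).Ok l ↔ l ≤ x ∧ e.Ok l := Iff.rfl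
@[simp] theorem ok_put : (put b i e).Ok l ↔ i.Ok l ∧ e.Ok l := Iff.rfl
@[simp] theorem ok_seq : (seq p q).Ok l ↔ p.Ok l ∧ q.Ok l := Iff.rfl
@[simp] theorem ok_loop : (loop x y p).Ok l ↔ y < l ∧ l ≤ x ∧ p.Ok l := Iff.rfl
@[simp] theorem keepsV_set : (set x e).KeepsV z ↔ z ≠ x := Iff.rfl
@[simp] theorem keepsV_put : (put b i e).KeepsV z := trivial
@[simp] theorem keepsV_seq : (seq p q).KeepsV z ↔ p.KeepsV z ∧ q.KeepsV z := Iff.rfl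
@[simp] theorem keepsV_loop : (loop x y p).KeepsV z ↔ z ≠ x ∧ p.KeepsV z := Iff.rfl
@[simp] theorem keepsA_set : (set x e).KeepsA b := trivial
@[simp] theorem keepsA_put : (put b' i e).KeepsA b ↔ b ≠ b' := Iff.rfl
@[simp] theorem keepsA_seq : (seq p q).KeepsA b ↔ p.KeepsA b ∧ q.KeepsA b := Iff.rfl
@[simp] theorem keepsA_loop : (loop x y p).KeepsA b ↔ p.KeepsA b := Iff.rfl

end

/-- Sets the entries of the array `b` below the value of `y`. -/
def fill (b x y : ℕ) (e : Ex) : Cmd := loop x y (put b (Ex.v x) e)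

section

variable {e : Ex} {x y z l b b' : ℕ}

@[simp] theorem ok_fill : (fill b x y e).Ok l ↔ y < l ∧ l ≤ x ∧ e.Ok l := by simp [fill]
@[simp] theorem keepsV_fill : (fill b x y e).KeepsV z ↔ z ≠ x := by simp [fill]
@[simp] theorem keepsA_fill : (fill b x y e).KeepsA b' ↔ b' ≠ b := by simp [fill]

end

/-- Runs the commands `f i` for `i < k`. -/
def seqF (p : Cmd) (f : ℕ → Cmd) : ℕ → Cmd
  | 0 => p
  | k + 1 => seq (seqF p f k) (f k)

section

variable {p : Cmd} {f : ℕ → Cmd} {z l b k : ℕ}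

theorem ok_seqF (hp : p.Ok l) (h : ∀ i < k, (f i).Ok l) : (seqF p f k).Ok l := by
  induction k with
  | zero => exact hp
  | succ k ih => exact ⟨ih fun i hi => h i (by omega), h k (by omega)⟩

theorem keepsV_seqF (hp : p.KeepsV z) (h : ∀ i < k, (f i).KeepsV z) : (seqF p f k).KeepsV z := by
  induction k with
  | zero => exact hp
  | succ k ih => exact ⟨ih fun i hi => h i (by omega), h k (by omega)⟩

theorem keepsA_seqF (hp : p.KeepsA b) (h : ∀ i < k, (f i).KeepsA b) : (seqF p f k).KeepsA b := by
  induction k with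
  | zero => exact hp
  | succ k ih => exact ⟨ih fun i hi => h i (by omega), h k (by omega)⟩

theorem depth_seqF_le {D : ℕ} (hp : p.depth ≤ D) (h : ∀ i < k, (f i).depth ≤ D) :
    (seqF p f k).depth ≤ D := by
  induction k with
  | zero => exact hp
  | succ k ih => exact max_le (ih fun i hi => h i (by omega)) (h k (by omega))

theorem seqF_induction {s : Store} (I : ℕ → Store → Prop) (h0 : I 0 (p.run s))
    (h : ∀ i < k, ∀ s', I i s' → I (i + 1) ((f i).run s')) : I k ((seqF p f k).run s) := by
  induction k with
  | zero => exact h0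
  | succ k ih => exact h k (by omega) _ (ih fun i hi => h i (by omega))

end

end Cmd

/-! #### Tuples of vertices -/

/-- The variable that holds the entry `i` of the current tuple. -/
abbrev tv (i : ℕ) : ℕ := 100 + i

namespace Store

/-- Sets the entries of the current tuple from `lo` on. -/
def setT (τ : ℕ → ℕ) : ℕ → ℕ → Store → Store
  | _, 0, s => s
  | lo, len + 1, s => setT τ (lo + 1) len (s.setV (tv lo) (τ lo))

variable (τ : ℕ → ℕ)

@[simp] theorem setT_a : ∀ len lo s, (setT τ lo len s).a = s.a
  | 0, _, _ => rfl
  | len + 1, lo, s => by rw [setT, setT_a len]; rfl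

@[simp] theorem setT_inp : ∀ len lo s, (setT τ lo len s).inp = s.inp
  | 0, _, _ => rfl
  | len + 1, lo, s => by rw [setT, setT_inp len]; rfl

theorem setT_v_of_lt {x : ℕ} : ∀ len lo s, x < tv lo → (setT τ lo len s).v x = s.v x
  | 0, _, _, _ => rfl
  | len + 1, lo, s, h => by
    rw [setT, setT_v_of_lt len _ _ (by unfold tv at *; omega), setV_v, if_neg h.ne]

theorem setT_v {i : ℕ} : ∀ len lo s, lo ≤ i → i < lo + len → (setT τ lo len s).v (tv i) = τ i
  | 0, _, _, h, h' => by omega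
  | len + 1, lo, s, h, h' => by
    rw [setT]
    rcases h.eq_or_lt with rfl | h
    · rw [setT_v_of_lt _ _ _ _ (by unfold tv; omega)]; simp
    · exact setT_v len _ _ h (by omega)

theorem setT_congr {τ τ' : ℕ → ℕ} : ∀ len lo s, (∀ i, lo ≤ i → τ i = τ' i) →
    setT τ lo len s = setT τ' lo len s
  | 0, _, _, _ => rfl
  | len + 1, lo, s, h => by
    rw [setT, setT, h lo le_rfl, setT_congr len _ _ fun i hi => h i (by omega)]

end Store

/-- Some choice of the entries of the tuple from `lo` on makes `p` true. -/
def Ex.exT (p : Ex) : ℕ → ℕ → Ex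
  | _, 0 => p
  | lo, len + 1 => Ex.sum (tv lo) 0 (Ex.exT p (lo + 1) len)

theorem Ex.ok_exT {p : Ex} {l : ℕ} (hl : 0 < l) (hl' : l ≤ 100) (hp : p.Ok l) :
    ∀ len lo, (p.exT lo len).Ok l
  | 0, _ => hp
  | len + 1, lo => ⟨hl, by unfold tv; omega, ok_exT hl hl' hp len (lo + 1)⟩

theorem Ex.T_exT {p : Ex} : ∀ (len lo : ℕ) (s : Store), (p.exT lo len).T s ↔
    ∃ τ : ℕ → ℕ, (∀ i, lo ≤ i → i < lo + len → τ i < s.v 0) ∧ p.T (Store.setT τ lo len s)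
  | 0, lo, s => by
    simp only [exT, Store.setT]
    exact ⟨fun h => ⟨fun _ => 0, fun i _ _ => by omega, h⟩, fun ⟨_, _, h⟩ => h⟩
  | len + 1, lo, s => by
    simp only [exT, T_sum, T_exT len, Store.setV_v, (show 0 ≠ tv lo by unfold tv; omega), if_false]
    constructor
    · rintro ⟨i, hi, τ, hτ, h⟩
      refine ⟨Function.update τ lo i, fun j hj hj' => ?_, ?_⟩
      · rcases hj.eq_or_lt with rfl | hj
        · simpa using hi
        · rw [Function.update_of_ne (by omega)]; exact hτ j hj (by omega)
      · rw [Store.setT, Function.update_self]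
        rwa [Store.setT_congr len (lo + 1) (τ' := τ)]
        intro j hj
        rw [Function.update_of_ne (by omega)]
    · rintro ⟨τ, hτ, h⟩
      exact ⟨τ lo, hτ lo le_rfl (by omega), τ, fun i hi hi' => hτ i (by omega) (by omega), h⟩

namespace Cmd

/-- Runs `p` for all choices of the entries of the tuple from `lo` on. -/
def loopT (p : Cmd) : ℕ → ℕ → Cmd
  | _, 0 => p
  | lo, len + 1 => loop (tv lo) 0 (loopT p (lo + 1) len)

theorem ok_loopT {p : Cmd} {l : ℕ} (hl : 0 < l) (hl' : l ≤ 100) (hp : p.Ok l) :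
    ∀ len lo, (p.loopT lo len).Ok l
  | 0, _ => hp
  | len + 1, lo => ⟨hl, by unfold tv; omega, ok_loopT hl hl' hp len (lo + 1)⟩

theorem keepsV_loopT {p : Cmd} {z : ℕ} (hp : p.KeepsV z) : ∀ len lo, z < tv lo →
    (p.loopT lo len).KeepsV z
  | 0, _, _ => hp
  | len + 1, lo, h => ⟨h.ne, keepsV_loopT hp len (lo + 1) (by unfold tv at *; omega)⟩

@[simp] theorem keepsA_loopT {p : Cmd} {b : ℕ} : ∀ len lo,
    (p.loopT lo len).KeepsA b ↔ p.KeepsA b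
  | 0, _ => Iff.rfl
  | len + 1, lo => keepsA_loopT len (lo + 1)

/-- Induction over the tuples processed by `loopT`. -/
theorem loopT_induction {hi n lo₀ : ℕ} {p : Cmd} (J : Set (Fin hi → ℕ) → Store → Prop)
    (hn : ∀ A s, J A s → s.v 0 = n)
    (hJ : ∀ A s i x, lo₀ ≤ i → i < hi → J A s → J A (s.setV (tv i) x))
    (hp : ∀ A s, J A s → (∀ i, lo₀ ≤ i → i < hi → s.v (tv i) < n) →
      (fun i : Fin hi => s.v (tv i)) ∉ A → J (insert (fun i : Fin hi => s.v (tv i)) A) (p.run s))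
    (hk : ∀ i < hi, p.KeepsV (tv i)) :
    ∀ len lo, lo₀ ≤ lo → lo + len = hi → ∀ s A, J A s →
      (∀ i, lo₀ ≤ i → i < lo → s.v (tv i) < n) →
      (∀ τ ∈ A, ∃ i : Fin hi, i < lo ∧ τ i ≠ s.v (tv i)) →
      ∃ A', A ⊆ A' ∧ J A' ((p.loopT lo len).run s) ∧
        (∀ τ ∈ A', τ ∈ A ∨ ∀ i : Fin hi, i < lo → τ i = s.v (tv i)) ∧
        ∀ τ : Fin hi → ℕ, (∀ i : Fin hi, lo ≤ i → τ i < n) →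
          (∀ i : Fin hi, i < lo → τ i = s.v (tv i)) → τ ∈ A' := by
  intro len
  induction len with
  | zero =>
    intro lo hlo hlen s A hA hlt hnew
    refine ⟨insert (fun i : Fin hi => s.v (tv i)) A, Set.subset_insert _ _, hp A s hA (fun i h1 h2 => hlt i h1 (by omega)) ?_,
      ?_, ?_⟩
    · intro h
      obtain ⟨i, _, hi⟩ := hnew _ h
      exact hi rfl
    · rintro τ (rfl | h)
      · exact Or.inr fun _ _ => rfl
      · exact Or.inl h
    · intro τ _ h
      exact Or.inl (funext fun i => h i (by omega))
  | succ len ih =>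
    intro lo hlo hlen s A hA hlt hnew
    have hs0 := hn A s hA
    -- After `i` rounds the tuples added are among those that agree with the current prefix and have
    -- an entry below `i` at `lo`. Hence no tuple is processed twice, which the body may rely on.
    have := loop_induction (x := tv lo) (y := 0) (p := p.loopT (lo + 1) len) (s := s)
      (fun i s' => ∃ A', A ⊆ A' ∧ J A' s' ∧
        (∀ τ ∈ A', τ ∈ A ∨ (∀ i : Fin hi, i < lo → τ i = s.v (tv i)) ∧ τ ⟨lo, by omega⟩ < i) ∧
        ∀ τ : Fin hi → ℕ, (∀ i : Fin hi, lo ≤ i → τ i < n) →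
          (∀ i : Fin hi, i < lo → τ i = s.v (tv i)) → τ ⟨lo, by omega⟩ < i → τ ∈ A')
      ⟨A, subset_rfl, hA, fun τ h => Or.inl h, fun τ _ _ h => by omega⟩ ?_
    · obtain ⟨A', h0, h1, h2, h3⟩ := this
      refine ⟨A', h0, h1, fun τ hτ => (h2 τ hτ).imp_right And.left, fun τ h h' => h3 τ h h' ?_⟩
      rw [hs0]
      exact h ⟨lo, by omega⟩ le_rfl
    · rintro i hi s' hv - - ⟨A', h0, h1, h2, h3⟩
      have hv' : ∀ j < lo, (s'.setV (tv lo) i).v (tv j) = s.v (tv j) := by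
        intro j hj
        rw [Store.setV_v, if_neg (by unfold tv; omega)]
        exact hv _ (by unfold tv; omega)
          (keepsV_loopT (hk j (by omega)) _ _ (by unfold tv; omega))
      obtain ⟨A'', g0, g1, g2, g3⟩ := ih (lo + 1) (by omega) (by omega) (s'.setV (tv lo) i) A'
        (hJ _ _ _ _ hlo (by omega) h1) (fun j hj hj' => by
          rcases Nat.lt_succ_iff_lt_or_eq.1 hj' with h | rfl
          · rw [hv' j h]; exact hlt j hj h
          · simpa [← hs0] using hi) (fun τ hτ => by
          rcases h2 τ hτ with h | h
          · obtain ⟨j, hj, hne⟩ := hnew τ h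
            exact ⟨j, by omega, by rwa [hv' j hj]⟩
          · exact ⟨⟨lo, by omega⟩, Nat.lt_succ_self _, by simpa using h.2.ne⟩)
      refine ⟨A'', h0.trans g0, g1, fun τ hτ => ?_, fun τ hτ hpre hlt' => ?_⟩
      · rcases g2 τ hτ with h | h
        · rcases h2 τ h with h | h
          · exact Or.inl h
          · exact Or.inr ⟨h.1, by omega⟩
        · refine Or.inr ⟨fun j hj => by rw [h j (by omega), hv' j hj], ?_⟩
          rw [h ⟨lo, by omega⟩ (Nat.lt_succ_self _)]; simp
      · by_cases hτi : τ ⟨lo, by omega⟩ = i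
        · refine g3 τ (fun j hj => hτ j (by omega)) fun j hj => ?_
          rcases Nat.lt_succ_iff_lt_or_eq.1 hj with h | h
          · rw [hv' j h, hpre j h]
          · have e : j = ⟨lo, by omega⟩ := Fin.ext h
            rw [e, hτi]; simp
        · exact g0 (h3 τ hτ hpre (by omega))

end Cmd

end Loop


namespace Loop

open RAM

/-! #### Input and output -/

/-- The machine program that runs `p` and outputs the variable `z`. -/
def program (p : Cmd) (z : ℕ) : Prog :=
  .seq (.copy 4 0) <| .seq (.copy 6 1) <| .seq (.copy 5 0) <| .seq (.const 7 1) <|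
  .seq (.loop 5 (.seq (.add 2 2 0) (.sub 5 5 7))) <| .seq (p.code 0) (.copy 0 (varReg z))

/-- The store at the start of the computation. -/
noncomputable def initStore {n : ℕ} (G : SimpleGraph (Fin n)) (k : ℕ) : Store where
  v x := if x = 0 then n else if x = 1 then k else 0
  a _ _ := 0
  inp := (RAM.input G k).mem

/-- Without multiplication, `n * n` is obtained by repeated addition; it is where the arrays start
and serves to guard reads of the input. -/
theorem exec_square (N n : ℕ) : ∀ σ : State, σ.reg 0 = n → σ.reg 5 = N → σ.reg 7 = 1 →
    Exec (.loop 5 (.seq (.add 2 2 0) (.sub 5 5 7))) σ (3 * N + 1)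
      ⟨fun x => if x = 2 then σ.reg 2 + n * N else if x = 5 then 0 else σ.reg x, σ.mem⟩ := by
  induction N with
  | zero =>
    intro σ _ h _
    have e : (⟨fun x => if x = 2 then σ.reg 2 + n * 0 else if x = 5 then 0 else σ.reg x,
        σ.mem⟩ : State) = σ := by
      cases σ with
      | mk reg mem =>
        simp only [State.mk.injEq, and_true]
        funext x
        split_ifs with h1 h2
        · simp [h1]
        · rw [h2]; exact h.symm
        · rfl
    rw [e]
    exact Exec.loop_stop h
  | succ N ih =>
    intro σ h0 h5 h7
    have := Exec.loop_step (by rw [h5]; omega)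
      (Exec.seq (Exec.add 2 2 0 σ) (Exec.sub 5 5 7 _))
      (ih _ (by simp [h0]) (by simp [h5, h7]) (by simp [h7]))
    convert this using 1
    · ring
    · simp only [State.mk.injEq]
      constructor
      · funext x
        by_cases h2 : x = 2
        · subst h2
          simp only [State.setReg_reg, if_true, h0, show (2 : ℕ) ≠ 5 by omega, if_false]
          ring
        · by_cases h5 : x = 5
          · simp [h5]
          · simp [h2, h5]
      · rfl

theorem exec_program (p : Cmd) (z : ℕ) {n : ℕ} (G : SimpleGraph (Fin n)) (k : ℕ) :
    ∃ σ, Exec (program p z) (RAM.input G k) (p.time (initStore G k) + (3 * n + 6)) σ ∧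
      σ.reg 0 = (p.run (initStore G k)).v z := by
  have e := exec_square n n (((((RAM.input G k).setReg 4 n).setReg 6 k).setReg 5 n).setReg 7 1)
    (by simp [RAM.input]) (by simp) (by simp)
  have hrel : Rel n _ (initStore G k) := (show Rel n ⟨fun x => if x = 2 then
      (((((RAM.input G k).setReg 4 n).setReg 6 k).setReg 5 n).setReg 7 1).reg 2 + n * n
      else if x = 5 then 0
      else (((((RAM.input G k).setReg 4 n).setReg 6 k).setReg 5 n).setReg 7 1).reg x,
      (((((RAM.input G k).setReg 4 n).setReg 6 k).setReg 5 n).setReg 7 1).mem⟩ _ from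
    { sq := by simp [RAM.input]
      var := fun x => by
        have h2 : varReg x ≠ 2 := by unfold varReg; omega
        have h5 : varReg x ≠ 5 := by unfold varReg; omega
        have h7 : varReg x ≠ 7 := by unfold varReg; omega
        have h0 : varReg x ≠ 0 := by unfold varReg; omega
        have h1 : varReg x ≠ 1 := by unfold varReg; omega
        have h4 : varReg x = 4 ↔ x = 0 := by unfold varReg; omega
        have h6 : varReg x = 6 ↔ x = 1 := by unfold varReg; omega
        simp only [h2, h5, h7, h0, h1, h4, h6, if_false, State.setReg_reg, initStore, RAM.input]
        split_ifs <;> simp_all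
      arr := fun b i => by
        have : ¬ ∃ i' j' : Fin n, cell n b i = (i' : ℕ) * n + j' ∧ G.Adj i' j' := by
          rintro ⟨i', j', h, -⟩
          have h1 := le_cell n b i
          have h2 := i'.2
          have h3 := j'.2
          have : ((i' : ℕ) + 1) * n ≤ n * n := Nat.mul_le_mul_right _ h2
          rw [add_mul] at this
          omega
        simp [RAM.input, initStore, this]
      inp := fun i _ => rfl
      inp_eq_zero := fun i hi => by
        have : ¬ ∃ i' j' : Fin n, i = (i' : ℕ) * n + j' ∧ G.Adj i' j' := by
          rintro ⟨i', j', h, -⟩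
          have h2 := i'.2
          have h3 := j'.2
          have : ((i' : ℕ) + 1) * n ≤ n * n := Nat.mul_le_mul_right _ h2
          rw [add_mul] at this
          omega
        simp [RAM.input, initStore, this] })
  obtain ⟨σ, e₁, r₁, -, -⟩ := p.exec n 0 _ _ hrel
  refine ⟨σ.setReg 0 (σ.reg (varReg z)), ?_, by simp [r₁.var]⟩
  have := Exec.seq (Exec.copy 4 0 (RAM.input G k)) (Exec.seq (Exec.copy 6 1 _)
    (Exec.seq (Exec.copy 5 0 _) (Exec.seq (Exec.const 7 1 _) (Exec.seq (by
      simpa [RAM.input] using e) (Exec.seq e₁ (Exec.copy 0 (varReg z) σ))))))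
  exact this.cast (by ring)

/-! #### Graphs in the input -/

/-- The store holds the graph `Γ` on the vertices below `n`. -/
structure Holds (Γ : SimpleGraph ℕ) (n : ℕ) (s : Store) : Prop where
  n_eq : s.v 0 = n
  adj : ∀ i < n, ∀ j < n, s.inp (n * i + j) ≠ 0 ↔ Γ.Adj i j

theorem holds_initStore {n : ℕ} (G : SimpleGraph (Fin n)) (k : ℕ) :
    Holds (G.map Fin.valEmbedding) n (initStore G k) := by
  refine ⟨by simp [initStore], fun i hi j hj => ?_⟩
  have h1 : (initStore G k).inp (n * i + j) ≠ 0 ↔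
      ∃ i' j' : Fin n, n * i + j = (i' : ℕ) * n + j' ∧ G.Adj i' j' := by
    simp [initStore, RAM.input]
  rw [h1, SimpleGraph.map_adj]
  constructor
  · rintro ⟨i', j', h, hadj⟩
    have hi' : i = i' ∧ j = j' := by
      have h2 := j'.2
      have hn : 0 < n := by omega
      have e1 := congrArg (· / n) h
      have e2 := congrArg (· % n) h
      simp only [Nat.mul_add_div hn, Nat.div_eq_of_lt hj, mul_comm (i' : ℕ) n,
        Nat.div_eq_of_lt h2, Nat.mul_add_mod, Nat.mod_eq_of_lt hj, Nat.mod_eq_of_lt h2] at e1 e2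
      omega
    exact ⟨i', j', hadj, hi'.1.symm, hi'.2.symm⟩
  · rintro ⟨i', j', hadj, rfl, rfl⟩
    exact ⟨i', j', by simp [mul_comm], hadj⟩

namespace Holds

variable {Γ : SimpleGraph ℕ} {n : ℕ} {s s' : Store} {x y : ℕ}

theorem congr (h : Holds Γ n s) (h0 : s'.v 0 = s.v 0) (hi : s'.inp = s.inp) : Holds Γ n s' :=
  ⟨h0.trans h.n_eq, by rw [hi]; exact h.adj⟩

theorem setV (h : Holds Γ n s) (hx : x ≠ 0) (w : ℕ) : Holds Γ n (s.setV x w) :=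
  h.congr (by simp [hx.symm]) rfl

theorem setT (h : Holds Γ n s) (τ : ℕ → ℕ) (lo len : ℕ) : Holds Γ n (Store.setT τ lo len s) :=
  h.congr (Store.setT_v_of_lt _ _ _ _ (by unfold tv; omega)) (Store.setT_inp _ _ _ _)

end Holds

/-- The set stored in the array `b`. -/
def Store.set (s : Store) (n b : ℕ) : Finset ℕ := (Finset.range n).filter fun v => s.a b v ≠ 0

theorem Store.mem_set {s : Store} {n b v : ℕ} : v ∈ s.set n b ↔ v < n ∧ s.a b v ≠ 0 := by
  simp [Store.set]

theorem Store.set_congr {s s' : Store} {n b : ℕ} (h : s'.a b = s.a b) : s'.set n b = s.set n b := by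
  rw [Store.set, Store.set, h]

namespace Ex

/-- Adjacency of the vertices in the variables `x` and `y`. -/
def adj (x y : ℕ) : Ex := inp (add (sum 50 0 (v x)) (v y))

/-- The number of neighbours of the vertex in `z` in the set stored in the array `0`. -/
def deg (z u : ℕ) : Ex := count u 0 (and (arr 0 (v u)) (adj z u))

/-- The first `k` entries of the tuple are pairwise adjacent. -/
def clique (k : ℕ) : Ex := allF (fun b => allF (fun a => adj (tv a) (tv b)) b) k

variable {Γ : SimpleGraph ℕ} {n : ℕ} {s : Store} {x y z u l k : ℕ}

/-- The variable `50` is the index of the sum that multiplies by `n`, so `x` must be a different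
one. -/
theorem T_adj (h : Holds Γ n s) (hx : x ≠ 50) (hxn : s.v x < n) (hyn : s.v y < n) :
    (adj x y).T s ↔ Γ.Adj (s.v x) (s.v y) := by
  rw [← h.adj _ hxn _ hyn]
  simp [T, adj, eval, hx, h.n_eq]

theorem ok_adj (hl : 0 < l) (hl' : l ≤ 50) : (adj x y).Ok l := ⟨⟨hl, hl', trivial⟩, trivial⟩

theorem eval_deg (h : Holds Γ n s) (hz : z ≠ 50) (hzu : z ≠ u) (hu : u ≠ 0) (hzn : s.v z < n) :
    (deg z u).eval s = (trace Γ (s.set n 0) (s.v z)).card := by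
  classical
  rw [deg, eval_count]
  congr 1
  ext w
  rw [Finset.mem_filter, mem_trace, Store.mem_set, h.n_eq, Finset.mem_range, T_and, T_arr, eval_v,
    and_assoc]
  refine and_congr_right fun hw => ?_
  rw [T_adj (h.setV hu w) hz (by simpa [hzu] using hzn) (by simpa using hw)]
  simp [hzu]

theorem ok_deg (hl : 0 < l) (hl' : l ≤ 50) (hu : l ≤ u) : (deg z u).Ok l := by
  simp [deg, ok_adj hl hl', hl, hu]

theorem T_clique (h : Holds Γ n s) (hk : ∀ i < k, s.v (tv i) < n) :
    (clique k).T s ↔ ∀ b < k, ∀ a < b, Γ.Adj (s.v (tv a)) (s.v (tv b)) := by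
  simp only [clique, T_allF]
  refine forall₂_congr fun b hb => forall₂_congr fun a ha => ?_
  exact T_adj h (by unfold tv; omega) (hk a (by omega)) (hk b hb)

theorem ok_clique (hl : 0 < l) (hl' : l ≤ 50) : (clique k).Ok l :=
  ok_allF fun _ _ => ok_allF fun _ _ => ok_adj hl hl'

end Ex

end Loop


/-! ### Greedy packing of petals by loops over tuples. -/

/-- The program enumerates tuples while the kernelization speaks of sets. Entries that are pairwise
adjacent are distinct, so a tuple that extends `τ` yields a petal; conversely,
`IsPetal.exists_tuple` lists `τ` first and then the petal in increasing order. -/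
theorem isPetal_of_tuple {Γ : SimpleGraph ℕ} {vs L : Finset ℕ} {r j : ℕ} {τ : Fin j → ℕ}
    (hjr : j ≤ r) {σ : Fin r → ℕ} (hadj : ∀ a b, a < b → Γ.Adj (σ a) (σ b)) (hvs : ∀ i, σ i ∈ vs)
    (hτ : ∀ i : Fin j, σ (Fin.castLE hjr i) = τ i) (hL : ∀ i : Fin r, j ≤ i → σ i ∈ L) :
    IsPetal Γ vs L r τ ((Finset.univ.filter fun i : Fin r => j ≤ i).image σ) := by
  have hne : ∀ a b, a ≠ b → Γ.Adj (σ a) (σ b) := fun a b h => by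
    rcases lt_or_gt_of_ne h with h | h
    · exact hadj a b h
    · exact (hadj b a h).symm
  have hinj : Function.Injective σ := fun a b h => by
    by_contra hab
    exact (hne a b hab).ne h
  have hU : Finset.univ.image τ ∪ (Finset.univ.filter fun i : Fin r => j ≤ i).image σ =
      Finset.univ.image σ := by
    ext x
    simp only [Finset.mem_union, Finset.mem_image, Finset.mem_univ, true_and, Finset.mem_filter]
    constructor
    · rintro (⟨i, rfl⟩ | ⟨i, -, rfl⟩)
      · exact ⟨_, hτ i⟩
      · exact ⟨i, rfl⟩
    · rintro ⟨i, rfl⟩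
      by_cases hi : j ≤ i
      · exact Or.inr ⟨i, hi, rfl⟩
      · exact Or.inl ⟨⟨i, by omega⟩, (hτ _).symm⟩
  refine ⟨fun x hx => ?_, ?_, ?_⟩
  · obtain ⟨i, hi, rfl⟩ := Finset.mem_image.1 hx
    exact hL i (Finset.mem_filter.1 hi).2
  · rw [Finset.disjoint_left]
    rintro x hx hx'
    obtain ⟨i, -, rfl⟩ := Finset.mem_image.1 hx
    obtain ⟨i', hi', h⟩ := Finset.mem_image.1 hx'
    rw [← hτ] at h
    have h1 := congrArg Fin.val (hinj h)
    have h2 := (Finset.mem_filter.1 hi').2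
    have h3 := i.2
    simp only [Fin.val_castLE] at h1
    omega
  · rw [hU]
    refine ⟨fun x hx => ?_, ?_, ?_⟩
    · obtain ⟨i, -, rfl⟩ := Finset.mem_image.1 hx
      exact hvs i
    · rw [Finset.card_image_of_injective _ hinj, Finset.card_univ, Fintype.card_fin]
    · intro a ha b hb hab
      obtain ⟨i, -, rfl⟩ := Finset.mem_image.1 ha
      obtain ⟨i', -, rfl⟩ := Finset.mem_image.1 hb
      exact hne i i' fun h => hab (h ▸ rfl)

theorem IsPetal.exists_tuple {Γ : SimpleGraph ℕ} {vs L : Finset ℕ} {r j : ℕ} {τ : Fin j → ℕ}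
    (hjr : j ≤ r) (hτ : ∀ a b, a < b → Γ.Adj (τ a) (τ b)) {Z : Finset ℕ}
    (h : IsPetal Γ vs L r τ Z) :
    ∃ σ : Fin r → ℕ, (∀ a b, a < b → Γ.Adj (σ a) (σ b)) ∧ (∀ i, σ i ∈ vs) ∧
      (∀ i : Fin j, σ (Fin.castLE hjr i) = τ i) ∧ ∀ i : Fin r, j ≤ i → σ i ∈ Z := by
  obtain ⟨hZL, hdj, hvs, hcard, hadj⟩ := h
  have hinj : Function.Injective τ := fun a b h => by
    by_contra hab
    rcases lt_or_gt_of_ne hab with hab | hab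
    · exact (hτ a b hab).ne h
    · exact (hτ b a hab).ne h.symm
  have hZ : Z.card = r - j := by
    rw [Finset.card_union_of_disjoint hdj, Finset.card_image_of_injective _ hinj,
      Finset.card_univ, Fintype.card_fin] at hcard
    omega
  set σ : Fin r → ℕ := fun i => if h : (i : ℕ) < j then τ ⟨i, h⟩ else
    Z.orderEmbOfFin hZ ⟨i - j, by omega⟩ with hσ
  have hlt : ∀ (i : Fin r) (h : (i : ℕ) < j), σ i = τ ⟨i, h⟩ := fun i h => by simp [hσ, h]
  have hge : ∀ (i : Fin r) (_ : ¬ (i : ℕ) < j), σ i ∈ Z := fun i h => by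
    simp only [hσ, h, dif_neg, not_false_eq_true]; exact Finset.orderEmbOfFin_mem _ _ _
  have hτmem : ∀ i, τ i ∈ Finset.univ.image τ := fun i =>
    Finset.mem_image_of_mem _ (Finset.mem_univ i)
  have hmem : ∀ i, σ i ∈ Finset.univ.image τ ∪ Z := fun i => by
    by_cases h : (i : ℕ) < j
    · rw [hlt i h]; exact Finset.mem_union_left _ (hτmem _)
    · exact Finset.mem_union_right _ (hge i h)
  refine ⟨σ, fun a b hab => ?_, fun i => hvs (hmem i), fun i => ?_, fun i hi => hge i (by omega)⟩
  · by_cases hb : (b : ℕ) < j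
    · rw [hlt a (by omega), hlt b hb]; exact hτ _ _ hab
    · refine hadj _ (hmem a) _ (hmem b) fun he => ?_
      by_cases ha : (a : ℕ) < j
      · refine Finset.disjoint_left.1 hdj (hτmem ⟨a, ha⟩) ?_
        rw [← hlt a ha, he]; exact hge b hb
      · simp only [hσ, ha, hb, dif_neg, not_false_eq_true] at he
        have := congrArg Fin.val ((Z.orderEmbOfFin hZ).injective he)
        simp only at this
        omega
  · rw [hlt _ i.2]; rfl

namespace Loop

open Ex Cmd

/-- When the entry `i` is computed, the entries from `i` on still have their old values, so the
expression may read the entry that it overwrites. -/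
theorem Cmd.run_fill_iff {b x y : ℕ} {e : Ex} {s : Store} (P : ℕ → Prop)
    (h : ∀ i < s.v y, ∀ s' : Store, (∀ z, z ≠ x → s'.v z = s.v z) →
      (∀ b', b' ≠ b → s'.a b' = s.a b') → s'.inp = s.inp →
      (∀ j, i ≤ j → s'.a b j = s.a b j) → (e.T (s'.setV x i) ↔ P i)) {j : ℕ} (hj : j < s.v y) :
    ((fill b x y e).run s).a b j ≠ 0 ↔ P j := by
  refine (loop_induction (fun i s' => ∀ j, (j < i → (s'.a b j ≠ 0 ↔ P j)) ∧
    (i ≤ j → s'.a b j = s.a b j)) (by simp) (fun i hi s' hv ha hinp hI j => ?_) j).1 hj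
  have h1 := h i hi s' (fun z hz => hv z hz trivial) (fun b' hb => ha b' (by simpa using hb)) hinp
    (fun j hj => (hI j).2 hj)
  rw [run_put, Store.setA_a]
  simp only [eval_v, Store.setV_v, if_true, true_and, Store.setV_a]
  by_cases hji : j = i
  · subst hji; simpa [Ex.T] using h1
  · rw [if_neg hji]
    exact ⟨fun h => (hI j).1 (by omega), fun h => (hI j).2 (by omega)⟩

/-- Adds the new entries of the tuple to the array `4` if they form a petal. -/
def greedyBody (j r : ℕ) (L : ℕ → Ex) : Cmd :=
  seq (set 20 (and (clique r) (allF (fun i => and (L (tv (j + i)))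
    (not (arr 4 (v (tv (j + i)))))) (r - j))))
  (seq (fill 4 21 0 (or (arr 4 (v 21)) (and (v 20) (exF (fun i => eq (v 21) (v (tv (j + i))))
    (r - j)))))
  (set 14 (add (v 14) (ite (v 20) (c 1) (c 0)))))

/-- Packs disjoint petals of the first `j` entries of the tuple greedily. -/
def greedy (j r : ℕ) (L : ℕ → Ex) : Cmd := (greedyBody j r L).loopT j (r - j)

theorem ok_greedy {j r l : ℕ} {L : ℕ → Ex} (hl : 0 < l) (hl' : l ≤ 14)
    (hL : ∀ i, (L (tv i)).Ok l) : (greedy j r L).Ok l := by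
  refine ok_loopT hl (by omega) ?_ _ _
  simp only [greedyBody, ok_seq, ok_set, ok_fill, ok_and, ok_or, ok_arr, ok_v, ok_add, ok_ite, ok_c]
  refine ⟨⟨by omega, ok_clique hl (by omega), ok_allF fun i _ => ?_⟩, ⟨hl, by omega, trivial,
    trivial, ok_exF fun i _ => by simp⟩, by omega, by simp⟩
  simp [hL]

theorem keepsV_greedy {j r z : ℕ} {L : ℕ → Ex} (hz : z < tv j) (h20 : z ≠ 20) (h21 : z ≠ 21)
    (h14 : z ≠ 14) : (greedy j r L).KeepsV z :=
  keepsV_loopT (by simp [greedyBody, h20, h21, h14]) _ _ hz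

theorem keepsA_greedy {j r b : ℕ} {L : ℕ → Ex} (hb : b ≠ 4) : (greedy j r L).KeepsA b := by
  simp [greedy, greedyBody, hb]

/-- A processed tuple that forms a petal is either added or meets the union of the packing, which
only grows; this gives maximality. The array `4` holds the union and the variable `14` counts the
petals. -/
theorem run_greedy {Γ : SimpleGraph ℕ} {n j r : ℕ} {L : ℕ → Ex} {K : Finset ℕ} (hjr : j < r)
    {s : Store} (hs : Holds Γ n s)
    (hL : ∀ s', Holds Γ n s' → s'.a 0 = s.a 0 → s'.v 11 = s.v 11 → ∀ i < r, s'.v (tv i) < n →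
      ((L (tv i)).T s' ↔ s'.v (tv i) ∈ K))
    (hused : ∀ v < n, s.a 4 v = 0) (hcnt : s.v 14 = 0) {τ : Fin j → ℕ}
    (hsτ : ∀ i : Fin j, s.v (tv i) = τ i) (hτn : ∀ i, τ i < n)
    (hτ : ∀ a b, a < b → Γ.Adj (τ a) (τ b)) :
    ∃ 𝒵, IsPetalPacking Γ (Finset.range n) K r τ 𝒵 ∧
      ((greedy j r L).run s).set n 4 = 𝒵.biUnion id ∧ ((greedy j r L).run s).v 14 = 𝒵.card := by
  have key := loopT_induction (hi := r) (n := n) (lo₀ := j) (p := greedyBody j r L)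
    (fun A s' => Holds Γ n s' ∧ s'.a 0 = s.a 0 ∧ s'.v 11 = s.v 11 ∧
      (∀ i : Fin j, s'.v (tv i) = τ i) ∧ ∃ 𝒵 : Finset (Finset ℕ),
        (∀ Z ∈ 𝒵, IsPetal Γ (Finset.range n) K r τ Z) ∧
        (∀ Z ∈ 𝒵, ∀ Z' ∈ 𝒵, Z ≠ Z' → Disjoint Z Z') ∧
        s'.set n 4 = 𝒵.biUnion id ∧ s'.v 14 = 𝒵.card ∧
        ∀ σ ∈ A, (∀ a b, a < b → Γ.Adj (σ a) (σ b)) → (∀ i : Fin r, j ≤ i → σ i ∈ K) →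
          ∃ i : Fin r, j ≤ i ∧ σ i ∈ s'.set n 4)
    (fun A s' h => h.1.n_eq) ?_ ?_ ?_ (r - j) j le_rfl (by omega) s ∅ ?_ (fun i _ _ => by omega)
    (by simp)
  · obtain ⟨A, -, ⟨-, -, -, -, 𝒵, h1, h2, h3, h4, h5⟩, -, h6⟩ := key
    refine ⟨𝒵, ⟨h1, h2, fun Z hZ => ?_⟩, h3, h4⟩
    obtain ⟨σ, g1, g2, g3, g4⟩ := hZ.exists_tuple hjr.le hτ
    obtain ⟨i, hi, hi'⟩ := h5 σ (h6 σ (fun i _ => Finset.mem_range.1 (g2 i)) fun i hi => by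
      rw [hsτ ⟨i, hi⟩, ← g3]; rfl) g1 fun i hi => hZ.1 (g4 i hi)
    have h3' : σ i ∈ 𝒵.biUnion id := by rw [← h3]; exact hi'
    obtain ⟨Z', hZ', hm⟩ := Finset.mem_biUnion.1 h3'
    exact ⟨Z', hZ', fun hd => Finset.disjoint_left.1 hd (g4 i hi) hm⟩
  · rintro A s' i x hi - ⟨h1, h2, h3, h4, 𝒵, h5, h6, h7, h8, h9⟩
    refine ⟨h1.setV (by unfold tv; omega) x, h2, ?_, fun i' => ?_, 𝒵, h5, h6, h7, ?_, h9⟩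
    · rw [Store.setV_v, if_neg (by unfold tv; omega), h3]
    · rw [Store.setV_v, if_neg (by unfold tv; omega), h4]
    · rw [Store.setV_v, if_neg (by unfold tv; omega), h8]
  · rintro A s' ⟨h1, h2, h3, h4, 𝒵, h5, h6, h7, h8, h9⟩ hlt -
    have hlt' : ∀ i < r, s'.v (tv i) < n := fun i hi => by
      by_cases hij : j ≤ i
      · exact hlt i hij hi
      · rw [h4 ⟨i, by omega⟩]; exact hτn _
    set σ : Fin r → ℕ := fun i => s'.v (tv i) with hσ
    have hg : (and (clique r) (allF (fun i => and (L (tv (j + i)))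
        (not (arr 4 (v (tv (j + i)))))) (r - j))).T s' ↔ (∀ a b, a < b → Γ.Adj (σ a) (σ b)) ∧
          ∀ i : Fin r, j ≤ i → σ i ∈ K ∧ σ i ∉ s'.set n 4 := by
      rw [T_and, T_clique h1 hlt', T_allF]
      refine and_congr ⟨fun h a b hab => h b b.2 a hab, fun h b hb a hab =>
        h ⟨a, by omega⟩ ⟨b, hb⟩ hab⟩ ⟨fun h i hi => ?_, fun h i hi => ?_⟩
      · have := h (i - j) (by omega)
        rw [T_and, T_not, T_arr, eval_v, show j + (i - j) = i by omega,
          hL s' h1 h2 h3 i i.2 (hlt' i i.2)] at this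
        exact ⟨this.1, fun hm => this.2 (Store.mem_set.1 hm).2⟩
      · have := h ⟨j + i, by omega⟩ (Nat.le_add_right _ _)
        rw [T_and, T_not, T_arr, eval_v, hL s' h1 h2 h3 _ (by omega) (hlt' _ (by omega))]
        exact ⟨this.1, fun hm => this.2 (Store.mem_set.2 ⟨hlt' _ (by omega), hm⟩)⟩
    set g := (and (clique r) (allF (fun i => and (L (tv (j + i)))
        (not (arr 4 (v (tv (j + i)))))) (r - j))).eval s' with hgdef
    have hg' : g ≠ 0 ↔ _ := hg
    have hset : ∀ w, w ∈ ((greedyBody j r L).run s').set n 4 ↔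
        w ∈ s'.set n 4 ∨ (g ≠ 0 ∧ ∃ i : Fin r, j ≤ i ∧ w = σ i) := by
      intro w
      by_cases hw : w < n
      swap
      · rw [Store.mem_set, Store.mem_set]
        refine ⟨fun h => absurd h.1 hw, ?_⟩
        rintro (h | ⟨-, i, -, rfl⟩)
        · exact absurd h.1 hw
        · exact absurd (hlt' i i.2) hw
      rw [Store.mem_set]
      simp only [hw, true_and, greedyBody, run_seq, run_set, Store.setV_a]
      rw [← hgdef]
      refine run_fill_iff (fun w => w ∈ s'.set n 4 ∨ (g ≠ 0 ∧ ∃ i : Fin r, j ≤ i ∧ w = σ i))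
        (fun i hi s'' hv ha hinp hge => ?_) (by simpa [h1.n_eq] using hw)
      have hi' : i < n := by simpa [h1.n_eq] using hi
      rw [T_or, T_and, T_arr, T_v, T_exF, Store.mem_set]
      simp only [eval_v, T_eq, Store.setV_v, Store.setV_a, if_true, hge i le_rfl, hi', true_and,
        show (20 : ℕ) ≠ 21 by omega, if_false, hv 20 (by omega)]
      refine or_congr_right (and_congr_right fun _ => ⟨?_, ?_⟩)
      · rintro ⟨e, he, h⟩
        rw [if_neg (by unfold tv; omega), hv _ (by unfold tv; omega), Store.setV_v,
          if_neg (by unfold tv; omega)] at h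
        exact ⟨⟨j + e, by omega⟩, Nat.le_add_right _ _, h⟩
      · rintro ⟨e, he, rfl⟩
        refine ⟨e - j, by omega, ?_⟩
        rw [if_neg (by unfold tv; omega), hv _ (by unfold tv; omega), Store.setV_v,
          if_neg (by unfold tv; omega), show j + (e - j) = e by omega]
    have hkv : ∀ z, z ≠ 20 → z ≠ 21 → z ≠ 14 → ((greedyBody j r L).run s').v z = s'.v z :=
      fun z h1 h2 h3 => KeepsV.run_v (by simp [greedyBody, h1, h2, h3]) s'
    have hcnt' : ((greedyBody j r L).run s').v 14 = s'.v 14 + if g ≠ 0 then 1 else 0 := by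
      have e1 : ∀ s₁ : Store, ((fill 4 21 0 (or (arr 4 (v 21)) (and (v 20) (exF (fun i => eq (v 21)
          (v (tv (j + i)))) (r - j))))).run s₁).v 14 = s₁.v 14 :=
        fun s₁ => KeepsV.run_v (by simp) s₁
      have e2 : ∀ s₁ : Store, ((fill 4 21 0 (or (arr 4 (v 21)) (and (v 20) (exF (fun i => eq (v 21)
          (v (tv (j + i)))) (r - j))))).run s₁).v 20 = s₁.v 20 :=
        fun s₁ => KeepsV.run_v (by simp) s₁
      simp only [greedyBody, run_seq, run_set, Store.setV_v, if_true, eval, e1, e2]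
      simp [hgdef]
    refine ⟨h1.congr (hkv 0 (by omega) (by omega) (by omega)) (run_inp _ _),
      (KeepsA.run_a (by simp [greedyBody]) s').trans h2,
      (hkv 11 (by omega) (by omega) (by omega)).trans h3,
      fun i => (hkv _ (by unfold tv; omega) (by unfold tv; omega) (by unfold tv; omega)).trans (h4 i),
      ?_⟩
    by_cases hg0 : g ≠ 0
    · have hP := hg'.1 hg0
      set Z := (Finset.univ.filter fun i : Fin r => j ≤ i).image σ with hZ
      have hZp : IsPetal Γ (Finset.range n) K r τ Z := isPetal_of_tuple hjr.le hP.1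
        (fun i => Finset.mem_range.2 (hlt' i i.2)) (fun i => h4 i) fun i hi => (hP.2 i hi).1
      have hmemZ : ∀ w, w ∈ Z ↔ ∃ i : Fin r, j ≤ i ∧ w = σ i := by
        intro w
        simp only [hZ, Finset.mem_image, Finset.mem_filter, Finset.mem_univ, true_and, eq_comm]
      have hZd : ∀ Z' ∈ 𝒵, Disjoint Z Z' := by
        intro Z' hZ'
        rw [Finset.disjoint_left]
        intro w hw hw'
        obtain ⟨i, hi, rfl⟩ := (hmemZ w).1 hw
        refine (hP.2 i hi).2 ?_
        rw [h7]
        exact Finset.mem_biUnion.2 ⟨Z', hZ', hw'⟩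
      -- As `j < r`, the petal is nonempty; being disjoint from the earlier ones it is new, so the
      -- count is right.
      have hlast : σ ⟨j, hjr⟩ ∈ Z := (hmemZ _).2 ⟨⟨j, hjr⟩, le_rfl, rfl⟩
      have hZn : Z ∉ 𝒵 := fun h => Finset.disjoint_left.1 (hZd Z h) hlast hlast
      refine ⟨insert Z 𝒵, ?_, ?_, ?_, ?_, ?_⟩
      · intro Z' hZ'
        rcases Finset.mem_insert.1 hZ' with rfl | h
        · exact hZp
        · exact h5 Z' h
      · intro Z₁ hZ₁ Z₂ hZ₂ hne
        rcases Finset.mem_insert.1 hZ₁ with e₁ | m₁ <;> rcases Finset.mem_insert.1 hZ₂ with e₂ | m₂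
        · exact absurd (e₁.trans e₂.symm) hne
        · exact e₁ ▸ hZd Z₂ m₂
        · exact e₂ ▸ (hZd Z₁ m₁).symm
        · exact h6 Z₁ m₁ Z₂ m₂ hne
      · ext w
        rw [hset, Finset.biUnion_insert, Finset.mem_union, h7, or_comm, id, hmemZ]
        exact or_congr_left (and_iff_right hg0)
      · rw [hcnt', if_pos hg0, Finset.card_insert_of_notMem hZn, h8]
      · rintro σ' (rfl | hσ') ha hK
        · exact ⟨⟨j, hjr⟩, le_rfl, (hset _).2 (Or.inr ⟨hg0, ⟨j, hjr⟩, le_rfl, rfl⟩)⟩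
        · obtain ⟨i, hi, hm⟩ := h9 σ' hσ' ha hK
          exact ⟨i, hi, (hset _).2 (Or.inl hm)⟩
    · have hset' : ((greedyBody j r L).run s').set n 4 = s'.set n 4 := by
        ext w
        rw [hset]
        exact or_iff_left fun h => hg0 h.1
      refine ⟨𝒵, h5, h6, hset'.trans h7, ?_, ?_⟩
      · rw [hcnt', if_neg hg0, h8]; rfl
      · rw [hset']
        rintro σ' (rfl | hσ') ha hK
        · by_contra hcon
          push Not at hcon
          exact hg0 (hg'.2 ⟨ha, fun i hi => ⟨hK i hi, hcon i hi⟩⟩)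
        · exact h9 σ' hσ' ha hK
  · intro i hi
    simp only [greedyBody, keepsV_seq, keepsV_set, keepsV_fill]
    refine ⟨?_, ?_, ?_⟩ <;> (unfold tv; omega)
  · refine ⟨hs, rfl, rfl, hsτ, ∅, by simp, by simp, ?_, by simp [hcnt], by simp⟩
    ext w
    rw [Store.mem_set]
    simp only [Finset.biUnion_empty, Finset.notMem_empty, iff_false, not_and, not_not]
    exact hused w

end Loop


/-! ### One round of the kernelization as a program. -/

/-- The numbers satisfying a downward closed predicate form an initial segment, so counting them
finds the first failure. The least admissible degree bound `d` is computed in this way. -/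
theorem card_filter_range_spec {n : ℕ} {P : ℕ → Prop} [DecidablePred P]
    (hP : ∀ i j, i ≤ j → P j → P i) :
    (((Finset.range n).filter P).card < n → ¬ P ((Finset.range n).filter P).card) ∧
      ∀ i < ((Finset.range n).filter P).card, P i := by
  set d := ((Finset.range n).filter P).card with hd
  constructor
  · intro hdn h
    have : Finset.range (d + 1) ⊆ (Finset.range n).filter P := by
      intro i hi
      rw [Finset.mem_range] at hi
      exact Finset.mem_filter.2 ⟨Finset.mem_range.2 (by omega), hP i d (by omega) h⟩
    have := Finset.card_le_card this
    rw [Finset.card_range] at this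
    omega
  · intro i hi
    by_contra h
    have : (Finset.range n).filter P ⊆ Finset.range i := by
      intro j hj
      rw [Finset.mem_range]
      by_contra hij
      exact h (hP i j (by omega) (Finset.mem_filter.1 hj).2)
    have := Finset.card_le_card this
    rw [Finset.card_range] at this
    omega

namespace Loop

open Ex Cmd

namespace Ex

/-- The vertex in `z` has few neighbours in the set stored in the array `0`. -/
def low (z : ℕ) : Ex := and (not (arr 0 (v z))) (le (deg z 51) (v 11))

/-- The vertex in `z` is the least one with its trace. -/
def rep (z : ℕ) : Ex := and (low z) (all 24 0 (or (not (lt (v 24) (v z))) (or (not (low 24))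
  (sum 25 0 (and (arr 0 (v 25)) (or (and (adj z 25) (not (adj 24 25)))
    (and (not (adj z 25)) (adj 24 25))))))))

/-- The bound on the size of a packing of the first `j` entries of the tuple. -/
def threshold (j : ℕ) : Ex :=
  sum 22 0 (ite (and (rep 22) (allF (fun i => adj 22 (tv i)) j)) (v 11) (c 0))

/-- The first `j` entries of the tuple form a clique in the set stored in the array `0`. -/
def core (j : ℕ) : Ex := and (allF (fun i => arr 0 (v (tv i))) j) (clique j)

variable {Γ : SimpleGraph ℕ} {n : ℕ} {s : Store} {z j l : ℕ}

theorem T_low (h : Holds Γ n s) (h50 : z ≠ 50) (h51 : z ≠ 51) (hz : s.v z < n) :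
    (low z).T s ↔ s.v z ∈ lowSet Γ (Finset.range n) (s.set n 0) (s.v 11) := by
  rw [low, T_and, T_not, T_le, eval_deg h h50 h51 (by omega) hz, lowSet, Finset.mem_filter,
    Finset.mem_sdiff, Finset.mem_range, Store.mem_set, T_arr, eval_v, eval_v]
  simp [hz]

theorem ok_low (hl : 0 < l) (hl' : l ≤ 50) : (low z).Ok l := by
  simp [low, ok_deg hl hl' (show l ≤ 51 by omega)]

theorem T_rep (h : Holds Γ n s) (h24 : z ≠ 24) (h25 : z ≠ 25) (h50 : z ≠ 50) (h51 : z ≠ 51)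
    (hz : s.v z < n) :
    (rep z).T s ↔ s.v z ∈ lowSet Γ (Finset.range n) (s.set n 0) (s.v 11) ∧
      ∀ w ∈ lowSet Γ (Finset.range n) (s.set n 0) (s.v 11), w < s.v z →
        trace Γ (s.set n 0) w ≠ trace Γ (s.set n 0) (s.v z) := by
  rw [rep, T_and, T_low h h50 h51 hz, T_all]
  refine and_congr_right fun _ => ?_
  rw [h.n_eq]
  have key : ∀ w < n, (sum 25 0 (and (arr 0 (v 25)) (or (and (adj z 25) (not (adj 24 25)))
      (and (not (adj z 25)) (adj 24 25))))).T (s.setV 24 w) ↔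
      trace Γ (s.set n 0) w ≠ trace Γ (s.set n 0) (s.v z) := by
    intro w hw
    rw [T_sum, Ne, Finset.ext_iff, not_forall]
    constructor
    · rintro ⟨u, hu, hT⟩
      have hu' : u < n := by simpa [h.n_eq] using hu
      have hH := (h.setV (show 24 ≠ 0 by omega) w).setV (show 25 ≠ 0 by omega) u
      rw [T_and, T_or, T_and, T_and, T_not, T_not, T_adj hH h50 (by simpa [h24, h25] using hz)
        (by simpa using hu'), T_adj hH (by omega) (by simpa using hw) (by simpa using hu'), T_arr] at hT
      simp [h24, h25] at hT
      refine ⟨u, ?_⟩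
      rw [mem_trace, mem_trace, Store.mem_set]
      tauto
    · rintro ⟨u, hu⟩
      rw [mem_trace, mem_trace, Store.mem_set] at hu
      have hu' : u < n := by tauto
      have hH := (h.setV (show 24 ≠ 0 by omega) w).setV (show 25 ≠ 0 by omega) u
      refine ⟨u, by simpa [h.n_eq] using hu', ?_⟩
      rw [T_and, T_or, T_and, T_and, T_not, T_not, T_adj hH h50 (by simpa [h24, h25] using hz)
        (by simpa using hu'), T_adj hH (by omega) (by simpa using hw) (by simpa using hu'), T_arr]
      simp [h24, h25]
      tauto
  refine ⟨fun hall w hw hlt => ?_, fun hall w hw => ?_⟩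
  · have hwn : w < n := by
      have := (Finset.mem_filter.1 hw).1
      simpa using (Finset.mem_sdiff.1 this).1
    have := hall w hwn
    rw [T_or, T_or, T_not, T_not, T_lt, key w hwn,
      T_low (h.setV (show 24 ≠ 0 by omega) w) (by omega) (by omega) (by simpa using hwn)] at this
    rcases this with h1 | h1 | h1
    · simp [h24, hlt] at h1
    · exact absurd (by simpa [Store.set_congr (s := s) (s' := s.setV 24 w) rfl] using hw) h1
    · exact h1
  · rw [T_or, T_or, T_not, T_not, T_lt, key w hw,
      T_low (h.setV (show 24 ≠ 0 by omega) w) (by omega) (by omega) (by simpa using hw)]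
    by_cases hlt : w < s.v z
    · by_cases hwl : w ∈ lowSet Γ (Finset.range n) (s.set n 0) (s.v 11)
      · exact Or.inr (Or.inr (hall w hwl hlt))
      · refine Or.inr (Or.inl ?_)
        simpa [Store.set_congr (s := s) (s' := s.setV 24 w) rfl] using hwl
    · left; simpa [h24] using hlt

theorem ok_rep (hl : 0 < l) (hl' : l ≤ 24) : (rep z).Ok l := by
  simp [rep, ok_low hl (show l ≤ 50 by omega), ok_adj hl (show l ≤ 50 by omega), hl, hl',
    (show l ≤ 25 by omega)]

/-- Distinct traces are counted by the least low vertices that have them. Summing the value of the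
variable `11` over these vertices performs the multiplication as well. -/
theorem eval_threshold (h : Holds Γ n s) (hj : ∀ i < j, s.v (tv i) < n) {τ : Fin j → ℕ}
    (hτ : ∀ i : Fin j, s.v (tv i) = τ i) (hτM : ∀ i, τ i ∈ s.set n 0) :
    (threshold j).eval s = s.v 11 * numTraces Γ (Finset.range n) (s.set n 0) (s.v 11) τ := by
  classical
  have hT : ∀ z < n, (and (rep 22) (allF (fun i => adj 22 (tv i)) j)).T (s.setV 22 z) ↔
      (z ∈ lowSet Γ (Finset.range n) (s.set n 0) (s.v 11) ∧
        ∀ w ∈ lowSet Γ (Finset.range n) (s.set n 0) (s.v 11), w < z →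
          trace Γ (s.set n 0) w ≠ trace Γ (s.set n 0) z) ∧
        ∀ i, τ i ∈ trace Γ (s.set n 0) z := by
    intro z hz
    have hH := h.setV (show 22 ≠ 0 by omega) z
    rw [T_and, T_rep hH (by omega) (by omega) (by omega) (by omega) (by simpa using hz), T_allF,
      Store.set_congr (s := s) (s' := s.setV 22 z) rfl]
    simp only [Store.setV_v, if_true, show (11 : ℕ) ≠ 22 by omega, if_false]
    refine and_congr_right fun _ => ⟨fun hall i => ?_, fun hall i hi => ?_⟩
    · have := hall i i.2
      rw [T_adj hH (by omega) (by simpa using hz)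
        (by rw [Store.setV_v, if_neg (by unfold tv; omega)]; exact hj i i.2)] at this
      rw [Store.setV_v, if_pos rfl, Store.setV_v, if_neg (by unfold tv; omega), hτ] at this
      exact mem_trace.2 ⟨hτM i, this⟩
    · rw [T_adj hH (by omega) (by simpa using hz)
        (by rw [Store.setV_v, if_neg (by unfold tv; omega)]; exact hj i hi)]
      rw [Store.setV_v, if_pos rfl, Store.setV_v, if_neg (by unfold tv; omega), hτ ⟨i, hi⟩]
      exact (mem_trace.1 (hall ⟨i, hi⟩)).2
  rw [threshold, eval_sum, h.n_eq, numTraces]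
  set R := (Finset.range n).filter fun z =>
      (z ∈ lowSet Γ (Finset.range n) (s.set n 0) (s.v 11) ∧
        ∀ w ∈ lowSet Γ (Finset.range n) (s.set n 0) (s.v 11), w < z →
          trace Γ (s.set n 0) w ≠ trace Γ (s.set n 0) z) ∧
        ∀ i, τ i ∈ trace Γ (s.set n 0) z with hR
  have h1 : ((lowSet Γ (Finset.range n) (s.set n 0) (s.v 11)).image
      (trace Γ (s.set n 0))).filter (fun T => ∀ i, τ i ∈ T) = R.image (trace Γ (s.set n 0)) := by
    ext T
    simp only [Finset.mem_filter, Finset.mem_image]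
    constructor
    · rintro ⟨⟨z, hz, rfl⟩, hT⟩
      have hex : ∃ w, w ∈ lowSet Γ (Finset.range n) (s.set n 0) (s.v 11) ∧
          trace Γ (s.set n 0) w = trace Γ (s.set n 0) z := ⟨z, hz, rfl⟩
      refine ⟨Nat.find hex, Finset.mem_filter.2 ⟨?_, ⟨(Nat.find_spec hex).1, fun w hw hlt he => ?_⟩, ?_⟩, (Nat.find_spec hex).2⟩
      · exact (Finset.mem_sdiff.1 (Finset.mem_filter.1 (Nat.find_spec hex).1).1).1
      · exact Nat.find_min hex hlt ⟨hw, he.trans (Nat.find_spec hex).2⟩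
      · rw [(Nat.find_spec hex).2]; exact hT
    · rintro ⟨z, hz, rfl⟩
      obtain ⟨-, ⟨h2, -⟩, h3⟩ := Finset.mem_filter.1 hz
      exact ⟨⟨z, h2, rfl⟩, h3⟩
  have h2 : Set.InjOn (trace Γ (s.set n 0)) (R : Set ℕ) := by
    intro z hz w hw he
    obtain ⟨-, ⟨z1, z2⟩, -⟩ := Finset.mem_filter.1 hz
    obtain ⟨-, ⟨w1, w2⟩, -⟩ := Finset.mem_filter.1 hw
    rcases lt_trichotomy z w with hlt | hlt | hlt
    · exact absurd he (w2 z z1 hlt)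
    · exact hlt
    · exact absurd he.symm (z2 w w1 hlt)
  have h3 : ∀ z ∈ Finset.range n,
      (ite (and (rep 22) (allF (fun i => adj 22 (tv i)) j)) (v 11) (c 0)).eval (s.setV 22 z) =
        if z ∈ R then s.v 11 else 0 := by
    intro z hz
    rw [eval_ite, hR]
    simp only [hT z (Finset.mem_range.1 hz), Finset.mem_filter, hz, true_and]
    simp
  rw [Finset.sum_congr rfl h3, Finset.sum_ite_mem, Finset.inter_eq_right.2 (Finset.filter_subset _ _),
    Finset.sum_const, smul_eq_mul, mul_comm]
  congr 1
  rw [← Finset.card_image_of_injOn h2, ← h1]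

theorem ok_threshold (hl : 0 < l) (hl' : l ≤ 22) : (threshold j).Ok l := by
  simp only [threshold, ok_sum, ok_ite, ok_and, ok_v, ok_c, and_true]
  exact ⟨hl, hl', ok_rep hl (by omega), ok_allF fun _ _ => ok_adj hl (by omega)⟩

theorem T_core (h : Holds Γ n s) (hj : ∀ i < j, s.v (tv i) < n) :
    (core j).T s ↔ (∀ i < j, s.v (tv i) ∈ s.set n 0) ∧
      ∀ b < j, ∀ a < b, Γ.Adj (s.v (tv a)) (s.v (tv b)) := by
  rw [core, T_and, T_clique h hj, T_allF]
  refine and_congr_left fun _ => forall₂_congr fun i hi => ?_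
  rw [T_arr, eval_v, Store.mem_set]
  simp [hj i hi]

theorem ok_core (hl : 0 < l) (hl' : l ≤ 50) : (core j).Ok l := by
  rw [core, ok_and]
  exact ⟨ok_allF fun i _ => by simp, ok_clique hl hl'⟩

end Ex

/-- Adds the packing of the first `j` entries of the tuple to the array `3` if it is small. -/
def coreBody (j r : ℕ) : Cmd :=
  seq (set 13 (threshold j)) <| seq (fill 4 21 0 (c 0)) <| seq (set 14 (c 0)) <|
  seq (greedy j r low) <|
  fill 3 21 0 (or (arr 3 (v 21)) (and (and (core j) (le (v 14) (v 13))) (arr 4 (v 21))))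

/-- One round of the kernelization of the set stored in the array `0`. -/
def round (r : ℕ) : Cmd :=
  seq (set 12 (count 21 0 (arr 0 (v 21)))) <|
  seq (set 11 (count 21 0 (lt (v 12) (count 22 0 (and (not (arr 0 (v 22))) (lt (v 21) (deg 22 51))))))) <|
  seq (seqF (fill 3 21 0 (not (low 21))) (fun i => (coreBody (i + 1) r).loopT 0 (i + 1)) (r - 1)) <|
  fill 0 21 0 (arr 3 (v 21))

theorem ok_coreBody {j r l : ℕ} (hl : 0 < l) (hl' : l ≤ 11) : (coreBody j r).Ok l := by
  simp only [coreBody, ok_seq, ok_set, ok_fill, ok_c, ok_or, ok_arr, ok_v, ok_and, ok_le, and_true,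
    true_and]
  exact ⟨⟨by omega, ok_threshold hl (by omega)⟩, ⟨hl, by omega⟩, by omega,
    ok_greedy hl (by omega) fun i => ok_low hl (by omega), hl, by omega, ok_core hl (by omega)⟩

theorem ok_round {r l : ℕ} (hl : 0 < l) (hl' : l ≤ 11) : (round r).Ok l := by
  simp only [round, ok_seq, ok_set, ok_count, ok_arr, ok_v, ok_lt, ok_and, ok_not, ok_fill, true_and,
    and_true]
  exact ⟨⟨by omega, hl, by omega⟩, ⟨hl', hl, by omega, hl, by omega, ok_deg hl (by omega) (by omega)⟩,
    ok_seqF (by simp [ok_low hl (show l ≤ 50 by omega), hl]; omega)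
      (fun i _ => ok_loopT hl (by omega) (ok_coreBody hl hl') _ _), hl, by omega⟩

theorem keepsV_coreBody {j r z : ℕ} (hz : z < tv j) (h13 : z ≠ 13) (h14 : z ≠ 14) (h20 : z ≠ 20)
    (h21 : z ≠ 21) : (coreBody j r).KeepsV z := by
  simp only [coreBody, keepsV_seq, keepsV_set, keepsV_fill]
  exact ⟨h13, h21, h14, keepsV_greedy hz h20 h21 h14, h21⟩

theorem keepsA_coreBody {j r b : ℕ} (h3 : b ≠ 3) (h4 : b ≠ 4) : (coreBody j r).KeepsA b := by
  simp only [coreBody, keepsA_seq, keepsA_set, keepsA_fill]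
  exact ⟨trivial, h4, trivial, keepsA_greedy h4, h3⟩

theorem keepsA_round {r b : ℕ} (h0 : b ≠ 0) (h3 : b ≠ 3) (h4 : b ≠ 4) : (round r).KeepsA b := by
  simp only [round, keepsA_seq, keepsA_set, keepsA_fill]
  exact ⟨trivial, trivial, keepsA_seqF (by simpa using h3)
    (fun i _ => by simpa using keepsA_coreBody h3 h4), h0⟩

/-- The effect of `coreBody`. -/
theorem run_coreBody {Γ : SimpleGraph ℕ} {n j r : ℕ} (hj : 0 < j) (hjr : j < r) {s : Store}
    (hs : Holds Γ n s) (τ : Fin j → ℕ) (hsτ : ∀ i : Fin j, s.v (tv i) = τ i) (hτn : ∀ i, τ i < n) :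
    ∃ 𝒵, (IsCore Γ (s.set n 0) r τ →
      IsPetalPacking Γ (Finset.range n) (lowSet Γ (Finset.range n) (s.set n 0) (s.v 11)) r τ 𝒵) ∧
      ∀ w < n, ((coreBody j r).run s).a 3 w ≠ 0 ↔ s.a 3 w ≠ 0 ∨ (IsCore Γ (s.set n 0) r τ ∧
        𝒵.card ≤ s.v 11 * numTraces Γ (Finset.range n) (s.set n 0) (s.v 11) τ ∧
        ∃ Z ∈ 𝒵, w ∈ Z) := by
  have hjn : ∀ i < j, s.v (tv i) < n := fun i hi => by rw [hsτ ⟨i, hi⟩]; exact hτn _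
  set s₁ := s.setV 13 ((threshold j).eval s) with hs₁
  set s₂ := (fill 4 21 0 (c 0)).run s₁ with hs₂
  set s₃ := s₂.setV 14 0 with hs₃
  set s₄ := (greedy j r low).run s₃ with hs₄
  have hrun : (coreBody j r).run s = (fill 3 21 0 (or (arr 3 (v 21)) (and (and (core j)
      (le (v 14) (v 13))) (arr 4 (v 21))))).run s₄ := rfl
  have hs₂v : ∀ z, z ≠ 13 → z ≠ 21 → s₂.v z = s.v z := fun z h h' => by
    rw [hs₂, KeepsV.run_v (by simpa using h'), hs₁, Store.setV_v, if_neg h]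
  have hs₃v : ∀ z, z ≠ 13 → z ≠ 14 → z ≠ 21 → s₃.v z = s.v z := fun z h h' h'' => by
    rw [hs₃, Store.setV_v, if_neg h', hs₂v z h h'']
  have hs₃a : ∀ b, b ≠ 4 → s₃.a b = s.a b := fun b h => by
    rw [hs₃, Store.setV_a, hs₂, KeepsA.run_a (by simpa using h)]; rfl
  have hinp₃ : s₃.inp = s.inp := by rw [hs₃, Store.setV_inp, hs₂, run_inp]; rfl
  have H₃ : Holds Γ n s₃ := hs.congr (hs₃v 0 (by omega) (by omega) (by omega)) hinp₃
  have hs₄v : ∀ z, z < tv j → z ≠ 13 → z ≠ 14 → z ≠ 20 → z ≠ 21 → s₄.v z = s.v z :=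
    fun z h h1 h2 h3 h4 => by
      rw [hs₄, KeepsV.run_v (keepsV_greedy h h3 h4 h2), hs₃v z h1 h2 h4]
  have hs₄a : ∀ b, b ≠ 4 → s₄.a b = s.a b := fun b h => by
    rw [hs₄, KeepsA.run_a (keepsA_greedy h), hs₃a b h]
  have H₄ : Holds Γ n s₄ := hs.congr (hs₄v 0 (by unfold tv; omega) (by omega) (by omega) (by omega)
    (by omega)) (by rw [hs₄, run_inp, hinp₃])
  have h13 : s₄.v 13 = (threshold j).eval s := by
    rw [hs₄, KeepsV.run_v (keepsV_greedy (by unfold tv; omega) (by omega) (by omega) (by omega)),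
      hs₃, Store.setV_v, if_neg (by omega), hs₂, KeepsV.run_v (by simp), hs₁]
    simp
  have htv : ∀ i < j, s₄.v (tv i) = s.v (tv i) := fun i hi =>
    hs₄v _ (by unfold tv; omega) (by unfold tv; omega) (by unfold tv; omega) (by unfold tv; omega)
      (by unfold tv; omega)
  have hcore : IsCore Γ (s.set n 0) r τ ↔ (∀ i < j, s.v (tv i) ∈ s.set n 0) ∧
      ∀ b < j, ∀ a < b, Γ.Adj (s.v (tv a)) (s.v (tv b)) := by
    constructor
    · intro h
      refine ⟨fun i hi => by rw [hsτ ⟨i, hi⟩]; exact h.mem _, fun b hb a hab => ?_⟩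
      rw [hsτ ⟨b, hb⟩, hsτ ⟨a, by omega⟩]
      exact h.adj _ _ hab
    · rintro ⟨h1, h2⟩
      exact ⟨hj, hjr, fun i => hsτ i ▸ h1 i i.2, fun i i' hi => by
        rw [← hsτ, ← hsτ]; exact h2 i' i'.2 i hi⟩
  -- the final loop
  have hfin : ∀ w < n, ((coreBody j r).run s).a 3 w ≠ 0 ↔ s.a 3 w ≠ 0 ∨
      ((IsCore Γ (s.set n 0) r τ ∧ s₄.v 14 ≤ (threshold j).eval s) ∧ w ∈ s₄.set n 4) := by
    intro w hw
    rw [hrun]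
    refine run_fill_iff (fun w => s.a 3 w ≠ 0 ∨
      ((IsCore Γ (s.set n 0) r τ ∧ s₄.v 14 ≤ (threshold j).eval s) ∧ w ∈ s₄.set n 4))
      (fun i hi s' hv ha hinp hge => ?_) (by rwa [H₄.n_eq])
    have hi' : i < n := by rwa [H₄.n_eq] at hi
    have H' : Holds Γ n (s'.setV 21 i) := H₄.congr (by simp [hv 0]) hinp
    have htv' : ∀ i' < j, (s'.setV 21 i).v (tv i') = s.v (tv i') := fun i' hi' => by
      rw [Store.setV_v, if_neg (by unfold tv; omega), hv _ (by unfold tv; omega), htv i' hi']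
    rw [T_or, T_and, T_and, T_core H' (fun i' hi' => by rw [htv' i' hi']; exact hjn i' hi'), T_le,
      T_arr, T_arr]
    simp only [eval_v, Store.setV_v, if_true, Store.setV_a, hge i le_rfl, hs₄a 3 (by omega),
      show (14 : ℕ) ≠ 21 by omega, show (13 : ℕ) ≠ 21 by omega, if_false, hv 13 (by omega),
      hv 14 (by omega), h13, ha 4 (by omega)]
    rw [hcore, Store.set_congr (s := s) (s' := s'.setV 21 i)
      (by rw [Store.setV_a, ha 0 (by omega), hs₄a 0 (by omega)]), Store.mem_set]
    simp only [hi', true_and]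
    refine or_congr_right (and_congr_left fun _ => and_congr_left fun _ => and_congr
      (forall₂_congr fun i' hi' => ?_) (forall₂_congr fun b hb => forall₂_congr fun a hab => ?_))
    · have := htv' i' hi'
      rw [Store.setV_v] at this
      rw [this]
    · have h1 := htv' b hb
      have h2 := htv' a (by omega)
      rw [Store.setV_v] at h1 h2
      rw [h1, h2]
  -- The program packs petals for every tuple, but the result is used, and need be meaningful, only
  -- for cores.
  by_cases hc : IsCore Γ (s.set n 0) r τ
  · obtain ⟨𝒵, hZ, h4, h14⟩ := run_greedy (Γ := Γ) (n := n) (L := low)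
      (K := lowSet Γ (Finset.range n) (s.set n 0) (s.v 11)) hjr H₃ (fun s' H' ha hv i _ hi => by
        rw [T_low H' (by unfold tv; omega) (by unfold tv; omega) hi, hv,
          hs₃v 11 (by omega) (by omega) (by omega), Store.set_congr (ha.trans (hs₃a 0 (by omega)))])
      (fun w hw => by
        by_contra hne
        refine (run_fill_iff (b := 4) (x := 21) (y := 0) (e := c 0) (s := s₁) (fun _ => False)
          (fun i hi s' _ _ _ _ => by simp [T_c]) (j := w) ?_).1 hne
        rw [hs₁, Store.setV_v, if_neg (by omega), hs.n_eq]; exact hw)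
      (by simp [hs₃]) (τ := τ) (fun i => by
        rw [hs₃v _ (by unfold tv; omega) (by unfold tv; omega) (by unfold tv; omega), hsτ]) hτn
      (fun a b hab => hc.adj a b hab)
    refine ⟨𝒵, fun _ => hZ, fun w hw => ?_⟩
    rw [hfin w hw, h14, h4, eval_threshold hs hjn hsτ hc.mem]
    simp only [hc, true_and, Finset.mem_biUnion, id]
  · refine ⟨∅, fun h => absurd h hc, fun w hw => ?_⟩
    rw [hfin w hw]
    simp [hc]

/-- The effect of `round`. -/
theorem run_round {Γ : SimpleGraph ℕ} {n r : ℕ} {s : Store} (hs : Holds Γ n s) :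
    ∃ d pk, IsKernelStep Γ (Finset.range n) r (s.set n 0) (((round r).run s).set n 0) d pk := by
  classical
  set M := s.set n 0 with hM
  set s₁ := s.setV 12 ((count 21 0 (arr 0 (v 21))).eval s) with hs₁
  set d := (count 21 0 (lt (v 12) (count 22 0 (and (not (arr 0 (v 22)))
    (lt (v 21) (deg 22 51)))))).eval s₁ with hd
  set s₂ := s₁.setV 11 d with hs₂
  set s₃ := (seqF (fill 3 21 0 (not (low 21))) (fun i => (coreBody (i + 1) r).loopT 0 (i + 1))
    (r - 1)).run s₂ with hs₃
  have hrun : (round r).run s = (fill 0 21 0 (arr 3 (v 21))).run s₃ := rfl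
  have h12 : s₁.v 12 = M.card := by
    rw [hs₁, Store.setV_v, if_pos rfl, eval_count, hs.n_eq, hM, Store.set]
    congr 1
    ext w
    simp [T_arr]
  have H₁ : Holds Γ n s₁ := hs.setV (by omega) _
  have H₂ : Holds Γ n s₂ := H₁.setV (by omega) _
  have hhigh : ∀ i < n, (lt (v 12) (count 22 0 (and (not (arr 0 (v 22)))
      (lt (v 21) (deg 22 51))))).T (s₁.setV 21 i) ↔
      M.card < (highSet Γ (Finset.range n) M i).card := by
    intro i hi
    have H' := H₁.setV (show 21 ≠ 0 by omega) i
    rw [T_lt, eval_count, eval_v, Store.setV_v, if_neg (by omega), h12, H'.n_eq]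
    have : ((Finset.range n).filter fun w => (and (not (arr 0 (v 22))) (lt (v 21) (deg 22 51))).T
        ((s₁.setV 21 i).setV 22 w)) = highSet Γ (Finset.range n) M i := by
      ext w
      rw [highSet, Finset.mem_filter, Finset.mem_filter, Finset.mem_sdiff, and_assoc]
      refine and_congr_right fun hw => ?_
      have hw' := Finset.mem_range.1 hw
      rw [T_and, T_not, T_lt, T_arr, eval_deg (H'.setV (show 22 ≠ 0 by omega) w) (by omega)
        (by omega) (by omega) (by simpa using hw'), hM, Store.mem_set,
        Store.set_congr (s := s) (s' := (s₁.setV 21 i).setV 22 w) rfl]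
      simp [hw', hs₁]
    rw [this]
  have hanti : ∀ i j, i ≤ j → highSet Γ (Finset.range n) M j ⊆ highSet Γ (Finset.range n) M i := by
    intro i j hij z hz
    rw [highSet, Finset.mem_filter] at *
    exact ⟨hz.1, by omega⟩
  have hdcard : d = ((Finset.range n).filter fun i =>
      M.card < (highSet Γ (Finset.range n) M i).card).card := by
    rw [hd, eval_count, H₁.n_eq]
    congr 1
    exact Finset.filter_congr fun i hi => hhigh i (Finset.mem_range.1 hi)
  have hspec := card_filter_range_spec (n := n)
    (P := fun i => M.card < (highSet Γ (Finset.range n) M i).card)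
    fun i j hij h => lt_of_lt_of_le h (Finset.card_le_card (hanti i j hij))
  rw [← hdcard] at hspec
  have hMn : M.card ≤ n := by
    simpa using Finset.card_le_card (show M ⊆ Finset.range n from Finset.filter_subset _ _)
  -- The count stops at `n`; if it reaches `n`, the high set is small anyway, because no vertex has
  -- more than `n` neighbours in `M`.
  have hempty : highSet Γ (Finset.range n) M n = ∅ := by
    rw [highSet, Finset.filter_eq_empty_iff]
    intro z _ h
    have : (trace Γ M z).card ≤ M.card := Finset.card_le_card fun w hw => (mem_trace.1 hw).1
    omega
  have hdn : d ≤ n := by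
    rw [hdcard]; simpa using Finset.card_filter_le (Finset.range n) _
  have hM₂ : s₂.set n 0 = M := Store.set_congr rfl
  have hd₂ : s₂.v 11 = d := by simp [hs₂]
  -- the families of petals
  have hmain := seqF_induction (p := fill 3 21 0 (not (low 21))) (k := r - 1) (s := s₂)
    (f := fun i => (coreBody (i + 1) r).loopT 0 (i + 1))
    (fun jc s' => Holds Γ n s' ∧ s'.a 0 = s.a 0 ∧ s'.v 11 = d ∧
      ∃ pk : ∀ j, (Fin j → ℕ) → Finset (Finset ℕ),
        (∀ j ≤ jc, ∀ τ : Fin j → ℕ, IsCore Γ M r τ →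
          IsPetalPacking Γ (Finset.range n) (lowSet Γ (Finset.range n) M d) r τ (pk j τ)) ∧
        ∀ w < n, s'.a 3 w ≠ 0 ↔ w ∉ lowSet Γ (Finset.range n) M d ∨ ∃ j ≤ jc, ∃ τ : Fin j → ℕ,
          IsCore Γ M r τ ∧ (pk j τ).card ≤ d * numTraces Γ (Finset.range n) M d τ ∧
          ∃ Z ∈ pk j τ, w ∈ Z) ?_ ?_
  · obtain ⟨H₃, ha, -, pk, hpk, hmem⟩ := hmain
    rw [← hs₃] at H₃ ha hmem
    have hM' : ∀ w, w ∈ ((round r).run s).set n 0 ↔ w < n ∧ (w ∉ lowSet Γ (Finset.range n) M d ∨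
        ∃ j ≤ r - 1, ∃ τ : Fin j → ℕ, IsCore Γ M r τ ∧
          (pk j τ).card ≤ d * numTraces Γ (Finset.range n) M d τ ∧ ∃ Z ∈ pk j τ, w ∈ Z) := by
      intro w
      rw [Store.mem_set]
      refine and_congr_right fun hw => ?_
      rw [hrun, ← hmem w hw]
      exact run_fill_iff (fun w => s₃.a 3 w ≠ 0) (fun i hi s' hv ha hinp hge => by
        rw [T_arr, eval_v, Store.setV_v, if_pos rfl, Store.setV_a, ha 3 (by omega)])
        (by rwa [H₃.n_eq])
    have hMlow : ∀ w ∈ M, w ∉ lowSet Γ (Finset.range n) M d := by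
      intro w hw h
      exact (Finset.mem_sdiff.1 (Finset.mem_filter.1 h).1).2 hw
    have hMr : ∀ w ∈ M, w < n := fun w hw => (Store.mem_set.1 hw).1
    refine ⟨d, pk, ⟨?_, ?_, ?_, ?_, ?_, ?_, ?_, ?_⟩⟩
    · exact Finset.filter_subset _ _
    · intro w hw
      exact (hM' w).2 ⟨hMr w hw, Or.inl (hMlow w hw)⟩
    · by_contra h
      rcases hdn.lt_or_eq with h' | h'
      · exact hspec.1 h' (by omega)
      · rw [h', hempty] at h; simp at h
    · exact hspec.2
    · intro w hw
      rw [highSet, Finset.mem_filter, Finset.mem_sdiff, Finset.mem_range] at hw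
      refine (hM' w).2 ⟨hw.1.1, Or.inl fun h => ?_⟩
      have := (Finset.mem_filter.1 h).2
      omega
    · exact fun j τ hτ => hpk j (by have := hτ.lt; omega) τ hτ
    · intro j τ hτ hcard Z hZ w hw
      have hp := (hpk j (by have := hτ.lt; omega) τ hτ).petal Z hZ
      have hwl := hp.1 hw
      have hwn := Finset.mem_range.1 (Finset.mem_sdiff.1 (Finset.mem_filter.1 hwl).1).1
      exact (hM' w).2 ⟨hwn, Or.inr ⟨j, by have := hτ.lt; omega, τ, hτ, hcard, Z, hZ, hw⟩⟩
    · intro w hw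
      obtain ⟨hwn, h | ⟨j, -, τ, h1, h2, h3⟩⟩ := (hM' w).1 hw
      · by_cases hwM : w ∈ M
        · exact Or.inl hwM
        · right; left
          rw [lowSet, Finset.mem_filter, Finset.mem_sdiff, Finset.mem_range] at h
          rw [highSet, Finset.mem_filter, Finset.mem_sdiff, Finset.mem_range]
          refine ⟨⟨hwn, hwM⟩, ?_⟩
          by_contra h'
          exact h ⟨⟨hwn, hwM⟩, by omega⟩
      · exact Or.inr (Or.inr ⟨j, τ, h1, h2, h3⟩)
  · refine ⟨H₂.congr (KeepsV.run_v (by simp) _) (run_inp _ _), (KeepsA.run_a (by simp) _).trans rfl,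
      (KeepsV.run_v (by simp) _).trans hd₂, fun _ _ => ∅, ?_, fun w hw => ?_⟩
    · rintro j hj τ hτ
      exact absurd hτ.pos (by omega)
    · rw [run_fill_iff (fun w => w ∉ lowSet Γ (Finset.range n) M d) (fun i hi s' hv ha hinp hge => ?_)
        (by rwa [H₂.n_eq])]
      · simp
      · have hi' : i < n := by rwa [H₂.n_eq] at hi
        rw [T_not, T_low (H₂.congr (s' := s'.setV 21 i) (by simp [hv 0]) hinp) (by omega) (by omega)
          (by simpa using hi'), Store.set_congr (s := s₂) (s' := s'.setV 21 i)
            (by rw [Store.setV_a, ha 0 (by omega)]), hM₂]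
        simp [hv 11, hd₂]
  · rintro jc hjc s' ⟨H', ha', hd', pk, hpk, hmem⟩
    have hM₃ : s'.set n 0 = M := Store.set_congr ha'
    obtain ⟨A, -, ⟨H'', ha'', hd'', q, hq, hmem'⟩, -, hall⟩ := loopT_induction (hi := jc + 1) (n := n)
      (lo₀ := 0) (p := coreBody (jc + 1) r)
      (fun A s'' => Holds Γ n s'' ∧ s''.a 0 = s.a 0 ∧ s''.v 11 = d ∧
        ∃ q : (Fin (jc + 1) → ℕ) → Finset (Finset ℕ),
          (∀ τ ∈ A, IsCore Γ M r τ →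
            IsPetalPacking Γ (Finset.range n) (lowSet Γ (Finset.range n) M d) r τ (q τ)) ∧
          ∀ w < n, s''.a 3 w ≠ 0 ↔ s'.a 3 w ≠ 0 ∨ ∃ τ ∈ A,
            IsCore Γ M r τ ∧ (q τ).card ≤ d * numTraces Γ (Finset.range n) M d τ ∧
            ∃ Z ∈ q τ, w ∈ Z)
      (fun A s'' h => h.1.n_eq)
      (by
        rintro A s'' i x - - ⟨h1, h2, h3, h4⟩
        exact ⟨h1.setV (by unfold tv; omega) x, h2,
          by rw [Store.setV_v, if_neg (by unfold tv; omega), h3], h4⟩)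
      (by
        rintro A s'' ⟨h1, h2, h3, q, h4, h5⟩ hlt hA
        obtain ⟨𝒵, hZ, hw⟩ := run_coreBody (r := r) (j := jc + 1) (by omega) (by omega) h1
          (fun i => s''.v (tv i)) (fun i => rfl) (fun i => hlt i (Nat.zero_le _) i.2)
        have hk : ∀ z, z < tv (jc + 1) → z ≠ 13 → z ≠ 14 → z ≠ 20 → z ≠ 21 →
            ((coreBody (jc + 1) r).run s'').v z = s''.v z := fun z a b c d e =>
          KeepsV.run_v (keepsV_coreBody a b c d e) _
        rw [Store.set_congr (s := s) h2, h3, ← hM] at hZ hw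
        refine ⟨h1.congr (hk 0 (by unfold tv; omega) (by omega) (by omega) (by omega) (by omega))
          (run_inp _ _), (KeepsA.run_a (keepsA_coreBody (by omega) (by omega)) _).trans h2,
          (hk 11 (by unfold tv; omega) (by omega) (by omega) (by omega) (by omega)).trans h3,
          Function.update q (fun i : Fin (jc + 1) => s''.v (tv i)) 𝒵, ?_, fun w hwn => ?_⟩
        -- The current tuple has not been processed before, so recording its packing leaves the
        -- earlier ones intact.
        · rintro τ (rfl | hτ) hc
          · rw [Function.update_self]; exact hZ hc
          · rw [Function.update_of_ne (ne_of_mem_of_not_mem hτ hA)]; exact h4 τ hτ hc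
        · rw [hw w hwn, h5 w hwn, or_assoc]
          refine or_congr_right ?_
          constructor
          · rintro (⟨τ, hτ, h⟩ | h)
            · refine ⟨τ, Or.inr hτ, ?_⟩
              rwa [Function.update_of_ne (ne_of_mem_of_not_mem hτ hA)]
            · exact ⟨_, Or.inl rfl, by rwa [Function.update_self]⟩
          · rintro ⟨τ, rfl | hτ, h⟩
            · rw [Function.update_self] at h; exact Or.inr h
            · rw [Function.update_of_ne (ne_of_mem_of_not_mem hτ hA)] at h; exact Or.inl ⟨τ, hτ, h⟩)
      (fun i hi => keepsV_coreBody (by unfold tv; omega) (by unfold tv; omega) (by unfold tv; omega)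
        (by unfold tv; omega) (by unfold tv; omega))
      (jc + 1) 0 le_rfl (by omega) s' ∅
      ⟨H', ha', hd', fun _ => ∅, by simp, by simp⟩ (fun i _ h => by omega) (by simp)
    refine ⟨H'', ha'', hd'', Function.update pk (jc + 1) q, fun j hj τ hτ => ?_, fun w hw => ?_⟩
    · rcases Nat.le_succ_iff.1 hj with h | rfl
      · rw [Function.update_of_ne (by omega)]; exact hpk j h τ hτ
      · rw [Function.update_self]
        exact hq τ (hall τ (fun i _ => (Store.mem_set.1 (hτ.mem i)).1) fun i hi => by omega) hτ
    · rw [hmem' w hw, hmem w hw, or_assoc]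
      refine or_congr_right ?_
      constructor
      · rintro (⟨j, hj, τ, h⟩ | ⟨τ, -, h⟩)
        · refine ⟨j, by omega, τ, ?_⟩
          rwa [Function.update_of_ne (by omega)]
        · exact ⟨jc + 1, le_rfl, τ, by rwa [Function.update_self]⟩
      · rintro ⟨j, hj, τ, h⟩
        rcases Nat.le_succ_iff.1 hj with hj | rfl
        · rw [Function.update_of_ne (by omega)] at h
          exact Or.inl ⟨j, hj, τ, h⟩
        · rw [Function.update_self] at h
          exact Or.inr ⟨τ, hall τ (fun i _ => (Store.mem_set.1 (h.1.mem i)).1)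
            (fun i hi => by omega), h⟩

end Loop


/-! ### The kernelization program and the parameters of the dynamic program. -/

namespace Loop

open Ex Cmd

/-- Packs disjoint `r`-cliques greedily into the array `0`; the flag `16` tells if there are at most
`k` of them. -/
def start (r : ℕ) : Cmd :=
  seq (greedy 0 r fun _ => c 1) <| seq (set 16 (le (v 14) (v 1))) <|
  fill 0 21 0 (and (v 16) (arr 4 (v 21)))

theorem ok_start {r l : ℕ} (hl : 0 < l) (hl' : l ≤ 14) : (start r).Ok l := by
  simp only [start, ok_seq, ok_set, ok_le, ok_v, ok_fill, ok_and, ok_arr, and_true]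
  exact ⟨ok_greedy hl hl' fun _ => trivial, by omega, hl, by omega⟩

/-- An `r`-clique is a petal of the empty tuple. More than `k` disjoint cliques rule out a solution;
otherwise the union of a maximal packing is a cover. In the negative case the set is emptied, so
that the size bound, and with it the running time, holds there too. -/
theorem run_start {Γ : SimpleGraph ℕ} {n r k : ℕ} (hr : 0 < r) {s : Store} (hs : Holds Γ n s)
    (hk : s.v 1 = k) (h4 : ∀ v < n, s.a 4 v = 0) (h14 : s.v 14 = 0) :
    (((start r).run s).v 16 ≠ 0 ∧ IsCover Γ (Finset.range n) r (((start r).run s).set n 0) ∧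
        (((start r).run s).set n 0).card ≤ r * k) ∨
      (((start r).run s).v 16 = 0 ∧ ((start r).run s).set n 0 = ∅ ∧
        ¬ ∃ S, IsCover Γ (Finset.range n) r S ∧ S.card ≤ k) := by
  obtain ⟨𝒵, hZ, hset, hcard⟩ := run_greedy (L := fun _ => c 1) (K := Finset.range n) hr hs
    (fun s' _ _ _ i _ hi => by simp [T_c, hi]) h4 h14 (τ := Fin.elim0) (fun i => i.elim0)
    (fun i => i.elim0) (fun i => i.elim0)
  set s₁ := (greedy 0 r fun _ => c 1).run s with hs₁
  set s₂ := s₁.setV 16 ((le (v 14) (v 1)).eval s₁) with hs₂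
  have hrun : (start r).run s = (fill 0 21 0 (and (v 16) (arr 4 (v 21)))).run s₂ := rfl
  have hv : ∀ z, z < 100 → z ≠ 14 → z ≠ 20 → z ≠ 21 → s₁.v z = s.v z := fun z h1 h2 h3 h4 =>
    KeepsV.run_v (keepsV_greedy (by unfold tv; omega) h3 h4 h2) s
  have h1 : s₁.v 1 = k := (hv 1 (by omega) (by omega) (by omega) (by omega)).trans hk
  have h0 : s₂.v 0 = n := by
    rw [hs₂, Store.setV_v, if_neg (by omega), hv 0 (by omega) (by omega) (by omega) (by omega), hs.n_eq]
  have h16 : s₂.v 16 ≠ 0 ↔ 𝒵.card ≤ k := by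
    rw [hs₂, Store.setV_v, if_pos rfl]
    change (le (v 14) (v 1)).T s₁ ↔ _
    rw [T_le, eval_v, eval_v, hcard, h1]
  have h16' : ((start r).run s).v 16 = s₂.v 16 := by
    rw [hrun]; exact KeepsV.run_v (by simp) _
  have hM : ∀ w, w ∈ ((start r).run s).set n 0 ↔ 𝒵.card ≤ k ∧ w ∈ 𝒵.biUnion id := by
    intro w
    rw [← hset, Store.mem_set, Store.mem_set, and_left_comm]
    refine and_congr_right fun hw => ?_
    rw [hrun]
    refine run_fill_iff (fun w => 𝒵.card ≤ k ∧ s₁.a 4 w ≠ 0) (fun i hi s' hv ha hinp hge => ?_)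
      (by rwa [h0])
    rw [T_and, T_v, T_arr, eval_v, Store.setV_v, if_neg (by omega), Store.setV_v, if_pos rfl,
      Store.setV_a, ha 4 (by omega), hv 16 (by omega), h16]
    rfl
  have hpet : ∀ C, IsRClique Γ (Finset.range n) r C ↔
      IsPetal Γ (Finset.range n) (Finset.range n) r (Fin.elim0 : Fin 0 → ℕ) C := by
    intro C
    have : Finset.univ.image (Fin.elim0 : Fin 0 → ℕ) ∪ C = C := by simp
    rw [IsPetal, this]
    exact ⟨fun h => ⟨h.1, by simp, h⟩, fun h => h.2.2⟩
  by_cases hc : 𝒵.card ≤ k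
  · left
    rw [h16', h16]
    refine ⟨hc, fun C hC => ?_, ?_⟩
    · obtain ⟨Z, hZ', hnd⟩ := hZ.maximal C ((hpet C).1 hC)
      rw [Finset.not_disjoint_iff] at hnd
      obtain ⟨w, hw, hw'⟩ := hnd
      exact ⟨w, Finset.mem_inter.2 ⟨hw, (hM w).2 ⟨hc, Finset.mem_biUnion.2 ⟨Z, hZ', hw'⟩⟩⟩⟩
    · calc (((start r).run s).set n 0).card ≤ (𝒵.biUnion id).card :=
            Finset.card_le_card fun w hw => ((hM w).1 hw).2
        _ ≤ 𝒵.card * r := Finset.card_biUnion_le_card_mul _ _ _ fun Z h => (hZ.petal Z h).card_le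
        _ ≤ r * k := by rw [mul_comm]; exact Nat.mul_le_mul_left r hc
  · right
    refine ⟨?_, ?_, ?_⟩
    · rw [h16']; exact not_not.1 fun h => hc (h16.1 h)
    · exact Finset.eq_empty_of_forall_notMem fun w hw => hc ((hM w).1 hw).1
    · rintro ⟨S, hS, hSk⟩
      refine hc (le_trans ?_ hSk)
      have hex : ∀ Z, ∃ x, Z ∈ 𝒵 → x ∈ Z ∧ x ∈ S := by
        intro Z
        by_cases h : Z ∈ 𝒵
        · obtain ⟨x, hx⟩ := hS Z ((hpet Z).2 (hZ.petal Z h))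
          exact ⟨x, fun _ => Finset.mem_inter.1 hx⟩
        · exact ⟨0, fun h' => absurd h' h⟩
      choose f hf using hex
      refine Finset.card_le_card_of_injOn f (fun Z h => (hf Z h).2) fun Z h Z' h' he => ?_
      by_contra hne
      exact Finset.disjoint_left.1 (hZ.disjoint Z h Z' h' hne) (hf Z h).1 (he ▸ (hf Z' h').1)

/-- The kernelization. -/
def kernel (r : ℕ) : Cmd := seqF (start r) (fun _ => round r) (r - 1)

theorem ok_kernel {r l : ℕ} (hl : 0 < l) (hl' : l ≤ 11) : (kernel r).Ok l :=
  ok_seqF (ok_start hl (by omega)) fun _ _ => ok_round hl hl'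

theorem keepsA_kernel {r b : ℕ} (h0 : b ≠ 0) (h3 : b ≠ 3) (h4 : b ≠ 4) : (kernel r).KeepsA b := by
  refine keepsA_seqF ?_ fun _ _ => keepsA_round h0 h3 h4
  simp only [start, keepsA_seq, keepsA_set, keepsA_fill]
  exact ⟨keepsA_greedy h4, trivial, h0⟩

/-- The initial cover satisfies the invariant with index `1`, and `r - 1` rounds raise it to `r`.
The function `f` bounds the size after each round, whether or not the flag `16` is set. -/
theorem run_kernel {Γ : SimpleGraph ℕ} {n r k : ℕ} (hr : 0 < r) {s : Store} (hs : Holds Γ n s)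
    (hk : s.v 1 = k) (h4 : ∀ v < n, s.a 4 v = 0) (h14 : s.v 14 = 0) (f : ℕ → ℝ)
    (hf : ((r * k : ℕ) : ℝ) ≤ f 0) (hf' : ∀ i M M' d pk, M ⊆ Finset.range n →
      IsKernelStep Γ (Finset.range n) r M M' d pk → (M.card : ℝ) ≤ f i → (M'.card : ℝ) ≤ f (i + 1)) :
    (((kernel r).run s).set n 0).card ≤ f (r - 1) ∧
      ((((kernel r).run s).v 16 ≠ 0 ∧ ((∃ S, IsCover Γ (Finset.range n) r S ∧ S.card ≤ k) ↔
          ∃ S ⊆ ((kernel r).run s).set n 0, IsCover Γ (Finset.range n) r S ∧ S.card ≤ k)) ∨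
        (((kernel r).run s).v 16 = 0 ∧ ¬ ∃ S, IsCover Γ (Finset.range n) r S ∧ S.card ≤ k)) := by
  have h0 := run_start hr hs hk h4 h14
  have := seqF_induction (p := start r) (f := fun _ => round r) (k := r - 1) (s := s)
    (fun i s' => Holds Γ n s' ∧ ((s'.set n 0).card : ℝ) ≤ f i ∧
      ((s'.v 16 ≠ 0 ∧ KernelInv Γ (Finset.range n) r (s'.set n 0) (i + 1)) ∨
      (s'.v 16 = 0 ∧ ¬ ∃ S, IsCover Γ (Finset.range n) r S ∧ S.card ≤ k))) ?_ ?_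
  · obtain ⟨-, h1, h2⟩ := this
    refine ⟨h1, h2.imp_left fun h => ⟨h.1, ?_⟩⟩
    have := h.2
    rw [Nat.sub_add_cancel hr] at this
    exact this.exists_cover_subset
  · refine ⟨hs.congr ((ok_start (l := 1) (by omega) (by omega)).keepsV (by omega) |>.run_v s)
      (run_inp _ _), ?_, ?_⟩
    · refine le_trans ?_ hf
      rcases h0 with h | h
      · exact_mod_cast h.2.2
      · rw [h.2.1]; simp; positivity
    · exact h0.imp (fun h => ⟨h.1, h.2.1.kernelInv (Finset.filter_subset _ _)⟩)
        fun h => ⟨h.1, h.2.2⟩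
  · rintro i hi s' ⟨H', hc, h⟩
    obtain ⟨d, pk, hstep⟩ := run_round (r := r) H'
    have h16 : ((round r).run s').v 16 = s'.v 16 := by
      refine KeepsV.run_v ?_ s'
      simp only [round, keepsV_seq, keepsV_set, keepsV_fill]
      exact ⟨by omega, by omega, keepsV_seqF (by simp) fun i _ => keepsV_loopT
        (keepsV_coreBody (by unfold tv; omega) (by omega) (by omega) (by omega) (by omega)) _ _
        (by unfold tv; omega), by omega⟩
    refine ⟨H'.congr ((ok_round (l := 1) (by omega) (by omega)).keepsV (by omega) |>.run_v s')
      (run_inp _ _), hf' i _ _ d pk (Finset.filter_subset _ _) hstep hc, ?_⟩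
    rw [h16]
    exact h.imp_left fun h => ⟨h.1, h.2.step (by omega) hstep⟩

/-- Lists the set stored in the array `0` in the array `5` and stores its size in the variable `2`. -/
def listing : Cmd :=
  seq (set 2 (count 21 0 (arr 0 (v 21)))) <|
  loop 21 0 (put 5 (ite (arr 0 (v 21)) (count 22 0 (and (arr 0 (v 22)) (lt (v 22) (v 21)))) (v 0))
    (v 21))

theorem ok_listing {l : ℕ} (hl : 0 < l) (hl' : l ≤ 2) : listing.Ok l := by
  simp [listing, hl, hl', (show l ≤ 21 by omega), (show l ≤ 22 by omega)]

theorem run_listing {n : ℕ} {s : Store} (hn : s.v 0 = n) :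
    (listing.run s).v 2 = (s.set n 0).card ∧
      (∀ w ∈ s.set n 0, ∃ i < (s.set n 0).card, (listing.run s).a 5 i = w) ∧
      ∀ i < (s.set n 0).card, (listing.run s).a 5 i ∈ s.set n 0 := by
  classical
  set M := s.set n 0 with hM
  set s₁ := s.setV 2 ((count 21 0 (arr 0 (v 21))).eval s) with hs₁
  -- A member of `M` is stored at its rank; vertices outside `M` are written to the position `n`,
  -- beyond the list.
  set pos : ℕ → ℕ := fun w => (M.filter (· < w)).card with hpos
  have hposlt : ∀ w ∈ M, ∀ w', w < w' → pos w < pos w' := by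
    intro w hw w' hlt
    refine Finset.card_lt_card ⟨fun x hx => ?_, fun h => ?_⟩
    · rw [Finset.mem_filter] at *; exact ⟨hx.1, by omega⟩
    · have := h (Finset.mem_filter.2 ⟨hw, hlt⟩)
      rw [Finset.mem_filter] at this; omega
  have hposM : ∀ w ∈ M, pos w < M.card := fun w hw => by
    refine Finset.card_lt_card ⟨Finset.filter_subset _ _, fun h => ?_⟩
    have := h hw
    rw [Finset.mem_filter] at this; omega
  have hMn : M.card ≤ n := by
    simpa using Finset.card_le_card (show M ⊆ Finset.range n from Finset.filter_subset _ _)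
  have h2 : s₁.v 2 = M.card := by
    rw [hs₁, Store.setV_v, if_pos rfl, eval_count, hn, hM, Store.set]
    congr 1
    ext w
    simp [T_arr]
  have h0 : s₁.v 0 = n := by simp [hs₁, hn]
  have hloop := loop_induction (x := 21) (y := 0) (s := s₁)
    (p := put 5 (ite (arr 0 (v 21)) (count 22 0 (and (arr 0 (v 22)) (lt (v 22) (v 21)))) (v 0)) (v 21))
    (fun i s' => ∀ w < i, w ∈ M → s'.a 5 (pos w) = w) (by simp)
    (fun i hi s' hv ha hinp hI w hw hwM => by
      have hi' : i < n := by rwa [h0] at hi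
      have hidx : (ite (arr 0 (v 21)) (count 22 0 (and (arr 0 (v 22)) (lt (v 22) (v 21)))) (v 0)).eval
          (s'.setV 21 i) = if i ∈ M then pos i else n := by
        rw [eval_ite]
        have ha0 : s'.a 0 = s.a 0 := ha 0 (by simp)
        have e1 : (arr 0 (v 21)).T (s'.setV 21 i) ↔ i ∈ M := by
          rw [T_arr, hM, Store.mem_set]; simp [ha0, hi']
        have e0 : (s'.setV 21 i).v 0 = n := by simp [hv 0, h0]
        refine if_congr e1 ?_ (by rw [eval_v, e0])
        rw [eval_count, e0, hpos]
        congr 1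
        ext x
        simp only [Finset.mem_filter, T_and, T_lt, T_arr, eval_v, Store.setV_a, Store.setV_v, hM,
          Store.mem_set, if_true, Finset.mem_range, ha0, show (21 : ℕ) ≠ 22 by omega, if_false,
          and_assoc]
      rw [run_put, Store.setA_a, hidx]
      simp only [true_and, eval_v, Store.setV_v, if_true, Store.setV_a]
      rcases Nat.lt_succ_iff_lt_or_eq.1 hw with hlt | rfl
      · rw [if_neg, hI w hlt hwM]
        split_ifs with hiM
        · exact (hposlt w hwM i hlt).ne
        · exact ((hposM w hwM).trans_le hMn).ne
      · rw [if_pos (by rw [if_pos hwM])])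
  have hrun : listing.run s = (loop 21 0 (put 5 (ite (arr 0 (v 21)) (count 22 0 (and (arr 0 (v 22))
      (lt (v 22) (v 21)))) (v 0)) (v 21))).run s₁ := rfl
  rw [← hrun, h0] at hloop
  have hMlt : ∀ w ∈ M, w < n := fun w hw => (Store.mem_set.1 hw).1
  refine ⟨?_, fun w hw => ⟨pos w, hposM w hw, hloop w (hMlt w hw) hw⟩, fun i hi => ?_⟩
  · rw [hrun, KeepsV.run_v (by simp), h2]
  · have himg : M.image pos = Finset.range M.card := by
      refine Finset.eq_of_subset_of_card_le (fun x hx => ?_) ?_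
      · obtain ⟨w, hw, rfl⟩ := Finset.mem_image.1 hx
        exact Finset.mem_range.2 (hposM w hw)
      · rw [Finset.card_range, Finset.card_image_of_injOn]
        intro w hw w' hw' he
        rcases lt_trichotomy w w' with h | h | h
        · exact absurd he (hposlt w hw w' h).ne
        · exact h
        · exact absurd he (hposlt w' hw' w h).ne'
    have : i ∈ M.image pos := by rw [himg]; exact Finset.mem_range.2 hi
    obtain ⟨w, hw, rfl⟩ := Finset.mem_image.1 this
    rw [hloop w (hMlt w hw) hw]; exact hw

/-- Stores in the variable `3` the least `t ≤ m` with `C * m ^ b ≤ t ^ a`, or `m`. -/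
def depthBound (C a b : ℕ) : Cmd :=
  seq (seqF (set 31 (c C)) (fun _ => set 31 (sum 50 2 (v 31))) b) <| seq (set 3 (c 0)) <|
  loop 21 2 <| seq (seqF (set 33 (c 1)) (fun _ => set 33 (sum 50 2 (ite (lt (v 50) (v 3)) (v 33) (c 0)))) a)
    (set 3 (add (v 3) (ite (lt (v 33) (v 31)) (c 1) (c 0))))

theorem ok_depthBound {C a b : ℕ} : (depthBound C a b).Ok 3 := by
  simp only [depthBound, ok_seq, ok_set, ok_c, ok_loop, ok_add, ok_v, ok_ite, ok_lt, and_true]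
  refine ⟨ok_seqF (by simp) fun _ _ => by simp, le_rfl, by omega, by omega,
    ok_seqF (by simp) fun _ _ => by simp, le_rfl⟩

theorem depth_depthBound_le {C a b : ℕ} : (depthBound C a b).depth ≤ 2 := by
  have h1 : (seqF (set 31 (c C)) (fun _ => set 31 (sum 50 2 (v 31))) b).depth ≤ 2 :=
    depth_seqF_le (by simp [Cmd.depth, Ex.depth]) fun _ _ => by simp [Cmd.depth, Ex.depth]
  have h2 : (seqF (set 33 (c 1)) (fun _ => set 33 (sum 50 2 (ite (lt (v 50) (v 3)) (v 33) (c 0))))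
      a).depth ≤ 1 :=
    depth_seqF_le (by simp [Cmd.depth, Ex.depth]) fun _ _ => by simp [Cmd.depth, Ex.depth, lt]
  have h3 : (lt (v 33) (v 31)).depth = 0 := rfl
  simp only [depthBound, Cmd.depth, Ex.depth, h3]
  omega

theorem keepsA_depthBound {C a b b' : ℕ} : (depthBound C a b).KeepsA b' := by
  simp only [depthBound, keepsA_seq, keepsA_set, keepsA_loop]
  exact ⟨keepsA_seqF trivial fun _ _ => trivial, trivial, keepsA_seqF trivial fun _ _ => trivial,
    trivial⟩

theorem keepsV_depthBound {C a b z : ℕ} (h3 : z ≠ 3) (h21 : z ≠ 21) (h31 : z ≠ 31) (h33 : z ≠ 33) :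
    (depthBound C a b).KeepsV z := by
  simp only [depthBound, keepsV_seq, keepsV_set, keepsV_loop]
  exact ⟨keepsV_seqF h31 fun _ _ => h31, h3, h21, keepsV_seqF h33 fun _ _ => h33, h3⟩

/-- The depth is tested by comparing integer powers, which replaces the real power `m ^ α`. The
fallback `m` is harmless, since depth `|M|` always suffices, and minimality bounds the number of
strings. -/
theorem run_depthBound {C a b m : ℕ} {s : Store} (hm : s.v 2 = m) :
    ((depthBound C a b).run s).v 3 ≤ m ∧
      (C * m ^ b ≤ ((depthBound C a b).run s).v 3 ^ a ∨ ((depthBound C a b).run s).v 3 = m) ∧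
      ∀ t < ((depthBound C a b).run s).v 3, t ^ a < C * m ^ b := by
  set s₁ := (seqF (set 31 (c C)) (fun _ => set 31 (sum 50 2 (v 31))) b).run s with hs₁
  have h₁ : s₁.v 2 = m ∧ s₁.v 31 = C * m ^ b := by
    refine seqF_induction (fun i s' => s'.v 2 = m ∧ s'.v 31 = C * m ^ i) (by simp [hm]) ?_
    rintro i - s' ⟨h1, h2⟩
    simp only [run_set, Store.setV_v, eval_sum, eval_v, h1]
    simp [h2]; ring
  -- Multiplication by the current `t` is a sum over the numbers below `m` restricted to those below
  -- `t`: the variable `3` is still changing and is no permitted range of a sum.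
  have hpow : ∀ s' : Store, s'.v 2 = m → s'.v 3 ≤ m →
      ((seqF (set 33 (c 1)) (fun _ => set 33 (sum 50 2 (ite (lt (v 50) (v 3)) (v 33) (c 0)))) a).run
        s').v 33 = s'.v 3 ^ a := by
    intro s' h2 h3
    refine (seqF_induction (fun i s'' => s''.v 2 = m ∧ s''.v 3 = s'.v 3 ∧ s''.v 33 = s'.v 3 ^ i)
      (by simp [h2]) ?_).2.2
    rintro i - s'' ⟨g1, g2, g3⟩
    refine ⟨by simp [g1], by simp [g2], ?_⟩
    classical
    simp only [run_set, Store.setV_v, if_true, eval_sum, eval_ite, T_lt, eval_v, eval_c, g1, g2, g3,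
      show (3 : ℕ) ≠ 50 by omega, show (33 : ℕ) ≠ 50 by omega, if_false]
    rw [← Finset.sum_filter, Finset.sum_const, smul_eq_mul, pow_succ, mul_comm]
    congr 1
    rw [show (Finset.range m).filter (· < s'.v 3) = Finset.range (s'.v 3) by
      ext x; simp only [Finset.mem_filter, Finset.mem_range]; omega, Finset.card_range]
  have := loop_induction (x := 21) (y := 2) (s := s₁.setV 3 0)
    (p := seq (seqF (set 33 (c 1)) (fun _ => set 33 (sum 50 2 (ite (lt (v 50) (v 3)) (v 33) (c 0)))) a)
      (set 3 (add (v 3) (ite (lt (v 33) (v 31)) (c 1) (c 0)))))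
    (fun i s' => s'.v 3 ≤ i ∧ (C * m ^ b ≤ s'.v 3 ^ a ∨ s'.v 3 = i) ∧
      ∀ t < s'.v 3, t ^ a < C * m ^ b) (by simp) ?_
  · have e : (s₁.setV 3 0).v 2 = m := by simp [h₁.1]
    rw [e] at this
    exact this
  · rintro i hi s' hv - - ⟨g1, g2, g3⟩
    have hi' : i < m := by simpa [h₁.1] using hi
    have hk : ∀ z, z ≠ 33 → z ≠ 3 → z ≠ 21 → s'.v z = s₁.v z := fun z h1 h2 h3 => by
      rw [hv z h3 ⟨keepsV_seqF h1 fun _ _ => h1, h2⟩, Store.setV_v, if_neg h2]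
    have e2 : (s'.setV 21 i).v 2 = m := by simp [hk 2, h₁.1]
    have e3 : (s'.setV 21 i).v 3 = s'.v 3 := by simp
    have e31 : (s'.setV 21 i).v 31 = C * m ^ b := by simp [hk 31, h₁.2]
    rw [run_seq, run_set]
    set s₂ := (seqF (set 33 (c 1)) (fun _ => set 33 (sum 50 2 (ite (lt (v 50) (v 3)) (v 33) (c 0))))
      a).run (s'.setV 21 i) with hs₂
    have f3 : s₂.v 3 = s'.v 3 := by
      rw [hs₂, KeepsV.run_v (keepsV_seqF (by simp) fun _ _ => by simp), e3]
    have f31 : s₂.v 31 = C * m ^ b := by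
      rw [hs₂, KeepsV.run_v (keepsV_seqF (by simp) fun _ _ => by simp), e31]
    have f33 : s₂.v 33 = s'.v 3 ^ a := by
      rw [hs₂, hpow _ e2 (by rw [e3]; omega), e3]
    have hval : (s₂.setV 3 ((add (v 3) (ite (lt (v 33) (v 31)) (c 1) (c 0))).eval s₂)).v 3 =
        s'.v 3 + if s'.v 3 ^ a < C * m ^ b then 1 else 0 := by
      classical
      simp only [Store.setV_v, if_true, eval_add, eval_ite, T_lt, eval_v, eval_c, f3, f31, f33]
    rw [hval]
    split_ifs with hlt
    · refine ⟨by omega, ?_, fun t ht => ?_⟩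
      · rcases g2 with h | h
        · omega
        · right; omega
      · rcases Nat.lt_succ_iff_lt_or_eq.1 ht with h | rfl
        · exact g3 t h
        · exact hlt
    · exact ⟨by omega, Or.inl (not_lt.1 hlt), g3⟩

/-- Stores the number of codes of strings of at most `t` letters in the variable `4`. -/
def numCodes : Cmd :=
  seq (set 4 (c 1)) <| loop 21 3 <| set 4 (add (sum 50 2 (add (v 4) (v 4))) (c 1))

theorem ok_numCodes : numCodes.Ok 4 := by simp [numCodes]

theorem run_numCodes {m t : ℕ} {s : Store} (hm : s.v 2 = m) (ht : s.v 3 = t) :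
    (numCodes.run s).v 4 = lastCode (2 * m) t 0 + 1 := by
  have := loop_induction (x := 21) (y := 3) (s := s.setV 4 1)
    (p := set 4 (add (sum 50 2 (add (v 4) (v 4))) (c 1)))
    (fun i s' => s'.v 4 = lastCode (2 * m) i 0 + 1) (by simp [lastCode]) ?_
  · have e : (s.setV 4 1).v 3 = t := by simp [ht]
    rw [e] at this
    exact this
  · intro i hi s' hv _ _ hI
    have e2 : s'.v 2 = m := by rw [hv 2 (by omega) (by simp)]; simp [hm]
    rw [lastCode_succ]
    simp [e2, hI]
    ring

end Loop


/-! ### Decoding, the status table, and components as programs. -/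

theorem Nat.mul_add_inj_of_lt {n c c' v v' : ℕ} (hv : v < n) (hv' : v' < n)
    (h : n * c + v = n * c' + v') : c = c' ∧ v = v' := by
  have hn : 0 < n := by omega
  have e1 := congrArg (· / n) h
  have e2 := congrArg (· % n) h
  simp only [Nat.mul_add_div hn, Nat.div_eq_of_lt hv, Nat.div_eq_of_lt hv', Nat.mul_add_mod,
    Nat.mod_eq_of_lt hv, Nat.mod_eq_of_lt hv'] at e1 e2
  exact ⟨by omega, e2⟩

namespace Loop

open Ex Cmd

/-- Decodes the last letter of the code in the variable `60`. -/
def decode : Cmd :=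
  seq (set 61 (sub (v 60) (c 1))) <|
  seq (set 62 (count 66 4 (le (sum 50 2 (add (add (v 66) (c 1)) (add (v 66) (c 1)))) (v 61)))) <|
  seq (set 63 (sub (v 61) (sum 50 2 (add (v 62) (v 62))))) <|
  seq (set 64 (ite (lt (v 63) (v 2)) (arr 5 (v 63)) (arr 5 (sub (v 63) (v 2))))) <|
  set 65 (ite (lt (v 63) (v 2)) (c 1) (c 2))

theorem ok_decode : decode.Ok 5 := by simp [decode]

/-- The quotient by `2 * m` is the number of positive multiples of `2 * m` up to `e`; candidates
below `N` suffice because `e < N`. -/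
theorem run_decode {s : Store} {m N e : ℕ} (hm : s.v 2 = m) (hN : s.v 4 = N) (h60 : s.v 60 = e + 1)
    (hm0 : 0 < m) (he : e < N) :
    (decode.run s).v 62 = e / (2 * m) ∧
      (decode.run s).v 64 = letterVertex (s.a 5) m (e % (2 * m)) ∧
      (decode.run s).v 65 = letterStatus m (e % (2 * m)) := by
  classical
  set s₁ := s.setV 61 e with hs₁
  have e₁ : (set 61 (sub (v 60) (c 1))).run s = s₁ := by simp [h60, hs₁]
  have h62 : (count 66 4 (le (sum 50 2 (add (add (v 66) (c 1)) (add (v 66) (c 1)))) (v 61))).eval s₁ =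
      e / (2 * m) := by
    rw [eval_count]
    have : ((Finset.range (s₁.v 4)).filter fun i =>
        (le (sum 50 2 (add (add (v 66) (c 1)) (add (v 66) (c 1)))) (v 61)).T (s₁.setV 66 i)) =
        Finset.range (e / (2 * m)) := by
      ext z
      simp only [Finset.mem_filter, Finset.mem_range, T_le, eval_sum, eval_add, eval_v, eval_c,
        Store.setV_v, if_true, Finset.sum_const, Finset.card_range, smul_eq_mul, hs₁,
        show (2 : ℕ) ≠ 66 by omega, show (2 : ℕ) ≠ 61 by omega, show (61 : ℕ) ≠ 66 by omega,
        show (66 : ℕ) ≠ 50 by omega, show (4 : ℕ) ≠ 61 by omega, if_false, hm, hN]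
      have h0 : z < e / (2 * m) ↔ z.succ * (2 * m) ≤ e := by
        rw [← Nat.succ_le_iff, Nat.le_div_iff_mul_le (by omega)]
      rw [h0]
      have h1 : m * (z + 1 + (z + 1)) = z.succ * (2 * m) := by rw [Nat.succ_eq_add_one]; ring
      rw [h1]
      refine ⟨fun h => h.2, fun h => ⟨?_, h⟩⟩
      have : z.succ * 1 ≤ z.succ * (2 * m) := Nat.mul_le_mul_left _ (by omega)
      omega
    rw [this, Finset.card_range]
  set s₂ := s₁.setV 62 (e / (2 * m)) with hs₂
  have h63 : (sub (v 61) (sum 50 2 (add (v 62) (v 62)))).eval s₂ = e % (2 * m) := by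
    have h1 := Nat.mod_add_div e (2 * m)
    have h2 : m * (e / (2 * m) + e / (2 * m)) = 2 * m * (e / (2 * m)) := by ring
    simp [hs₂, hs₁, hm, h2]
    omega
  set s₃ := s₂.setV 63 (e % (2 * m)) with hs₃
  have e₂ : (set 62 (count 66 4 (le (sum 50 2 (add (add (v 66) (c 1)) (add (v 66) (c 1))))
      (v 61)))).run s₁ = s₂ := by rw [run_set, h62]
  have e₃ : (set 63 (sub (v 61) (sum 50 2 (add (v 62) (v 62))))).run s₂ = s₃ := by rw [run_set, h63]
  simp only [decode, run_seq, e₁, e₂, e₃]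
  refine ⟨by simp [hs₃, hs₂], ?_, ?_⟩
  · simp [letterVertex, eval_ite, hs₃, hs₂, hs₁, hm]
  · simp [letterStatus, eval_ite, hs₃, hs₂, hs₁, hm]

theorem keepsV_decode {z : ℕ} (hz : z < 61 ∨ 65 < z) : decode.KeepsV z := by
  simp only [decode, keepsV_seq, keepsV_set]; omega

theorem keepsA_decode {b : ℕ} : decode.KeepsA b := by simp [decode]

/-- The status of the vertex in `x` after the decisions coded by the variable `y`. -/
def Ex.status (y x : ℕ) : Ex := arr 6 (add (sum 50 0 (v y)) (v x))

theorem Ex.eval_status {s : Store} {y x n : ℕ} (hn : s.v 0 = n) (hy : y ≠ 50) :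
    (status y x).eval s = s.a 6 (n * s.v y + s.v x) := by
  simp [status, hn, hy]

theorem Ex.ok_status {y x l : ℕ} (hl : 0 < l) (hl' : l ≤ 50) : (status y x).Ok l := by
  simp [status, hl, hl']

/-- Tabulates the status of all vertices for all codes. -/
def statusTable : Cmd :=
  loop 60 4 <| seq decode <| loop 67 0 <| put 6 (add (sum 50 0 (v 60)) (v 67))
    (ite (v 60) (ite (status 62 67) (status 62 67) (ite (eq (v 67) (v 64)) (v 65) (c 0))) (c 0))

theorem ok_statusTable : statusTable.Ok 5 := by
  simp [statusTable, ok_decode, ok_status]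

theorem keepsV_statusTable {z : ℕ} (hz : z < 60) : statusTable.KeepsV z := by
  simp only [statusTable, keepsV_loop, keepsV_seq, keepsV_put]
  exact ⟨by omega, keepsV_decode (by omega), by omega, trivial⟩

theorem keepsA_statusTable {b : ℕ} (hb : b ≠ 6) : statusTable.KeepsA b := by
  simp [statusTable, keepsA_decode, hb]

/-- Parents have smaller codes, so their rows are complete when needed. If `m = 0`, there are no
letters and only the empty string has to be treated. -/
theorem run_statusTable {s : Store} {n m N : ℕ} (hn : s.v 0 = n) (hm : s.v 2 = m) (hN : s.v 4 = N)
    (hmN : 0 < m ∨ N ≤ 1) : ∀ code < N, ∀ w < n,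
      (statusTable.run s).a 6 (n * code + w) = statusOf (s.a 5) m code w := by
  classical
  have := loop_induction (x := 60) (y := 4) (s := s) (p := seq decode <| loop 67 0 <|
    put 6 (add (sum 50 0 (v 60)) (v 67)) (ite (v 60) (ite (status 62 67) (status 62 67)
      (ite (eq (v 67) (v 64)) (v 65) (c 0))) (c 0)))
    (fun i s' => ∀ code < i, ∀ w < n, s'.a 6 (n * code + w) = statusOf (s.a 5) m code w) (by simp) ?_
  · rw [hN] at this; exact this
  intro i hi s' hv ha hinp hI
  rw [hN] at hi
  have hv' : ∀ z < 60, s'.v z = s.v z := fun z hz => hv z (by omega)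
    ⟨keepsV_decode (by omega), by omega, trivial⟩
  have ha5 : s'.a 5 = s.a 5 := ha 5 (by simp [keepsA_decode])
  rw [run_seq]
  set s₁ := s'.setV 60 i with hs₁
  set s₂ := decode.run s₁ with hs₂
  have hv₂ : ∀ z < 60, s₂.v z = s.v z := fun z hz => by
    rw [hs₂, (keepsV_decode (by omega)).run_v, hs₁, Store.setV_v, if_neg (by omega), hv' z hz]
  have h60 : s₂.v 60 = i := by
    rw [hs₂, (keepsV_decode (by omega)).run_v, hs₁, Store.setV_v, if_pos rfl]
  have ha₂ : s₂.a 6 = s'.a 6 := by rw [hs₂, keepsA_decode.run_a]; rfl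
  have hdec : ∀ e, i = e + 1 → s₂.v 62 = e / (2 * m) ∧
      s₂.v 64 = letterVertex (s.a 5) m (e % (2 * m)) ∧ s₂.v 65 = letterStatus m (e % (2 * m)) := by
    rintro e rfl
    have := run_decode (s := s₁) (m := m) (N := N) (e := e) (by simp [hs₁, hv', hm])
      (by simp [hs₁, hv', hN]) (by simp [hs₁]) (by omega) (by omega)
    rwa [hs₁, Store.setV_a, ha5, ← hs₁, ← hs₂] at this
  have hn₂ : s₂.v 0 = n := (hv₂ 0 (by omega)).trans hn
  have inner := loop_induction (x := 67) (y := 0) (s := s₂) (p :=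
    put 6 (add (sum 50 0 (v 60)) (v 67)) (ite (v 60) (ite (status 62 67) (status 62 67)
      (ite (eq (v 67) (v 64)) (v 65) (c 0))) (c 0)))
    (fun j s'' => (∀ code < i, ∀ w < n, s''.a 6 (n * code + w) = statusOf (s.a 5) m code w) ∧
      ∀ w < j, s''.a 6 (n * i + w) = statusOf (s.a 5) m i w)
    ⟨by rw [ha₂]; exact hI, by simp⟩ ?_
  · rw [hn₂] at inner
    intro code hcode w hw
    rcases Nat.lt_succ_iff_lt_or_eq.1 hcode with h | rfl
    · exact inner.1 code h w hw
    · exact inner.2 w hw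
  rintro j hj s'' hv'' ha'' - ⟨h1, h2⟩
  rw [hn₂] at hj
  have hv3 : ∀ z, z ≠ 67 → (s''.setV 67 j).v z = s₂.v z := fun z hz => by
    rw [Store.setV_v, if_neg hz, hv'' z hz trivial]
  have hidx : (add (sum 50 0 (v 60)) (v 67)).eval (s''.setV 67 j) = n * i + j := by
    simp [hv'', hn₂, h60]
  have hval : (ite (v 60) (ite (status 62 67) (status 62 67) (ite (eq (v 67) (v 64)) (v 65) (c 0)))
      (c 0)).eval (s''.setV 67 j) = statusOf (s.a 5) m i j := by
    have est := eval_status (y := 62) (x := 67) ((hv3 0 (by omega)).trans hn₂) (by omega)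
    have eT : (status 62 67).T (s''.setV 67 j) ↔ s''.a 6 (n * s₂.v 62 + j) ≠ 0 := by
      rw [T, est, hv3 62 (by omega)]; simp
    simp only [eval_ite, T_v, T_eq, eT, est, eval_v, eval_c, hv3 60 (by omega), hv3 62 (by omega),
      hv3 64 (by omega), hv3 65 (by omega), h60, Store.setV_a]
    rw [Store.setV_v, if_pos rfl]
    rcases i with _ | e
    · simp [statusOf]
    · obtain ⟨d1, d2, d3⟩ := hdec e rfl
      rw [d1, d2, d3, h1 _ (Nat.lt_succ_of_le (Nat.div_le_self _ _)) j hj, if_pos (by omega), statusOf]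
  rw [run_put, hidx, hval]
  refine ⟨fun code hcode w hw => ?_, fun w hw => ?_⟩
  · rw [Store.setA_a, if_neg, Store.setV_a, h1 code hcode w hw]
    rintro ⟨-, h⟩
    have := (Nat.mul_add_inj_of_lt hw hj h).1
    omega
  · rw [Store.setA_a]
    rcases Nat.lt_succ_iff_lt_or_eq.1 hw with h | rfl
    · rw [if_neg (by omega), Store.setV_a, h2 w h]
    · rw [if_pos ⟨rfl, rfl⟩]

/-- The vertex in `x` is undecided. -/
def Ex.open' (x : ℕ) : Ex := and (arr 0 (v x)) (not (status 60 x))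

/-- Stores the vertices reachable from the one in `x` through undecided vertices in the array `7`. -/
def closure (x : ℕ) : Cmd :=
  seq (fill 7 67 0 (eq (v 67) (v x))) <| loop 68 0 <|
  fill 7 67 0 (or (arr 7 (v 67)) (and (open' 67) (sum 69 0 (and (arr 7 (v 69)) (adj 69 67)))))

theorem ok_closure {x : ℕ} : (closure x).Ok 5 := by
  simp [closure, open', ok_status, ok_adj]

theorem keepsV_closure {x z : ℕ} (h67 : z ≠ 67) (h68 : z ≠ 68) : (closure x).KeepsV z := by
  simp [closure, h67, h68]

theorem keepsA_closure {x b : ℕ} (hb : b ≠ 7) : (closure x).KeepsA b := by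
  simp [closure, hb]

/-- A round that starts with a set not yet closed adds at least one vertex, so `n` rounds suffice.
Vertices added within a round are used at once; this is harmless, since only reachable vertices are
ever added. -/
theorem run_closure {Γ : SimpleGraph ℕ} {n x w : ℕ} {s : Store} (hs : Holds Γ n s) (h67 : x ≠ 67)
    (hw : s.v x = w) (hwn : w < n) {U : Finset ℕ}
    (hU : ∀ y, y ∈ U ↔ y < n ∧ s.a 0 y ≠ 0 ∧ s.a 6 (n * s.v 60 + y) = 0) :
    ((closure x).run s).set n 7 = reach Γ U w := by
  set s₁ := (fill 7 67 0 (eq (v 67) (v x))).run s with hs₁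
  have hv₁ : ∀ z, z ≠ 67 → s₁.v z = s.v z := fun z hz => KeepsV.run_v (by simpa using hz) s
  have ha₁ : ∀ b, b ≠ 7 → s₁.a b = s.a b := fun b hb => KeepsA.run_a (by simpa using hb) s
  have hreachn : ∀ y ∈ reach Γ U w, y < n := by
    intro y hy
    rcases Relation.ReflTransGen.cases_tail (mem_reach.1 hy) with h | ⟨z, _, h⟩
    · exact h ▸ hwn
    · exact ((hU y).1 h.2).1
  have hstart : s₁.set n 7 = {w} := by
    ext y
    rw [Store.mem_set, Finset.mem_singleton]
    constructor
    · rintro ⟨hy, h⟩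
      refine (run_fill_iff (fun y => y = w) (fun i hi s' hv _ _ _ => ?_) (by rwa [hs.n_eq])).1 h
      simp [T_eq, hv x h67, h67, hw]
    · rintro rfl
      refine ⟨hwn, (run_fill_iff (fun y' => y' = y) (fun i hi s' hv _ _ _ => ?_)
        (by rwa [hs.n_eq])).2 rfl⟩
      simp [T_eq, hv x h67, h67, hw]
  have := loop_induction (x := 68) (y := 0) (s := s₁) (p :=
    fill 7 67 0 (or (arr 7 (v 67)) (and (open' 67) (sum 69 0 (and (arr 7 (v 69)) (adj 69 67))))))
    (fun i s' => w ∈ s'.set n 7 ∧ s'.set n 7 ⊆ reach Γ U w ∧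
      ((∀ a ∈ s'.set n 7, ∀ b ∈ U, Γ.Adj a b → b ∈ s'.set n 7) ∨ i + 1 ≤ (s'.set n 7).card)) ?_ ?_
  · rw [hv₁ 0 (by omega), hs.n_eq] at this
    change w ∈ ((closure x).run s).set n 7 ∧ ((closure x).run s).set n 7 ⊆ _ ∧ _ at this
    obtain ⟨h1, h2, h3⟩ := this
    refine Finset.Subset.antisymm h2 fun y hy => ?_
    rcases h3 with h3 | h3
    · rw [mem_reach] at hy
      induction hy with
      | refl => exact h1
      | tail _ hab ih => exact h3 _ ih _ hab.2 hab.1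
    · have := Finset.card_le_card (show ((closure x).run s).set n 7 ⊆ Finset.range n from
        Finset.filter_subset _ _)
      rw [Finset.card_range] at this
      change n + 1 ≤ (((closure x).run s).set n 7).card at h3
      omega
  · rw [hstart]
    exact ⟨by simp, by simpa using self_mem_reach, Or.inr (by simp)⟩
  · rintro i hi s' hv ha hinp ⟨h1, h2, h3⟩
    have hv' : ∀ z, z ≠ 67 → z ≠ 68 → s'.v z = s.v z := fun z h h' => by
      rw [hv z h' (by simpa using h), hv₁ z h]
    have ha' : ∀ b, b ≠ 7 → s'.a b = s.a b := fun b hb => by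
      rw [ha b (by simpa using hb), ha₁ b hb]
    have hinp' : s'.inp = s.inp := by rw [hinp, hs₁, run_inp]
    set s₂ := s'.setV 68 i with hs₂
    have H₂ : Holds Γ n s₂ := hs.congr (by simp [hs₂, hv' 0]) (by simp [hs₂, hinp'])
    set B := s'.set n 7 with hB
    -- the new set contains what one full round would add and stays inside the reachable set
    have hround := loop_induction (x := 67) (y := 0) (s := s₂) (p := put 7 (v 67)
      (or (arr 7 (v 67)) (and (open' 67) (sum 69 0 (and (arr 7 (v 69)) (adj 69 67))))))
      (fun j s'' => B ⊆ s''.set n 7 ∧ s''.set n 7 ⊆ reach Γ U w ∧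
        ∀ b < j, b ∈ U → (∃ a ∈ B, Γ.Adj a b) → b ∈ s''.set n 7)
      ⟨subset_rfl, h2, by simp⟩ ?_
    · rw [H₂.n_eq] at hround
      obtain ⟨g1, g2, g3⟩ := hround
      change B ⊆ ((fill 7 67 0 _).run s₂).set n 7 at g1
      refine ⟨g1 h1, g2, ?_⟩
      by_cases hcl : ∀ a ∈ B, ∀ b ∈ U, Γ.Adj a b → b ∈ B
      · left
        have hall : ∀ y ∈ reach Γ U w, y ∈ B := by
          intro y hy
          rw [mem_reach] at hy
          induction hy with
          | refl => exact h1
          | tail _ hab ih => exact hcl _ ih _ hab.2 hab.1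
        intro a ha b hb hab
        exact g1 (hcl a (hall a (g2 ha)) b hb hab)
      · right
        rcases h3 with h3 | h3
        · exact absurd h3 hcl
        push Not at hcl
        obtain ⟨a, haB, b, hbU, hab, hbB⟩ := hcl
        have hbn := ((hU b).1 hbU).1
        have : B.card < (((fill 7 67 0 (or (arr 7 (v 67)) (and (open' 67) (sum 69 0
            (and (arr 7 (v 69)) (adj 69 67)))))).run s₂).set n 7).card :=
          Finset.card_lt_card ⟨g1, fun h => hbB (h (g3 b hbn hbU ⟨a, haB, hab⟩))⟩
        omega
    · rintro j hj s'' hv'' ha'' hinp'' ⟨g1, g2, g3⟩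
      have hjn : j < n := by rwa [H₂.n_eq] at hj
      have H'' : Holds Γ n (s''.setV 67 j) := H₂.congr (by simp [hv'' 0]) hinp''
      have hT : (or (arr 7 (v 67)) (and (open' 67) (sum 69 0 (and (arr 7 (v 69))
          (adj 69 67))))).T (s''.setV 67 j) ↔
          j ∈ s''.set n 7 ∨ (j ∈ U ∧ ∃ a ∈ s''.set n 7, Γ.Adj a j) := by
        have e0 : s''.a 0 = s.a 0 := by rw [ha'' 0 (by simp)]; simp [hs₂, ha' 0]
        have e6 : s''.a 6 = s.a 6 := by rw [ha'' 6 (by simp)]; simp [hs₂, ha' 6]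
        have e60 : (s''.setV 67 j).v 60 = s.v 60 := by
          rw [Store.setV_v, if_neg (by omega), hv'' 60 (by omega) trivial]; simp [hs₂, hv' 60]
        rw [T_or, T_and, open', T_and, T_not, T_arr, T_arr, T, eval_status H''.n_eq (by omega), e60,
          T_sum, H''.n_eq, hU, Store.mem_set]
        simp only [eval_v, Store.setV_v, if_true, Store.setV_a, e0, e6, hjn, true_and, not_not]
        refine or_congr_right (and_congr_right fun _ => ⟨?_, ?_⟩)
        · rintro ⟨a, ha, h⟩
          rw [T_and, T_adj (H''.setV (by omega) a) (by omega) (by simpa using ha)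
            (by simpa using hjn), T_arr] at h
          simp at h
          exact ⟨a, Store.mem_set.2 ⟨ha, h.1⟩, h.2⟩
        · rintro ⟨a, ha, h⟩
          rw [Store.mem_set] at ha
          refine ⟨a, ha.1, ?_⟩
          rw [T_and, T_adj (H''.setV (by omega) a) (by omega) (by simpa using ha.1)
            (by simpa using hjn), T_arr]
          simpa using ⟨ha.2, h⟩
      have hset : ∀ y, y ∈ ((put 7 (v 67) (or (arr 7 (v 67)) (and (open' 67) (sum 69 0
          (and (arr 7 (v 69)) (adj 69 67)))))).run (s''.setV 67 j)).set n 7 ↔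
          y ∈ s''.set n 7 ∨ (y = j ∧ j ∈ U ∧ ∃ a ∈ s''.set n 7, Γ.Adj a j) := by
        intro y
        rw [Store.mem_set, run_put, Store.setA_a]
        simp only [true_and, eval_v, Store.setV_v, if_true, Store.setV_a]
        by_cases hy : y = j
        · subst hy
          rw [if_pos rfl]
          change y < n ∧ T _ _ ↔ _
          rw [hT]
          simp [hjn]
        · rw [if_neg hy, Store.mem_set]; simp [hy]
      refine ⟨fun y hy => (hset y).2 (Or.inl (g1 hy)), fun y hy => ?_, fun b hb hbU hab => ?_⟩
      · rcases (hset y).1 hy with h | ⟨rfl, hyU, a, ha, haj⟩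
        · exact g2 h
        · exact mem_reach_of_adj (g2 ha) haj hyU
      · rcases Nat.lt_succ_iff_lt_or_eq.1 hb with h | rfl
        · exact (hset b).2 (Or.inl (g3 b h hbU hab))
        · obtain ⟨a, ha, haj⟩ := hab
          exact (hset b).2 (Or.inr ⟨rfl, hbU, a, g1 ha, haj⟩)

end Loop


/-! ### The dynamic program as a program. -/

/-- Only entries of children are consulted, and these have larger codes. -/
theorem IsBest.congr {mv F F' : ℕ → ℕ} {m c x : ℕ} {K : Finset ℕ} (h : IsBest mv m F c K x)
    (hF : ∀ e, c < e → F' e = F e) : IsBest mv m F' c K x := by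
  have key : ∀ i < m, F' (c * (2 * m) + i + 1) = F (c * (2 * m) + i + 1) ∧
      F' (c * (2 * m) + (m + i) + 1) = F (c * (2 * m) + (m + i) + 1) := by
    intro i hi
    have : c * 1 ≤ c * (2 * m) := Nat.mul_le_mul_left _ (by omega)
    exact ⟨hF _ (by omega), hF _ (by omega)⟩
  refine ⟨fun hx => ?_, fun i hi hK => ?_⟩
  · obtain ⟨i, hi, hK, h'⟩ := h.1 hx
    exact ⟨i, hi, hK, by rwa [(key i hi).1, (key i hi).2]⟩
  · rw [(key i hi).1, (key i hi).2]
    exact h.2 i hi hK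

/-- The entry of the table `F` for the code `c` is computed correctly from the later ones. -/
def IsRow (Γ : SimpleGraph ℕ) (vs : Finset ℕ) (r : ℕ) (M : Finset ℕ) (mv : ℕ → ℕ) (m : ℕ)
    (F : ℕ → ℕ) (c x : ℕ) : Prop :=
  ∃ best : ℕ → ℕ,
    (∀ w ∈ compReps Γ M mv m c, IsBest mv m F c (reach Γ (undecided M mv m c) w) (best w)) ∧
    (Conflict Γ vs r M mv m c ∨ (∃ w ∈ compReps Γ M mv m c, best w = 0) → x = 0) ∧
    (¬ Conflict Γ vs r M mv m c → (∀ w ∈ compReps Γ M mv m c, best w ≠ 0) →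
      x = 1 + ∑ w ∈ compReps Γ M mv m c, (best w - 1))

theorem IsRow.congr {Γ : SimpleGraph ℕ} {vs M : Finset ℕ} {mv F F' : ℕ → ℕ} {r m c x : ℕ}
    (h : IsRow Γ vs r M mv m F c x) (hF : ∀ e, c < e → F' e = F e) :
    IsRow Γ vs r M mv m F' c x := by
  obtain ⟨best, h1, h2⟩ := h
  exact ⟨best, fun w hw => (h1 w hw).congr hF, h2⟩

namespace Loop

open Ex Cmd

/-- Some `r`-clique meets the array `0` only in vertices left out. -/
def Ex.conflict (r : ℕ) : Ex :=
  exT (and (clique r) (allF (fun i => or (not (arr 0 (v (tv i)))) (eq (status 60 (tv i)) (c 2))) r)) 0 r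

theorem Ex.ok_conflict {r l : ℕ} (hl : 0 < l) (hl' : l ≤ 50) : (conflict r).Ok l := by
  refine ok_exT hl (by omega) ?_ _ _
  rw [ok_and]
  exact ⟨ok_clique hl hl', ok_allF fun i _ => by simp [ok_status hl hl']⟩

theorem Ex.T_conflict {Γ : SimpleGraph ℕ} {n r m code : ℕ} {M : Finset ℕ} {mv : ℕ → ℕ} {s : Store}
    (hs : Holds Γ n s) (hM : s.set n 0 = M) (h60 : s.v 60 = code)
    (h6 : ∀ w < n, s.a 6 (n * code + w) = statusOf mv m code w) :
    (conflict r).T s ↔ Conflict Γ (Finset.range n) r M mv m code := by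
  have key : ∀ τ : ℕ → ℕ, (∀ i < r, τ i < n) → ((and (clique r) (allF (fun i =>
      or (not (arr 0 (v (tv i)))) (eq (status 60 (tv i)) (c 2))) r)).T (Store.setT τ 0 r s) ↔
      (∀ b < r, ∀ a < b, Γ.Adj (τ a) (τ b)) ∧
        ∀ i < r, τ i ∈ M → statusOf mv m code (τ i) = 2) := by
    intro τ hτ
    have hs' : Holds Γ n (Store.setT τ 0 r s) := hs.setT τ 0 r
    have hv : ∀ i < r, (Store.setT τ 0 r s).v (tv i) = τ i := fun i hi =>
      Store.setT_v τ r 0 s (by omega) (by omega)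
    rw [T_and, T_clique hs' fun i hi => by rw [hv i hi]; exact hτ i hi, T_allF]
    refine and_congr (forall₂_congr fun b hb => forall₂_congr fun a ha => ?_)
      (forall₂_congr fun i hi => ?_)
    · rw [hv a (by omega), hv b hb]
    · rw [T_or, T_not, T_arr, T_eq, eval_status hs'.n_eq (by omega), eval_v, hv i hi,
        Store.setT_v_of_lt _ _ _ _ (by unfold tv; omega), h60, Store.setT_a, h6 _ (hτ i hi), eval_c,
        ← imp_iff_not_or, ← hM, Store.mem_set]
      simp [hτ i hi]
  rw [conflict, T_exT, hs.n_eq]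
  constructor
  · rintro ⟨τ, h1, h2⟩
    have h1' : ∀ i < r, τ i < n := fun i hi => h1 i (by omega) (by omega)
    obtain ⟨g1, g2⟩ := (key τ h1').1 h2
    have hp := isPetal_of_tuple (Γ := Γ) (vs := Finset.range n) (L := Finset.range n) (r := r)
      (τ := (Fin.elim0 : Fin 0 → ℕ)) (Nat.zero_le r) (σ := fun i : Fin r => τ i)
      (fun a b hab => g1 b b.2 a hab) (fun i => Finset.mem_range.2 (h1' i i.2)) (fun i => i.elim0)
      (fun i _ => Finset.mem_range.2 (h1' i i.2))
    refine ⟨_, hp.2.2, fun x hx => ?_⟩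
    simp only [Finset.mem_union, Finset.mem_image, Finset.mem_filter, Finset.mem_univ, true_and] at hx
    rcases hx with ⟨i, -⟩ | ⟨i, -, rfl⟩
    · exact i.elim0
    · exact g2 i i.2
  · rintro ⟨C, hC, hst⟩
    have hp : IsPetal Γ (Finset.range n) C r (Fin.elim0 : Fin 0 → ℕ) C := by
      have : Finset.univ.image (Fin.elim0 : Fin 0 → ℕ) ∪ C = C := by simp
      exact ⟨subset_rfl, by simp, by rwa [this]⟩
    obtain ⟨σ, g1, g2, -, g4⟩ := hp.exists_tuple (Nat.zero_le r) (fun a => a.elim0)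
    have e : ∀ i (hi : i < r), (fun i => if h : i < r then σ ⟨i, h⟩ else 0) i = σ ⟨i, hi⟩ :=
      fun i hi => dif_pos hi
    have hlt : ∀ i < r, (fun i => if h : i < r then σ ⟨i, h⟩ else 0) i < n := fun i hi => by
      rw [e i hi]; exact Finset.mem_range.1 (g2 _)
    refine ⟨fun i => if h : i < r then σ ⟨i, h⟩ else 0, fun i _ hi => hlt i (by omega),
      (key _ hlt).2 ⟨fun b hb a ha => ?_, fun i hi => ?_⟩⟩
    · have := g1 ⟨a, by omega⟩ ⟨b, hb⟩ ha
      rwa [← e a (by omega), ← e b hb] at this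
    · have := hst _ (g4 ⟨i, hi⟩ (Nat.zero_le _))
      rwa [← e i hi] at this

/-- The smaller one of two values, where zero stands for infinity. -/
def Ex.minE (p q : Ex) : Ex := ite p (ite q (ite (lt p q) p q) p) q

theorem Ex.eval_minE {p q : Ex} {s : Store} : (minE p q).eval s =
    if p.eval s = 0 then q.eval s else if q.eval s = 0 then p.eval s else
      min (p.eval s) (q.eval s) := by
  classical
  simp only [minE, eval_ite, T_lt]
  simp only [T]
  by_cases hp : p.eval s = 0
  · simp [hp]
  by_cases hq : q.eval s = 0
  · simp [hp, hq]
  simp only [hp, hq, ne_eq, not_false_eq_true, if_true, if_false]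
  split_ifs <;> omega

/-- One update of the running minimum `x` to `y`, with zero as infinity: `p` is the entry for
putting the vertex in, which costs one more, `q` the entry for leaving it out, and `P` says that the
vertex belongs to the component. -/
theorem min_step {x y z a p q : ℕ} {P : Prop} (ha : p ≠ 0 → a = p + 1) (ha' : p = 0 → a = 0)
    (hz : P → z = if a = 0 then q else if q = 0 then a else min a q) (hz' : ¬ P → z = 0)
    (hy : y = if x = 0 then z else if z = 0 then x else min x z) :
    (x ≠ 0 → y ≠ 0 ∧ y ≤ x) ∧ (P → (p ≠ 0 → y ≠ 0 ∧ y ≤ p + 1) ∧ (q ≠ 0 → y ≠ 0 ∧ y ≤ q)) ∧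
      (y = 0 ∨ y = x ∨ (P ∧ ((p ≠ 0 ∧ y = p + 1) ∨ (q ≠ 0 ∧ y = q)))) := by
  by_cases hP : P
  · have hz := hz hP
    simp only [hP, true_and, forall_const]
    by_cases hp : p = 0
    · simp only [ha' hp, if_true] at hz
      subst hz
      split_ifs at hy <;> omega
    · have h1 := ha hp
      rw [if_neg (by omega)] at hz
      clear ha ha' hz'
      refine ⟨fun h => ?_, ⟨fun h => ?_, fun h => ?_⟩, ?_⟩ <;> split_ifs at hz hy <;> omega
  · have hz := hz' hP
    subst hz
    simp only [hP, false_and, or_false, false_implies, true_and, if_true] at hy ⊢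
    split_ifs at hy <;> omega

/-- The values of the two decisions for the vertex number `73` of the list. -/
def Ex.putIn : Ex := arr 8 (add (add (sum 50 2 (add (v 60) (v 60))) (v 73)) (c 1))
def Ex.leaveOut : Ex := arr 8 (add (add (sum 50 2 (add (v 60) (v 60))) (add (v 2) (v 73))) (c 1))

/-- Computes the cheapest decision for a vertex in the array `7`. -/
def bestOf : Cmd :=
  seq (set 72 (c 0)) <| loop 73 2 <| set 72 (minE (v 72)
    (ite (arr 7 (arr 5 (v 73))) (minE (ite putIn (add putIn (c 1)) (c 0)) leaveOut) (c 0)))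

theorem ok_bestOf : bestOf.Ok 5 := by simp [bestOf, minE, putIn, leaveOut]

theorem keepsV_bestOf {z : ℕ} (h72 : z ≠ 72) (h73 : z ≠ 73) : bestOf.KeepsV z := by
  simp [bestOf, h72, h73]

theorem keepsA_bestOf {b : ℕ} : bestOf.KeepsA b := by simp [bestOf]

theorem run_bestOf {s : Store} {m : ℕ} {K : Finset ℕ} (hm : s.v 2 = m)
    (hK : ∀ i < m, s.a 7 (s.a 5 i) ≠ 0 ↔ s.a 5 i ∈ K) :
    IsBest (s.a 5) m (s.a 8) (s.v 60) K ((bestOf.run s).v 72) := by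
  classical
  have := loop_induction (x := 73) (y := 2) (s := s.setV 72 0) (p := set 72 (minE (v 72)
    (ite (arr 7 (arr 5 (v 73))) (minE (ite putIn (add putIn (c 1)) (c 0)) leaveOut) (c 0))))
    (fun j s' => (s'.v 72 ≠ 0 → ∃ i < j, s.a 5 i ∈ K ∧
      ((s.a 8 (s.v 60 * (2 * m) + i + 1) ≠ 0 ∧ s'.v 72 = s.a 8 (s.v 60 * (2 * m) + i + 1) + 1) ∨
      (s.a 8 (s.v 60 * (2 * m) + (m + i) + 1) ≠ 0 ∧
        s'.v 72 = s.a 8 (s.v 60 * (2 * m) + (m + i) + 1)))) ∧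
      ∀ i < j, s.a 5 i ∈ K →
      (s.a 8 (s.v 60 * (2 * m) + i + 1) ≠ 0 →
        s'.v 72 ≠ 0 ∧ s'.v 72 ≤ s.a 8 (s.v 60 * (2 * m) + i + 1) + 1) ∧
      (s.a 8 (s.v 60 * (2 * m) + (m + i) + 1) ≠ 0 →
        s'.v 72 ≠ 0 ∧ s'.v 72 ≤ s.a 8 (s.v 60 * (2 * m) + (m + i) + 1))) (by simp) ?_
  · have e : (s.setV 72 0).v 2 = m := by simp [hm]
    rw [e] at this
    exact this
  · rintro j hj s' hv ha - ⟨h1, h2⟩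
    have hjm : j < m := by simpa [hm] using hj
    have ha' : s'.a = s.a := funext fun b => ha b trivial
    have hv' : ∀ z, z ≠ 72 → z ≠ 73 → s'.v z = s.v z := fun z h h' => by
      rw [hv z h' h, Store.setV_v, if_neg h]
    have e1 : putIn.eval (s'.setV 73 j) = s.a 8 (s.v 60 * (2 * m) + j + 1) := by
      simp only [putIn, eval_arr, eval_add, eval_sum, eval_v, eval_c, Store.setV_v, Store.setV_a, ha',
        show (60 : ℕ) ≠ 50 by omega, show (60 : ℕ) ≠ 73 by omega, show (2 : ℕ) ≠ 73 by omega,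
        if_false, if_true, hv' 60 (by omega) (by omega), hv' 2 (by omega) (by omega), hm,
        Finset.sum_const, Finset.card_range, smul_eq_mul]
      congr 3; ring
    have e2 : leaveOut.eval (s'.setV 73 j) = s.a 8 (s.v 60 * (2 * m) + (m + j) + 1) := by
      simp only [leaveOut, eval_arr, eval_add, eval_sum, eval_v, eval_c, Store.setV_v, Store.setV_a, ha',
        show (60 : ℕ) ≠ 50 by omega, show (60 : ℕ) ≠ 73 by omega, show (2 : ℕ) ≠ 73 by omega,
        if_false, if_true, hv' 60 (by omega) (by omega), hv' 2 (by omega) (by omega), hm,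
        Finset.sum_const, Finset.card_range, smul_eq_mul]
      congr 3; ring
    have e3 : (arr 7 (arr 5 (v 73))).T (s'.setV 73 j) ↔ s.a 5 j ∈ K := by
      rw [T_arr, ← hK j hjm]; simp [ha']
    have e5 : putIn.T (s'.setV 73 j) ↔ s.a 8 (s.v 60 * (2 * m) + j + 1) ≠ 0 := by rw [T, e1]
    have e4 : (v 72).eval (s'.setV 73 j) = s'.v 72 := by simp
    set x := s'.v 72
    set pj := s.a 8 (s.v 60 * (2 * m) + j + 1) with hpj
    set qj := s.a 8 (s.v 60 * (2 * m) + (m + j) + 1) with hqj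
    have hnew : ∃ y, ((set 72 (minE (v 72) (ite (arr 7 (arr 5 (v 73)))
        (minE (ite putIn (add putIn (c 1)) (c 0)) leaveOut) (c 0)))).run (s'.setV 73 j)).v 72 = y ∧
        (x ≠ 0 → y ≠ 0 ∧ y ≤ x) ∧ (s.a 5 j ∈ K → (pj ≠ 0 → y ≠ 0 ∧ y ≤ pj + 1) ∧
          (qj ≠ 0 → y ≠ 0 ∧ y ≤ qj)) ∧ (y = 0 ∨ y = x ∨ (s.a 5 j ∈ K ∧
          ((pj ≠ 0 ∧ y = pj + 1) ∨ (qj ≠ 0 ∧ y = qj)))) := by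
      refine ⟨_, rfl, ?_⟩
      rw [run_set, Store.setV_v, if_pos rfl, eval_minE, eval_ite, eval_minE, eval_ite]
      simp only [e3, e5, e4, e2, eval_add, e1, eval_c]
      refine min_step (a := if pj ≠ 0 then pj + 1 else 0) (fun h => ?_) (fun h => ?_) (fun h => ?_) (fun h => ?_) rfl
      exacts [if_pos h, if_neg (not_not.2 h), if_pos h, if_neg h]
    obtain ⟨y, hy, y1, y2, y3⟩ := hnew
    rw [hy]
    refine ⟨fun hy0 => ?_, fun i hi hiK => ?_⟩
    · rcases y3 with h | h | h
      · exact absurd h hy0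
      · obtain ⟨i, hi, h'⟩ := h1 (h ▸ hy0)
        exact ⟨i, by omega, by rwa [h]⟩
      · exact ⟨j, by omega, h⟩
    · rcases Nat.lt_succ_iff_lt_or_eq.1 hi with h | rfl
      · obtain ⟨g1, g2⟩ := h2 i h hiK
        exact ⟨fun h => ⟨(y1 (g1 h).1).1, (y1 (g1 h).1).2.trans (g1 h).2⟩,
          fun h => ⟨(y1 (g2 h).1).1, (y1 (g2 h).1).2.trans (g2 h).2⟩⟩
      · exact y2 hiK

/-- Adds the value of the component represented by the variable `71`, if it represents one. -/
def component : Cmd :=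
  seq (closure 71) <| seq bestOf <|
  set 70 (ite (and (arr 9 (v 71)) (all 74 0 (or (not (arr 7 (v 74))) (le (v 71) (v 74)))))
    (ite (and (v 70) (v 72)) (sub (add (v 70) (v 72)) (c 1)) (c 0)) (v 70))

theorem ok_component : component.Ok 5 := by simp [component, ok_closure, ok_bestOf]

theorem keepsV_component {z : ℕ} (hz : z < 67) : component.KeepsV z := by
  simp only [component, keepsV_seq, keepsV_set]
  exact ⟨keepsV_closure (by omega) (by omega), keepsV_bestOf (by omega) (by omega), by omega⟩

theorem keepsA_component {b : ℕ} (hb : b ≠ 7) : component.KeepsA b := by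
  simp [component, keepsA_closure hb, keepsA_bestOf]

/-- Computes the entry of the table for the code in the variable `60`. -/
def row (r : ℕ) : Cmd :=
  seq decode <| seq (closure 64) <|
  seq (fill 9 67 0 (ite (v 60) (and (arr 7 (v 67)) (not (eq (v 67) (v 64)))) (arr 0 (v 67)))) <|
  seq (set 70 (c 1)) <| seq (loop 71 0 component) <|
  seq (set 70 (ite (conflict r) (c 0) (v 70))) <| put 8 (v 60) (v 70)

theorem ok_row {r : ℕ} : (row r).Ok 5 := by
  simp [row, ok_decode, ok_closure, ok_component, ok_conflict]

theorem keepsV_row {r z : ℕ} (hz : z < 61) : (row r).KeepsV z := by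
  simp only [row, keepsV_seq, keepsV_set, keepsV_fill, keepsV_loop, keepsV_put, and_true]
  exact ⟨keepsV_decode (by omega), keepsV_closure (by omega) (by omega), by omega, by omega,
    ⟨by omega, keepsV_component (by omega)⟩, by omega⟩

theorem keepsA_row {r b : ℕ} (h7 : b ≠ 7) (h8 : b ≠ 8) (h9 : b ≠ 9) : (row r).KeepsA b := by
  simp [row, keepsA_decode, keepsA_closure h7, keepsA_component h7, h8, h9]

/-- The store holds the set `M`, its list, and the status table. -/
structure Ready (Γ : SimpleGraph ℕ) (n m N : ℕ) (M : Finset ℕ) (mv : ℕ → ℕ) (s : Store) : Prop where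
  holds : Holds Γ n s
  m_eq : s.v 2 = m
  N_eq : s.v 4 = N
  set_eq : s.set n 0 = M
  mv_eq : s.a 5 = mv
  mv_mem : ∀ i < m, mv i ∈ M
  pos : 0 < m ∨ N ≤ 1
  status : ∀ code < N, ∀ w < n, s.a 6 (n * code + w) = statusOf mv m code w

theorem Ready.congr {Γ : SimpleGraph ℕ} {n m N : ℕ} {M : Finset ℕ} {mv : ℕ → ℕ} {s s' : Store}
    (h : Ready Γ n m N M mv s) (hv : ∀ z < 5, s'.v z = s.v z) (hi : s'.inp = s.inp)
    (ha : ∀ b < 7, s'.a b = s.a b) : Ready Γ n m N M mv s' where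
  holds := h.holds.congr (hv 0 (by omega)) hi
  m_eq := (hv 2 (by omega)).trans h.m_eq
  N_eq := (hv 4 (by omega)).trans h.N_eq
  set_eq := (Store.set_congr (ha 0 (by omega))).trans h.set_eq
  mv_eq := (ha 5 (by omega)).trans h.mv_eq
  mv_mem := h.mv_mem
  pos := h.pos
  status := by rw [ha 6 (by omega)]; exact h.status

theorem Ready.mem_undecided {Γ : SimpleGraph ℕ} {n m N code : ℕ} {M : Finset ℕ} {mv : ℕ → ℕ}
    {s : Store} (h : Ready Γ n m N M mv s) (hc : code < N) (y : ℕ) :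
    y ∈ undecided M mv m code ↔ y < n ∧ s.a 0 y ≠ 0 ∧ s.a 6 (n * code + y) = 0 := by
  rw [undecided, Finset.mem_filter, ← h.set_eq, Store.mem_set, and_assoc]
  refine and_congr_right fun hy => and_congr_right fun _ => ?_
  rw [h.status code hc y hy]

/-- The accumulator `70` and the best value are both shifted by one to make room for infinity, so
one has to be subtracted from their sum. Vertices that are not the least ones of pending components
leave it unchanged. -/
theorem run_component {Γ : SimpleGraph ℕ} {n m N code w : ℕ} {M : Finset ℕ} {mv : ℕ → ℕ}
    {s : Store} (h : Ready Γ n m N M mv s) (hc : code < N) (h60 : s.v 60 = code) (h71 : s.v 71 = w)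
    (hw : w < n) (h9 : s.set n 9 = pending Γ M mv m code) :
    ∃ best, IsBest mv m (s.a 8) code (reach Γ (undecided M mv m code) w) best ∧
      (component.run s).v 70 = if w ∈ compReps Γ M mv m code then
        if s.v 70 ≠ 0 ∧ best ≠ 0 then s.v 70 + best - 1 else 0 else s.v 70 := by
  classical
  set s₁ := (closure 71).run s with hs₁
  have hset : s₁.set n 7 = reach Γ (undecided M mv m code) w :=
    run_closure h.holds (by omega) h71 hw (by rw [h60]; exact h.mem_undecided hc)
  have hv₁ : ∀ z, z ≠ 67 → z ≠ 68 → s₁.v z = s.v z := fun z h h' => (keepsV_closure h h').run_v s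
  have ha₁ : ∀ b, b ≠ 7 → s₁.a b = s.a b := fun b h => (keepsA_closure h).run_a s
  have h5 : s₁.a 5 = mv := (ha₁ 5 (by omega)).trans h.mv_eq
  have hMn : ∀ x ∈ M, x < n := fun x hx => by
    rw [← h.set_eq, Store.mem_set] at hx; exact hx.1
  have hb := run_bestOf (s := s₁) (m := m) (K := reach Γ (undecided M mv m code) w)
    (by rw [hv₁ 2 (by omega) (by omega), h.m_eq]) (fun i hi => by
      rw [← hset, Store.mem_set, h5]
      simp [hMn _ (h.mv_mem i hi)])
  rw [h5, ha₁ 8 (by omega), hv₁ 60 (by omega) (by omega), h60] at hb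
  refine ⟨_, hb, ?_⟩
  set s₂ := bestOf.run s₁ with hs₂
  have hv₂ : ∀ z, z ≠ 67 → z ≠ 68 → z ≠ 72 → z ≠ 73 → s₂.v z = s.v z := fun z g1 g2 g3 g4 => by
    rw [hs₂, (keepsV_bestOf g3 g4).run_v, hv₁ z g1 g2]
  have ha₂ : s₂.a = s₁.a := funext fun b => keepsA_bestOf.run_a s₁
  have h0 : s₂.v 0 = n :=
    (hv₂ 0 (by omega) (by omega) (by omega) (by omega)).trans h.holds.n_eq
  have h71' : s₂.v 71 = w := (hv₂ 71 (by omega) (by omega) (by omega) (by omega)).trans h71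
  have h70 : s₂.v 70 = s.v 70 := hv₂ 70 (by omega) (by omega) (by omega) (by omega)
  have hrep : (and (arr 9 (v 71)) (all 74 0 (or (not (arr 7 (v 74))) (le (v 71) (v 74))))).T s₂ ↔
      w ∈ compReps Γ M mv m code := by
    rw [compReps, Finset.mem_filter, ← h9, ← hset, Store.mem_set]
    simp only [T_and, T_all, T_or, T_not, T_le, T_arr, eval_v, Store.setV_v, if_true, Store.setV_a, ha₂,
      show (71 : ℕ) ≠ 74 by omega, if_false, h71', ha₁ 9 (by omega), hw, true_and, h0, Store.mem_set]
    refine and_congr_right fun _ => ⟨fun g a ha => ?_, fun g a ha => ?_⟩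
    · exact (g a ha.1).resolve_left fun h' => h' ha.2
    · by_cases h' : s₁.a 7 a = 0
      · exact Or.inl fun h'' => h'' h'
      · exact Or.inr (g a ⟨ha, h'⟩)
  change (set 70 (ite (and (arr 9 (v 71)) (all 74 0 (or (not (arr 7 (v 74))) (le (v 71) (v 74)))))
    (ite (and (v 70) (v 72)) (sub (add (v 70) (v 72)) (c 1)) (c 0)) (v 70)) |>.run s₂).v 70 = _
  rw [run_set, Store.setV_v, if_pos rfl, eval_ite, eval_ite]
  simp only [hrep, T_and, T_v, eval_sub, eval_add, eval_v, eval_c, h70]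

/-- The row condition refers to the table before the write, which is enough because only later
entries are consulted. -/
theorem run_row {Γ : SimpleGraph ℕ} {n m N code r : ℕ} {M : Finset ℕ} {mv : ℕ → ℕ}
    {s : Store} (h : Ready Γ n m N M mv s) (hc : code < N) (h60 : s.v 60 = code) :
    ∃ x, IsRow Γ (Finset.range n) r M mv m (s.a 8) code x ∧
      ∀ e, ((row r).run s).a 8 e = if e = code then x else s.a 8 e := by
  classical
  have hMn : ∀ x ∈ M, x < n := fun x hx => by
    rw [← h.set_eq, Store.mem_set] at hx; exact hx.1
  set s₁ := decode.run s with hs₁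
  set s₂ := (closure 64).run s₁ with hs₂
  set s₃ := (fill 9 67 0 (ite (v 60) (and (arr 7 (v 67)) (not (eq (v 67) (v 64))))
    (arr 0 (v 67)))).run s₂ with hs₃
  set s₄ := s₃.setV 70 1 with hs₄
  set s₅ := (loop 71 0 component).run s₄ with hs₅
  have hv₁ : ∀ z < 61, s₁.v z = s.v z := fun z hz => (keepsV_decode (by omega)).run_v s
  have ha₁ : ∀ b, s₁.a b = s.a b := fun b => keepsA_decode.run_a s
  have H₁ : Ready Γ n m N M mv s₁ := h.congr (fun z hz => hv₁ z (by omega)) (run_inp _ _)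
    fun b _ => ha₁ b
  have hv₂ : ∀ z < 67, s₂.v z = s₁.v z := fun z hz =>
    (keepsV_closure (by omega) (by omega)).run_v s₁
  have ha₂ : ∀ b, b ≠ 7 → s₂.a b = s.a b := fun b hb => by
    rw [hs₂, (keepsA_closure hb).run_a, ha₁]
  have H₂ : Ready Γ n m N M mv s₂ := H₁.congr (fun z hz => hv₂ z (by omega)) (run_inp _ _)
    fun b hb => (keepsA_closure (by omega)).run_a s₁
  have h60₂ : s₂.v 60 = code := by rw [hv₂ 60 (by omega), hv₁ 60 (by omega), h60]
  have hpend : s₃.set n 9 = pending Γ M mv m code := by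
    ext y
    rw [Store.mem_set]
    -- For the empty string there is no last letter, and the closure computed from the meaningless
    -- decoded vertex is ignored in favour of `M`.
    have hy : y < n → (s₃.a 9 y ≠ 0 ↔ if code = 0 then s.a 0 y ≠ 0 else
        s₂.a 7 y ≠ 0 ∧ y ≠ s₂.v 64) := fun hy => by
      refine run_fill_iff (fun y => if code = 0 then s.a 0 y ≠ 0 else
        s₂.a 7 y ≠ 0 ∧ y ≠ s₂.v 64) (fun i hi s' hv ha hinp hge => ?_) (by rwa [H₂.holds.n_eq])
      have e60 : (s'.setV 67 i).v 60 = code := by simp [hv 60, h60₂]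
      rw [T, eval_ite, T_v, e60]
      by_cases h0 : code = 0
      · rw [if_neg (by simpa using h0), if_pos h0]
        simp [ha 0, ha₂ 0]
      · rw [if_pos h0, if_neg h0]
        change T _ _ ↔ _
        simp [T_arr, ha 7, hv 64]
    rcases code with _ | e
    · simp only [if_true] at hy
      rw [pending, if_pos rfl, ← h.set_eq, Store.mem_set]
      exact and_congr_right hy
    · have hm0 : 0 < m := h.pos.resolve_right (by omega)
      obtain ⟨-, d2, -⟩ := run_decode h.m_eq h.N_eq h60 hm0 (by omega : e < N)
      rw [h.mv_eq] at d2
      have hlv : letterVertex mv m (e % (2 * m)) ∈ M := by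
        have := Nat.mod_lt e (show 0 < 2 * m by omega)
        rw [letterVertex]
        split_ifs with hlt
        · exact h.mv_mem _ hlt
        · exact h.mv_mem _ (by omega)
      have hset : s₂.set n 7 = reach Γ (undecided M mv m (e + 1)) (letterVertex mv m (e % (2 * m))) :=
        run_closure H₁.holds (by omega) d2 (hMn _ hlv)
          (by rw [hv₁ 60 (by omega), h60]; exact H₁.mem_undecided hc)
      rw [pending, if_neg (by omega), Nat.add_sub_cancel, Finset.mem_erase, ← hset, Store.mem_set,
        ← d2, ← hs₁, ← hv₂ 64 (by omega)]
      simp only [Nat.add_eq_zero_iff, one_ne_zero, and_false, if_false] at hy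
      constructor
      · rintro ⟨g1, g2⟩; exact ⟨((hy g1).1 g2).2, g1, ((hy g1).1 g2).1⟩
      · rintro ⟨g1, g2, g3⟩; exact ⟨g2, (hy g2).2 ⟨g3, g1⟩⟩
  have hv₄ : ∀ z < 67, s₄.v z = s₂.v z := fun z hz => by
    rw [hs₄, Store.setV_v, if_neg (by omega), hs₃, KeepsV.run_v (by simp; omega)]
  have ha₄ : ∀ b, b ≠ 9 → s₄.a b = s₂.a b := fun b hb => by
    rw [hs₄, Store.setV_a, hs₃, KeepsA.run_a (by simpa using hb)]
  have H₄ : Ready Γ n m N M mv s₄ := H₂.congr (fun z hz => hv₄ z (by omega))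
    (by simp [hs₄, hs₃, run_inp]) fun b hb => ha₄ b (by omega)
  -- The accumulator holds one plus the cost of the components represented so far, and stays at zero
  -- once some component admits no solution.
  have hloop := loop_induction (x := 71) (y := 0) (s := s₄) (p := component)
    (fun i s' => ∃ best : ℕ → ℕ, (∀ w ∈ compReps Γ M mv m code, w < i →
      IsBest mv m (s.a 8) code (reach Γ (undecided M mv m code) w) (best w)) ∧
      ((∃ w ∈ compReps Γ M mv m code, w < i ∧ best w = 0) → s'.v 70 = 0) ∧
      ((∀ w ∈ compReps Γ M mv m code, w < i → best w ≠ 0) →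
        s'.v 70 = 1 + ∑ w ∈ (compReps Γ M mv m code).filter (· < i), (best w - 1)))
    ⟨fun _ => 0, by simp, by simp, by simp [hs₄]⟩ ?_
  · rw [H₄.holds.n_eq] at hloop
    obtain ⟨best, b1, b2, b3⟩ := hloop
    have hlt : ∀ w ∈ compReps Γ M mv m code, w < n := fun w hw => by
      have := (Finset.mem_filter.1 hw).1
      rw [← hpend, Store.mem_set] at this
      exact this.1
    have H₅ : Ready Γ n m N M mv s₅ := H₄.congr (fun z hz => KeepsV.run_v
      (by rw [keepsV_loop]; exact ⟨by omega, keepsV_component (by omega)⟩) s₄) (run_inp _ _)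
      fun b hb => by
        by_cases h7 : b = 7
        · omega
        · exact KeepsA.run_a (by rw [keepsA_loop]; exact keepsA_component h7) s₄
    have h60₅ : s₅.v 60 = code := by
      rw [hs₅, KeepsV.run_v (by rw [keepsV_loop]; exact ⟨by omega, keepsV_component (by omega)⟩),
        hv₄ 60 (by omega), h60₂]
    have h8 : s₅.a 8 = s.a 8 := by
      rw [hs₅, KeepsA.run_a (by rw [keepsA_loop]; exact keepsA_component (by omega)),
        ha₄ 8 (by omega), ha₂ 8 (by omega)]
    have hT := T_conflict (r := r) H₅.holds H₅.set_eq h60₅ (H₅.status code hc)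
    refine ⟨if Conflict Γ (Finset.range n) r M mv m code then 0 else s₅.v 70,
      ⟨best, fun w hw => b1 w hw (hlt w hw), ?_, ?_⟩, fun e => ?_⟩
    · rintro (h' | ⟨w, hw, h'⟩)
      · rw [if_pos h']
      · rw [hs₅, b2 ⟨w, hw, hlt w hw, h'⟩, ite_self]
    · intro h' h''
      rw [if_neg h', hs₅, b3 fun w hw _ => h'' w hw, Finset.filter_true_of_mem hlt]
    · change ((put 8 (v 60) (v 70)).run ((set 70 (ite (conflict r) (c 0) (v 70))).run s₅)).a 8 e = _
      have e60 : ((set 70 (ite (conflict r) (c 0) (v 70))).run s₅).v 60 = code := by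
        rw [run_set, Store.setV_v, if_neg (by omega), h60₅]
      have e70 : ((set 70 (ite (conflict r) (c 0) (v 70))).run s₅).v 70 =
          if Conflict Γ (Finset.range n) r M mv m code then 0 else s₅.v 70 := by
        rw [run_set, Store.setV_v, if_pos rfl, eval_ite]
        simp only [hT, eval_c, eval_v]
      rw [run_put, Store.setA_a, eval_v, eval_v, e60, e70, run_set, Store.setV_a, h8]
      simp only [true_and]
  · rintro i hi s' hv ha hinp ⟨best, b1, b2, b3⟩
    rw [H₄.holds.n_eq] at hi
    have hv' : ∀ z < 67, s'.v z = s₄.v z := fun z hz => hv z (by omega) (keepsV_component hz)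
    have ha' : ∀ b, b ≠ 7 → s'.a b = s₄.a b := fun b hb => ha b (keepsA_component hb)
    have H' : Ready Γ n m N M mv (s'.setV 71 i) := H₄.congr
      (fun z hz => by rw [Store.setV_v, if_neg (by omega), hv' z (by omega)]) hinp
      fun b hb => ha' b (by omega)
    obtain ⟨x, x1, x2⟩ := run_component H' hc
      (by rw [Store.setV_v, if_neg (by omega), hv' 60 (by omega), hv₄ 60 (by omega), h60₂])
      (by simp) hi (by rw [← hpend]; exact Store.set_congr (ha' 9 (by omega)))
    have e8 : (s'.setV 71 i).a 8 = s.a 8 := by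
      rw [Store.setV_a, ha' 8 (by omega), ha₄ 8 (by omega), ha₂ 8 (by omega)]
    have e70 : (s'.setV 71 i).v 70 = s'.v 70 := by simp
    rw [e8] at x1
    rw [e70] at x2
    have hne : ∀ w, w < i → Function.update best i x w = best w := fun w hw =>
      Function.update_of_ne (by omega) _ _
    have hsum : ∑ w ∈ (compReps Γ M mv m code).filter (· < i), (Function.update best i x w - 1) =
        ∑ w ∈ (compReps Γ M mv m code).filter (· < i), (best w - 1) :=
      Finset.sum_congr rfl fun w hw => by rw [hne w (Finset.mem_filter.1 hw).2]
    refine ⟨Function.update best i x, fun w hw hwi => ?_, fun ⟨w, hw, hwi, hw0⟩ => ?_, fun hall => ?_⟩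
    · rcases Nat.lt_succ_iff_lt_or_eq.1 hwi with h' | rfl
      · rw [hne w h']; exact b1 w hw h'
      · rwa [Function.update_self]
    · rw [x2]
      rcases Nat.lt_succ_iff_lt_or_eq.1 hwi with h' | rfl
      · rw [hne w h'] at hw0
        have := b2 ⟨w, hw, h', hw0⟩
        simp [this]
      · rw [Function.update_self] at hw0
        simp [hw, hw0]
    · have hold := b3 fun w hw hwi => by
        have := hall w hw (by omega)
        rwa [hne w hwi] at this
      rw [x2]
      by_cases hmem : i ∈ compReps Γ M mv m code
      · have hx := hall i hmem (by omega)
        rw [Function.update_self] at hx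
        have hins : (compReps Γ M mv m code).filter (· < i + 1) =
            insert i ((compReps Γ M mv m code).filter (· < i)) := by
          ext w
          simp only [Finset.mem_filter, Finset.mem_insert]
          constructor
          · rintro ⟨g1, g2⟩
            rcases Nat.lt_succ_iff_lt_or_eq.1 g2 with h' | h'
            · exact Or.inr ⟨g1, h'⟩
            · exact Or.inl h'
          · rintro (rfl | ⟨g1, g2⟩)
            · exact ⟨hmem, by omega⟩
            · exact ⟨g1, by omega⟩
        rw [if_pos hmem, if_pos ⟨by omega, hx⟩, hold, hins, Finset.sum_insert (by simp),
          Function.update_self, hsum]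
        omega
      · have hins : (compReps Γ M mv m code).filter (· < i + 1) =
            (compReps Γ M mv m code).filter (· < i) := by
          refine Finset.filter_congr fun w hw => ?_
          have : w ≠ i := fun h => hmem (h ▸ hw)
          omega
        rw [if_neg hmem, hold, hins, hsum]

/-- The dynamic program. -/
def table (r : ℕ) : Cmd := loop 59 4 <| seq (set 60 (sub (v 4) (add (v 59) (c 1)))) (row r)

theorem ok_table {r : ℕ} : (table r).Ok 5 := by simp [table, ok_row]

/-- Rows are computed by decreasing code, so all children are known and later writes do not disturb
finished rows. The array is zero initially, which is the value infinity for the codes from `N` on.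
-/
theorem run_table {Γ : SimpleGraph ℕ} {n m N r : ℕ} {M : Finset ℕ} {mv : ℕ → ℕ}
    {s : Store} (h : Ready Γ n m N M mv s) (h8 : s.a 8 = fun _ => 0) :
    IsTable Γ (Finset.range n) r M mv m (((table r).run s).a 8) N := by
  have hloop := loop_induction (x := 59) (y := 4) (s := s)
    (p := seq (set 60 (sub (v 4) (add (v 59) (c 1)))) (row r))
    (fun i s' => (∀ e, N ≤ e → s'.a 8 e = 0) ∧ ∀ e < N, N ≤ e + i →
      IsRow Γ (Finset.range n) r M mv m (s'.a 8) e (s'.a 8 e))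
    ⟨fun e _ => by rw [h8], fun e he he' => by omega⟩ ?_
  · rw [h.N_eq] at hloop
    exact ⟨hloop.1, fun e he => hloop.2 e he (by omega)⟩
  · rintro i hi s' hv ha hinp ⟨h1, h2⟩
    rw [h.N_eq] at hi
    have hv' : ∀ z < 59, s'.v z = s.v z := fun z hz => hv z (by omega)
      ⟨by simp; omega, keepsV_row (by omega)⟩
    have ha' : ∀ b < 7, s'.a b = s.a b := fun b hb => ha b
      ⟨trivial, keepsA_row (by omega) (by omega) (by omega)⟩
    rw [run_seq, run_set]
    set s₁ := (s'.setV 59 i).setV 60 ((sub (v 4) (add (v 59) (c 1))).eval (s'.setV 59 i)) with hs₁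
    have H₁ : Ready Γ n m N M mv s₁ := h.congr (fun z hz => by
      rw [hs₁, Store.setV_v, if_neg (by omega), Store.setV_v, if_neg (by omega), hv' z (by omega)])
      (by simp [hs₁, hinp]) fun b hb => by simp [hs₁, ha' b hb]
    have h60 : s₁.v 60 = N - (i + 1) := by simp [hs₁, hv' 4, h.N_eq]
    have e8 : s₁.a 8 = s'.a 8 := by simp [hs₁]
    obtain ⟨x, x1, x2⟩ := run_row (r := r) H₁ (by omega) h60
    rw [e8] at x1 x2
    refine ⟨fun e he => by rw [x2, if_neg (by omega), h1 e he], fun e he he' => ?_⟩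
    have hcongr : ∀ e', e < e' → ((row r).run s₁).a 8 e' = s'.a 8 e' := fun e' he'' => by
      rw [x2, if_neg (by omega)]
    rw [x2]
    split_ifs with h'
    · subst h'; exact x1.congr hcongr
    · exact (h2 e he (by omega)).congr hcongr

end Loop


/-! ### The complete algorithm. -/

theorem hasCliqueCover_iff {n : ℕ} (G : SimpleGraph (Fin n)) (r k : ℕ) : HasCliqueCover G r k ↔
    ∃ S, IsCover (G.map Fin.valEmbedding) (Finset.range n) r S ∧ S.card ≤ k := by
  classical
  constructor
  · rintro ⟨X, hX, hfree⟩
    rw [SimpleGraph.cliqueFree_induce_iff] at hfree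
    refine ⟨X.map Fin.valEmbedding, fun C ⟨hC, hCr, hCa⟩ => ?_, by simpa using hX⟩
    by_contra hne
    rw [Finset.not_nonempty_iff_eq_empty] at hne
    have hmap : (Finset.univ.filter fun x : Fin n => (x : ℕ) ∈ C).map Fin.valEmbedding = C := by
      ext y
      simp only [Finset.mem_map, Finset.mem_filter, Finset.mem_univ, true_and]
      exact ⟨fun ⟨x, hx, h⟩ => h ▸ hx, fun h => ⟨⟨y, Finset.mem_range.1 (hC h)⟩, h, rfl⟩⟩
    refine hfree (t := Finset.univ.filter fun x : Fin n => (x : ℕ) ∈ C) (fun x hx hxX => ?_) ⟨?_, ?_⟩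
    · have : (x : ℕ) ∈ C ∩ X.map Fin.valEmbedding :=
        Finset.mem_inter.2 ⟨by simpa using hx, Finset.mem_map_of_mem Fin.valEmbedding hxX⟩
      simp [hne] at this
    · intro x hx y hy hxy
      have := hCa x (by simpa using hx) y (by simpa using hy) fun h => hxy (Fin.ext h)
      rw [SimpleGraph.map_adj] at this
      obtain ⟨x', y', h, hx', hy'⟩ := this
      rwa [← Fin.valEmbedding.injective hx', ← Fin.valEmbedding.injective hy']
    · rw [← hCr, ← hmap, Finset.card_map, hmap]
  · rintro ⟨S, hS, hSk⟩
    refine ⟨Finset.univ.filter fun x : Fin n => (x : ℕ) ∈ S, le_trans ?_ hSk, ?_⟩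
    · exact Finset.card_le_card_of_injOn (fun x => (x : ℕ)) (fun x hx => by simpa using hx)
        fun x _ y _ h => Fin.ext h
    · rw [SimpleGraph.cliqueFree_induce_iff]
      rintro t ht ⟨htc, htr⟩
      have hC : IsRClique (G.map Fin.valEmbedding) (Finset.range n) r (t.map Fin.valEmbedding) := by
        refine ⟨fun y hy => ?_, by simpa using htr, fun a ha b hb hab => ?_⟩
        · obtain ⟨x, -, rfl⟩ := Finset.mem_map.1 hy
          exact Finset.mem_range.2 x.2
        · obtain ⟨x, hx, rfl⟩ := Finset.mem_map.1 ha
          obtain ⟨y, hy, rfl⟩ := Finset.mem_map.1 hb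
          rw [SimpleGraph.map_adj]
          exact ⟨x, y, htc hx hy fun h => hab (h ▸ rfl), rfl, rfl⟩
      obtain ⟨y, hy⟩ := hS _ hC
      obtain ⟨hy1, hy2⟩ := Finset.mem_inter.1 hy
      obtain ⟨x, hx, rfl⟩ := Finset.mem_map.1 hy1
      exact ht hx (Finset.mem_coe.2 (Finset.mem_filter.2 ⟨Finset.mem_univ _, hy2⟩))

namespace Loop

open Ex Cmd

/-- Decides whether there is a solution, given the table. -/
def answer : Cmd := set 40 (and (v 16) (and (arr 8 (c 0)) (le (arr 8 (c 0)) (add (v 1) (c 1)))))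

theorem run_answer (s : Store) :
    (answer.run s).v 40 = 1 ↔ s.v 16 ≠ 0 ∧ s.a 8 0 ≠ 0 ∧ s.a 8 0 ≤ s.v 1 + 1 := by
  have hval : (and (v 16) (and (arr 8 (c 0)) (le (arr 8 (c 0)) (add (v 1) (c 1))))).eval s ≤ 1 := by
    classical
    simp only [Ex.and, le, Ex.not, eval_ite, eval_c]
    split_ifs <;> omega
  have hT : (and (v 16) (and (arr 8 (c 0)) (le (arr 8 (c 0)) (add (v 1) (c 1))))).T s ↔
      s.v 16 ≠ 0 ∧ s.a 8 0 ≠ 0 ∧ s.a 8 0 ≤ s.v 1 + 1 := by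
    simp [T_v, T_arr]
  rw [answer, run_set, Store.setV_v, if_pos rfl, ← hT, T]
  omega

/-- The algorithm for `K_r`-Cover. -/
def solver (r C a b : ℕ) : Cmd :=
  seq (seq (kernel r) listing) <| seq (depthBound C a b) <| seq numCodes <|
  seq statusTable <| seq (table r) answer

/-- Besides correctness this exposes the stores at which the later phases start. Each phase may loop
over the numbers computed before it: first `n` and `k`, then also `m`, then `t`, and finally the
number of codes. The variables holding them are bounded separately for the time estimate. -/
theorem run_solver {n : ℕ} (G : SimpleGraph (Fin n)) {r k C a b : ℕ} (hr : 0 < r) (f : ℕ → ℝ)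
    (hf : ((r * k : ℕ) : ℝ) ≤ f 0) (hf' : ∀ i M M' d pk, M ⊆ Finset.range n →
      IsKernelStep (G.map Fin.valEmbedding) (Finset.range n) r M M' d pk →
        (M.card : ℝ) ≤ f i → (M'.card : ℝ) ≤ f (i + 1))
    (hel : ∀ M ⊆ Finset.range n, ∀ t, C * M.card ^ b ≤ t ^ a →
      ElimDepth (G.map Fin.valEmbedding) t M) :
    ∃ m t : ℕ, (m : ℝ) ≤ f (r - 1) ∧ (∀ t' < t, t' ^ a < C * m ^ b) ∧
      ((((solver r C a b).run (initStore G k)).v 40 = 1) ↔ HasCliqueCover G r k) ∧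
      ∃ s₁ s₂ s₃ : Store, (∀ y < 2, (initStore G k).v y ≤ n + k) ∧ (∀ y < 3, s₁.v y ≤ n + k) ∧
        (∀ y < 4, s₂.v y ≤ n + k) ∧
        (∀ y < 5, s₃.v y ≤ n + k + (lastCode (2 * m) t 0 + 1)) ∧
        (solver r C a b).time (initStore G k) = (seq (kernel r) listing).time (initStore G k) +
          ((depthBound C a b).time s₁ + (numCodes.time s₂ +
            (seq statusTable (seq (table r) answer)).time s₃)) := by
  set Γ := G.map Fin.valEmbedding with hΓ
  set s := initStore G k with hs
  have H := holds_initStore G k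
  obtain ⟨hcard, hker⟩ := run_kernel (k := k) hr H (by simp [initStore]) (by simp [initStore])
    (by simp [initStore]) f hf hf'
  set s₀ := (kernel r).run s with hs₀
  have hok : (kernel r).Ok 2 := ok_kernel (by omega) (by omega)
  have hv₀ : ∀ z < 2, s₀.v z = s.v z := fun z hz => (hok.keepsV hz).run_v s
  have H₀ : Holds Γ n s₀ := H.congr (hv₀ 0 (by omega)) (run_inp _ _)
  set M := s₀.set n 0 with hM
  set s₁ := listing.run s₀ with hs₁
  obtain ⟨l1, l2, l3⟩ := run_listing H₀.n_eq
  rw [← hs₁, ← hM] at l1 l2 l3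
  set m := M.card with hm
  have hMn : M ⊆ Finset.range n := Finset.filter_subset _ _
  have hv₁ : ∀ z, z ≠ 2 → z ≠ 21 → s₁.v z = s₀.v z := fun z h h' =>
    KeepsV.run_v (by simp [listing, h, h']) s₀
  have ha₁ : ∀ b, b ≠ 5 → s₁.a b = s₀.a b := fun b h => KeepsA.run_a (by simp [listing, h]) s₀
  set s₂ := (depthBound C a b).run s₁ with hs₂
  obtain ⟨d1, d2, d3⟩ := run_depthBound (C := C) (a := a) (b := b) l1
  rw [← hs₂] at d1 d2 d3
  set t := s₂.v 3 with ht
  have hv₂ : ∀ z, z ≠ 3 → z ≠ 21 → z ≠ 31 → z ≠ 33 → s₂.v z = s₁.v z := fun z h1 h2 h3 h4 =>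
    (keepsV_depthBound h1 h2 h3 h4).run_v s₁
  have ha₂ : ∀ b', s₂.a b' = s₁.a b' := fun b' => keepsA_depthBound.run_a s₁
  have h2₂ : s₂.v 2 = m := by rw [hv₂ 2 (by omega) (by omega) (by omega) (by omega), l1]
  set s₃ := numCodes.run s₂ with hs₃
  have h4₃ : s₃.v 4 = lastCode (2 * m) t 0 + 1 := run_numCodes h2₂ ht.symm
  have hv₃ : ∀ z, z ≠ 4 → z ≠ 21 → s₃.v z = s₂.v z := fun z h h' =>
    KeepsV.run_v (by simp [numCodes, h, h']) s₂
  have ha₃ : ∀ b', s₃.a b' = s₂.a b' := fun b' => KeepsA.run_a (by simp [numCodes]) s₂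
  set N := lastCode (2 * m) t 0 + 1 with hN
  have hvs : ∀ z, z < 2 → s₃.v z = s.v z := fun z hz => by
    rw [hv₃ z (by omega) (by omega), hv₂ z (by omega) (by omega) (by omega) (by omega),
      hv₁ z (by omega) (by omega), hv₀ z hz]
  have h16 : s₃.v 16 = s₀.v 16 := by
    rw [hv₃ 16 (by omega) (by omega), hv₂ 16 (by omega) (by omega) (by omega) (by omega),
      hv₁ 16 (by omega) (by omega)]
  have has : ∀ b', b' ≠ 5 → s₃.a b' = s₀.a b' := fun b' h => by rw [ha₃, ha₂, ha₁ b' h]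
  have h5 : s₃.a 5 = s₁.a 5 := by rw [ha₃, ha₂]
  have hm₃ : s₃.v 2 = m := by rw [hv₃ 2 (by omega) (by omega), h2₂]
  have hn₃ : s₃.v 0 = n := by rw [hvs 0 (by omega), H.n_eq]
  have hpos : 0 < m ∨ N ≤ 1 := by
    rcases Nat.eq_zero_or_pos m with h | h
    · right
      have : t = 0 := by omega
      rw [hN, this]; simp [lastCode]
    · exact Or.inl h
  set s₄ := statusTable.run s₃ with hs₄
  have hv₄ : ∀ z < 60, s₄.v z = s₃.v z := fun z hz => (keepsV_statusTable hz).run_v s₃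
  have ha₄ : ∀ b', b' ≠ 6 → s₄.a b' = s₃.a b' := fun b' h => (keepsA_statusTable h).run_a s₃
  have hready : Ready Γ n m N M (s₁.a 5) s₄ :=
    { holds := H.congr (by rw [hv₄ 0 (by omega), hvs 0 (by omega)]) (by
        simp only [hs₄, hs₃, hs₂, hs₁, hs₀, run_inp, hs])
      m_eq := by rw [hv₄ 2 (by omega), hm₃]
      N_eq := by rw [hv₄ 4 (by omega), h4₃]
      set_eq := Store.set_congr (by rw [ha₄ 0 (by omega), has 0 (by omega)])
      mv_eq := by rw [ha₄ 5 (by omega), h5]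
      mv_mem := l3
      pos := hpos
      status := by
        have := run_statusTable hn₃ hm₃ h4₃ hpos
        rwa [h5] at this }
  have h8 : s₄.a 8 = fun _ => 0 := by
    rw [ha₄ 8 (by omega), has 8 (by omega), hs₀,
      (keepsA_kernel (by omega) (by omega) (by omega)).run_a s]
    rfl
  have htab := run_table (r := r) hready h8
  set s₅ := (table r).run s₄ with hs₅
  have hv₅ : ∀ z < 59, s₅.v z = s₄.v z := fun z hz => KeepsV.run_v (by
    simp only [table, keepsV_loop, keepsV_seq, keepsV_set]
    exact ⟨by omega, by omega, keepsV_row (by omega)⟩) s₄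
  have hdepth : ElimDepth Γ t M := by
    rcases d2 with h | h
    · exact hel M hMn t h
    · rw [h]; exact ElimDepth.card_self M
  have hroot := htab.root (k := k) l2 (Nat.lt_succ_self _) hdepth
  have hmn : m ≤ n := by simpa using Finset.card_le_card hMn
  have h0n : s.v 0 = n := H.n_eq
  have h1k : s.v 1 = k := by simp [hs, initStore]
  have key : ∀ (s' : Store) (z : ℕ), (∀ y < 2, s'.v y = s.v y) → s'.v 2 = m → z < 3 →
      s'.v z ≤ n + k := by
    intro s' z h h' hz
    interval_cases z
    · rw [h 0 (by omega), h0n]; omega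
    · rw [h 1 (by omega), h1k]; omega
    · rw [h']; omega
  have hs1 : ∀ y < 2, s₁.v y = s.v y := fun y hy => by
    rw [hv₁ y (by omega) (by omega), hv₀ y hy]
  have hs2 : ∀ y < 2, s₂.v y = s.v y := fun y hy => by
    rw [hv₂ y (by omega) (by omega) (by omega) (by omega), hs1 y hy]
  refine ⟨m, t, hcard, d3, ?_, s₁, s₂, s₃, fun y hy => ?_, fun y hy => key s₁ y hs1 l1 hy,
    fun y hy => ?_, fun y hy => ?_, rfl⟩
  · change (answer.run s₅).v 40 = 1 ↔ _
    rw [run_answer, hasCliqueCover_iff, hv₅ 16 (by omega), hv₄ 16 (by omega), h16,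
      hv₅ 1 (by omega), hv₄ 1 (by omega), hvs 1 (by omega), h1k, hroot]
    rcases hker with ⟨g1, g2⟩ | ⟨g1, g2⟩
    · rw [g2]; exact ⟨fun h => h.2, fun h => ⟨g1, h⟩⟩
    · exact ⟨fun h => absurd g1 h.1, fun h => absurd h g2⟩
  · interval_cases y <;> omega
  · rcases Nat.lt_succ_iff_lt_or_eq.1 hy with h | rfl
    · exact key s₂ y hs2 h2₂ h
    · omega
  · rcases Nat.lt_succ_iff_lt_or_eq.1 hy with h | rfl
    · rcases Nat.lt_succ_iff_lt_or_eq.1 h with h | rfl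
      · exact (key s₃ y hvs hm₃ h).trans (by omega)
      · rw [hv₃ 3 (by omega) (by omega)]; omega
    · omega

/-- The nesting depth of the algorithm. -/
def solverDepth (r : ℕ) : ℕ := (solver r 0 0 0).depth + 2

/-- Only the factor `K` depends on `C`, `a` and `b`. The exponent depends on `r` alone, because
`depthBound` has nesting depth at most `2` for all parameters. -/
theorem exists_time_solver_le (r C a b : ℕ) : ∃ K : ℕ, ∀ (Q : ℕ) (s s₁ s₂ s₃ : Store),
    (∀ y < 2, s.v y ≤ Q) → (∀ y < 3, s₁.v y ≤ Q) → (∀ y < 4, s₂.v y ≤ Q) → (∀ y < 5, s₃.v y ≤ Q) →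
    (seq (kernel r) listing).time s + ((depthBound C a b).time s₁ + (numCodes.time s₂ +
      (seq statusTable (seq (table r) answer)).time s₃)) ≤ K * (Q + 1) ^ solverDepth r := by
  obtain ⟨K₁, h₁⟩ := (seq (kernel r) listing).exists_time_le
  obtain ⟨K₂, h₂⟩ := (depthBound C a b).exists_time_le
  obtain ⟨K₃, h₃⟩ := numCodes.exists_time_le
  obtain ⟨K₄, h₄⟩ := (seq statusTable (seq (table r) answer)).exists_time_le
  refine ⟨K₁ + (K₂ + (K₃ + K₄)), fun Q s s₁ s₂ s₃ q₁ q₂ q₃ q₄ => ?_⟩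
  have hmono : ∀ {K d : ℕ}, d ≤ solverDepth r → K * (Q + 1) ^ d ≤ K * (Q + 1) ^ solverDepth r :=
    fun h => Nat.mul_le_mul_left _ (Nat.pow_le_pow_right (Nat.succ_pos _) h)
  have e : solverDepth r = max (seq (kernel r) listing).depth (max (depthBound 0 0 0).depth
    (max numCodes.depth (seq statusTable (seq (table r) answer)).depth)) + 2 := rfl
  have b₁ := (h₁ 2 Q s ⟨ok_kernel (by omega) (by omega), ok_listing (by omega) (by omega)⟩ q₁).trans
    (hmono (by omega))
  have b₂ := (h₂ 3 Q s₁ ok_depthBound q₂).trans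
    (hmono (depth_depthBound_le.trans (by omega)))
  have b₃ := (h₃ 4 Q s₂ ok_numCodes q₃).trans (hmono (by omega))
  have b₄ := (h₄ 5 Q s₃ ⟨ok_statusTable, ok_table, by simp [answer]⟩ q₄).trans (hmono (by omega))
  rw [add_mul, add_mul, add_mul]
  omega

end Loop


/-! ### Running time -/

theorem lastCode_add_one_le (b : ℕ) : ∀ t, lastCode b t 0 + 1 ≤ (b + 1) ^ t
  | 0 => by simp [lastCode]
  | t + 1 => by
    have := Nat.mul_le_mul_right (b + 1) (lastCode_add_one_le b t)
    rw [lastCode_succ, pow_succ]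
    nlinarith

/-- Every round raises the size to the power `1 + δ` up to a factor, starting from `r k`. The base
`max k 1` makes the bounds valid and monotone in the exponent for `k = 0` too. -/
theorem exists_kernel_card_le (r : ℕ) (c α δ : ℝ) (hc : 0 ≤ c) (hα0 : 0 ≤ α) (hα : α < 1)
    (hδ : 0 < δ) : ∃ E : ℝ, 0 ≤ E ∧ ∀ (Γ : SimpleGraph ℕ) (vs : Finset ℕ) (k : ℕ),
      HasSeparators Γ vs c α → ∃ f : ℕ → ℝ, ((r * k : ℕ) : ℝ) ≤ f 0 ∧
        (∀ i M M' d pk, M ⊆ vs → IsKernelStep Γ vs r M M' d pk → (M.card : ℝ) ≤ f i →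
          (M'.card : ℝ) ≤ f (i + 1)) ∧
        f (r - 1) ≤ E * ((max k 1 : ℕ) : ℝ) ^ ((1 + δ) ^ (r - 1)) := by
  obtain ⟨C, hC, hstep⟩ := exists_kernelStep_card_le r c α δ hc hα0 hα hδ
  set E : ℕ → ℝ := fun i => Nat.rec (r : ℝ) (fun _ e => C * e ^ (1 + δ)) i with hE
  have hE0 : ∀ i, 0 ≤ E i := by
    intro i
    induction i with
    | zero => exact Nat.cast_nonneg r
    | succ i ih => exact mul_nonneg hC (Real.rpow_nonneg ih _)
  refine ⟨E (r - 1), hE0 _, fun Γ vs k hsep =>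
    ⟨fun i => E i * ((max k 1 : ℕ) : ℝ) ^ ((1 + δ) ^ i), ?_, ?_, le_rfl⟩⟩
  · show ((r * k : ℕ) : ℝ) ≤ r * ((max k 1 : ℕ) : ℝ) ^ ((1 + δ) ^ 0)
    rw [pow_zero, Real.rpow_one]
    have : r * k ≤ r * max k 1 := Nat.mul_le_mul_left _ (le_max_left _ _)
    have h : ((r * k : ℕ) : ℝ) ≤ ((r * max k 1 : ℕ) : ℝ) := by exact_mod_cast this
    rw [Nat.cast_mul r (max k 1)] at h
    exact h
  · intro i M M' d pk hM hker hcard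
    refine (hstep Γ vs M M' d pk hM hsep hker).trans ?_
    calc C * (M.card : ℝ) ^ (1 + δ)
        ≤ C * (E i * ((max k 1 : ℕ) : ℝ) ^ ((1 + δ) ^ i)) ^ (1 + δ) :=
          mul_le_mul_of_nonneg_left
            (Real.rpow_le_rpow (Nat.cast_nonneg _) hcard (by linarith)) hC
      _ = C * E i ^ (1 + δ) * ((max k 1 : ℕ) : ℝ) ^ ((1 + δ) ^ (i + 1)) := by
          rw [Real.mul_rpow (hE0 i) (by positivity), ← Real.rpow_mul (Nat.cast_nonneg _), pow_succ,
            mul_assoc]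

/-- A form of the depth bound that the machine can test: `α` is rounded up to a fraction, the
inequality is raised to the power `a`, and the constant is rounded up. -/
theorem exists_elimDepth_nat (c α : ℝ) (hc : 0 ≤ c) (hα : 0 < α) {a b : ℕ} (ha : 0 < a)
    (hab : α ≤ (b : ℝ) / a) : ∃ C : ℕ, ∀ (Γ : SimpleGraph ℕ) (vs : Finset ℕ),
      HasSeparators Γ vs c α → ∀ M ⊆ vs, ∀ t : ℕ, C * M.card ^ b ≤ t ^ a → ElimDepth Γ t M := by
  obtain ⟨C, hC, h⟩ := exists_elimDepth c α hc hα
  refine ⟨⌈C ^ a⌉₊, fun Γ vs hsep M hM t ht => h Γ vs hsep M hM t ?_⟩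
  rcases Nat.eq_zero_or_pos M.card with h0 | h0
  · rw [h0, Nat.cast_zero, Real.zero_rpow hα.ne', mul_zero]; positivity
  have h1 : (1 : ℝ) ≤ M.card := by exact_mod_cast h0
  have ht' : (⌈C ^ a⌉₊ : ℝ) * (M.card : ℝ) ^ b ≤ (t : ℝ) ^ a := by exact_mod_cast ht
  have hpow : (C * (M.card : ℝ) ^ ((b : ℝ) / a)) ^ a ≤ (t : ℝ) ^ a := by
    rw [mul_pow, ← Real.rpow_natCast ((M.card : ℝ) ^ ((b : ℝ) / a)), ← Real.rpow_mul (by positivity),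
      div_mul_cancel₀ _ (by positivity), Real.rpow_natCast]
    exact (mul_le_mul_of_nonneg_right (Nat.le_ceil _) (by positivity)).trans ht'
  calc C * (M.card : ℝ) ^ α ≤ C * (M.card : ℝ) ^ ((b : ℝ) / a) :=
        mul_le_mul_of_nonneg_left (Real.rpow_le_rpow_of_exponent_le h1 hab) hC
    _ ≤ t := le_of_pow_le_pow_left₀ ha.ne' (Nat.cast_nonneg _) hpow

/-- The predecessor of `t` fails the test, which bounds it by a root; the summand `1` in the
constant pays for the last step. -/
theorem exists_depth_le (C a b : ℕ) (E θ : ℝ) (ha : 0 < a) (hE : 0 ≤ E) (hθ : 0 ≤ θ) :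
    ∃ T : ℝ, 0 ≤ T ∧ ∀ (m t : ℕ) (κ : ℝ), 1 ≤ κ → (m : ℝ) ≤ E * κ ^ θ →
      (∀ t' < t, t' ^ a < C * m ^ b) → (t : ℝ) ≤ T * κ ^ (θ * ((b : ℝ) / a)) := by
  refine ⟨(C * E ^ b) ^ (1 / (a : ℝ)) + 1, by positivity, fun m t κ hκ hm ht => ?_⟩
  have hκ0 : 0 ≤ κ := by linarith
  have h1 : 1 ≤ κ ^ (θ * ((b : ℝ) / a)) := Real.one_le_rpow hκ (by positivity)
  rcases t with _ | t
  · rw [Nat.cast_zero]; positivity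
  have h2 : (t : ℝ) ^ a ≤ C * (m : ℝ) ^ b := by exact_mod_cast (ht t (Nat.lt_succ_self t)).le
  have h3 : (t : ℝ) ≤ (C * E ^ b) ^ (1 / (a : ℝ)) * κ ^ (θ * ((b : ℝ) / a)) := by
    refine le_of_pow_le_pow_left₀ ha.ne' (by positivity) (h2.trans ?_)
    rw [mul_pow, ← Real.rpow_natCast ((C * E ^ b) ^ (1 / (a : ℝ))), ← Real.rpow_mul (by positivity),
      one_div_mul_cancel (by positivity), Real.rpow_one,
      ← Real.rpow_natCast (κ ^ (θ * ((b : ℝ) / a))), ← Real.rpow_mul hκ0, mul_assoc θ,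
      div_mul_cancel₀ _ (by positivity), Real.rpow_mul hκ0, Real.rpow_natCast, mul_assoc, ← mul_pow]
    gcongr
  rw [Nat.cast_succ, add_mul, one_mul]
  linarith

/-- There are at most `(2m + 1)^t = exp (t log (2m + 1))` codes, and `log (2m + 1)` is at most a
constant times `1 + log κ`. -/
theorem exists_numCodes_le (E θ T η : ℝ) (hE : 0 ≤ E) (hθ : 0 ≤ θ) (hT : 0 ≤ T) :
    ∃ P : ℝ, 0 ≤ P ∧ ∀ (m t : ℕ) (κ : ℝ), 1 ≤ κ → (m : ℝ) ≤ E * κ ^ θ → (t : ℝ) ≤ T * κ ^ η →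
      ((lastCode (2 * m) t 0 + 1 : ℕ) : ℝ) ≤ Real.exp (P * (κ ^ η * (1 + Real.log κ))) := by
  have hL : 0 ≤ Real.log (2 * E + 1) := Real.log_nonneg (by linarith)
  refine ⟨T * (Real.log (2 * E + 1) + θ), by positivity, fun m t κ hκ hm ht => ?_⟩
  have hκ0 : 0 < κ := by linarith
  have hlog : 0 ≤ Real.log κ := Real.log_nonneg hκ
  have h1 : 1 ≤ κ ^ θ := Real.one_le_rpow hκ hθ
  have h2 : (2 * m + 1 : ℝ) ≤ (2 * E + 1) * κ ^ θ := by nlinarith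
  have h3 : (2 * m + 1 : ℝ) ≤ Real.exp (Real.log (2 * E + 1) + θ * Real.log κ) := by
    rw [Real.exp_add, Real.exp_log (by linarith), mul_comm θ, Real.exp_mul, Real.exp_log hκ0]
    exact h2
  have h4 : Real.log (2 * E + 1) + θ * Real.log κ ≤
      (Real.log (2 * E + 1) + θ) * (1 + Real.log κ) := by
    nlinarith [mul_nonneg hL hlog]
  calc ((lastCode (2 * m) t 0 + 1 : ℕ) : ℝ) ≤ (2 * m + 1 : ℝ) ^ t := by
        exact_mod_cast lastCode_add_one_le (2 * m) t
    _ ≤ Real.exp (Real.log (2 * E + 1) + θ * Real.log κ) ^ t := by gcongr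
    _ = Real.exp (t * (Real.log (2 * E + 1) + θ * Real.log κ)) := by rw [← Real.exp_nat_mul]
    _ ≤ Real.exp (T * κ ^ η * ((Real.log (2 * E + 1) + θ) * (1 + Real.log κ))) := by
        refine Real.exp_le_exp.2 (mul_le_mul ht h4 (by positivity) (by positivity))
    _ = _ := by congr 1; ring

/-- For large `κ` the factor `κ^(γ-η)` exceeds `2P`, while for the remaining bounded `κ` the left
side is bounded. Thus constants depending on the class move from the exponent into a factor of the
running time. -/
theorem exists_absorb (P η γ : ℝ) (hP : 0 ≤ P) (hη : 0 ≤ η) (hηγ : η < γ) :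
    ∃ C : ℝ, ∀ κ : ℝ, 1 ≤ κ → P * (κ ^ η * (1 + Real.log κ)) ≤ C + κ ^ γ * Real.log κ := by
  set κ₀ : ℝ := max (Real.exp 1) ((2 * P) ^ (1 / (γ - η))) with hκ₀
  have hκ₀1 : 1 ≤ κ₀ := (Real.one_le_exp (by norm_num)).trans (le_max_left _ _)
  have hlog₀ : 0 ≤ Real.log κ₀ := Real.log_nonneg hκ₀1
  refine ⟨P * (κ₀ ^ η * (1 + Real.log κ₀)), fun κ hκ => ?_⟩
  have hκ0 : 0 < κ := by linarith
  have hlog : 0 ≤ Real.log κ := Real.log_nonneg hκ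
  rcases le_total κ κ₀ with h | h
  · have h1 : P * (κ ^ η * (1 + Real.log κ)) ≤ P * (κ₀ ^ η * (1 + Real.log κ₀)) := by
      have := Real.log_le_log hκ0 h
      gcongr
    have h2 : 0 ≤ κ ^ γ * Real.log κ := by positivity
    linarith
  · have h1 : 1 ≤ Real.log κ := by
      rw [Real.le_log_iff_exp_le hκ0]; exact (le_max_left _ _).trans h
    have hγη : 0 < γ - η := by linarith
    have h2 : 2 * P ≤ κ ^ (γ - η) := by
      calc 2 * P = ((2 * P) ^ (1 / (γ - η))) ^ (γ - η) := by
            rw [← Real.rpow_mul (by positivity), one_div_mul_cancel hγη.ne', Real.rpow_one]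
        _ ≤ κ ^ (γ - η) :=
            Real.rpow_le_rpow (by positivity) ((le_max_right _ _).trans h) hγη.le
    have h3 : 0 ≤ P * (κ₀ ^ η * (1 + Real.log κ₀)) := by positivity
    have h4 : κ ^ γ = κ ^ (γ - η) * κ ^ η := by rw [← Real.rpow_add hκ0]; congr 1; ring
    have h5 : 0 < κ ^ η := by positivity
    calc P * (κ ^ η * (1 + Real.log κ)) ≤ P * (κ ^ η * (2 * Real.log κ)) := by gcongr; linarith
      _ = 2 * P * (κ ^ η * Real.log κ) := by ring
      _ ≤ κ ^ (γ - η) * (κ ^ η * Real.log κ) := by gcongr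
      _ = κ ^ γ * Real.log κ := by rw [h4]; ring
      _ ≤ _ := by linarith

/-- The sum `n + k + N + 1` is at most four times the product of `max n 1`, `max k 1` and `N`, which
separates the polynomial in `n` from the exponential factor. -/
theorem time_le (K D : ℕ) (P : ℝ) (n k N : ℕ) (x : ℝ) (hN1 : 1 ≤ N)
    (hk : ((max k 1 : ℕ) : ℝ) ≤ Real.exp x) (hN : (N : ℝ) ≤ Real.exp (P * x)) :
    ((K * (n + k + N + 1) ^ D + (3 * n + 6) : ℕ) : ℝ) ≤
      (K * 4 ^ D + 9) * Real.exp (D * (1 + P) * x) * ((max n 1 : ℕ) : ℝ) ^ (D + 1) := by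
  set n' := max n 1 with hn'
  set κ := max k 1 with hκ
  have h1 : 1 ≤ n' := le_max_right _ _
  have h2 : 1 ≤ κ := le_max_right _ _
  have h3 : n ≤ n' := le_max_left _ _
  have h4 : k ≤ κ := le_max_left _ _
  have hx : 1 ≤ κ * N := Nat.mul_pos h2 hN1
  have hsum : n + k + N + 1 ≤ 4 * (n' * (κ * N)) := by
    have e1 : n' * 1 ≤ n' * (κ * N) := Nat.mul_le_mul_left _ hx
    have e2 : 1 * (κ * N) ≤ n' * (κ * N) := Nat.mul_le_mul_right _ h1
    have e3 : κ * 1 ≤ κ * N := Nat.mul_le_mul_left _ hN1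
    have e4 : 1 * N ≤ κ * N := Nat.mul_le_mul_right _ h2
    omega
  have hκN : ((κ * N : ℕ) : ℝ) ≤ Real.exp ((1 + P) * x) := by
    rw [Nat.cast_mul, add_mul, one_mul, Real.exp_add]
    gcongr
  have hκN1 : (1 : ℝ) ≤ ((κ * N : ℕ) : ℝ) := by exact_mod_cast hx
  have hn1 : (1 : ℝ) ≤ n' := by exact_mod_cast h1
  have hpow : ((κ * N : ℕ) : ℝ) ^ D ≤ Real.exp (D * (1 + P) * x) := by
    rw [mul_assoc, Real.exp_nat_mul]
    gcongr
  have hexp : 1 ≤ Real.exp (D * (1 + P) * x) := (one_le_pow₀ hκN1).trans hpow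
  have m1 : ((n + k + N + 1 : ℕ) : ℝ) ^ D ≤
      4 ^ D * (Real.exp (D * (1 + P) * x) * (n' : ℝ) ^ (D + 1)) := by
    calc ((n + k + N + 1 : ℕ) : ℝ) ^ D ≤ (4 * (n' * ((κ * N : ℕ) : ℝ))) ^ D := by
          gcongr
          exact_mod_cast hsum
      _ = 4 ^ D * (((κ * N : ℕ) : ℝ) ^ D * (n' : ℝ) ^ D) := by rw [mul_pow, mul_pow]; ring
      _ ≤ _ := by
          gcongr
          · omega
  have m2 : ((3 * n + 6 : ℕ) : ℝ) ≤ 9 * (Real.exp (D * (1 + P) * x) * (n' : ℝ) ^ (D + 1)) := by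
    have e1 : ((3 * n + 6 : ℕ) : ℝ) ≤ 9 * n' := by
      have : 3 * n + 6 ≤ 9 * n' := by omega
      exact_mod_cast this
    have e2 : (n' : ℝ) ≤ (n' : ℝ) ^ (D + 1) := le_self_pow₀ hn1 (by omega)
    nlinarith [mul_le_mul_of_nonneg_right hexp (show (0 : ℝ) ≤ (n' : ℝ) ^ (D + 1) by positivity)]
  rw [Nat.cast_add, Nat.cast_mul, Nat.cast_pow]
  nlinarith [mul_le_mul_of_nonneg_left m1 (Nat.cast_nonneg (α := ℝ) K)]

/-- For `α < 1` one has `α < 2α/(1+α) = 2/(1+1/α)`. A fraction strictly in between leaves room for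
the factor `(1 + δ)^r` when `δ` is small. -/
theorem exists_exponents {α : ℝ} (hα0 : 0 < α) (hα : α < 1) (r : ℕ) : ∃ (a b : ℕ) (δ : ℝ), 0 < a ∧
    0 < δ ∧ α ≤ (b : ℝ) / a ∧ (1 + δ) ^ r * ((b : ℝ) / a) < 2 / (1 + 1 / α) := by
  have h1 : α < 2 / (1 + 1 / α) := by
    rw [lt_div_iff₀ (by positivity)]
    field_simp
    linarith
  obtain ⟨q, hq1, hq2⟩ := exists_rat_btwn h1
  have hq0 : 0 < q := by
    have : (0 : ℝ) < q := hα0.trans hq1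
    exact_mod_cast this
  have hqe : ((q.num.toNat : ℕ) : ℝ) / (q.den : ℕ) = q := by
    have e : ((q.num.toNat : ℕ) : ℤ) = q.num := Int.toNat_of_nonneg (Rat.num_pos.2 hq0).le
    have e' : ((q.num.toNat : ℕ) : ℝ) = ((q.num : ℤ) : ℝ) := by rw [← Int.cast_natCast, e]
    rw [e', ← Rat.cast_def]
  have hcont : Filter.Tendsto (fun δ : ℝ => (1 + δ) ^ r * (q : ℝ)) (nhdsWithin 0 (Set.Ioi 0))
      (nhds ((1 + 0) ^ r * (q : ℝ))) :=
    (Continuous.tendsto (by fun_prop) 0).mono_left nhdsWithin_le_nhds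
  rw [add_zero, one_pow, one_mul] at hcont
  obtain ⟨δ, hδ, hδ0⟩ := ((hcont.eventually_lt_const hq2).and self_mem_nhdsWithin).exists
  exact ⟨q.den, q.num.toNat, δ, q.den_pos, hδ0, by rw [hqe]; exact hq1.le, by rw [hqe]; exact hδ⟩

/-- Both sides vanish for `k = 0`, as `Real.log 0 = 0 = Real.log 1`; so the estimates can work with
a base that is at least one. -/
theorem rpow_mul_log_max (k : ℕ) (γ : ℝ) : ((max k 1 : ℕ) : ℝ) ^ γ * Real.log ((max k 1 : ℕ) : ℝ) =
    (k : ℝ) ^ γ * Real.log k := by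
  rcases Nat.eq_zero_or_pos k with rfl | h
  · simp
  · rw [max_eq_left h]

theorem two_rpow_one_div_log_two_mul (x : ℝ) : (2 : ℝ) ^ (1 / Real.log 2 * x) = Real.exp x := by
  have : Real.log 2 ≠ 0 := (Real.log_pos (by norm_num)).ne'
  rw [Real.rpow_def_of_pos (by norm_num), ← mul_assoc, mul_one_div_cancel this, one_mul]

/-- The empty clique has order `0` and survives every deletion, so the answer is always negative. -/
theorem exists_program_zero (𝒢 : GraphClass) (γ : ℝ) (B : ℕ) :
    ∃ (p : RAM.Prog) (C : ℝ), p.SolvesCliqueCover 0 𝒢 fun n k =>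
      C * (2 : ℝ) ^ (1 / Real.log 2 * ((k : ℝ) ^ γ * Real.log k)) * ((max n 1 : ℕ) : ℝ) ^ B := by
  refine ⟨.const 0 0, 1, fun n G _ k => ⟨1, _, .const 0 0 _, ?_, ?_⟩⟩
  · beta_reduce
    rw [two_rpow_one_div_log_two_mul, ← rpow_mul_log_max, Nat.cast_one, one_mul]
    have h1 : (1 : ℝ) ≤ ((max n 1 : ℕ) : ℝ) := by exact_mod_cast le_max_right n 1
    have h2 : (1 : ℝ) ≤ ((max k 1 : ℕ) : ℝ) := by exact_mod_cast le_max_right k 1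
    have h3 : 0 ≤ Real.log ((max k 1 : ℕ) : ℝ) := Real.log_nonneg h2
    exact one_le_mul_of_one_le_of_one_le (Real.one_le_exp (by positivity)) (one_le_pow₀ h1)
  · have : ¬ HasCliqueCover G 0 k := by
      rintro ⟨X, -, h⟩
      exact h ∅ (by simp)
    simp [this, RAM.State.setReg]

theorem exists_time_exp_le {r a b : ℕ} (C : ℕ) {E θ γ : ℝ} (ha : 0 < a) (hE : 0 ≤ E) (hθ : 0 ≤ θ)
    (hlt : θ * ((b : ℝ) / a) < γ) : ∃ L : ℝ, ∀ (n k m t : ℕ) (s s₁ s₂ s₃ : Loop.Store),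
      (m : ℝ) ≤ E * ((max k 1 : ℕ) : ℝ) ^ θ → (∀ t' < t, t' ^ a < C * m ^ b) →
      (∀ y < 2, s.v y ≤ n + k) → (∀ y < 3, s₁.v y ≤ n + k) → (∀ y < 4, s₂.v y ≤ n + k) →
      (∀ y < 5, s₃.v y ≤ n + k + (lastCode (2 * m) t 0 + 1)) →
      (((Loop.Cmd.seq (Loop.kernel r) Loop.listing).time s + ((Loop.depthBound C a b).time s₁ +
        (Loop.numCodes.time s₂ + (Loop.Cmd.seq Loop.statusTable
          (Loop.Cmd.seq (Loop.table r) Loop.answer)).time s₃)) + (3 * n + 6) : ℕ) : ℝ) ≤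
        L * Real.exp ((k : ℝ) ^ γ * Real.log k) *
          ((max n 1 : ℕ) : ℝ) ^ (Loop.solverDepth r + 1) := by
  obtain ⟨K, hK⟩ := Loop.exists_time_solver_le r C a b
  generalize Loop.solverDepth r = D at hK ⊢
  have hη0 : 0 ≤ θ * ((b : ℝ) / a) := by positivity
  generalize hη : θ * ((b : ℝ) / a) = η at hlt hη0
  obtain ⟨T, hT, hdepth⟩ := exists_depth_le C a b E θ ha hE hθ
  obtain ⟨P, hP, hcodes⟩ := exists_numCodes_le E θ T η hE hθ hT
  obtain ⟨L, hL⟩ := exists_absorb (D * (1 + P)) η γ (by positivity) hη0 hlt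
  refine ⟨(K * 4 ^ D + 9) * Real.exp L, fun n k m t s s₁ s₂ s₃ hm ht q₀ q₁ q₂ q₃ => ?_⟩
  set κ : ℝ := ((max k 1 : ℕ) : ℝ) with hκ
  have hκ1 : 1 ≤ κ := by rw [hκ]; exact_mod_cast le_max_right k 1
  have hN := hcodes m t κ hκ1 hm (hη ▸ hdepth m t κ hκ1 hm ht)
  have hN1 : 1 ≤ lastCode (2 * m) t 0 + 1 := by omega
  generalize lastCode (2 * m) t 0 + 1 = N at hN q₃ hN1
  have htime := hK (n + k + N) s s₁ s₂ s₃ (fun y hy => (q₀ y hy).trans (by omega))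
      (fun y hy => (q₁ y hy).trans (by omega)) (fun y hy => (q₂ y hy).trans (by omega)) q₃
  have hlog : 0 ≤ Real.log κ := Real.log_nonneg hκ1
  have hκx : κ ≤ Real.exp (κ ^ η * (1 + Real.log κ)) := by
    calc κ = Real.exp (Real.log κ) := (Real.exp_log (by linarith)).symm
      _ ≤ _ := Real.exp_le_exp.2 (by nlinarith [Real.one_le_rpow hκ1 hη0])
  have hall := time_le K D P n k N (κ ^ η * (1 + Real.log κ)) hN1 hκx hN
  refine (Nat.cast_le.2 (Nat.add_le_add_right htime (3 * n + 6))).trans (hall.trans ?_)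
  rw [← rpow_mul_log_max, ← hκ, mul_assoc _ (Real.exp L), ← Real.exp_add]
  have := hL κ hκ1
  gcongr

theorem mainTheorem3 (r : ℕ) :
    ∃ (A : ℝ) (B : ℕ), ∀ (α : ℝ), 0 < α → α < 1 →
      ∀ (𝒢 : GraphClass), 𝒢.IsHereditary →
        (∃ c : ℝ, ∀ (n : ℕ) (G : SimpleGraph (Fin n)), 1 ≤ n → G ∈ 𝒢 n →
          (numCliquesLT G r : ℝ) ≤ c * n) →
        (∃ c : ℝ, ∀ (n : ℕ) (G : SimpleGraph (Fin n)), 1 ≤ n → G ∈ 𝒢 n →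
          (treewidth G : ℝ) ≤ c * (n : ℝ) ^ α) →
        ∃ (p : RAM.Prog) (C : ℝ), p.SolvesCliqueCover r 𝒢 fun n k =>
          C * (2 : ℝ) ^ (A * ((k : ℝ) ^ (2 / (1 + 1 / α)) * Real.log k)) *
            ((max n 1 : ℕ) : ℝ) ^ B := by
  -- The first constant only converts powers of `2` into `exp`, since all other constants in the
  -- exponent are absorbed. The extra `1` in the second covers the linear cost of setting up the
  -- store.
  refine ⟨1 / Real.log 2, Loop.solverDepth r + 1, fun α hα0 hα 𝒢 h𝒢 _ ⟨c, hc⟩ => ?_⟩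
  obtain rfl | hr := Nat.eq_zero_or_pos r
  · exact exists_program_zero 𝒢 _ _
  have hc0 : 0 ≤ max c 0 + 1 := add_nonneg (le_max_right _ _) zero_le_one
  have hsep : ∀ (n : ℕ) (G : SimpleGraph (Fin n)), G ∈ 𝒢 n →
      HasSeparators (G.map Fin.valEmbedding) (Finset.range n) (max c 0 + 1) α := fun n G hG =>
    h𝒢.hasSeparators hα0 (fun n G hn hG => (hc n G hn hG).trans
      (mul_le_mul_of_nonneg_right (le_max_left c 0) (by positivity))) hG
  obtain ⟨a, b, δ, ha, hδ, hab, hlt⟩ := exists_exponents hα0 hα (r - 1)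
  obtain ⟨E, hE, hkern⟩ := exists_kernel_card_le r (max c 0 + 1) α δ hc0 hα0.le hα hδ
  obtain ⟨C, hC⟩ := exists_elimDepth_nat (max c 0 + 1) α hc0 hα0 ha hab
  obtain ⟨L, hL⟩ := exists_time_exp_le (r := r) C ha hE (by positivity) hlt
  refine ⟨Loop.program (Loop.solver r C a b) 40, L, fun n G hG k => ?_⟩
  obtain ⟨f, hf, hf', hfE⟩ := hkern _ _ k (hsep n G hG)
  obtain ⟨m, t, hm, ht, hcorrect, s₁, s₂, s₃, q₀, q₁, q₂, q₃, htime⟩ :=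
    Loop.run_solver G hr f hf hf' (hC _ _ (hsep n G hG))
  obtain ⟨σ, hexec, hσ⟩ := Loop.exec_program (Loop.solver r C a b) 40 G k
  rw [htime] at hexec
  refine ⟨_, σ, hexec, ?_, by rw [hσ]; exact hcorrect⟩
  beta_reduce
  rw [two_rpow_one_div_log_two_mul]
  exact hL n k m t _ s₁ s₂ s₃ (hm.trans hfE) ht q₀ q₁ q₂ q₃
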